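/- Let $n\ge 1$ be an integer, let $\sigma\ge 1$, $\mu>0$, $\delta\in(0,\sigma/2)$, $a\ge 0$, let $1\le p\le q\le\infty$, and let $r\in[1,\infty]$ be given by $1+\frac1q=\frac1r+\frac1p$. Write $|D|^a$ for the Fourier multiplier with symbol $|\xi|^a$ (so $(-\Delta)^s=|D|^{2s}$) and $[\frac n2]$ for the integer part of $\frac n2$. Consider the Cauchy problem on $[0,\infty)\times\mathbb R^n$ $$u_{tt}+(-\Delta)^\sigma u+\mu(-\Delta)^\delta u_t=0,\qquad u(0,x)=u_0(x),\quad u_t(0,x)=u_1(x),$$ with data $u_0,u_1\in L^p(\mathbb R^n)$. Solutions are understood in the sense of distributions: for each $t\ge0$ the functions $u(t,\cdot)$ and $u_t(t,\cdot)$ belong to some Lebesgue spaces $L^s(\mathbb R^n)$, $1\le s\le\infty$, they take the values $u_0,u_1$ at $t=0$, and for every Schwartz function $\varphi$ and every $t\ge 0$ (one-sided derivatives at $t=0$) $$\frac{d}{dt}\int u\,\varphi\,dx=\int u_t\,\varphi\,dx,\qquad \frac{d}{dt}\int u_t\,\varphi\,dx=-\int u\,(-\Delta)^\sigma\varphi\,dx-\mu\int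 u_t\,(-\Delta)^\delta\varphi\,dx .$$ Then there is a constant $C>0$, depending only on $n,\sigma,\delta,\mu,a,p,q$, such that every solution satisfies the following: for every $t>0$ the distributions $|D|^a u(t,\cdot)$ and $|D|^a u_t(t,\cdot)$ are functions in $L^q(\mathbb R^n)$; for $t\in(0,1]$, $$\big\||D|^a u(t,\cdot)\big\|_{L^q}\le C\Big(t^{-(2+[\frac n2])(\frac{\sigma}{2\delta}-1)\frac1r-\frac{n}{2\delta}(1-\frac1r)-\frac{a}{2\delta}}\|u_0\|_{L^p}+t^{1-(1+[\frac n2])(\frac{\sigma}{2\delta}-1)\frac1r-\frac{n}{2\delta}(1-\frac1r)-\frac{a}{2\delta}}\|u_1\|_{L^p}\Big),$$ $$\big\||D|^a u_t(t,\cdot)\big\|_{L^q}\le C\Big(t^{1-(1+[\frac n2])(\frac{\sigma}{2\delta}-1)\frac1r-\frac{n}{2\delta}(1-\frac1r)-\frac{a+2\sigma}{2\delta}}\|u_0\|_{L^p}+t^{-(2+[\frac n2])(\frac{\sigma}{2\delta}-1)\frac1r-\frac{n}{2\delta}(1-\frac1r)-\frac{a}{2\delta}}\|u_1\|_{L^p}\Big);$$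 and for $t\in[1,\infty)$, $$\big\||D|^a u(t,\cdot)\big\|_{L^q}\le C\Big(t^{-\frac{n}{2(\sigma-\delta)}(1-\frac1r)-\frac{a}{2(\sigma-\delta)}}\|u_0\|_{L^p}+t^{1-\frac{n}{2(\sigma-\delta)}(1-\frac1r)-\frac{a}{2(\sigma-\delta)}}\|u_1\|_{L^p}\Big),$$ $$\big\||D|^a u_t(t,\cdot)\big\|_{L^q}\le C\Big(t^{-\frac{n}{2(\sigma-\delta)}(1-\frac1r)-\frac{a+2\delta}{2(\sigma-\delta)}}\|u_0\|_{L^p}+t^{1-\frac{n}{2(\sigma-\delta)}(1-\frac1r)-\frac{a+2\delta}{2(\sigma-\delta)}}\|u_1\|_{L^p}\Big).$$ -/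

import Mathlib

open MeasureTheory Set
open scoped ENNReal FourierTransform SchwartzMap

noncomputable section

/-- `|D|^a φ` for a Schwartz function `φ`: the Fourier multiplier with symbol `|ξ|^a`. Mathlib's
Fourier transform has the kernel `exp (-2πi⟨x, ξ⟩)`, so the frequency variable is `2πξ`; with this
normalisation `|D|^2 = -Δ`, and `(-Δ)^s = |D|^(2s)`. -/
def absD {n : ℕ} (a : ℝ) (φ : 𝓢(EuclideanSpace ℝ (Fin n), ℂ)) : EuclideanSpace ℝ (Fin n) → ℂ :=
  𝓕⁻ (fun ξ : EuclideanSpace ℝ (Fin n) =>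
    (((2 * Real.pi * ‖ξ‖) ^ a : ℝ) : ℂ) * 𝓕 (φ : EuclideanSpace ℝ (Fin n) → ℂ) ξ)

/-- `f` lies in some Lebesgue space `L^s(ℝⁿ)`, `1 ≤ s ≤ ∞`. For such `f` and `a ≥ 0` the pairing of
`f` with `|D|^a φ` converges absolutely, since `|D|^a φ` is bounded and integrable. -/
def InSomeLp {n : ℕ} (f : EuclideanSpace ℝ (Fin n) → ℂ) : Prop :=
  ∃ s : ℝ≥0∞, 1 ≤ s ∧ MemLp f s volume

/-- `w = |D|^a f` in the sense of distributions (the symbol `|ξ|^a` is even). -/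
def IsAbsD {n : ℕ} (a : ℝ) (f w : EuclideanSpace ℝ (Fin n) → ℂ) : Prop :=
  ∀ φ : 𝓢(EuclideanSpace ℝ (Fin n), ℂ), ∫ x, f x * absD a φ x = ∫ x, w x * φ x

/-- `|D|^a f` is a function in `L^q` and `‖|D|^a f‖_{L^q} ≤ B`. -/
def AbsDNormLE {n : ℕ} (a : ℝ) (f : EuclideanSpace ℝ (Fin n) → ℂ) (q B : ℝ≥0∞) : Prop :=
  ∃ w : EuclideanSpace ℝ (Fin n) → ℂ,
    MemLp w q volume ∧ IsAbsD a f w ∧ eLpNorm w q volume ≤ B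

/-- `u`, with time derivative `u_t = ut`, is a distributional solution on `[0, ∞) × ℝⁿ` of
`u_tt + (-Δ)^σ u + μ (-Δ)^δ u_t = 0`, `u(0) = u₀`, `u_t(0) = u₁`: the equation is tested, at each
time `t ≥ 0`, against Schwartz functions of the space variable. -/
structure IsSolution {n : ℕ} (σ δ μ : ℝ) (u₀ u₁ : EuclideanSpace ℝ (Fin n) → ℂ)
    (u ut : ℝ → EuclideanSpace ℝ (Fin n) → ℂ) : Prop where
  inLp : ∀ t : ℝ, 0 ≤ t → InSomeLp (u t)
  inLp_deriv : ∀ t : ℝ, 0 ≤ t → InSomeLp (ut t)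
  hasDeriv : ∀ φ : 𝓢(EuclideanSpace ℝ (Fin n), ℂ), ∀ t : ℝ, 0 ≤ t →
    HasDerivWithinAt (fun s => ∫ x, u s x * φ x) (∫ x, ut t x * φ x) (Ici 0) t
  equation : ∀ φ : 𝓢(EuclideanSpace ℝ (Fin n), ℂ), ∀ t : ℝ, 0 ≤ t →
    HasDerivWithinAt (fun s => ∫ x, ut s x * φ x)
      (-(∫ x, u t x * absD (2 * σ) φ x) - (μ : ℂ) * ∫ x, ut t x * absD (2 * δ) φ x) (Ici 0) t
  initial : u 0 =ᵐ[volume] u₀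
  initial_deriv : ut 0 =ᵐ[volume] u₁

/-- `C (t^α ‖u₀‖_{L^p} + t^β ‖u₁‖_{L^p})`. -/
def dataBound {n : ℕ} (p : ℝ≥0∞) (u₀ u₁ : EuclideanSpace ℝ (Fin n) → ℂ) (C t α β : ℝ) : ℝ≥0∞ :=
  ENNReal.ofReal C * (ENNReal.ofReal (t ^ α) * eLpNorm u₀ p volume
    + ENNReal.ofReal (t ^ β) * eLpNorm u₁ p volume)

end

/-! At each frequency the equation is the ODE y'' + A y' + Q y = 0 with A = μ|ξ|^{2δ} and Q =
|ξ|^{2σ}, whose solution is `cosProp` · y(0) + t · `meanProp` · y'(0). Hence |D|^a u and |D|^a u_t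
should be convolutions of the data with kernels of explicit radial symbols. A kernel with L¹ norm at
most K and sup norm at most M maps L^p to L^q with norm at most K^{1/r} M^{1-1/r}
(`lintegral_kernel_young`), so two bounds per kernel suffice. The sup norm is at most the L¹ norm of
the symbol; the L¹ norm of the kernel is the real work.

For the L¹ norm, the symbols are holomorphic in |ξ|². Writing |ξ|² = x²(1 + z), the exponential
bounds for z = 0 persist, up to constants, for complex z with |z| ≤ κ/N, where N = 1 + t x^σ for
small times and N = 1 + t x^{2(σ-δ)} for large times (`small_time_symbol`, `large_time_symbol`; the
point is to follow the characteristic roots under perturbation). Cauchy's estimates then give all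
derivatives at once, each at a cost of N/x (`lineBound_of_holomorphic`), and a Bernstein inequality
on dyadic annuli turns a symbol of size B into a kernel of L¹ norm B N^{n/2}
(`exists_integral_fourierInv_le`). The sum over annuli converges if B N^{n/2} decays at both ends.
At low frequencies |ξ|^a supplies this when a > 0; when a = 0 a Gaussian symbol is subtracted first,
as its kernel has L¹ norm 1.

For t ≤ 1 the damping is effective at |ξ| ~ t^{-1/(2δ)}, where N ~ t^{1-σ/(2δ)}. The loss is n/2
powers of this from Bernstein, and half a power more from the low frequencies when a = 0; in all
(n+1)/2 ≤ 1 + [n/2]. For t ≥ 1 the relevant scale is |ξ| ~ t^{-1/(2(σ-δ))}, where N is bounded and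
nothing is lost.

It remains to see that every distributional solution is given by these kernels. The symbols are not
smooth at the origin, and the Fourier transform of the data may charge it. Tested against functions
with frequencies in an annulus, the solution has a Taylor series in time with iterates of the dual
ODE system as test functions; uniform boundedness controls the remainder, and the series sums to the
propagators (`annular_representation`). Summation over annuli gives the formula for |D|^a u with a >
0. For a = 0 the annuli miss the spectrum at the origin, so the formula is applied to the second
time derivative, which carries |D|^{2σ} and |D|^{2δ}, and is then integrated in time
(`dataSym_representation_zero`). -/

noncomputable section

/-! ### The scalar ODE and its entire propagators -/

/-- The entire function `V ↦ cosh √V`. -/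
def coshSqrt (V : ℂ) : ℂ := ∑' k : ℕ, V ^ k / ((2 * k).factorial : ℂ)

/-- The entire function `V ↦ sinh √V / √V`. -/
def sinhcSqrt (V : ℂ) : ℂ := ∑' k : ℕ, V ^ k / ((2 * k + 1).factorial : ℂ)

lemma norm_pow_div_factorial_le (V : ℂ) {k j : ℕ} (h : k ≤ j) :
    ‖V ^ k / (j.factorial : ℂ)‖ ≤ ‖V‖ ^ k / (k.factorial : ℝ) := by
  rw [norm_div, norm_pow, Complex.norm_natCast]
  have : (k.factorial : ℝ) ≤ j.factorial := by exact_mod_cast Nat.factorial_le h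
  have h0 : (0 : ℝ) < k.factorial := by exact_mod_cast Nat.factorial_pos k
  gcongr

/-- Since (j k)! ≥ k!, the exponential series dominates on every ball. Working with series in V
rather than with a square root avoids branches and double roots. -/
lemma differentiable_tsum_pow_div_factorial (j : ℕ → ℕ) (hj : ∀ k, k ≤ j k) :
    Differentiable ℂ (fun V : ℂ => ∑' k : ℕ, V ^ k / ((j k).factorial : ℂ)) := by
  intro V
  have := Complex.differentiableOn_tsum_of_summable_norm (u := fun k : ℕ => (‖V‖ + 1) ^ k / (k.factorial : ℝ))
    (F := fun (k : ℕ) (V : ℂ) => V ^ k / ((j k).factorial : ℂ)) (U := Metric.ball 0 (‖V‖ + 1))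
    (Real.summable_pow_div_factorial _) (fun k => by fun_prop) Metric.isOpen_ball
    (fun k w hw => by
      refine (norm_pow_div_factorial_le w (hj k)).trans ?_
      have : ‖w‖ ≤ ‖V‖ + 1 := by simpa using (Metric.mem_ball.1 hw).le
      gcongr)
  exact (this V (by simp)).differentiableAt (Metric.isOpen_ball.mem_nhds (by simp))

lemma differentiable_coshSqrt : Differentiable ℂ coshSqrt :=
  differentiable_tsum_pow_div_factorial (fun k => 2 * k) (fun k => by omega)

lemma differentiable_sinhcSqrt : Differentiable ℂ sinhcSqrt :=
  differentiable_tsum_pow_div_factorial (fun k => 2 * k + 1) (fun k => by omega)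

lemma coshSqrt_sq (z : ℂ) : coshSqrt (z ^ 2) = Complex.cosh z := by
  rw [Complex.cosh_eq_tsum, coshSqrt]
  simp [pow_mul]

lemma mul_sinhcSqrt_sq (z : ℂ) : z * sinhcSqrt (z ^ 2) = Complex.sinh z := by
  rw [Complex.sinh_eq_tsum, sinhcSqrt, ← tsum_mul_left]
  congr 1; ext k; rw [pow_succ z (2 * k), pow_mul]; ring

lemma norm_tsum_pow_div_factorial_sub_one_le (j : ℕ → ℕ) (hj : ∀ k, k ≤ j k) (h0 : (j 0).factorial = 1)
    (V : ℂ) : ‖(∑' k : ℕ, V ^ k / ((j k).factorial : ℂ)) - 1‖ ≤ ‖V‖ * Real.exp ‖V‖ := by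
  have hs : Summable (fun k : ℕ => V ^ k / ((j k).factorial : ℂ)) :=
    Summable.of_norm_bounded (Real.summable_pow_div_factorial ‖V‖)
      (fun k => norm_pow_div_factorial_le V (hj k))
  rw [hs.tsum_eq_zero_add]
  simp only [pow_zero, h0, Nat.cast_one, div_one, add_sub_cancel_left]
  have hb : ∀ k : ℕ, ‖V ^ (k + 1) / ((j (k + 1)).factorial : ℂ)‖ ≤ ‖V‖ * (‖V‖ ^ k / (k.factorial : ℝ)) := by
    intro k
    refine (norm_pow_div_factorial_le V (hj (k + 1))).trans ?_
    have : (k.factorial : ℝ) ≤ (k + 1).factorial := by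
      exact_mod_cast Nat.factorial_le (Nat.le_succ k)
    have h0 : (0 : ℝ) < k.factorial := by exact_mod_cast Nat.factorial_pos k
    rw [pow_succ, mul_comm (‖V‖ ^ k), ← mul_div_assoc]
    gcongr
  refine tsum_of_norm_bounded (g := fun k : ℕ => ‖V‖ * (‖V‖ ^ k / (k.factorial : ℝ))) ?_ hb
  refine HasSum.mul_left _ ?_
  rw [Real.exp_eq_exp_ℝ]
  exact NormedSpace.expSeries_div_hasSum_exp ‖V‖

lemma norm_coshSqrt_sub_one_le (V : ℂ) : ‖coshSqrt V - 1‖ ≤ ‖V‖ * Real.exp ‖V‖ :=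
  norm_tsum_pow_div_factorial_sub_one_le (fun k => 2 * k) (fun k => by omega) rfl V

lemma norm_sinhcSqrt_sub_one_le (V : ℂ) : ‖sinhcSqrt V - 1‖ ≤ ‖V‖ * Real.exp ‖V‖ :=
  norm_tsum_pow_div_factorial_sub_one_le (fun k => 2 * k + 1) (fun k => by omega) rfl V

lemma coshSqrt_zero : coshSqrt 0 = 1 := by
  have := norm_coshSqrt_sub_one_le 0
  simpa [sub_eq_zero] using this

lemma sinhcSqrt_zero : sinhcSqrt 0 = 1 := by
  have := norm_sinhcSqrt_sub_one_le 0
  simpa [sub_eq_zero] using this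

lemma norm_cosh_le (z : ℂ) : ‖Complex.cosh z‖ ≤ Real.exp |z.re| := by
  rw [Complex.cosh, norm_div, Complex.norm_ofNat, div_le_iff₀ (by norm_num)]
  refine (norm_add_le _ _).trans ?_
  rw [Complex.norm_exp, Complex.norm_exp]
  have h1 : Real.exp z.re ≤ Real.exp |z.re| := Real.exp_le_exp.2 (le_abs_self _)
  have h2 : Real.exp (-z).re ≤ Real.exp |z.re| := Real.exp_le_exp.2 (by simpa using neg_le_abs _)
  linarith

lemma norm_sinh_le (z : ℂ) : ‖Complex.sinh z‖ ≤ Real.exp |z.re| := by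
  rw [Complex.sinh, norm_div, Complex.norm_ofNat, div_le_iff₀ (by norm_num)]
  refine (norm_sub_le _ _).trans ?_
  rw [Complex.norm_exp, Complex.norm_exp]
  have h1 : Real.exp z.re ≤ Real.exp |z.re| := Real.exp_le_exp.2 (le_abs_self _)
  have h2 : Real.exp (-z).re ≤ Real.exp |z.re| := Real.exp_le_exp.2 (by simpa using neg_le_abs _)
  linarith

/-- sinh z is the integral of z cosh(sz) over 0 ≤ s ≤ 1. The factor ‖z‖ is what keeps the bound on
sinh z / z uniform near z = 0. -/
lemma norm_sinh_le_norm_mul (z : ℂ) : ‖Complex.sinh z‖ ≤ ‖z‖ * Real.exp |z.re| := by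
  have hd : ∀ s ∈ Icc (0 : ℝ) 1, HasDerivWithinAt (fun s : ℝ => Complex.sinh (s * z))
      (Complex.cosh (s * z) * z) (Icc 0 1) s := by
    intro s _
    have h1 : HasDerivAt (fun w : ℂ => w * z) z (s : ℂ) := by
      simpa using (hasDerivAt_id (s : ℂ)).mul_const z
    exact (((Complex.hasDerivAt_sinh _).comp (s : ℂ) h1).comp_ofReal).hasDerivWithinAt
  have := norm_image_sub_le_of_norm_deriv_le_segment_01' (C := ‖z‖ * Real.exp |z.re|) hd (by
    intro s hs
    rw [norm_mul, mul_comm]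
    refine mul_le_mul_of_nonneg_left ((norm_cosh_le _).trans (Real.exp_le_exp.2 ?_)) (norm_nonneg _)
    rw [Complex.re_ofReal_mul, abs_mul, abs_of_nonneg hs.1]
    nlinarith [abs_nonneg z.re, hs.2])
  simpa using this

lemma norm_coshSqrt_sq_le (z : ℂ) : ‖coshSqrt (z ^ 2)‖ ≤ Real.exp |z.re| := by
  rw [coshSqrt_sq]; exact norm_cosh_le z

lemma norm_sinhcSqrt_sq_le (z : ℂ) : ‖sinhcSqrt (z ^ 2)‖ ≤ Real.exp |z.re| := by
  rcases eq_or_ne z 0 with rfl | hz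
  · simp [sinhcSqrt_zero]
  · have := norm_sinh_le_norm_mul z
    rw [← mul_sinhcSqrt_sq, norm_mul] at this
    exact le_of_mul_le_mul_left this (norm_pos_iff.2 hz)

lemma norm_exp_sub_one_le_of_re_nonpos {z : ℂ} (hz : z.re ≤ 0) : ‖Complex.exp z - 1‖ ≤ ‖z‖ := by
  have hd : ∀ s ∈ Icc (0 : ℝ) 1, HasDerivWithinAt (fun s : ℝ => Complex.exp (s * z))
      (Complex.exp (s * z) * z) (Icc 0 1) s := by
    intro s _
    have h1 : HasDerivAt (fun w : ℂ => w * z) z (s : ℂ) := by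
      simpa using (hasDerivAt_id (s : ℂ)).mul_const z
    exact (((Complex.hasDerivAt_exp _).comp (s : ℂ) h1).comp_ofReal).hasDerivWithinAt
  have := norm_image_sub_le_of_norm_deriv_le_segment_01' (C := ‖z‖) hd (by
    intro s hs
    rw [norm_mul, Complex.norm_exp, Complex.re_ofReal_mul]
    have : Real.exp (s * z.re) ≤ 1 := Real.exp_le_one_iff.2 (by nlinarith [hs.1])
    nlinarith [norm_nonneg z])
  simpa using this

/-- `(e^{λ₁t} - e^{λ₂t}) / ((λ₁ - λ₂) t)`, where `λ₁, λ₂` are the roots of `λ² + Aλ + Q`. -/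
def meanProp (t : ℝ) (A Q : ℂ) : ℂ :=
  Complex.exp (-(A * t / 2)) * sinhcSqrt (t ^ 2 * (A ^ 2 / 4 - Q))

/-- The solution of `y'' + A y' + Q y = 0` with `y(0) = 1`, `y'(0) = 0`. -/
def cosProp (t : ℝ) (A Q : ℂ) : ℂ :=
  Complex.exp (-(A * t / 2)) *
    (coshSqrt (t ^ 2 * (A ^ 2 / 4 - Q)) + A * t / 2 * sinhcSqrt (t ^ 2 * (A ^ 2 / 4 - Q)))

lemma exists_sq_eq (V : ℂ) : ∃ D : ℂ, D ^ 2 = V :=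
  IsAlgClosed.exists_pow_nat_eq V (by norm_num)

section ODE

variable (A Q : ℂ)

/-- With a square root D of V the function is sinh(tD)/D; the double root D = 0 is separate. -/
lemma hasDerivAt_t_mul_sinhcSqrt (V : ℂ) (t : ℝ) :
    HasDerivAt (fun t : ℝ => (t : ℂ) * sinhcSqrt (t ^ 2 * V)) (coshSqrt (t ^ 2 * V)) t := by
  obtain ⟨D, rfl⟩ := exists_sq_eq V
  rcases eq_or_ne D 0 with rfl | hD
  · simpa [sinhcSqrt_zero, coshSqrt_zero] using (hasDerivAt_id (t : ℂ)).comp_ofReal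
  · have h1 : HasDerivAt (fun w : ℂ => w * D) D (t : ℂ) := by
      simpa using (hasDerivAt_id (t : ℂ)).mul_const D
    have h2 := ((((Complex.hasDerivAt_sinh _).comp (t : ℂ) h1).comp_ofReal)).div_const D
    have e : (fun t : ℝ => (t : ℂ) * sinhcSqrt (t ^ 2 * D ^ 2)) =
        fun t : ℝ => Complex.sinh (t * D) / D := by
      ext s
      rw [← mul_sinhcSqrt_sq, mul_pow]; field_simp
    rw [e, ← mul_pow, coshSqrt_sq]
    refine h2.congr_deriv ?_
    field_simp

lemma hasDerivAt_coshSqrt (V : ℂ) (t : ℝ) :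
    HasDerivAt (fun t : ℝ => coshSqrt (t ^ 2 * V)) (t * sinhcSqrt (t ^ 2 * V) * V) t := by
  obtain ⟨D, rfl⟩ := exists_sq_eq V
  have h1 : HasDerivAt (fun w : ℂ => w * D) D (t : ℂ) := by
    simpa using (hasDerivAt_id (t : ℂ)).mul_const D
  have h2 := (((Complex.hasDerivAt_cosh _).comp (t : ℂ) h1).comp_ofReal)
  have e : (fun t : ℝ => coshSqrt (t ^ 2 * D ^ 2)) = fun t : ℝ => Complex.cosh (t * D) := by
    ext s
    rw [← coshSqrt_sq, mul_pow]
  rw [e]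
  refine h2.congr_deriv ?_
  rw [← mul_sinhcSqrt_sq, mul_pow]; ring

lemma hasDerivAt_exp_damp (t : ℝ) :
    HasDerivAt (fun t : ℝ => Complex.exp (-(A * t / 2))) (Complex.exp (-(A * t / 2)) * (-(A / 2))) t := by
  have h1 : HasDerivAt (fun w : ℂ => -(A * w / 2)) (-(A / 2)) (t : ℂ) := by
    have := (((hasDerivAt_id (t : ℂ)).const_mul A).div_const 2).fun_neg
    simpa using this
  exact ((Complex.hasDerivAt_exp _).comp (t : ℂ) h1).comp_ofReal

lemma hasDerivAt_t_mul_meanProp (t : ℝ) :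
    HasDerivAt (fun t : ℝ => (t : ℂ) * meanProp t A Q) (cosProp t A Q - A * (t * meanProp t A Q)) t := by
  have := (hasDerivAt_exp_damp A t).mul (hasDerivAt_t_mul_sinhcSqrt (A ^ 2 / 4 - Q) t)
  have e : (fun t : ℝ => (t : ℂ) * meanProp t A Q) = (fun t : ℝ => Complex.exp (-(A * t / 2))) *
      (fun t : ℝ => (t : ℂ) * sinhcSqrt (t ^ 2 * (A ^ 2 / 4 - Q))) := by
    ext s; simp only [meanProp, Pi.mul_apply]; ring
  rw [e]
  refine this.congr_deriv ?_
  simp only [cosProp, meanProp]; ring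

lemma hasDerivAt_cosProp (t : ℝ) :
    HasDerivAt (fun t : ℝ => cosProp t A Q) (-(Q * (t * meanProp t A Q))) t := by
  have := (hasDerivAt_exp_damp A t).mul ((hasDerivAt_coshSqrt (A ^ 2 / 4 - Q) t).add
    ((hasDerivAt_t_mul_sinhcSqrt (A ^ 2 / 4 - Q) t).const_mul (A / 2)))
  have e : (fun t : ℝ => cosProp t A Q) = (fun t : ℝ => Complex.exp (-(A * t / 2))) *
      ((fun t : ℝ => coshSqrt (t ^ 2 * (A ^ 2 / 4 - Q))) +
      (fun t : ℝ => A / 2 * ((t : ℂ) * sinhcSqrt (t ^ 2 * (A ^ 2 / 4 - Q))))) := by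
    ext s; simp only [cosProp, Pi.mul_apply, Pi.add_apply]; ring
  rw [e]
  refine this.congr_deriv ?_
  simp only [meanProp, Pi.add_apply]; ring

@[simp] lemma meanProp_zero : meanProp 0 A Q = 1 := by simp [meanProp, sinhcSqrt_zero]

@[simp] lemma cosProp_zero : cosProp 0 A Q = 1 := by simp [cosProp, coshSqrt_zero]

end ODE

end

/-! ### Characteristic roots under complex perturbation -/

noncomputable section

section PropBounds

/-- The characteristic roots are -A/2 ± D, so Re A/2 - |Re D| is the smaller decay rate. Either
square root may serve as D, and D = 0 is harmless. -/
lemma norm_meanProp_le {t : ℝ} (ht : 0 ≤ t) {A Q D : ℂ} (hD : D ^ 2 = A ^ 2 / 4 - Q) :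
    ‖meanProp t A Q‖ ≤ Real.exp (-(t * (A.re / 2 - |D.re|))) := by
  rw [meanProp, ← hD, ← mul_pow, norm_mul, Complex.norm_exp]
  refine (mul_le_mul_of_nonneg_left (norm_sinhcSqrt_sq_le _) (Real.exp_nonneg _)).trans ?_
  rw [← Real.exp_add, Real.exp_le_exp, Complex.re_ofReal_mul, abs_mul, abs_of_nonneg ht]
  have : (-(A * t / 2)).re = -(A.re * t / 2) := by simp
  rw [this]; linarith

lemma norm_cosProp_le {t : ℝ} (ht : 0 ≤ t) {A Q D : ℂ} (hD : D ^ 2 = A ^ 2 / 4 - Q) :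
    ‖cosProp t A Q‖ ≤ (1 + t * ‖A‖ / 2) * Real.exp (-(t * (A.re / 2 - |D.re|))) := by
  have h1 := norm_meanProp_le ht hD
  have h2 : ‖Complex.exp (-(A * t / 2)) * coshSqrt (t ^ 2 * (A ^ 2 / 4 - Q))‖ ≤
      Real.exp (-(t * (A.re / 2 - |D.re|))) := by
    rw [← hD, ← mul_pow, norm_mul, Complex.norm_exp]
    refine (mul_le_mul_of_nonneg_left (norm_coshSqrt_sq_le _) (Real.exp_nonneg _)).trans ?_
    rw [← Real.exp_add, Real.exp_le_exp, Complex.re_ofReal_mul, abs_mul, abs_of_nonneg ht]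
    have : (-(A * t / 2)).re = -(A.re * t / 2) := by simp
    rw [this]; linarith
  have e : cosProp t A Q = Complex.exp (-(A * t / 2)) * coshSqrt (t ^ 2 * (A ^ 2 / 4 - Q)) +
      A * t / 2 * meanProp t A Q := by
    rw [cosProp, meanProp]; ring
  rw [e]
  refine (norm_add_le _ _).trans ?_
  have h3 : ‖A * t / 2 * meanProp t A Q‖ = t * ‖A‖ / 2 * ‖meanProp t A Q‖ := by
    rw [norm_mul, norm_div, norm_mul, Complex.norm_real, Real.norm_of_nonneg ht, Complex.norm_ofNat]
    ring
  rw [h3, add_mul, one_mul]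
  have : 0 ≤ t * ‖A‖ / 2 := by positivity
  gcongr

variable {m b η : ℝ} {α β D : ℂ}

/-- In the application m = μx^{2δ} is the damping, b = x^σ the frequency of oscillation, and α, β
are the factors (1+z)^δ and (1+z)^σ, close to 1. The three regimes below compare m with b. -/
lemma norm_discr_sub_le (hη : η ≤ 1) (hα : ‖α - 1‖ ≤ η) (hβ : ‖β - 1‖ ≤ η) :
    ‖((m * α) ^ 2 / 4 - b ^ 2 * β) - ((m ^ 2 / 4 - b ^ 2 : ℝ) : ℂ)‖ ≤ (3 / 4 * m ^ 2 + b ^ 2) * η := by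
  have e : ((m * α) ^ 2 / 4 - b ^ 2 * β) - ((m ^ 2 / 4 - b ^ 2 : ℝ) : ℂ) =
      ((m ^ 2 / 4 : ℝ) : ℂ) * ((α - 1) * ((α - 1) + 2)) - ((b ^ 2 : ℝ) : ℂ) * (β - 1) := by
    push_cast; ring
  rw [e]
  refine (norm_sub_le _ _).trans ?_
  rw [norm_mul, norm_mul, norm_mul, Complex.norm_real, Complex.norm_real,
    Real.norm_of_nonneg (by positivity), Real.norm_of_nonneg (by positivity)]
  have h1 : ‖(α - 1) + 2‖ ≤ 3 := by
    refine (norm_add_le _ _).trans ?_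
    rw [Complex.norm_ofNat]; linarith
  have h0 : 0 ≤ η := (norm_nonneg _).trans hα
  have : ‖α - 1‖ * ‖α - 1 + 2‖ ≤ η * 3 := by gcongr
  have h2 : m ^ 2 / 4 * (‖α - 1‖ * ‖α - 1 + 2‖) ≤ m ^ 2 / 4 * (η * 3) := by gcongr
  have h3 : b ^ 2 * ‖β - 1‖ ≤ b ^ 2 * η := by gcongr
  linarith

lemma re_le_of_norm_sub_le {z : ℂ} {r c : ℝ} (h : ‖z - (r : ℂ)‖ ≤ c) : z.re ≤ r + c := by
  have := (Complex.abs_re_le_norm (z - r)).trans h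
  simp only [Complex.sub_re, Complex.ofReal_re] at this
  linarith [(abs_le.1 this).2]

lemma le_re_of_norm_sub_le {z : ℂ} {r c : ℝ} (h : ‖z - (r : ℂ)‖ ≤ c) : r - c ≤ z.re := by
  have := (Complex.abs_re_le_norm (z - r)).trans h
  simp only [Complex.sub_re, Complex.ofReal_re] at this
  linarith [(abs_le.1 this).1]

lemma abs_im_le_of_norm_sub_le {z : ℂ} {r c : ℝ} (h : ‖z - (r : ℂ)‖ ≤ c) : |z.im| ≤ c := by
  have := (Complex.abs_im_le_norm (z - r)).trans h
  simpa using this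

/-- In the oscillating regime the square root of the discriminant is almost imaginary. -/
lemma abs_re_sqrt_discr_le_of_le (hm : 0 < m) (hmb : m ≤ b) (hη : η ≤ 1 / 100) (hα : ‖α - 1‖ ≤ η)
    (hβ : ‖β - 1‖ ≤ η) (hD : D ^ 2 = (m * α) ^ 2 / 4 - b ^ 2 * β) : |D.re| ≤ 2 * b * η := by
  have h := norm_discr_sub_le (m := m) (b := b) (by linarith) hα hβ
  rw [← hD] at h
  have hb : 0 < b := hm.trans_le hmb
  have h0 : 0 ≤ η := (norm_nonneg _).trans hα
  have hre := re_le_of_norm_sub_le h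
  have him := abs_im_le_of_norm_sub_le h
  have e1 : (D ^ 2).re = D.re ^ 2 - D.im ^ 2 := by rw [pow_two, Complex.mul_re]; ring
  have e2 : |(D ^ 2).im| = 2 * (|D.re| * |D.im|) := by
    rw [pow_two, Complex.mul_im, ← abs_mul, ← abs_two, ← abs_mul]
    congr 1; ring
  rw [e1] at hre
  rw [e2] at him
  have hmb2 : m ^ 2 ≤ b ^ 2 := by gcongr
  have hq : b / 2 ≤ |D.im| := by
    apply abs_le_of_sq_le_sq' _ (abs_nonneg _) |>.2
    rw [sq_abs]
    nlinarith [sq_nonneg D.re]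
  have h3 : |D.re| * (b / 2) ≤ |D.re| * |D.im| := by gcongr
  have h4 : (3 / 4 * m ^ 2 + b ^ 2) * η ≤ 2 * b ^ 2 * η := by gcongr; linarith [sq_nonneg b]
  have h5 : |D.re| * b ≤ (2 * b * η) * b := by nlinarith
  exact le_of_mul_le_mul_right h5 hb

/-- The intermediate regime b ≤ m ≤ 4b, which contains the double root m = 2b. As b² ≥ m²/16, the
discriminant has real part at most about 0.205 m² and small imaginary part, so |Re D| ≤ 0.47 m,
whereas half the damping is at least 0.495 m. The difference is m/40. -/
lemma re_sub_abs_re_sqrt_discr_of_le (hm : 0 < m) (hmb : b ≤ m) (hbm : m ^ 2 ≤ 16 * b ^ 2)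
    (hb : 0 < b) (hη : η ≤ 1 / 100) (hα : ‖α - 1‖ ≤ η) (hβ : ‖β - 1‖ ≤ η)
    (hD : D ^ 2 = (m * α) ^ 2 / 4 - b ^ 2 * β) : m / 40 ≤ (m * α).re / 2 - |D.re| := by
  have h := norm_discr_sub_le (m := m) (b := b) (by linarith) hα hβ
  rw [← hD] at h
  have h0 : 0 ≤ η := (norm_nonneg _).trans hα
  have hre := re_le_of_norm_sub_le h
  have him := abs_im_le_of_norm_sub_le h
  have e1 : (D ^ 2).re = D.re ^ 2 - D.im ^ 2 := by rw [pow_two, Complex.mul_re]; ring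
  have e2 : |(D ^ 2).im| = 2 * (|D.re| * |D.im|) := by
    rw [pow_two, Complex.mul_im, ← abs_mul, ← abs_two, ← abs_mul]
    congr 1; ring
  rw [e1] at hre
  rw [e2] at him
  have hmb2 : b ^ 2 ≤ m ^ 2 := by gcongr
  have hA : 99 / 100 ≤ α.re := by
    have := le_re_of_norm_sub_le (r := 1) (by simpa using hα); linarith
  rw [Complex.re_ofReal_mul]
  have herr : (3 / 4 * m ^ 2 + b ^ 2) * η ≤ m ^ 2 * (7 / 400) := by
    calc _ ≤ (3 / 4 * m ^ 2 + m ^ 2) * (1 / 100) := by gcongr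
      _ = _ := by ring
  have hp : |D.re| ≤ 47 / 100 * m := by
    -- If |Re D| exceeded 0.47 m, the bound on the imaginary part of D² would force |Im D| ≤ m/40,
    -- and then the real part of D² would be too large.
    by_contra! hcon
    have hp2 : (47 / 100 * m) ^ 2 ≤ D.re ^ 2 := by rw [← sq_abs D.re]; gcongr
    have hq : |D.im| ≤ m / 40 := by
      by_contra! hq
      have : (47 / 100 * m) * (m / 40) ≤ |D.re| * |D.im| := by gcongr
      nlinarith
    have hq2 : D.im ^ 2 ≤ (m / 40) ^ 2 := by rw [← sq_abs D.im]; gcongr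
    nlinarith
  nlinarith

/-- In the overdamped regime one root of the characteristic equation is of size `b² / m`. -/
lemma exists_sqrt_discr_of_le (hm : 0 < m) (hbm : 16 * b ^ 2 ≤ m ^ 2) (hη : η ≤ 1 / 100)
    (hα : ‖α - 1‖ ≤ η) (hβ : ‖β - 1‖ ≤ η) :
    ∃ D : ℂ, D ^ 2 = (m * α) ^ 2 / 4 - b ^ 2 * β ∧ 0 ≤ D.re ∧
      b ^ 2 / (2 * m) ≤ (m * α / 2 - D).re ∧ m / 4 ≤ ‖D‖ ∧ ‖m * α / 2 - D‖ ≤ 2 * b ^ 2 / m := by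
  have hα' : ‖α - 1‖ ≤ 1 / 100 := hα.trans hη
  have hβ' : ‖β - 1‖ ≤ 1 / 100 := hβ.trans hη
  have hαl : 99 / 100 ≤ ‖α‖ := by
    have := norm_sub_norm_le 1 α
    rw [norm_one, norm_sub_rev] at this; linarith
  have hαu : ‖α‖ ≤ 101 / 100 := by
    have := norm_sub_norm_le α 1
    rw [norm_one] at this; linarith
  have hβu : ‖β‖ ≤ 101 / 100 := by
    have := norm_sub_norm_le β 1
    rw [norm_one] at this; linarith
  have hα0 : α ≠ 0 := by rintro rfl; norm_num at hαl
  have hmC : (m : ℂ) ≠ 0 := by exact_mod_cast hm.ne'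
  -- Normalised so that the discriminant is (mα/2)²(1 - q). Then D = (mα/2)s with s the square root
  -- of 1 - q in the right half plane, and s is near 1.
  set q : ℂ := b ^ 2 * β / (m * α / 2) ^ 2 with hq
  have hq1 : ‖q‖ ≤ 13 / 50 := by
    rw [hq, norm_div, norm_pow, norm_mul, norm_div, norm_mul, norm_pow, Complex.norm_real,
      Complex.norm_real, Complex.norm_ofNat, Real.norm_of_nonneg hm.le, Real.norm_eq_abs, sq_abs]
    have h1 : (m * (99 / 100) / 2) ^ 2 ≤ (m * ‖α‖ / 2) ^ 2 := by gcongr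
    have h0 : 0 < (m * (99 / 100) / 2) ^ 2 := by positivity
    rw [div_le_iff₀ (h0.trans_le h1)]
    have h2 : b ^ 2 * ‖β‖ ≤ m ^ 2 / 16 * (101 / 100) := by gcongr; linarith
    nlinarith [sq_nonneg m]
  obtain ⟨s, hs2, hsre⟩ : ∃ s : ℂ, s ^ 2 = 1 - q ∧ 0 ≤ s.re := by
    obtain ⟨s, hs⟩ := exists_sq_eq (1 - q)
    rcases le_total 0 s.re with h | h
    · exact ⟨s, hs, h⟩
    · exact ⟨-s, by simpa using hs, by simpa using h⟩
  have hs1 : 1 ≤ ‖1 + s‖ := by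
    refine le_trans ?_ (Complex.re_le_norm _)
    simpa using hsre
  have hs3 : (1 - s) * (1 + s) = q := by linear_combination -hs2
  have hs4 : ‖1 - s‖ ≤ 13 / 50 := by
    have : ‖1 - s‖ * ‖1 + s‖ = ‖q‖ := by rw [← norm_mul, hs3]
    nlinarith [norm_nonneg (1 - s)]
  have hs5 : 174 / 100 ≤ ‖1 + s‖ := by
    have := norm_sub_norm_le 2 (1 - s)
    rw [Complex.norm_ofNat, show (2 : ℂ) - (1 - s) = 1 + s by ring] at this
    linarith
  have hs6 : ‖1 + s‖ ≤ 226 / 100 := by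
    have := norm_sub_le 2 (1 - s)
    rw [Complex.norm_ofNat, show (2 : ℂ) - (1 - s) = 1 + s by ring] at this
    linarith
  have hs0 : 1 + s ≠ 0 := by intro h; rw [h] at hs1; norm_num at hs1
  -- The slow root without cancellation: mα/2 - D = (mα/2)q/(1 + s) = (2b²/m)w, where w is within
  -- 1/10 of its unperturbed limit 1/2.
  set w : ℂ := β / (α * (1 + s)) with hw
  have hw1 : ‖w - ((1 / 2 : ℝ) : ℂ)‖ ≤ 1 / 10 := by
    have e : (w - ((1 / 2 : ℝ) : ℂ)) * (α * (1 + s)) =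
        (β - 1) - (α - 1) * (1 + s) / 2 + (1 - s) / 2 := by
      rw [hw, sub_mul, div_mul_cancel₀ _ (mul_ne_zero hα0 hs0)]
      push_cast; ring
    have h1 : ‖w - ((1 / 2 : ℝ) : ℂ)‖ * (‖α‖ * ‖1 + s‖) ≤ 16 / 100 := by
      rw [← norm_mul, ← norm_mul, e]
      refine (norm_add_le _ _).trans ?_
      have h2 := norm_sub_le (β - 1) ((α - 1) * (1 + s) / 2)
      rw [norm_div, norm_mul, Complex.norm_ofNat] at h2
      rw [norm_div, Complex.norm_ofNat]
      have h3 : ‖α - 1‖ * ‖1 + s‖ ≤ 1 / 100 * (226 / 100) := by gcongr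
      linarith
    have h2 : 99 / 100 * (174 / 100) ≤ ‖α‖ * ‖1 + s‖ := by gcongr
    nlinarith [norm_nonneg (w - ((1 / 2 : ℝ) : ℂ))]
  have hBD : m * α / 2 - m * α / 2 * s = ((2 * b ^ 2 / m : ℝ) : ℂ) * w := by
    have : m * α / 2 - m * α / 2 * s = m * α / 2 * (q / (1 + s)) := by
      rw [← hs3]; field_simp
    rw [this, hq, hw]; push_cast; field_simp
  have hb0 : 0 ≤ 2 * b ^ 2 / m := by positivity
  have hαs : ‖α * s - ((1 : ℝ) : ℂ)‖ ≤ 3 / 10 := by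
    have e : α * s - ((1 : ℝ) : ℂ) = (α - 1) - α * (1 - s) := by push_cast; ring
    rw [e]
    refine (norm_sub_le _ _).trans ?_
    rw [norm_mul]
    have : ‖α‖ * ‖1 - s‖ ≤ 101 / 100 * (13 / 50) := by gcongr
    linarith
  have e3 : (m * α / 2 * s : ℂ) = ((m / 2 : ℝ) : ℂ) * (α * s) := by push_cast; ring
  have h7 := le_re_of_norm_sub_le hαs
  refine ⟨m * α / 2 * s, ?_, ?_, ?_, ?_, ?_⟩
  · rw [mul_pow, hs2, hq]; field_simp; ring
  · rw [e3, Complex.re_ofReal_mul]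
    have : 0 ≤ (α * s).re := by linarith
    positivity
  · rw [hBD, Complex.re_ofReal_mul]
    have := le_re_of_norm_sub_le hw1
    calc b ^ 2 / (2 * m) = 2 * b ^ 2 / m * (1 / 4) := by field_simp; norm_num
      _ ≤ _ := by gcongr; linarith
  · rw [e3]
    refine le_trans ?_ (Complex.re_le_norm _)
    rw [Complex.re_ofReal_mul]; nlinarith
  · rw [hBD, norm_mul, Complex.norm_real, Real.norm_of_nonneg hb0]
    have : ‖w‖ ≤ 1 := by
      have := norm_sub_norm_le w ((1 / 2 : ℝ) : ℂ)
      rw [Complex.norm_real, Real.norm_of_nonneg (by norm_num)] at this; linarith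
    nlinarith

end PropBounds

end

/-! ### Propagator bounds in the different regimes -/

noncomputable section

section PropEstimates

variable {t m b η : ℝ} {α β : ℂ}

lemma norm_one_sub_near {z : ℂ} (h : ‖z - 1‖ ≤ η) (hη : η ≤ 1 / 100) :
    ‖z‖ ≤ 101 / 100 ∧ 99 / 100 ≤ z.re := by
  have h1 := norm_sub_norm_le z 1
  rw [norm_one] at h1
  have := le_re_of_norm_sub_le (r := 1) (z := z) (c := η) (by simpa using h)
  constructor <;> linarith

lemma norm_discr_le (hη : η ≤ 1 / 100) (hα : ‖α - 1‖ ≤ η) (hβ : ‖β - 1‖ ≤ η) :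
    ‖(m * α) ^ 2 / 4 - b ^ 2 * β‖ ≤ m ^ 2 + 2 * b ^ 2 := by
  obtain ⟨h1, -⟩ := norm_one_sub_near hα hη
  obtain ⟨h2, -⟩ := norm_one_sub_near hβ hη
  refine (norm_sub_le _ _).trans ?_
  rw [norm_div, norm_pow, norm_mul, norm_mul, norm_pow, Complex.norm_real, Complex.norm_real,
    Complex.norm_ofNat, mul_pow, Real.norm_eq_abs, Real.norm_eq_abs, sq_abs, sq_abs]
  have h3 : ‖α‖ ^ 2 ≤ (101 / 100) ^ 2 := by gcongr
  have h4 : m ^ 2 * ‖α‖ ^ 2 ≤ m ^ 2 * (101 / 100) ^ 2 := by gcongr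
  have h5 : b ^ 2 * ‖β‖ ≤ b ^ 2 * (101 / 100) := by gcongr
  nlinarith [sq_nonneg m, sq_nonneg b]

lemma norm_exp_damp_le_one (ht : 0 ≤ t) (hm : 0 < m) (hη : η ≤ 1 / 100) (hα : ‖α - 1‖ ≤ η) :
    ‖Complex.exp (-(m * α * t / 2))‖ ≤ 1 ∧ ‖Complex.exp (-(m * α * t / 2)) - 1‖ ≤ t * m := by
  obtain ⟨h1, h2⟩ := norm_one_sub_near hα hη
  have e : (-(m * α * t / 2) : ℂ) = ((-(t * m / 2) : ℝ) : ℂ) * α := by push_cast; ring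
  have hre : (-(m * α * t / 2) : ℂ).re ≤ 0 := by
    rw [e, Complex.re_ofReal_mul]
    have : 0 ≤ t * m / 2 * α.re := by positivity
    linarith
  constructor
  · rw [Complex.norm_exp, Real.exp_le_one_iff]; exact hre
  · refine (norm_exp_sub_one_le_of_re_nonpos hre).trans ?_
    rw [e, norm_mul, Complex.norm_real, Real.norm_eq_abs, abs_neg, abs_of_nonneg (by positivity)]
    have : 0 ≤ t * m := by positivity
    nlinarith

/-- Absorbs the linear factor in front of the exponential in `norm_cosProp_le` at the price of a
small part of the decay. -/
lemma one_add_mul_exp_le {y K : ℝ} (hK : 0 < K) (hy : 0 ≤ y) :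
    1 + y ≤ (1 + K) * Real.exp (y / K) := by
  have h1 := Real.add_one_le_exp (y / K)
  have h0 : 0 ≤ y / K := by positivity
  calc 1 + y = 1 + K * (y / K) := by field_simp
    _ ≤ (1 + K) * (y / K + 1) := by nlinarith
    _ ≤ _ := by gcongr

set_option maxHeartbeats 400000 in
-- On bounded time intervals the growth t|Re D| is bounded: for m ≤ b because tbη ≤ 1 controls the
-- perturbation of the phase, and for b ≤ m because m ≤ M there. The distance to 1 is measured by
-- square roots on purpose: √(tb) will later cost only half a power of t^{1-σ/(2δ)}.
lemma small_time_bounds (T M : ℝ) (hT : 0 ≤ T) (hM : 0 ≤ M) :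
    ∃ C : ℝ, 0 < C ∧ ∀ (t m b η : ℝ) (α β : ℂ), 0 ≤ t → t ≤ T → 0 < m → 0 < b →
      (b ≤ m → m ≤ M) → η ≤ 1 / 100 → t * b * η ≤ 1 → ‖α - 1‖ ≤ η → ‖β - 1‖ ≤ η →
      (‖meanProp t (m * α) (b ^ 2 * β)‖ ≤ C * Real.exp (-(t * m / 8)) ∧
      ‖cosProp t (m * α) (b ^ 2 * β)‖ ≤ C * Real.exp (-(t * m / 8))) ∧
      (t * m ≤ 1 →
        ‖meanProp t (m * α) (b ^ 2 * β) - 1‖ ≤ C * (√(t * m) + √(t * b)) ∧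
        ‖cosProp t (m * α) (b ^ 2 * β) - 1‖ ≤ C * (√(t * m) + √(t * b))) := by
  set K : ℝ := 2 + 2 * T * M with hK
  have hK0 : 0 ≤ K := by positivity
  refine ⟨5 * Real.exp K + 2 * Real.exp 4 + 2, by positivity, ?_⟩
  intro t m b η α β ht htT hm hb hbm hη htb hα hβ
  set V : ℂ := (m * α) ^ 2 / 4 - b ^ 2 * β with hV
  obtain ⟨D, hD⟩ := exists_sq_eq V
  obtain ⟨hα1, hα2⟩ := norm_one_sub_near hα hη
  have hη0 : 0 ≤ η := (norm_nonneg _).trans hα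
  have hDre : t * |D.re| ≤ K := by
    rcases le_total m b with h | h
    · have := abs_re_sqrt_discr_le_of_le hm h hη hα hβ hD
      calc t * |D.re| ≤ t * (2 * b * η) := by gcongr
        _ = 2 * (t * b * η) := by ring
        _ ≤ 2 := by linarith
        _ ≤ K := by rw [hK]; linarith [mul_nonneg hT hM]
    · have h1 := norm_discr_le (m := m) (b := b) hη hα hβ
      rw [← hV, ← hD, norm_pow] at h1
      have h2 : ‖D‖ ≤ 2 * m := by
        apply abs_le_of_sq_le_sq' _ (by positivity) |>.2
        have : b ^ 2 ≤ m ^ 2 := by gcongr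
        nlinarith
      calc t * |D.re| ≤ T * (2 * M) := by
            have := (Complex.abs_re_le_norm D).trans h2
            have := hbm h
            gcongr; linarith
        _ ≤ K := by rw [hK]; linarith
  -- Half of Re α is at least 0.495, rounded down to 0.49; the surplus over 1/8 absorbs the linear
  -- factor of `cosProp`.
  have hexp : Real.exp (-(t * ((m * α : ℂ).re / 2 - |D.re|))) ≤
      Real.exp K * Real.exp (-(t * m * (49 / 100))) := by
    rw [← Real.exp_add, Real.exp_le_exp, Complex.re_ofReal_mul]
    have : t * m * (99 / 100) ≤ t * m * α.re := by gcongr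
    have h0 : 0 ≤ t * m := by positivity
    nlinarith
  have htm : 0 ≤ t * m := by positivity
  have hexp2 : Real.exp (-(t * m * (49 / 100))) ≤ Real.exp (-(t * m / 8)) := by
    rw [Real.exp_le_exp]; linarith
  have hmean : ‖meanProp t (m * α) (b ^ 2 * β)‖ ≤ Real.exp K * Real.exp (-(t * m / 8)) :=
    (norm_meanProp_le ht hD).trans (hexp.trans (by gcongr))
  have hcos : ‖cosProp t (m * α) (b ^ 2 * β)‖ ≤ 5 * Real.exp K * Real.exp (-(t * m / 8)) := by
    refine (norm_cosProp_le ht hD).trans ?_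
    have h1 : 1 + t * ‖(m * α : ℂ)‖ / 2 ≤ 1 + t * m := by
      rw [norm_mul, Complex.norm_real, Real.norm_of_nonneg hm.le]
      nlinarith
    have h2 := one_add_mul_exp_le (K := 4) (by norm_num) htm
    calc _ ≤ ((1 + 4) * Real.exp (t * m / 4)) *
            (Real.exp K * Real.exp (-(t * m * (49 / 100)))) := by
          gcongr; exact h1.trans h2
      _ = 5 * Real.exp K * (Real.exp (t * m / 4) * Real.exp (-(t * m * (49 / 100)))) := by ring
      _ ≤ _ := by
          rw [← Real.exp_add]; gcongr; linarith
  have e4 : 0 < Real.exp 4 := Real.exp_pos _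
  have eK : 0 < Real.exp K := Real.exp_pos _
  have he8 : Real.exp (-(t * m / 8)) ≤ 1 := Real.exp_le_one_iff.2 (by linarith)
  refine ⟨⟨hmean.trans ?_, hcos.trans ?_⟩, fun htm1 => ?_⟩
  · gcongr; linarith
  · gcongr; linarith
  have hmean1 : ‖meanProp t (m * α) (b ^ 2 * β)‖ ≤ Real.exp K :=
    hmean.trans (mul_le_of_le_one_right eK.le he8)
  have hcos1 : ‖cosProp t (m * α) (b ^ 2 * β)‖ ≤ 5 * Real.exp K :=
    hcos.trans (mul_le_of_le_one_right (by positivity) he8)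
  have hs1 : 0 ≤ √(t * m) := Real.sqrt_nonneg _
  -- For tb ≤ 1 the entire series are compared with their first term; for tb ≥ 1 the right-hand side
  -- is bounded below and boundedness of the propagators is enough.
  rcases le_total (t * b) 1 with htb1 | htb1
  · have htb0 : 0 ≤ t * b := by positivity
    have hsq : ∀ u : ℝ, 0 ≤ u → u ≤ 1 → u ^ 2 ≤ √u ∧ u ≤ √u := by
      intro u h0 h1
      have h2 : √u ≤ 1 := Real.sqrt_le_one.2 h1
      have h3 := Real.sq_sqrt h0
      have h4 := Real.sqrt_nonneg u
      constructor <;> nlinarith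
    have hW : ‖(t : ℂ) ^ 2 * V‖ ≤ (t * m) ^ 2 + 2 * (t * b) ^ 2 := by
      rw [norm_mul, norm_pow, Complex.norm_real, Real.norm_of_nonneg ht]
      have := norm_discr_le (m := m) (b := b) hη hα hβ
      calc _ ≤ t ^ 2 * (m ^ 2 + 2 * b ^ 2) := by gcongr
        _ = _ := by ring
    have hW4 : ‖(t : ℂ) ^ 2 * V‖ ≤ 4 := by nlinarith
    have hW2 : ‖(t : ℂ) ^ 2 * V‖ ≤ 2 * (√(t * m) + √(t * b)) := by
      linarith [(hsq _ htm htm1).1, (hsq _ htb0 htb1).1]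
    have hWe : ‖(t : ℂ) ^ 2 * V‖ * Real.exp ‖(t : ℂ) ^ 2 * V‖ ≤
        2 * Real.exp 4 * (√(t * m) + √(t * b)) := by
      calc _ ≤ (2 * (√(t * m) + √(t * b))) * Real.exp 4 := by gcongr
        _ = _ := by ring
    obtain ⟨hE1, hE2⟩ := norm_exp_damp_le_one ht hm hη hα
    have hs2 : 0 ≤ √(t * b) := Real.sqrt_nonneg _
    have hts := (hsq _ htm htm1).2
    have key : ∀ F : ℂ, ‖F - 1‖ ≤ 2 * Real.exp 4 * (√(t * m) + √(t * b)) →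
        ‖Complex.exp (-(m * α * t / 2)) * F - 1‖ ≤
        (2 * Real.exp 4 + 1) * (√(t * m) + √(t * b)) := by
      intro F hF
      have e : Complex.exp (-(m * α * t / 2)) * F - 1 =
        Complex.exp (-(m * α * t / 2)) * (F - 1) + (Complex.exp (-(m * α * t / 2)) - 1) := by ring
      rw [e]
      refine (norm_add_le _ _).trans ?_
      rw [norm_mul]
      have := mul_le_mul hE1 hF (norm_nonneg _) zero_le_one
      linarith
    have hm1 := key _ ((norm_sinhcSqrt_sub_one_le _).trans hWe)
    have hc1 := key _ ((norm_coshSqrt_sub_one_le _).trans hWe)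
    constructor
    · refine hm1.trans ?_
      gcongr ?_ * _
      linarith
    · have e : cosProp t (m * α) (b ^ 2 * β) - 1 =
          (Complex.exp (-(m * α * t / 2)) * coshSqrt (t ^ 2 * V) - 1) +
          m * α * t / 2 * meanProp t (m * α) (b ^ 2 * β) := by
        rw [cosProp, meanProp]; ring
      rw [e]
      refine (norm_add_le _ _).trans ?_
      have h3 : ‖(m * α * t / 2 : ℂ) * meanProp t (m * α) (b ^ 2 * β)‖ ≤
          Real.exp K * (√(t * m) + √(t * b)) := by
        rw [norm_mul, norm_div, norm_mul, norm_mul, Complex.norm_real, Complex.norm_real,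
          Real.norm_of_nonneg ht, Real.norm_of_nonneg hm.le, Complex.norm_ofNat]
        have : m * ‖α‖ * t / 2 ≤ t * m := by
          have := mul_le_mul_of_nonneg_left (show ‖α‖ / 2 ≤ 1 by linarith) htm
          linarith
        calc _ ≤ (t * m) * Real.exp K := by gcongr
          _ ≤ (√(t * m) + √(t * b)) * Real.exp K := by gcongr; linarith
          _ = _ := by ring
      have : 0 ≤ √(t * m) + √(t * b) := by positivity
      calc _ ≤ (2 * Real.exp 4 + 1) * (√(t * m) + √(t * b)) +
            Real.exp K * (√(t * m) + √(t * b)) := add_le_add hc1 h3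
        _ = (Real.exp K + 2 * Real.exp 4 + 1) * (√(t * m) + √(t * b)) := by ring
        _ ≤ _ := by gcongr <;> linarith
  · have hs2 : 1 ≤ √(t * b) := Real.one_le_sqrt.2 htb1
    have : 1 ≤ √(t * m) + √(t * b) := by linarith
    have h1 : ∀ F : ℂ, ‖F‖ ≤ 5 * Real.exp K →
        ‖F - 1‖ ≤ (5 * Real.exp K + 2 * Real.exp 4 + 2) * (√(t * m) + √(t * b)) := by
      intro F hF
      have := norm_sub_le F 1
      rw [norm_one] at this
      calc _ ≤ 5 * Real.exp K + 2 * Real.exp 4 + 2 := by linarith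
        _ ≤ _ := le_mul_of_one_le_right (by positivity) (by assumption)
    exact ⟨h1 _ (by linarith), h1 _ hcos1⟩

/-- For m ≥ 4b the roots separate: the slow rate is of size b²/m and the fast one of size m. Since D
is of size at least m/4, writing t D `meanProp` as a damped sinh gains a factor 1/(tm), which makes
up for the weak decay of `meanProp`. -/
lemma overdamped_bounds (ht : 0 ≤ t) (hm : 0 < m) (hbm : 16 * b ^ 2 ≤ m ^ 2)
    (hη : η ≤ 1 / 100) (hα : ‖α - 1‖ ≤ η) (hβ : ‖β - 1‖ ≤ η) :
    ‖meanProp t (m * α) (b ^ 2 * β)‖ ≤ Real.exp (-(t * (b ^ 2 / (2 * m)))) ∧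
    t * m * ‖meanProp t (m * α) (b ^ 2 * β)‖ ≤ 4 * Real.exp (-(t * (b ^ 2 / (2 * m)))) ∧
    ‖cosProp t (m * α) (b ^ 2 * β)‖ ≤ 4 * Real.exp (-(t * (b ^ 2 / (2 * m)))) ∧
    ‖cosProp t (m * α) (b ^ 2 * β) - 1‖ ≤ 12 * (t * (b ^ 2 / m)) ∧
    (t * m ≤ 1 → ‖meanProp t (m * α) (b ^ 2 * β) - 1‖ ≤ 16 * (t * m)) := by
  obtain ⟨D, hD, hD0, hre, hDm, hBD⟩ := exists_sqrt_discr_of_le hm hbm hη hα hβ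
  obtain ⟨hα1, hα2⟩ := norm_one_sub_near hα hη
  have hreB : (m * α / 2 - D : ℂ).re = (m * α : ℂ).re / 2 - |D.re| := by
    rw [abs_of_nonneg hD0, Complex.sub_re]
    simp
  rw [hreB] at hre
  have hexp : Real.exp (-(t * ((m * α : ℂ).re / 2 - |D.re|))) ≤
      Real.exp (-(t * (b ^ 2 / (2 * m)))) := by
    rw [Real.exp_le_exp, neg_le_neg_iff]; gcongr
  have hmean := (norm_meanProp_le ht hD).trans hexp
  have hDne : D ≠ 0 := by
    intro h; rw [h, norm_zero] at hDm; linarith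
  have hnA : ‖(m * α : ℂ)‖ ≤ 101 / 100 * m := by
    rw [norm_mul, Complex.norm_real, Real.norm_of_nonneg hm.le]; nlinarith
  have htD : t * D * meanProp t (m * α) (b ^ 2 * β) =
      Complex.exp (-(m * α * t / 2)) * Complex.sinh (t * D) := by
    rw [meanProp, ← hD, ← mul_pow, ← mul_sinhcSqrt_sq]; ring
  have hexpD : ∀ F : ℂ, ‖F‖ ≤ Real.exp |(t * D : ℂ).re| →
      ‖Complex.exp (-(m * α * t / 2)) * F‖ ≤ Real.exp (-(t * (b ^ 2 / (2 * m)))) := by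
    intro F hF
    refine le_trans ?_ hexp
    rw [norm_mul, Complex.norm_exp]
    refine (mul_le_mul_of_nonneg_left hF (Real.exp_nonneg _)).trans ?_
    rw [← Real.exp_add, Real.exp_le_exp, Complex.re_ofReal_mul, abs_mul, abs_of_nonneg ht]
    have : (-(m * α * t / 2) : ℂ).re = -((m * α : ℂ).re * t / 2) := by simp
    rw [this]; linarith
  have htD2 : t * ‖D‖ * ‖meanProp t (m * α) (b ^ 2 * β)‖ ≤ Real.exp (-(t * (b ^ 2 / (2 * m)))) := by
    have : t * ‖D‖ * ‖meanProp t (m * α) (b ^ 2 * β)‖ =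
        ‖t * D * meanProp t (m * α) (b ^ 2 * β)‖ := by
      rw [norm_mul, norm_mul, Complex.norm_real, Real.norm_of_nonneg ht]
    rw [this, htD]
    exact hexpD _ (norm_sinh_le _)
  have htm : t * m * ‖meanProp t (m * α) (b ^ 2 * β)‖ ≤ 4 * Real.exp (-(t * (b ^ 2 / (2 * m)))) := by
    calc _ ≤ t * (4 * ‖D‖) * ‖meanProp t (m * α) (b ^ 2 * β)‖ := by gcongr; linarith
      _ = 4 * (t * ‖D‖ * ‖meanProp t (m * α) (b ^ 2 * β)‖) := by ring
      _ ≤ _ := by gcongr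
  have hcos : cosProp t (m * α) (b ^ 2 * β) =
      Complex.exp (-(m * α * t / 2)) * Complex.cosh (t * D) +
      m * α * t / 2 * meanProp t (m * α) (b ^ 2 * β) := by
    rw [cosProp, meanProp, ← hD, ← mul_pow, coshSqrt_sq]; ring
  refine ⟨hmean, htm, ?_, ?_, ?_⟩
  · rw [hcos]
    refine (norm_add_le _ _).trans ?_
    have h1 := hexpD _ (norm_cosh_le (t * D))
    have h2 : ‖(m * α * t / 2 : ℂ) * meanProp t (m * α) (b ^ 2 * β)‖ ≤
        101 / 200 * (t * m * ‖meanProp t (m * α) (b ^ 2 * β)‖) := by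
      rw [norm_mul, norm_div, norm_mul, Complex.norm_real, Real.norm_of_nonneg ht,
        Complex.norm_ofNat]
      calc _ ≤ 101 / 100 * m * t / 2 * ‖meanProp t (m * α) (b ^ 2 * β)‖ := by gcongr
        _ = _ := by ring
    have h3 := Real.exp_pos (-(t * (b ^ 2 / (2 * m))))
    linarith
  · set B : ℂ := m * α / 2 with hB
    -- Partial fractions in the two exponentials. The slow one differs from 1 by O(tb²/m); the fast
    -- one differs from 1 by O(tm), but its coefficient is O(b²/m²).
    have e : cosProp t (m * α) (b ^ 2 * β) - 1 =
        (1 + B / D) / 2 * (Complex.exp (-((B - D) * t)) - 1) +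
        (D - B) / D / 2 * (Complex.exp (-((B + D) * t)) - 1) := by
      have h1 : m * α * t / 2 * meanProp t (m * α) (b ^ 2 * β) =
          B / D * (t * D * meanProp t (m * α) (b ^ 2 * β)) := by
        rw [hB]; field_simp
      have h2 : Complex.exp (-((B - D) * t)) = Complex.exp (-(m * α * t / 2)) *
          Complex.exp (t * D) := by
        rw [← Complex.exp_add]; congr 1; rw [hB]; ring
      have h3 : Complex.exp (-((B + D) * t)) = Complex.exp (-(m * α * t / 2)) *
          Complex.exp (-(t * D)) := by
        rw [← Complex.exp_add]; congr 1; rw [hB]; ring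
      rw [hcos, h1, htD, h2, h3, Complex.cosh, Complex.sinh]
      field_simp
      ring
    have hnB : ‖B‖ ≤ 101 / 200 * m := by
      rw [hB, norm_div, Complex.norm_ofNat]; linarith
    have hb2 : b ^ 2 / m ≤ m / 16 := by
      rw [div_le_iff₀ hm]; nlinarith
    have hb0 : 0 ≤ b ^ 2 / m := by positivity
    have hDpos : 0 < ‖D‖ := by linarith
    have h1 : ‖(1 + B / D) / 2‖ ≤ 2 := by
      rw [norm_div, Complex.norm_ofNat, div_le_iff₀ (by norm_num)]
      refine (norm_add_le _ _).trans ?_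
      rw [norm_one, norm_div]
      have : ‖B‖ / ‖D‖ ≤ 3 := by
        rw [div_le_iff₀ hDpos]; linarith
      linarith
    have hre0 : 0 ≤ (m * α : ℂ).re / 2 - |D.re| := le_trans (by positivity) hre
    have h2 : ‖Complex.exp (-((B - D) * t)) - 1‖ ≤ 2 * (t * (b ^ 2 / m)) := by
      refine (norm_exp_sub_one_le_of_re_nonpos ?_).trans ?_
      · rw [Complex.neg_re, Complex.re_mul_ofReal, hreB]
        have := mul_nonneg hre0 ht
        linarith
      · rw [norm_neg, norm_mul, Complex.norm_real, Real.norm_of_nonneg ht]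
        calc _ ≤ 2 * b ^ 2 / m * t := by gcongr
          _ = _ := by ring
    have h3 : ‖(D - B) / D / 2‖ ≤ 4 * (b ^ 2 / m / m) := by
      rw [norm_div, norm_div, Complex.norm_ofNat, norm_sub_rev, div_div, div_le_iff₀ (by positivity)]
      refine hBD.trans ?_
      calc 2 * b ^ 2 / m = 4 * (b ^ 2 / m / m) * (m / 4 * 2) := by field_simp
        _ ≤ _ := by gcongr
    have h4 : ‖Complex.exp (-((B + D) * t)) - 1‖ ≤ 2 * (t * m) := by
      refine (norm_exp_sub_one_le_of_re_nonpos ?_).trans ?_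
      · rw [Complex.neg_re, Complex.re_mul_ofReal]
        have h5 : 0 ≤ (B + D).re := by
          have : B.re = (m * α : ℂ).re / 2 := by rw [hB]; simp
          rw [Complex.add_re, this]; linarith [abs_nonneg D.re]
        have := mul_nonneg h5 ht
        linarith
      · rw [norm_neg, norm_mul, Complex.norm_real, Real.norm_of_nonneg ht]
        have h6 : ‖B + D‖ ≤ 2 * m := by
          have : B + D = 2 * B - (B - D) := by ring
          rw [this]
          refine (norm_sub_le _ _).trans ?_
          rw [norm_mul, Complex.norm_ofNat]
          have : ‖B - D‖ ≤ 2 * (b ^ 2 / m) := hBD.trans (le_of_eq (by ring))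
          linarith
        nlinarith
    rw [e]
    refine (norm_add_le _ _).trans ?_
    rw [norm_mul, norm_mul]
    have h5 : ‖(D - B) / D / 2‖ * ‖Complex.exp (-((B + D) * t)) - 1‖ ≤ 8 * (t * (b ^ 2 / m)) := by
      calc _ ≤ 4 * (b ^ 2 / m / m) * (2 * (t * m)) := by gcongr
        _ = _ := by field_simp; ring
    have h6 : ‖(1 + B / D) / 2‖ * ‖Complex.exp (-((B - D) * t)) - 1‖ ≤
        2 * (2 * (t * (b ^ 2 / m))) := by gcongr
    linarith
  · intro htm1
    obtain ⟨hE1, hE2⟩ := norm_exp_damp_le_one ht hm hη hα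
    set V : ℂ := (m * α) ^ 2 / 4 - b ^ 2 * β with hV
    have htm0 : 0 ≤ t * m := by positivity
    have hW : ‖(t : ℂ) ^ 2 * V‖ ≤ 9 / 8 * (t * m) := by
      rw [norm_mul, norm_pow, Complex.norm_real, Real.norm_of_nonneg ht]
      have := norm_discr_le (m := m) (b := b) hη hα hβ
      calc _ ≤ t ^ 2 * (m ^ 2 + 2 * b ^ 2) := by gcongr
        _ ≤ t ^ 2 * (9 / 8 * m ^ 2) := by gcongr; linarith
        _ = 9 / 8 * (t * m) ^ 2 := by ring
        _ ≤ _ := by nlinarith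
    have hexp4 : Real.exp ‖(t : ℂ) ^ 2 * V‖ ≤ 8 := by
      have h2 : Real.exp (9 / 8 : ℝ) ≤ 8 := by
        have : Real.exp (9 / 8 : ℝ) ≤ Real.exp 2 := Real.exp_le_exp.2 (by norm_num)
        have h3 : Real.exp 2 = Real.exp 1 ^ 2 := by rw [← Real.exp_nat_mul]; norm_num
        have := Real.exp_one_lt_d9
        have := Real.exp_pos 1
        nlinarith
      refine le_trans (Real.exp_le_exp.2 ?_) h2
      linarith
    have hS := (norm_sinhcSqrt_sub_one_le (t ^ 2 * V)).trans
      (mul_le_mul hW hexp4 (Real.exp_nonneg _) (by positivity))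
    have e : meanProp t (m * α) (b ^ 2 * β) - 1 =
        Complex.exp (-(m * α * t / 2)) * (sinhcSqrt (t ^ 2 * V) - 1) +
        (Complex.exp (-(m * α * t / 2)) - 1) := by rw [meanProp]; ring
    rw [e]
    refine (norm_add_le _ _).trans ?_
    rw [norm_mul]
    have := mul_le_mul hE1 hS (norm_nonneg _) zero_le_one
    linarith

/-- Valid for all times, with no upper limit. For m ≤ b the root D is almost imaginary and tbη ≤ 1
keeps its real part harmless; for b ≤ m ≤ 4b the margin m/40 of the intermediate regime applies.
`cosProp` keeps only half of that rate, after absorbing a linear factor. -/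
lemma oscillating_bounds (ht : 0 ≤ t) (hm : 0 < m) (hb : 0 < b) (hbm : m ^ 2 ≤ 16 * b ^ 2)
    (hη : η ≤ 1 / 100) (htb : m ≤ b → t * b * η ≤ 1) (hα : ‖α - 1‖ ≤ η) (hβ : ‖β - 1‖ ≤ η) :
    ‖meanProp t (m * α) (b ^ 2 * β)‖ ≤ Real.exp 2 * Real.exp (-(t * m / 40)) ∧
    ‖cosProp t (m * α) (b ^ 2 * β)‖ ≤ 81 * Real.exp 2 * Real.exp (-(t * m / 80)) := by
  obtain ⟨D, hD⟩ := exists_sq_eq ((m * α) ^ 2 / 4 - b ^ 2 * β)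
  obtain ⟨hα1, hα2⟩ := norm_one_sub_near hα hη
  have htm : 0 ≤ t * m := by positivity
  have hexp : Real.exp (-(t * ((m * α : ℂ).re / 2 - |D.re|))) ≤
      Real.exp 2 * Real.exp (-(t * m / 40)) := by
    rw [← Real.exp_add, Real.exp_le_exp]
    rcases le_total m b with h | h
    · have h1 := abs_re_sqrt_discr_le_of_le hm h hη hα hβ hD
      have h2 := htb h
      have h3 : t * |D.re| ≤ 2 := by
        calc t * |D.re| ≤ t * (2 * b * η) := by gcongr
          _ = 2 * (t * b * η) := by ring
          _ ≤ 2 := by linarith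
      rw [Complex.re_ofReal_mul]
      have : t * m * (99 / 100) ≤ t * m * α.re := by gcongr
      nlinarith
    · have h1 := re_sub_abs_re_sqrt_discr_of_le hm h hbm hb hη hα hβ hD
      have : t * (m / 40) ≤ t * ((m * α : ℂ).re / 2 - |D.re|) := by gcongr
      linarith
  refine ⟨(norm_meanProp_le ht hD).trans hexp, (norm_cosProp_le ht hD).trans ?_⟩
  have h1 : 1 + t * ‖(m * α : ℂ)‖ / 2 ≤ 1 + t * m := by
    rw [norm_mul, Complex.norm_real, Real.norm_of_nonneg hm.le]
    nlinarith
  have h2 := one_add_mul_exp_le (K := 80) (by norm_num) htm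
  calc _ ≤ ((1 + 80) * Real.exp (t * m / 80)) * (Real.exp 2 * Real.exp (-(t * m / 40))) := by
        gcongr; exact h1.trans h2
    _ = 81 * Real.exp 2 * (Real.exp (t * m / 80) * Real.exp (-(t * m / 40))) := by ring
    _ = _ := by rw [← Real.exp_add]; ring_nf

end PropEstimates

end

/-! ### Symbol bounds on complex discs -/

noncomputable section

section SymbolEstimates

lemma exp_neg_rpow_le_one_add_rpow {c θ : ℝ} (hc : 0 < c) (hθ : 0 < θ) (K : ℝ) (hK : 0 ≤ K) :
    ∃ C : ℝ, 0 < C ∧ ∀ y : ℝ, 0 ≤ y → Real.exp (-(c * y ^ θ)) ≤ C * (1 + y) ^ (-K) := by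
  -- With kθ ≥ K the k-th term of the exponential series alone outgrows y^K.
  obtain ⟨k, hk⟩ := exists_nat_ge (K / θ)
  refine ⟨2 ^ K * (1 + k.factorial / c ^ k), by positivity, fun y hy => ?_⟩
  have h1y : 0 < 1 + y := by linarith
  rw [Real.rpow_neg h1y.le, ← div_eq_mul_inv, le_div_iff₀ (by positivity), Real.exp_neg,
    inv_mul_le_iff₀ (Real.exp_pos _)]
  have hexp1 : 1 ≤ Real.exp (c * y ^ θ) := Real.one_le_exp (by positivity)
  have hkc : 0 ≤ (k.factorial : ℝ) / c ^ k := by positivity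
  have h2K : 0 < (2 : ℝ) ^ K := by positivity
  rcases le_total y 1 with h | h
  · calc (1 + y) ^ K ≤ 2 ^ K := Real.rpow_le_rpow h1y.le (by linarith) hK
      _ ≤ 1 * (2 ^ K * (1 + k.factorial / c ^ k)) := by nlinarith
      _ ≤ _ := by gcongr
  · have h2 : (c * y ^ θ) ^ k / k.factorial ≤ Real.exp (c * y ^ θ) :=
      Real.pow_div_factorial_le_exp _ (by positivity) k
    have h3 : y ^ K ≤ (y ^ θ) ^ k := by
      rw [← Real.rpow_natCast, ← Real.rpow_mul hy]
      apply Real.rpow_le_rpow_of_exponent_le h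
      rw [div_le_iff₀ hθ] at hk; linarith
    have h4 : (y ^ θ) ^ k = k.factorial / c ^ k * ((c * y ^ θ) ^ k / k.factorial) := by
      rw [mul_pow]
      have : (k.factorial : ℝ) ≠ 0 := by positivity
      field_simp
    calc (1 + y) ^ K ≤ (2 * y) ^ K := Real.rpow_le_rpow h1y.le (by linarith) hK
      _ = 2 ^ K * y ^ K := Real.mul_rpow (by norm_num) hy
      _ ≤ 2 ^ K * (k.factorial / c ^ k * Real.exp (c * y ^ θ)) := by
        gcongr; refine h3.trans (h4.trans_le ?_); gcongr
      _ ≤ _ := by nlinarith [Real.exp_pos (c * y ^ θ), mul_nonneg h2K.le (Real.exp_pos (c * y ^ θ)).le]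

lemma norm_one_add_cpow_sub_one_le {α : ℝ} (hα : 0 ≤ α) {z : ℂ} (hz : ‖z‖ ≤ 1 / 2) :
    ‖(1 + z) ^ (α : ℂ) - 1‖ ≤ 2 * α * Real.exp α * ‖z‖ := by
  have h1 : 1 + z ≠ 0 := by
    intro h
    have : z = -1 := by linear_combination h
    rw [this] at hz; norm_num at hz
  rw [Complex.cpow_def_of_ne_zero h1]
  have h2 := Complex.norm_log_one_add_half_le_self hz
  set y := Complex.log (1 + z) * α
  have hy : ‖y‖ ≤ 3 / 2 * ‖z‖ * α := by
    rw [norm_mul, Complex.norm_real, Real.norm_of_nonneg hα]; gcongr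
  have hy2 : ‖y‖ ≤ α := by nlinarith
  have h3 := Complex.norm_exp_sub_sum_le_norm_mul_exp y 1
  simp only [Finset.range_one, Finset.sum_singleton, pow_zero, Nat.factorial_zero, Nat.cast_one,
    div_one, pow_one] at h3
  calc _ ≤ ‖y‖ * Real.exp ‖y‖ := h3
    _ ≤ (2 * ‖z‖ * α) * Real.exp α := by
      gcongr
      nlinarith [mul_nonneg (norm_nonneg z) hα]
    _ = _ := by ring

/-- The damping symbol `μ|ξ|^{2δ}`, with `|ξ|² = x²(1 + z)`. -/
def dampSym (δ μ x : ℝ) (z : ℂ) : ℂ := (μ * x ^ (2 * δ) : ℝ) * (1 + z) ^ (δ : ℂ)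

/-- The symbol `|ξ|^{2σ}`, with `|ξ|² = x²(1 + z)`. -/
def waveSym (σ x : ℝ) (z : ℂ) : ℂ := (x ^ σ : ℝ) ^ 2 * (1 + z) ^ (σ : ℂ)

variable {σ δ μ : ℝ}

/-- The disc |z| ≤ κ/(1 + tx^σ) is the largest, up to constants, on which the phase tx^σ changes by
O(1), so that the oscillating factor stays bounded off the real axis. -/
lemma small_time_symbol (hσ : 0 < σ) (hμ : 0 < μ) (hδ : 0 < δ) (hδσ : 2 * δ < σ) (T : ℝ) (hT : 0 ≤ T) :
    ∃ κ : ℝ, 0 < κ ∧ κ ≤ 1 / 2 ∧ ∃ c : ℝ, 0 < c ∧ ∃ C : ℝ, 0 < C ∧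
    ∀ (t x : ℝ) (z : ℂ), 0 ≤ t → t ≤ T → 0 < x → ‖z‖ ≤ κ / (1 + t * x ^ σ) →
      ∀ P ∈ ({meanProp, cosProp} : Set (ℝ → ℂ → ℂ → ℂ)),
      ‖P t (dampSym δ μ x z) (waveSym σ x z)‖ ≤ C * Real.exp (-(c * (t * x ^ (2 * δ)))) ∧
      (t * (μ * x ^ (2 * δ)) ≤ 1 → ‖P t (dampSym δ μ x z) (waveSym σ x z) - 1‖ ≤
        C * (√(t * (μ * x ^ (2 * δ))) + √(t * x ^ σ))) := by
  -- Where the damping exceeds the oscillation, x ≤ μ^{1/(σ-2δ)}, so the damping there is at most M.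
  set M : ℝ := μ * (μ ^ (1 / (σ - 2 * δ))) ^ (2 * δ) with hM
  obtain ⟨C, hC, h⟩ := small_time_bounds T M hT (by positivity)
  set L : ℝ := 2 * δ * Real.exp δ + 2 * σ * Real.exp σ with hL
  have hL0 : 0 < L := by positivity
  refine ⟨min (1 / 2) (1 / (100 * L)), by positivity, min_le_left _ _, μ / 8, by positivity, C, hC, ?_⟩
  intro t x z ht htT hx hz P hP
  set κ := min (1 / 2) (1 / (100 * L)) with hκ
  have hκ0 : 0 < κ := by positivity
  have hLκ : L * κ ≤ 1 / 100 := by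
    calc L * κ ≤ L * (1 / (100 * L)) := by gcongr; exact min_le_right _ _
      _ = 1 / 100 := by field_simp
  have hb : 0 < x ^ σ := by positivity
  have hN : 1 ≤ 1 + t * x ^ σ := by linarith [mul_nonneg ht hb.le]
  have hzκ : ‖z‖ ≤ κ := hz.trans (div_le_self hκ0.le hN)
  have hz2 : ‖z‖ ≤ 1 / 2 := hzκ.trans (min_le_left _ _)
  have hη : L * ‖z‖ ≤ 1 / 100 := le_trans (by gcongr) hLκ
  have hα : ‖(1 + z) ^ (δ : ℂ) - 1‖ ≤ L * ‖z‖ := by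
    refine (norm_one_add_cpow_sub_one_le hδ.le hz2).trans ?_
    gcongr; rw [hL]; linarith [show 0 ≤ 2 * σ * Real.exp σ by positivity]
  have hβ : ‖(1 + z) ^ (σ : ℂ) - 1‖ ≤ L * ‖z‖ := by
    refine (norm_one_add_cpow_sub_one_le hσ.le hz2).trans ?_
    gcongr; rw [hL]; linarith [show 0 ≤ 2 * δ * Real.exp δ by positivity]
  have hm : 0 < μ * x ^ (2 * δ) := by positivity
  have hbm : x ^ σ ≤ μ * x ^ (2 * δ) → μ * x ^ (2 * δ) ≤ M := by
    intro hle
    have h1 : x ^ (σ - 2 * δ) ≤ μ := by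
      rw [Real.rpow_sub hx, div_le_iff₀ (by positivity)]; exact hle
    have h2 : x ≤ μ ^ (1 / (σ - 2 * δ)) := by
      have h3 := Real.rpow_le_rpow (by positivity) h1 (show 0 ≤ 1 / (σ - 2 * δ) by
        apply div_nonneg <;> linarith)
      rwa [← Real.rpow_mul hx.le, mul_one_div_cancel (by linarith), Real.rpow_one] at h3
    rw [hM]; gcongr
  have htb : t * x ^ σ * (L * ‖z‖) ≤ 1 := by
    have h0 : 0 ≤ t * x ^ σ := by positivity
    calc t * x ^ σ * (L * ‖z‖) ≤ (1 + t * x ^ σ) * (L * (κ / (1 + t * x ^ σ))) := by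
          gcongr; linarith
      _ = L * κ := by field_simp
      _ ≤ 1 := by linarith
  obtain ⟨⟨h1, h2⟩, h3⟩ := h t (μ * x ^ (2 * δ)) (x ^ σ) (L * ‖z‖) _ _ ht htT hm hb hbm hη htb hα hβ
  have e : t * (μ * x ^ (2 * δ)) / 8 = μ / 8 * (t * x ^ (2 * δ)) := by ring
  rw [e] at h1 h2
  rcases hP with rfl | rfl
  · exact ⟨h1, fun h => (h3 h).1⟩
  · exact ⟨h2, fun h => (h3 h).2⟩

set_option maxHeartbeats 400000 in
-- Two zones. Where 4x^σ ≤ μx^{2δ}, the slow root gives diffusion at rate x^{2(σ-δ)}; elsewhere the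
-- damping rate x^{2δ} prevails. The bounds on `meanProp` after multiplication by tx^{2δ} and on its
-- distance to 1 are kept because its natural scale at low frequency is tx^{2δ} ~ 1.
lemma large_time_symbol (hσ : 0 < σ) (hμ : 0 < μ) (hδ : 0 < δ) :
    ∃ κ : ℝ, 0 < κ ∧ κ ≤ 1 / 2 ∧ ∃ c : ℝ, 0 < c ∧ ∃ C : ℝ, 0 < C ∧
    ∀ (t x : ℝ) (z : ℂ), 1 ≤ t → 0 < x → ‖z‖ ≤ κ / (1 + t * x ^ (2 * (σ - δ))) →
      (4 * x ^ σ ≤ μ * x ^ (2 * δ) →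
        (∀ P ∈ ({meanProp, cosProp} : Set (ℝ → ℂ → ℂ → ℂ)),
          ‖P t (dampSym δ μ x z) (waveSym σ x z)‖ ≤ C * Real.exp (-(c * (t * x ^ (2 * (σ - δ)))))) ∧
        t * x ^ (2 * δ) * ‖meanProp t (dampSym δ μ x z) (waveSym σ x z)‖ ≤
          C * Real.exp (-(c * (t * x ^ (2 * (σ - δ))))) ∧
        ‖cosProp t (dampSym δ μ x z) (waveSym σ x z) - 1‖ ≤ C * (t * x ^ (2 * (σ - δ))) ∧
        (‖meanProp t (dampSym δ μ x z) (waveSym σ x z) - 1‖ ≤ C * (t * x ^ (2 * δ)))) ∧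
      (μ * x ^ (2 * δ) ≤ 4 * x ^ σ →
        ∀ P ∈ ({meanProp, cosProp} : Set (ℝ → ℂ → ℂ → ℂ)),
          ‖P t (dampSym δ μ x z) (waveSym σ x z)‖ ≤ C * Real.exp (-(c * (t * x ^ (2 * δ))))) := by
  set L : ℝ := 2 * δ * Real.exp δ + 2 * σ * Real.exp σ with hL
  have hL0 : 0 < L := by positivity
  -- The bound 1/2 keeps 1 + z off the branch cut, 1/(100L) makes the perturbation at most 1/100,
  -- and μ/L serves the phase bound `htb`.
  set κ := min (1 / 2) (min (1 / (100 * L)) (μ / L)) with hκ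
  have hκ0 : 0 < κ := by positivity
  set c : ℝ := min (1 / (2 * μ)) (μ / 80) with hc
  set C : ℝ := 4 + 4 / μ + 12 / μ + 16 * μ + 2 * μ + 81 * Real.exp 2 with hC
  refine ⟨κ, hκ0, min_le_left _ _, c, by positivity, C, by positivity, ?_⟩
  intro t x z ht hx hz
  have ht0 : 0 ≤ t := by linarith
  have hLκ : L * κ ≤ 1 / 100 := by
    calc L * κ ≤ L * (1 / (100 * L)) := by
          gcongr; exact (min_le_right _ _).trans (min_le_left _ _)
      _ = 1 / 100 := by field_simp
  have hLκ2 : L * κ ≤ μ := by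
    calc L * κ ≤ L * (μ / L) := by
          gcongr; exact (min_le_right _ _).trans (min_le_right _ _)
      _ = μ := by field_simp
  have hb : 0 < x ^ σ := by positivity
  have hg : 0 < x ^ (2 * (σ - δ)) := by positivity
  have ha : 0 < x ^ (2 * δ) := by positivity
  have hgb : (x ^ σ) ^ 2 = x ^ (2 * (σ - δ)) * x ^ (2 * δ) := by
    rw [← Real.rpow_add hx, ← Real.rpow_natCast, ← Real.rpow_mul hx.le]; congr 1; push_cast; ring
  have hgb2 : (x ^ σ) ^ 2 / (μ * x ^ (2 * δ)) = x ^ (2 * (σ - δ)) / μ := by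
    rw [hgb]; field_simp
  have hgb3 : (x ^ σ) ^ 2 / (2 * (μ * x ^ (2 * δ))) = x ^ (2 * (σ - δ)) / (2 * μ) := by
    rw [hgb]; field_simp
  have hN : 1 ≤ 1 + t * x ^ (2 * (σ - δ)) := by linarith [mul_nonneg ht0 hg.le]
  have hzκ : ‖z‖ ≤ κ := hz.trans (div_le_self hκ0.le hN)
  have hz2 : ‖z‖ ≤ 1 / 2 := hzκ.trans (min_le_left _ _)
  have hη : L * ‖z‖ ≤ 1 / 100 := le_trans (by gcongr) hLκ
  have hα : ‖(1 + z) ^ (δ : ℂ) - 1‖ ≤ L * ‖z‖ := by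
    refine (norm_one_add_cpow_sub_one_le hδ.le hz2).trans ?_
    gcongr; rw [hL]; linarith [show 0 ≤ 2 * σ * Real.exp σ by positivity]
  have hβ : ‖(1 + z) ^ (σ : ℂ) - 1‖ ≤ L * ‖z‖ := by
    refine (norm_one_add_cpow_sub_one_le hσ.le hz2).trans ?_
    gcongr; rw [hL]; linarith [show 0 ≤ 2 * δ * Real.exp δ by positivity]
  have hm : 0 < μ * x ^ (2 * δ) := by positivity
  have hC1 : 4 ≤ C ∧ 4 / μ ≤ C ∧ 12 / μ ≤ C ∧ 16 * μ ≤ C ∧ 81 * Real.exp 2 ≤ C ∧ 1 ≤ C := by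
    have h1 : 0 < 4 / μ := by positivity
    have h2 : 0 < 12 / μ := by positivity
    have h3 := Real.exp_pos 2
    rw [hC]
    refine ⟨?_, ?_, ?_, ?_, ?_, ?_⟩ <;> linarith
  obtain ⟨hC4, hC4μ, hC12, hC16, hC81, hCone⟩ := hC1
  constructor
  · intro hlow
    have hbm : 16 * (x ^ σ) ^ 2 ≤ (μ * x ^ (2 * δ)) ^ 2 := by
      calc 16 * (x ^ σ) ^ 2 = (4 * x ^ σ) ^ 2 := by ring
        _ ≤ _ := by gcongr
    obtain ⟨h1, h2, h3, h4, h5⟩ := overdamped_bounds ht0 hm hbm hη hα hβ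
    have hexp : Real.exp (-(t * ((x ^ σ) ^ 2 / (2 * (μ * x ^ (2 * δ)))))) ≤
        Real.exp (-(c * (t * x ^ (2 * (σ - δ))))) := by
      rw [Real.exp_le_exp, neg_le_neg_iff, hgb3]
      calc c * (t * x ^ (2 * (σ - δ))) ≤ 1 / (2 * μ) * (t * x ^ (2 * (σ - δ))) := by
            gcongr; exact min_le_left _ _
        _ = _ := by field_simp
    refine ⟨?_, ?_, ?_, ?_⟩
    · rintro P (rfl | rfl)
      · exact h1.trans (hexp.trans (le_mul_of_one_le_left (Real.exp_nonneg _) hCone))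
      · exact h3.trans (by gcongr)
    · have : t * x ^ (2 * δ) * ‖meanProp t (dampSym δ μ x z) (waveSym σ x z)‖ =
        (t * (μ * x ^ (2 * δ)) * ‖meanProp t (dampSym δ μ x z) (waveSym σ x z)‖) / μ := by
        field_simp
      rw [this, div_le_iff₀ hμ]
      refine h2.trans ?_
      calc _ ≤ 4 * Real.exp (-(c * (t * x ^ (2 * (σ - δ))))) := by gcongr
        _ = (4 / μ) * Real.exp (-(c * (t * x ^ (2 * (σ - δ))))) * μ := by field_simp
        _ ≤ _ := by gcongr
    · refine h4.trans ?_
      rw [hgb2]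
      calc 12 * (t * (x ^ (2 * (σ - δ)) / μ)) = 12 / μ * (t * x ^ (2 * (σ - δ))) := by ring
        _ ≤ _ := by gcongr
    · rcases le_total (t * (μ * x ^ (2 * δ))) 1 with h6 | h6
      · refine (h5 h6).trans ?_
        calc 16 * (t * (μ * x ^ (2 * δ))) = 16 * μ * (t * x ^ (2 * δ)) := by ring
          _ ≤ _ := by gcongr
      · have h7 : ‖meanProp t (dampSym δ μ x z) (waveSym σ x z)‖ ≤ 1 :=
          h1.trans (Real.exp_le_one_iff.2 (by rw [neg_nonpos]; positivity))
        have h8 := norm_sub_le (meanProp t (dampSym δ μ x z) (waveSym σ x z)) 1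
        rw [norm_one] at h8
        calc _ ≤ 2 * (t * (μ * x ^ (2 * δ))) := by linarith
          _ = 2 * μ * (t * x ^ (2 * δ)) := by ring
          _ ≤ _ := by gcongr; linarith
  · intro hhigh
    have hbm : (μ * x ^ (2 * δ)) ^ 2 ≤ 16 * (x ^ σ) ^ 2 := by
      calc (μ * x ^ (2 * δ)) ^ 2 ≤ (4 * x ^ σ) ^ 2 := by gcongr
        _ = _ := by ring
    -- Where m ≤ b one has μx^σ ≤ x^{2(σ-δ)}, so the disc adapted to diffusion also controls the
    -- phase tx^σ.
    have htb : μ * x ^ (2 * δ) ≤ x ^ σ → t * x ^ σ * (L * ‖z‖) ≤ 1 := by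
      intro hle
      have h1 : t * x ^ σ * μ ≤ 1 + t * x ^ (2 * (σ - δ)) := by
        have h2 : x ^ σ * μ ≤ x ^ (2 * (σ - δ)) := by
          have : x ^ σ * μ * x ^ (2 * δ) ≤ x ^ (2 * (σ - δ)) * x ^ (2 * δ) := by
            rw [← hgb]; nlinarith
          exact le_of_mul_le_mul_right this ha
        nlinarith
      calc t * x ^ σ * (L * ‖z‖) ≤ t * x ^ σ * (L * (κ / (1 + t * x ^ (2 * (σ - δ))))) := by gcongr
        _ = t * x ^ σ * (L * κ) / (1 + t * x ^ (2 * (σ - δ))) := by ring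
        _ ≤ t * x ^ σ * μ / (1 + t * x ^ (2 * (σ - δ))) := by gcongr
        _ ≤ 1 := by rw [div_le_one (by positivity)]; exact h1
    obtain ⟨h1, h2⟩ := oscillating_bounds ht0 hm hb hbm hη htb hα hβ
    have htx : 0 ≤ t * x ^ (2 * δ) := by positivity
    have hcμ : c ≤ μ / 80 := min_le_right _ _
    have e2 : 0 < Real.exp 2 := Real.exp_pos _
    have h3 : c * (t * x ^ (2 * δ)) ≤ t * (μ * x ^ (2 * δ)) / 80 :=
      (mul_le_mul_of_nonneg_right hcμ htx).trans_eq (by ring)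
    have h4 : c * (t * x ^ (2 * δ)) ≤ t * (μ * x ^ (2 * δ)) / 40 :=
      h3.trans (by linarith [mul_nonneg ht0 hm.le])
    rintro P (rfl | rfl)
    · exact h1.trans (mul_le_mul (by linarith) (Real.exp_le_exp.2 (neg_le_neg h4))
        (Real.exp_nonneg _) (by positivity))
    · exact h2.trans (mul_le_mul hC81 (Real.exp_le_exp.2 (neg_le_neg h3))
        (Real.exp_nonneg _) (by positivity))

end SymbolEstimates

end

/-! ### A Bernstein inequality -/

noncomputable section

open LineDeriv

section Bernstein

variable {n : ℕ}

lemma hasDerivAt_schwartz_line (g : 𝓢(EuclideanSpace ℝ (Fin n), ℂ)) (y v : EuclideanSpace ℝ (Fin n))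
    (s : ℝ) : HasDerivAt (fun s : ℝ => g (y + s • v)) ((∂_{v} g) (y + s • v)) s := by
  have h1 : HasDerivAt (fun s : ℝ => y + s • v) v s := by
    simpa using ((hasDerivAt_id s).smul_const v).const_add y
  have h2 := (g.differentiableAt (x := y + s • v)).hasFDerivAt
  rw [SchwartzMap.lineDerivOp_apply_eq_fderiv]
  exact h2.comp_hasDerivAt s h1

lemma iteratedDeriv_schwartz_line (g : 𝓢(EuclideanSpace ℝ (Fin n), ℂ))
    (y v : EuclideanSpace ℝ (Fin n)) (k : ℕ) :
    iteratedDeriv k (fun s : ℝ => g (y + s • v)) =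
      fun s : ℝ => ((fun h : 𝓢(EuclideanSpace ℝ (Fin n), ℂ) => ∂_{v} h)^[k] g) (y + s • v) := by
  induction k with
  | zero => simp
  | succ k ih =>
    rw [iteratedDeriv_succ, ih, Function.iterate_succ_apply']
    ext s
    exact (hasDerivAt_schwartz_line _ y v s).deriv

lemma fourierInv_iterate_lineDeriv (g : 𝓢(EuclideanSpace ℝ (Fin n), ℂ))
    (v : EuclideanSpace ℝ (Fin n)) (k : ℕ) (x : EuclideanSpace ℝ (Fin n)) :
    ‖𝓕⁻ ((fun h : 𝓢(EuclideanSpace ℝ (Fin n), ℂ) => ∂_{v} h)^[k] g) x‖ =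
      (2 * Real.pi * |inner ℝ x v|) ^ k * ‖𝓕⁻ g x‖ := by
  induction k with
  | zero => simp
  | succ k ih =>
    rw [Function.iterate_succ_apply', SchwartzMap.fourierInv_lineDerivOp_eq]
    have : (inner ℝ · v : EuclideanSpace ℝ (Fin n) → ℝ).HasTemperateGrowth := by fun_prop
    rw [smul_apply, SchwartzMap.smulLeftCLM_apply_apply this, norm_smul, norm_smul, ih]
    simp only [norm_neg, norm_mul, Complex.norm_ofNat, Complex.norm_real, Complex.norm_I,
      Real.norm_eq_abs, abs_of_pos Real.pi_pos]
    ring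

lemma integral_norm_sq_fourierInv (g : 𝓢(EuclideanSpace ℝ (Fin n), ℂ)) :
    ∫ x, ‖𝓕⁻ g x‖ ^ 2 = ∫ ξ, ‖g ξ‖ ^ 2 := by
  have := SchwartzMap.integral_norm_sq_fourier (𝓕⁻ g)
  rw [← this, FourierTransform.fourier_fourierInv_eq]

lemma integrable_norm_sq_schwartz (g : 𝓢(EuclideanSpace ℝ (Fin n), ℂ)) :
    Integrable (fun x => ‖g x‖ ^ 2) :=
  (g.memLp 2 volume).integrable_norm_pow (by norm_num)

lemma tsupport_iterate_lineDeriv_subset (g : 𝓢(EuclideanSpace ℝ (Fin n), ℂ))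
    (v : EuclideanSpace ℝ (Fin n)) (k : ℕ) :
    tsupport ((fun h : 𝓢(EuclideanSpace ℝ (Fin n), ℂ) => ∂_{v} h)^[k] g) ⊆ tsupport g := by
  induction k with
  | zero => simp
  | succ k ih =>
    rw [Function.iterate_succ_apply']
    exact (SchwartzMap.tsupport_lineDerivOp_subset _ _).trans ih

lemma integral_norm_sq_le_of_support (g : 𝓢(EuclideanSpace ℝ (Fin n), ℂ)) {B Λ : ℝ} (hΛ : 0 < Λ)
    (hB : ∀ ξ, ‖g ξ‖ ≤ B) (hs : tsupport g ⊆ Metric.closedBall 0 Λ) :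
    ∫ ξ, ‖g ξ‖ ^ 2 ≤ B ^ 2 * (Λ ^ n * volume.real (Metric.ball (0 : EuclideanSpace ℝ (Fin n)) 1)) := by
  have h1 : ∫ ξ, ‖g ξ‖ ^ 2 = ∫ ξ in Metric.closedBall 0 Λ, ‖g ξ‖ ^ 2 := by
    rw [setIntegral_eq_integral_of_forall_compl_eq_zero]
    intro ξ hξ
    rw [image_eq_zero_of_notMem_tsupport (fun h => hξ (hs h))]; simp
  rw [h1]
  have h2 := norm_setIntegral_le_of_norm_le_const (μ := volume) (f := fun ξ => ‖g ξ‖ ^ 2)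
    (s := Metric.closedBall (0 : EuclideanSpace ℝ (Fin n)) Λ) (C := B ^ 2)
    (by simpa using measure_closedBall_lt_top) (fun ξ _ => by
      rw [Real.norm_of_nonneg (by positivity)]
      gcongr; exact hB ξ)
  refine (le_abs_self _).trans (h2.trans_eq ?_)
  congr 1
  rw [measureReal_def, measureReal_def, Measure.addHaar_closedBall _ _ hΛ.le]
  simp [ENNReal.toReal_mul, ENNReal.toReal_ofReal, hΛ.le]

/-- Only pure powers of coordinates appear on the right, so that only the pure derivatives of order
n of the symbol have to be bounded. -/
lemma one_add_norm_sq_pow_le (y : EuclideanSpace ℝ (Fin n)) :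
    (1 + ‖y‖ ^ 2) ^ n ≤ (n + 1 : ℝ) ^ n * (1 + ∑ i, (|y i|) ^ (2 * n)) := by
  rcases isEmpty_or_nonempty (Fin n) with h | h
  · have : n = 0 := by
      by_contra hn
      exact h.elim ⟨0, Nat.pos_of_ne_zero hn⟩
    subst this; simp
  obtain ⟨j, -, hj⟩ := Finset.exists_max_image Finset.univ (fun i => |y i|) Finset.univ_nonempty
  have h1 : ‖y‖ ^ 2 ≤ n * |y j| ^ 2 := by
    rw [EuclideanSpace.norm_sq_eq]
    calc ∑ i, ‖y i‖ ^ 2 ≤ ∑ i : Fin n, |y j| ^ 2 := by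
          refine Finset.sum_le_sum fun i _ => ?_
          rw [Real.norm_eq_abs]
          have := hj i (Finset.mem_univ i)
          gcongr
      _ = _ := by simp
  have hS : |y j| ^ (2 * n) ≤ ∑ i, |y i| ^ (2 * n) :=
    Finset.single_le_sum (f := fun i => |y i| ^ (2 * n)) (fun i _ => by positivity)
      (Finset.mem_univ j)
  have hS0 : 0 ≤ ∑ i, |y i| ^ (2 * n) := Finset.sum_nonneg fun i _ => by positivity
  rcases le_total (|y j|) 1 with h2 | h2
  · calc (1 + ‖y‖ ^ 2) ^ n ≤ (n + 1 : ℝ) ^ n := by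
          refine pow_le_pow_left₀ (by positivity) ?_ n
          have : |y j| ^ 2 ≤ 1 := pow_le_one₀ (abs_nonneg _) h2
          nlinarith [Nat.cast_nonneg (α := ℝ) n]
      _ ≤ _ := le_mul_of_one_le_right (by positivity) (by linarith)
  · calc (1 + ‖y‖ ^ 2) ^ n ≤ ((n + 1 : ℝ) * |y j| ^ 2) ^ n := by
          gcongr
          have : 1 ≤ |y j| ^ 2 := one_le_pow₀ h2
          linarith
      _ = (n + 1 : ℝ) ^ n * |y j| ^ (2 * n) := by rw [mul_pow, pow_mul]
      _ ≤ _ := by gcongr; linarith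

/-- A Bernstein inequality: the inverse Fourier transform of a function with support in a ball is
integrable, with a bound in terms of its size and the size of its pure derivatives of order `n`. -/
lemma exists_integral_fourierInv_le (hn : 1 ≤ n) :
    ∃ C : ℝ, 0 < C ∧ ∀ (g : 𝓢(EuclideanSpace ℝ (Fin n), ℂ)) (B L Λ : ℝ), 0 < B → 0 < L → 0 < Λ →
      (∀ ξ, ‖g ξ‖ ≤ B) →
      (∀ i ξ, ‖iteratedDeriv n (fun s : ℝ => g (ξ + s • EuclideanSpace.single i (1 : ℝ))) 0‖
        ≤ B * L ^ n) →
      tsupport g ⊆ Metric.closedBall 0 Λ →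
      ∫ x, ‖𝓕⁻ g x‖ ≤ C * (B * (L * Λ) ^ ((n : ℝ) / 2)) := by
  set v := volume.real (Metric.ball (0 : EuclideanSpace ℝ (Fin n)) 1) with hv
  have hint : Integrable (fun x : EuclideanSpace ℝ (Fin n) => ((1 + ‖x‖ ^ 2) ^ n)⁻¹) := by
    have := integrable_rpow_neg_one_add_norm_sq (E := EuclideanSpace ℝ (Fin n)) (μ := volume)
      (r := 2 * n) (by
        simp only [finrank_euclideanSpace, Fintype.card_fin]
        have : (1 : ℝ) ≤ n := by exact_mod_cast hn
        linarith)
    refine this.congr (Filter.Eventually.of_forall fun x => ?_)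
    simp only
    rw [show -(2 * (n : ℝ)) / 2 = -(n : ℝ) by ring, Real.rpow_neg (by positivity), Real.rpow_natCast]
  set Y := ∫ x : EuclideanSpace ℝ (Fin n), ((1 + ‖x‖ ^ 2) ^ n)⁻¹ with hY
  have hY0 : 0 ≤ Y := integral_nonneg fun x => by positivity
  have hv0 : 0 ≤ v := measureReal_nonneg
  refine ⟨(n + 1) * v + (n + 1) ^ n * Y + 1, by positivity, ?_⟩
  intro g B L Λ hB hL hΛ hg hdg hsupp
  set G := fun i : Fin n => (fun h : 𝓢(EuclideanSpace ℝ (Fin n), ℂ) =>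
    ∂_{EuclideanSpace.single i (1 : ℝ)} h)^[n] g with hG
  have hGb : ∀ i ξ, ‖G i ξ‖ ≤ B * L ^ n := by
    intro i ξ
    have := hdg i ξ
    rw [iteratedDeriv_schwartz_line] at this
    simpa using this
  -- The weight is scaled by L⁻¹ so that by Plancherel each of its n + 1 terms costs the same, B²Λ^n
  -- times the volume of the unit ball.
  set W : EuclideanSpace ℝ (Fin n) → ℝ := fun x => 1 + ∑ i, (L⁻¹ * (2 * Real.pi * |x i|)) ^ (2 * n)
    with hW
  have hW1 : ∀ x, 1 ≤ W x := fun x => by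
    have : 0 ≤ ∑ i, (L⁻¹ * (2 * Real.pi * |x i|)) ^ (2 * n) :=
      Finset.sum_nonneg fun i _ => by positivity
    simp only [hW]; linarith
  have hWf : ∀ x, W x * ‖𝓕⁻ g x‖ ^ 2 = ‖𝓕⁻ g x‖ ^ 2 + ∑ i, (L⁻¹) ^ (2 * n) * ‖𝓕⁻ (G i) x‖ ^ 2 := by
    intro x
    simp only [hW, add_mul, one_mul, Finset.sum_mul]
    congr 1
    refine Finset.sum_congr rfl fun i _ => ?_
    rw [hG, fourierInv_iterate_lineDeriv]
    have : inner ℝ x (EuclideanSpace.single i (1 : ℝ)) = x i := by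
      rw [EuclideanSpace.inner_single_right]; simp
    rw [this]; ring
  have hWint : Integrable (fun x => W x * ‖𝓕⁻ g x‖ ^ 2) := by
    simp_rw [hWf]
    exact (integrable_norm_sq_schwartz _).add (integrable_finsetSum _ fun i _ =>
      (integrable_norm_sq_schwartz _).const_mul _)
  have hX : ∫ x, W x * ‖𝓕⁻ g x‖ ^ 2 ≤ (n + 1) * (B ^ 2 * (Λ ^ n * v)) := by
    simp_rw [hWf]
    rw [integral_add (integrable_norm_sq_schwartz _) (integrable_finsetSum _ fun i _ =>
      (integrable_norm_sq_schwartz _).const_mul _), integral_finsetSum _ fun i _ =>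
      (integrable_norm_sq_schwartz _).const_mul _]
    simp_rw [integral_const_mul, integral_norm_sq_fourierInv]
    have h1 := integral_norm_sq_le_of_support g hΛ hg hsupp
    have h2 : ∀ i, (L⁻¹) ^ (2 * n) * ∫ ξ, ‖G i ξ‖ ^ 2 ≤ B ^ 2 * (Λ ^ n * v) := by
      intro i
      have := integral_norm_sq_le_of_support (G i) hΛ (hGb i)
        ((tsupport_iterate_lineDeriv_subset g _ n).trans hsupp)
      calc _ ≤ (L⁻¹) ^ (2 * n) * ((B * L ^ n) ^ 2 * (Λ ^ n * v)) := by gcongr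
        _ = _ := by
          rw [mul_pow, ← pow_mul, mul_comm n 2, inv_pow]; field_simp
    calc _ ≤ B ^ 2 * (Λ ^ n * v) + ∑ i : Fin n, B ^ 2 * (Λ ^ n * v) :=
          add_le_add h1 (Finset.sum_le_sum fun i _ => h2 i)
      _ = _ := by simp; ring
  have hWinv : ∀ x, (W x)⁻¹ ≤ (n + 1) ^ n * ((1 + ‖L⁻¹ • x‖ ^ 2) ^ n)⁻¹ := by
    intro x
    have h0 : (1 + ‖L⁻¹ • x‖ ^ 2) ^ n ≤ (n + 1 : ℝ) ^ n * W x := by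
      refine (one_add_norm_sq_pow_le _).trans ?_
      simp only [hW]
      gcongr with i
      rw [PiLp.smul_apply, smul_eq_mul, abs_mul, abs_of_pos (inv_pos.2 hL)]
      gcongr
      have := Real.pi_gt_three
      nlinarith [abs_nonneg (x i)]
    rw [← div_eq_mul_inv, le_div_iff₀ (by positivity), inv_mul_le_iff₀ (by linarith [hW1 x]),
      mul_comm]
    linarith
  have hint2 : Integrable (fun x : EuclideanSpace ℝ (Fin n) => ((1 + ‖L⁻¹ • x‖ ^ 2) ^ n)⁻¹) :=
    hint.comp_smul (inv_ne_zero hL.ne')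
  have hYL : ∫ x : EuclideanSpace ℝ (Fin n), ((1 + ‖L⁻¹ • x‖ ^ 2) ^ n)⁻¹ = L ^ n * Y := by
    have := Measure.integral_comp_inv_smul_of_nonneg (volume : Measure (EuclideanSpace ℝ (Fin n)))
      (fun x => ((1 + ‖x‖ ^ 2) ^ n)⁻¹) hL.le
    simpa using this
  -- The parameter that balances the two terms below: lam·B²Λ^n = lam⁻¹·L^n = B(LΛ)^{n/2}.
  set lam : ℝ := B⁻¹ * (L / Λ) ^ ((n : ℝ) / 2) with hlam
  have hlam0 : 0 < lam := by positivity
  -- Cauchy–Schwarz against the weight in additive form: f ≤ lam·W f² + (lam·W)⁻¹.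
  have hpt : ∀ x, ‖𝓕⁻ g x‖ ≤ lam * (W x * ‖𝓕⁻ g x‖ ^ 2) +
      lam⁻¹ * ((n + 1) ^ n * ((1 + ‖L⁻¹ • x‖ ^ 2) ^ n)⁻¹) := by
    intro x
    have hw : 0 < W x := by linarith [hW1 x]
    refine le_trans ?_ (add_le_add_right (mul_le_mul_of_nonneg_left (hWinv x) (by positivity)) _)
    set f := ‖𝓕⁻ g x‖
    set w := W x
    have h1 : lam * (w * f ^ 2) + lam⁻¹ * w⁻¹ - f = (lam * w)⁻¹ * ((lam * w * f - 1 / 2) ^ 2 + 3 / 4) := by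
      field_simp; ring
    have : 0 ≤ (lam * w)⁻¹ * ((lam * w * f - 1 / 2) ^ 2 + 3 / 4) := by positivity
    linarith
  have hmain : ∫ x, ‖𝓕⁻ g x‖ ≤ lam * ((n + 1) * (B ^ 2 * (Λ ^ n * v))) +
      lam⁻¹ * ((n + 1) ^ n * (L ^ n * Y)) := by
    calc ∫ x, ‖𝓕⁻ g x‖ ≤ ∫ x, (lam * (W x * ‖𝓕⁻ g x‖ ^ 2) +
          lam⁻¹ * ((n + 1) ^ n * ((1 + ‖L⁻¹ • x‖ ^ 2) ^ n)⁻¹)) := by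
          refine integral_mono (SchwartzMap.integrable _).norm
            ((hWint.const_mul _).add ((hint2.const_mul _).const_mul _)) hpt
      _ = lam * (∫ x, W x * ‖𝓕⁻ g x‖ ^ 2) + lam⁻¹ * ((n + 1) ^ n * (L ^ n * Y)) := by
          rw [integral_add (hWint.const_mul _) ((hint2.const_mul _).const_mul _),
            integral_const_mul, integral_const_mul, integral_const_mul, hYL]
      _ ≤ _ := by gcongr
  have hpowL : L ^ n = L ^ ((n : ℝ) / 2) * L ^ ((n : ℝ) / 2) := by
    rw [← Real.rpow_add hL, ← Real.rpow_natCast]; congr 1; ring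
  have hpowΛ : Λ ^ n = Λ ^ ((n : ℝ) / 2) * Λ ^ ((n : ℝ) / 2) := by
    rw [← Real.rpow_add hΛ, ← Real.rpow_natCast]; congr 1; ring
  have e1 : lam * ((n + 1) * (B ^ 2 * (Λ ^ n * v))) =
      ((n + 1) * v) * (B * (L * Λ) ^ ((n : ℝ) / 2)) := by
    rw [hlam, Real.div_rpow hL.le hΛ.le, Real.mul_rpow hL.le hΛ.le, hpowΛ]
    field_simp
  have e2 : lam⁻¹ * ((n + 1) ^ n * (L ^ n * Y)) =
      ((n + 1) ^ n * Y) * (B * (L * Λ) ^ ((n : ℝ) / 2)) := by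
    rw [hlam, Real.div_rpow hL.le hΛ.le, Real.mul_rpow hL.le hΛ.le, hpowL]
    field_simp
  rw [e1, e2, ← add_mul] at hmain
  exact hmain.trans (mul_le_mul_of_nonneg_right (by linarith) (by positivity))

end Bernstein

end

/-! ### Directional derivative bounds and the dyadic partition of unity -/

noncomputable section

open LineDeriv

section Dyadic

variable {n : ℕ}

/-- Bounds of the form `|∂ᵢᵏ m(ξ)| ≤ B Lᵏ`, `k ≤ n`, for the pure partial derivatives of `m`. -/
def LineBound (m : EuclideanSpace ℝ (Fin n) → ℂ) (ξ : EuclideanSpace ℝ (Fin n)) (B L : ℝ) : Prop :=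
  ∀ i : Fin n, ∀ k ≤ n,
    ‖iteratedDeriv k (fun s : ℝ => m (ξ + s • EuclideanSpace.single i (1 : ℝ))) 0‖ ≤ B * L ^ k

lemma LineBound.mono {m : EuclideanSpace ℝ (Fin n) → ℂ} {ξ : EuclideanSpace ℝ (Fin n)}
    {B L B' L' : ℝ} (h : LineBound m ξ B L) (hL : 0 ≤ L) (hB' : 0 ≤ B') (hBB : B ≤ B')
    (hLL : L ≤ L') : LineBound m ξ B' L' := fun i k hk =>
  (h i k hk).trans (by gcongr)

lemma ContDiffAt.comp_line {m : EuclideanSpace ℝ (Fin n) → ℂ} {ξ v : EuclideanSpace ℝ (Fin n)}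
    {k : WithTop ℕ∞} (h : ContDiffAt ℝ k m ξ) : ContDiffAt ℝ k (fun s : ℝ => m (ξ + s • v)) 0 := by
  have h1 : ContDiffAt ℝ k (fun s : ℝ => ξ + s • v) 0 := by fun_prop
  exact ContDiffAt.comp (0 : ℝ) (by simpa using h) h1

lemma LineBound.mul {m₁ m₂ : EuclideanSpace ℝ (Fin n) → ℂ} {ξ : EuclideanSpace ℝ (Fin n)}
    {B₁ B₂ L : ℝ} (h₁ : LineBound m₁ ξ B₁ L) (h₂ : LineBound m₂ ξ B₂ L)
    (c₁ : ContDiffAt ℝ n m₁ ξ) (c₂ : ContDiffAt ℝ n m₂ ξ) (hB₁ : 0 ≤ B₁) (hB₂ : 0 ≤ B₂)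
    (hL : 0 ≤ L) : LineBound (fun ξ => m₁ ξ * m₂ ξ) ξ (2 ^ n * B₁ * B₂) L := by
  intro i k hk
  have hk' : (k : WithTop ℕ∞) ≤ n := by exact_mod_cast hk
  rw [iteratedDeriv_fun_mul ((c₁.of_le hk').comp_line) ((c₂.of_le hk').comp_line)]
  refine (norm_sum_le _ _).trans ?_
  calc _ ≤ ∑ j ∈ Finset.range (k + 1), (k.choose j : ℝ) * (B₁ * B₂ * L ^ k) := by
        refine Finset.sum_le_sum fun j hj => ?_
        have hjk : j ≤ k := Nat.lt_succ_iff.1 (Finset.mem_range.1 hj)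
        rw [norm_mul, norm_mul, Complex.norm_natCast]
        have e1 := h₁ i j (hjk.trans hk)
        have e2 := h₂ i (k - j) ((Nat.sub_le _ _).trans hk)
        calc _ ≤ (k.choose j : ℝ) * (B₁ * L ^ j) * (B₂ * L ^ (k - j)) := by gcongr
          _ = (k.choose j : ℝ) * (B₁ * B₂ * (L ^ j * L ^ (k - j))) := by ring
          _ = _ := by rw [← pow_add, Nat.add_sub_cancel' hjk]
    _ = 2 ^ k * (B₁ * B₂ * L ^ k) := by
        rw [← Finset.sum_mul]
        congr 1
        exact_mod_cast Nat.sum_range_choose k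
    _ ≤ 2 ^ n * (B₁ * B₂ * L ^ k) := by
        gcongr
        norm_num
    _ = _ := by ring

lemma exists_schwartz_line_decay (g : 𝓢(EuclideanSpace ℝ (Fin n), ℂ)) (M : ℕ) :
    ∃ C : ℝ, 0 < C ∧ ∀ (i : Fin n) (k : ℕ), k ≤ n → ∀ ξ,
      (1 + ‖ξ‖) ^ M * ‖iteratedDeriv k (fun s : ℝ => g (ξ + s • EuclideanSpace.single i (1 : ℝ))) 0‖
        ≤ C := by
  set f : Fin n → ℕ → ℝ := fun i k => 2 ^ M * (Finset.Iic (M, 0)).sup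
    (fun m => SchwartzMap.seminorm ℝ m.1 m.2) ((fun h : 𝓢(EuclideanSpace ℝ (Fin n), ℂ) =>
      ∂_{EuclideanSpace.single i (1 : ℝ)} h)^[k] g) with hf
  have hf0 : ∀ i k, 0 ≤ f i k := fun i k => by simp only [hf]; positivity
  refine ⟨1 + ∑ i, ∑ k ∈ Finset.range (n + 1), f i k, ?_, ?_⟩
  · have : 0 ≤ ∑ i, ∑ k ∈ Finset.range (n + 1), f i k :=
      Finset.sum_nonneg fun i _ => Finset.sum_nonneg fun k _ => hf0 i k
    linarith
  · intro i k hk ξ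
    rw [iteratedDeriv_schwartz_line]
    have h1 := SchwartzMap.one_add_le_sup_seminorm_apply (𝕜 := ℝ) (m := (M, 0)) le_rfl le_rfl
      ((fun h : 𝓢(EuclideanSpace ℝ (Fin n), ℂ) => ∂_{EuclideanSpace.single i (1 : ℝ)} h)^[k] g) ξ
    rw [norm_iteratedFDeriv_zero] at h1
    have h2 : f i k ≤ ∑ k ∈ Finset.range (n + 1), f i k :=
      Finset.single_le_sum (fun k _ => hf0 i k) (Finset.mem_range.2 (by omega))
    have h3 : ∑ k ∈ Finset.range (n + 1), f i k ≤ ∑ i, ∑ k ∈ Finset.range (n + 1), f i k :=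
      Finset.single_le_sum (f := fun i => ∑ k ∈ Finset.range (n + 1), f i k)
        (fun i _ => Finset.sum_nonneg fun k _ => hf0 i k) (Finset.mem_univ i)
    simp only [zero_smul, add_zero]
    calc _ ≤ f i k := h1
      _ ≤ _ := by linarith

/-- A smooth radial cutoff. -/
def ballBump (ξ : EuclideanSpace ℝ (Fin n)) : ℝ := Real.smoothTransition (2 - ‖ξ‖ ^ 2)

/-- A smooth radial cutoff to the annulus `1 ≤ |ξ| ≤ 4`. -/
def annBump (ξ : EuclideanSpace ℝ (Fin n)) : ℝ := ballBump ((2⁻¹ : ℝ) • ξ) - ballBump ξ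

lemma contDiff_ballBump {k : ℕ∞} : ContDiff ℝ k (ballBump (n := n)) := by
  have h : ContDiff ℝ k (fun ξ : EuclideanSpace ℝ (Fin n) => 2 - ‖ξ‖ ^ 2) :=
    contDiff_const.sub (contDiff_norm_sq ℝ)
  exact Real.smoothTransition.contDiff.comp h

lemma contDiff_annBump {k : ℕ∞} : ContDiff ℝ k (annBump (n := n)) :=
  (contDiff_ballBump.comp (contDiff_const_smul _)).sub contDiff_ballBump

lemma ballBump_eq_one {ξ : EuclideanSpace ℝ (Fin n)} (h : ‖ξ‖ ≤ 1) : ballBump ξ = 1 :=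
  Real.smoothTransition.one_of_one_le (by nlinarith [norm_nonneg ξ])

lemma ballBump_eq_zero {ξ : EuclideanSpace ℝ (Fin n)} (h : 2 ≤ ‖ξ‖) : ballBump ξ = 0 :=
  Real.smoothTransition.zero_of_nonpos (by nlinarith)

lemma annBump_nonneg (ξ : EuclideanSpace ℝ (Fin n)) : 0 ≤ annBump ξ := by
  rw [annBump, sub_nonneg]
  apply Real.smoothTransition.monotone
  rw [norm_smul, mul_pow]
  norm_num
  nlinarith [sq_nonneg ‖ξ‖]

lemma annBump_eq_zero_of_le {ξ : EuclideanSpace ℝ (Fin n)} (h : ‖ξ‖ ≤ 1) : annBump ξ = 0 := by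
  rw [annBump, ballBump_eq_one h, ballBump_eq_one, sub_self]
  rw [norm_smul]; norm_num; linarith

lemma annBump_eq_zero_of_ge {ξ : EuclideanSpace ℝ (Fin n)} (h : 4 ≤ ‖ξ‖) : annBump ξ = 0 := by
  rw [annBump, ballBump_eq_zero (ξ := ξ) (by linarith), ballBump_eq_zero, sub_self]
  rw [norm_smul]; norm_num; linarith

/-- The sum telescopes: the j-th term is a(j+1) - a(j) for the dilated ball cutoffs a, which are
eventually 1 as j → ∞ and 0 as j → -∞. -/
lemma hasSum_annBump {lam : ℝ} (hlam : 0 < lam) {ξ : EuclideanSpace ℝ (Fin n)} (hξ : ξ ≠ 0) :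
    HasSum (fun j : ℤ => annBump ((lam * 2 ^ (-j)) • ξ)) 1 := by
  set a : ℤ → ℝ := fun j => ballBump ((lam * 2 ^ (-j)) • ξ) with ha
  have hstep : ∀ j : ℤ, annBump ((lam * 2 ^ (-j)) • ξ) = a (j + 1) - a j := by
    intro j
    rw [annBump, ha]
    simp only [smul_smul]
    congr 3
    rw [neg_add, zpow_add₀ (by norm_num)]
    norm_num; ring
  have hpos : 0 < ‖ξ‖ := norm_pos_iff.2 hξ
  have hnorm : ∀ j : ℤ, ‖(lam * 2 ^ (-j)) • ξ‖ = lam * ‖ξ‖ * 2 ^ (-j) := by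
    intro j
    rw [norm_smul, Real.norm_of_nonneg (by positivity)]; ring
  have h1 : Filter.Tendsto (fun N : ℕ => a N) Filter.atTop (nhds 1) := by
    obtain ⟨J, hJ⟩ := pow_unbounded_of_one_lt (lam * ‖ξ‖) (one_lt_two)
    refine tendsto_const_nhds.congr' ?_
    filter_upwards [Filter.eventually_ge_atTop J] with N hN
    rw [ha]; simp only
    rw [ballBump_eq_one]
    rw [hnorm, zpow_neg, zpow_natCast, ← div_eq_mul_inv, div_le_one (by positivity)]
    exact hJ.le.trans (pow_le_pow_right₀ (by norm_num) hN)
  have h2 : Filter.Tendsto (fun N : ℕ => a (-(N : ℤ))) Filter.atTop (nhds 0) := by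
    obtain ⟨J, hJ⟩ := pow_unbounded_of_one_lt (2 / (lam * ‖ξ‖)) (one_lt_two (α := ℝ))
    refine tendsto_const_nhds.congr' ?_
    filter_upwards [Filter.eventually_ge_atTop J] with N hN
    rw [ha]; simp only
    rw [ballBump_eq_zero]
    rw [hnorm, neg_neg, zpow_natCast]
    rw [div_lt_iff₀ (by positivity)] at hJ
    calc (2 : ℝ) ≤ 2 ^ J * (lam * ‖ξ‖) := hJ.le
      _ ≤ 2 ^ N * (lam * ‖ξ‖) := by gcongr; norm_num
      _ = _ := by ring
  have s1 : HasSum (fun N : ℕ => annBump ((lam * 2 ^ (-(N : ℤ))) • ξ)) (1 - a 0) := by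
    rw [hasSum_iff_tendsto_nat_of_nonneg (fun N => annBump_nonneg _)]
    have : ∀ N : ℕ, ∑ i ∈ Finset.range N, annBump ((lam * 2 ^ (-(i : ℤ))) • ξ) = a N - a 0 := by
      intro N
      have := Finset.sum_range_sub (fun i : ℕ => a i) N
      simp only [Nat.cast_add, Nat.cast_one, Nat.cast_zero] at this
      rw [← this]
      exact Finset.sum_congr rfl fun i _ => hstep i
    simp_rw [this]
    exact h1.sub_const _
  have s2 : HasSum (fun N : ℕ => annBump ((lam * 2 ^ (-(-((N : ℤ) + 1)))) • ξ)) (a 0) := by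
    rw [hasSum_iff_tendsto_nat_of_nonneg (fun N => annBump_nonneg _)]
    have : ∀ N : ℕ, ∑ i ∈ Finset.range N, annBump ((lam * 2 ^ (-(-((i : ℤ) + 1)))) • ξ) =
        a 0 - a (-(N : ℤ)) := by
      intro N
      have := Finset.sum_range_sub (fun i : ℕ => - a (-(i : ℤ))) N
      simp only [Nat.cast_add, Nat.cast_one, Nat.cast_zero, neg_zero] at this
      rw [show a 0 - a (-(N : ℤ)) = -a (-(N : ℤ)) - -a 0 by ring, ← this]
      refine Finset.sum_congr rfl fun i _ => ?_
      rw [hstep]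
      have : -((i : ℤ) + 1) + 1 = -(i : ℤ) := by ring
      rw [this]; ring
    simp_rw [this]
    simpa using h2.const_sub (a 0)
  have := HasSum.of_nat_of_neg_add_one (f := fun j : ℤ => annBump ((lam * 2 ^ (-j)) • ξ)) s1 s2
  simpa using this

/-- The part of the symbol `m` living on the annulus `1 ≤ r|ξ| ≤ 4`. -/
def annPiece (m : EuclideanSpace ℝ (Fin n) → ℂ) (r : ℝ) (ξ : EuclideanSpace ℝ (Fin n)) : ℂ :=
  (annBump (r • ξ) : ℂ) * m ξ

lemma annPiece_eq_zero {m : EuclideanSpace ℝ (Fin n) → ℂ} {r : ℝ} (hr : 0 < r)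
    {ξ : EuclideanSpace ℝ (Fin n)} (h : ‖ξ‖ ≤ r⁻¹ ∨ 4 * r⁻¹ ≤ ‖ξ‖) : annPiece m r ξ = 0 := by
  have hn : ‖r • ξ‖ = r * ‖ξ‖ := by rw [norm_smul, Real.norm_of_nonneg hr.le]
  have : annBump (r • ξ) = 0 := by
    rcases h with h | h
    · apply annBump_eq_zero_of_le
      rw [hn]
      calc r * ‖ξ‖ ≤ r * r⁻¹ := by gcongr
        _ = 1 := mul_inv_cancel₀ hr.ne'
    · apply annBump_eq_zero_of_ge
      rw [hn]
      calc 4 = r * (4 * r⁻¹) := by field_simp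
        _ ≤ _ := by gcongr
  rw [annPiece, this]; simp

lemma tsupport_annPiece_subset {m : EuclideanSpace ℝ (Fin n) → ℂ} {r : ℝ} (hr : 0 < r) :
    tsupport (annPiece m r) ⊆ {ξ | r⁻¹ ≤ ‖ξ‖ ∧ ‖ξ‖ ≤ 4 * r⁻¹} := by
  apply closure_minimal
  · intro ξ hξ
    by_contra hcon
    apply hξ
    apply annPiece_eq_zero hr
    simp only [mem_ofPred_eq, not_and_or, not_le] at hcon
    exact hcon.imp le_of_lt le_of_lt
  · exact (isClosed_le continuous_const continuous_norm).inter
      (isClosed_le continuous_norm continuous_const)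

lemma contDiff_annBump_smul (r : ℝ) {k : ℕ∞} :
    ContDiff ℝ k (fun ξ : EuclideanSpace ℝ (Fin n) => (annBump (r • ξ) : ℂ)) :=
  Complex.ofRealCLM.contDiff.comp (contDiff_annBump.comp (contDiff_const_smul r))

lemma contDiff_annPiece {m : EuclideanSpace ℝ (Fin n) → ℂ} {r : ℝ} (hr : 0 < r)
    (hm : ∀ ξ ≠ 0, ContDiffAt ℝ ((⊤ : ℕ∞) : WithTop ℕ∞) m ξ) : ContDiff ℝ ((⊤ : ℕ∞) : WithTop ℕ∞) (annPiece m r) := by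
  rw [contDiff_iff_contDiffAt]
  intro ξ
  rcases eq_or_ne ξ 0 with rfl | h
  · have : annPiece m r =ᶠ[nhds 0] fun _ => 0 := by
      filter_upwards [Metric.ball_mem_nhds (0 : EuclideanSpace ℝ (Fin n)) (inv_pos.2 hr)] with ξ hξ
      exact annPiece_eq_zero hr (Or.inl (by simpa using (mem_ball_zero_iff.1 hξ).le))
    exact contDiffAt_const.congr_of_eventuallyEq this
  · exact (contDiff_annBump_smul r).contDiffAt.mul (hm ξ h)

lemma hasCompactSupport_annPiece {m : EuclideanSpace ℝ (Fin n) → ℂ} {r : ℝ} (hr : 0 < r) :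
    HasCompactSupport (annPiece m r) :=
  (isCompact_closedBall (0 : EuclideanSpace ℝ (Fin n)) (4 * r⁻¹)).of_isClosed_subset
    (isClosed_tsupport _) fun ξ hξ => by
      simpa using (tsupport_annPiece_subset hr hξ).2

/-- `annPiece` as a Schwartz function. -/
def annSchwartz (m : EuclideanSpace ℝ (Fin n) → ℂ) (r : ℝ) (hr : 0 < r)
    (hm : ∀ ξ ≠ 0, ContDiffAt ℝ ((⊤ : ℕ∞) : WithTop ℕ∞) m ξ) : 𝓢(EuclideanSpace ℝ (Fin n), ℂ) :=
  (hasCompactSupport_annPiece hr).toSchwartzMap (contDiff_annPiece hr hm)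

lemma coe_annSchwartz (m : EuclideanSpace ℝ (Fin n) → ℂ) (r : ℝ) (hr : 0 < r)
    (hm : ∀ ξ ≠ 0, ContDiffAt ℝ ((⊤ : ℕ∞) : WithTop ℕ∞) m ξ) :
    ⇑(annSchwartz m r hr hm) = annPiece m r := rfl

/-- By dilation from r = 1, where the bump is a fixed Schwartz function: each derivative brings out
a factor r. -/
lemma exists_lineBound_annBump :
    ∃ C : ℝ, 0 < C ∧ ∀ (r : ℝ) (ξ : EuclideanSpace ℝ (Fin n)), 0 < r →
      LineBound (fun ξ => (annBump (r • ξ) : ℂ)) ξ C r := by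
  obtain ⟨C, hC, h⟩ := exists_schwartz_line_decay
    (annSchwartz (n := n) (fun _ => 1) 1 one_pos fun _ _ => contDiffAt_const) 0
  refine ⟨C, hC, fun r ξ hr i k hk => ?_⟩
  have h1 := h i k hk (r • ξ)
  rw [coe_annSchwartz] at h1
  simp only [annPiece, mul_one, one_smul, pow_zero, one_mul] at h1
  set F : ℝ → ℂ := fun s => (annBump (r • ξ + s • EuclideanSpace.single i (1 : ℝ)) : ℂ) with hF
  have hFc : ContDiff ℝ k F := by
    have h0 : ContDiff ℝ k (fun s : ℝ => r • ξ + s • EuclideanSpace.single i (1 : ℝ)) := by fun_prop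
    exact Complex.ofRealCLM.contDiff.comp ((contDiff_annBump (k := (k : ℕ∞))).comp h0)
  have e : (fun s : ℝ => (annBump (r • (ξ + s • EuclideanSpace.single i (1 : ℝ))) : ℂ)) =
      fun s => F (r * s) := by
    ext s; simp only [hF, smul_add, smul_smul]
  rw [e, iteratedDeriv_comp_const_smul hFc]
  simp only [mul_zero, norm_smul, norm_pow, Real.norm_of_nonneg hr.le]
  rw [mul_comm]
  gcongr

end Dyadic

end

/-! ### Dyadic symbols: L¹ bounds and summation of the pieces -/

noncomputable section

section SymbolClass

variable {n : ℕ}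

/-- Symbols that are smooth away from the origin, of size `A min((λ|ξ|)^ε, (λ|ξ|)^{-ε})` up to a
loss of `N(ξ)^{n/2}`, where each derivative costs a factor `c₀ N(ξ) / |ξ|`,
`N(ξ) = 1 + θ |ξ|^κ`. -/
structure IsDyadicSymbol (c₀ κ ε θ lam A : ℝ) (m : EuclideanSpace ℝ (Fin n) → ℂ) : Prop where
  smooth : ∀ ξ ≠ 0, ContDiffAt ℝ ((⊤ : ℕ∞) : WithTop ℕ∞) m ξ
  bound : ∀ ξ ≠ 0, ∃ B : ℝ, 0 ≤ B ∧ LineBound m ξ B (c₀ * (1 + θ * ‖ξ‖ ^ κ) / ‖ξ‖) ∧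
    B * (1 + θ * ‖ξ‖ ^ κ) ^ ((n : ℝ) / 2) ≤ A * min ((lam * ‖ξ‖) ^ ε) ((lam * ‖ξ‖) ^ (-ε))

/-- On the annulus of radius Λ = 1/r all weights are comparable to their values at Λ. The Bernstein
inequality applies with L of size N/Λ on a ball of radius 4Λ, so that LΛ ~ N and the loss is
N^{n/2}, exactly what the symbol class has set aside. -/
lemma exists_integral_annPiece_le (hn : 1 ≤ n) {c₀ κ ε : ℝ} (hc₀ : 0 ≤ c₀) (hκ : 0 ≤ κ) (hε : 0 ≤ ε) :
    ∃ C : ℝ, 0 < C ∧ ∀ (θ lam A : ℝ) (m : EuclideanSpace ℝ (Fin n) → ℂ), 0 ≤ θ → 0 < lam → 0 < A →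
      IsDyadicSymbol c₀ κ ε θ lam A m → ∀ r : ℝ, 0 < r →
      ∫ x, ‖𝓕⁻ (annPiece m r) x‖ ≤ C * (A * min ((lam * r⁻¹) ^ ε) ((lam * r⁻¹) ^ (-ε))) := by
  obtain ⟨C₁, hC₁, hbern⟩ := exists_integral_fourierInv_le hn
  obtain ⟨C₂, hC₂, hann⟩ := exists_lineBound_annBump (n := n)
  -- The entry 1 gives r ≤ L, for the derivatives of the cutoff; the other entry covers those of the
  -- symbol, N varying by at most 4^κ on the annulus.
  set c := max 1 (c₀ * 4 ^ κ) with hc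
  have hc1 : 1 ≤ c := le_max_left _ _
  have hc0 : 0 < c := by linarith
  refine ⟨C₁ * (2 ^ n * C₂ * 4 ^ ε * (4 * c) ^ ((n : ℝ) / 2)), by positivity, ?_⟩
  intro θ lam A m hθ hlam hA hm r hr
  set Λ := r⁻¹ with hΛ
  have hΛ0 : 0 < Λ := inv_pos.2 hr
  set N := 1 + θ * Λ ^ κ with hN
  have hN1 : 1 ≤ N := by rw [hN]; linarith [show 0 ≤ θ * Λ ^ κ by positivity]
  have hN0 : 0 < N := by linarith
  set μ := min ((lam * Λ) ^ ε) ((lam * Λ) ^ (-ε)) with hμ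
  have hμ0 : 0 < μ := by rw [hμ]; positivity
  set L := c * N / Λ with hL
  have hL0 : 0 < L := by positivity
  have hrL : r ≤ L := by
    rw [hL, hΛ, div_inv_eq_mul]
    have : 1 ≤ c * N := one_le_mul_of_one_le_of_one_le hc1 hN1
    nlinarith
  -- The Bernstein loss is divided out in advance; 4^ε is the variation of the dyadic weight over
  -- the annulus.
  set B := 4 ^ ε * (A * μ) / N ^ ((n : ℝ) / 2) with hB
  have hB0 : 0 < B := by positivity
  have hline : ∀ ξ, LineBound (annPiece m r) ξ (2 ^ n * C₂ * B) L := by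
    intro ξ
    by_cases hξ : Λ ≤ ‖ξ‖ ∧ ‖ξ‖ ≤ 4 * Λ
    · have hpos : 0 < ‖ξ‖ := hΛ0.trans_le hξ.1
      have hξ0 : ξ ≠ 0 := norm_pos_iff.1 hpos
      obtain ⟨B', hB'0, hB', hBN⟩ := hm.bound ξ hξ0
      have hNξ : N ≤ 1 + θ * ‖ξ‖ ^ κ := by rw [hN]; gcongr; exact hξ.1
      have hNξ2 : 1 + θ * ‖ξ‖ ^ κ ≤ 4 ^ κ * N := by
        have h4 : (1 : ℝ) ≤ 4 ^ κ := Real.one_le_rpow (by norm_num) hκ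
        calc 1 + θ * ‖ξ‖ ^ κ ≤ 4 ^ κ * 1 + θ * (4 * Λ) ^ κ := by
              gcongr
              · linarith
              · exact hξ.2
          _ = _ := by rw [Real.mul_rpow (by norm_num) hΛ0.le, hN]; ring
      have hmin : min ((lam * ‖ξ‖) ^ ε) ((lam * ‖ξ‖) ^ (-ε)) ≤ 4 ^ ε * μ := by
        rw [hμ, mul_min_of_nonneg _ _ (by positivity)]
        apply min_le_min
        · rw [← Real.mul_rpow (by norm_num) (by positivity)]
          apply Real.rpow_le_rpow (by positivity) _ hε
          nlinarith [hξ.2]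
        · have h4 : (1 : ℝ) ≤ 4 ^ ε := Real.one_le_rpow (by norm_num) hε
          refine le_trans ?_ (le_mul_of_one_le_left (by positivity) h4)
          rw [Real.rpow_neg (by positivity), Real.rpow_neg (by positivity)]
          gcongr
          exact hξ.1
      have hB'B : B' ≤ B := by
        rw [hB, le_div_iff₀ (by positivity)]
        calc B' * N ^ ((n : ℝ) / 2) ≤ B' * (1 + θ * ‖ξ‖ ^ κ) ^ ((n : ℝ) / 2) := by gcongr
          _ ≤ A * min ((lam * ‖ξ‖) ^ ε) ((lam * ‖ξ‖) ^ (-ε)) := hBN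
          _ ≤ A * (4 ^ ε * μ) := by gcongr
          _ = _ := by ring
      have hLL : c₀ * (1 + θ * ‖ξ‖ ^ κ) / ‖ξ‖ ≤ L := by
        rw [hL]
        calc c₀ * (1 + θ * ‖ξ‖ ^ κ) / ‖ξ‖ ≤ c₀ * (4 ^ κ * N) / Λ := by gcongr; exact hξ.1
          _ = (c₀ * 4 ^ κ) * N / Λ := by ring
          _ ≤ _ := by gcongr; exact le_max_right _ _
      have h1 := (hann r ξ hr).mono hr.le hC₂.le le_rfl hrL
      have h2 := hB'.mono (by positivity) hB0.le hB'B hLL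
      exact h1.mul h2 (contDiff_annBump_smul r (k := n)).contDiffAt
        ((hm.smooth ξ hξ0).of_le (by exact_mod_cast le_top)) hC₂.le hB0.le hL0.le
    · intro i k hk
      have hnot : ξ ∉ tsupport (annPiece m r) := fun h => hξ (tsupport_annPiece_subset hr h)
      have hev := notMem_tsupport_iff_eventuallyEq.1 hnot
      have hcont : Filter.Tendsto (fun s : ℝ => ξ + s • EuclideanSpace.single i (1 : ℝ))
          (nhds 0) (nhds ξ) := by
        have : Continuous (fun s : ℝ => ξ + s • EuclideanSpace.single i (1 : ℝ)) := by fun_prop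
        simpa using this.tendsto 0
      have hev2 : (fun s : ℝ => annPiece m r (ξ + s • EuclideanSpace.single i (1 : ℝ)))
          =ᶠ[nhds 0] fun _ => 0 := hcont.eventually hev
      rw [hev2.iteratedDeriv_eq]
      have : iteratedDeriv k (fun _ : ℝ => (0 : ℂ)) 0 = 0 := by
        rw [iteratedDeriv_const]; simp
      rw [this, norm_zero]; positivity
  set g := annSchwartz m r hr hm.smooth with hg
  have hgc : ⇑g = annPiece m r := coe_annSchwartz _ _ _ _
  have := hbern g (2 ^ n * C₂ * B) L (4 * Λ) (by positivity) hL0 (by positivity)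
    (fun ξ => by
      have h0 := hline ξ ⟨0, hn⟩ 0 (Nat.zero_le _)
      simpa [hgc] using h0)
    (fun i ξ => by
      rw [hgc]; exact hline ξ i n le_rfl)
    (fun ξ hξ => by
      rw [hgc] at hξ
      simpa using (tsupport_annPiece_subset hr hξ).2)
  rw [SchwartzMap.fourierInv_coe, hgc] at this
  refine this.trans_eq ?_
  have e : L * (4 * Λ) = (4 * c) * N := by rw [hL]; field_simp
  rw [e, Real.mul_rpow (by positivity) hN0.le, hB]
  field_simp

/-- Dominated convergence: the bumps are nonnegative and sum to 1, so the norms of the pieces sum to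
‖m ξ‖ away from the origin. -/
lemma hasSum_fourierInv_annPiece {m : EuclideanSpace ℝ (Fin n) → ℂ} {lam : ℝ} (hlam : 0 < lam)
    (hsm : ∀ ξ ≠ 0, ContDiffAt ℝ ((⊤ : ℕ∞) : WithTop ℕ∞) m ξ) (hn : 1 ≤ n)
    (hint : Integrable m) (x : EuclideanSpace ℝ (Fin n)) :
    HasSum (fun j : ℤ => 𝓕⁻ (annPiece m (lam * 2 ^ (-j))) x) (𝓕⁻ m x) := by
  have : Nonempty (Fin n) := ⟨⟨0, hn⟩⟩
  have hae : ∀ᵐ ξ : EuclideanSpace ℝ (Fin n), ξ ≠ 0 := by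
    rw [ae_iff]; simp
  simp only [Real.fourierInv_eq]
  refine hasSum_integral_of_dominated_convergence
    (fun (j : ℤ) ξ => annBump ((lam * 2 ^ (-j)) • ξ) * ‖m ξ‖) ?_ ?_ ?_ ?_ ?_
  · intro j
    have h1 : Continuous (annPiece m (lam * 2 ^ (-j))) :=
      (contDiff_annPiece (by positivity) hsm).continuous
    have h2 : Continuous fun v : EuclideanSpace ℝ (Fin n) => Real.fourierChar (inner ℝ v x) := by
      fun_prop
    exact (h2.smul h1).aestronglyMeasurable
  · intro j
    refine Filter.Eventually.of_forall fun ξ => ?_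
    rw [Circle.norm_smul, annPiece, norm_mul, Complex.norm_real,
      Real.norm_of_nonneg (annBump_nonneg _)]
  · filter_upwards [hae] with ξ hξ
    exact (hasSum_annBump hlam hξ).summable.mul_right _
  · refine hint.norm.congr ?_
    filter_upwards [hae] with ξ hξ
    rw [((hasSum_annBump hlam hξ).mul_right _).tsum_eq, one_mul]
  · filter_upwards [hae] with ξ hξ
    have h1 : HasSum (fun j : ℤ => (annBump ((lam * 2 ^ (-j)) • ξ) : ℂ)) 1 := by
      simpa using Complex.ofRealCLM.hasSum (hasSum_annBump hlam hξ)
    have h2 := (h1.mul_right (m ξ)).const_smul (Real.fourierChar (inner ℝ ξ x))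
    simpa [annPiece] using h2

lemma summable_two_zpow_min {ε : ℝ} (hε : 0 < ε) :
    Summable (fun j : ℤ => min (((2 : ℝ) ^ j) ^ ε) (((2 : ℝ) ^ j) ^ (-ε))) := by
  have hq : (2 : ℝ) ^ (-ε) < 1 := Real.rpow_lt_one_of_one_lt_of_neg (by norm_num) (by linarith)
  have hgeo : Summable (fun k : ℕ => ((2 : ℝ) ^ (-ε)) ^ k) :=
    summable_geometric_of_lt_one (by positivity) hq
  refine Summable.of_nat_of_neg_add_one ?_ ?_
  · refine Summable.of_nonneg_of_le (fun k => by positivity) (fun k => ?_) hgeo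
    refine (min_le_right _ _).trans_eq ?_
    rw [zpow_natCast, ← Real.rpow_natCast, ← Real.rpow_mul (by norm_num), ← Real.rpow_natCast,
      ← Real.rpow_mul (by norm_num), mul_comm]
  · refine Summable.of_nonneg_of_le (fun k => by positivity) (fun k => ?_)
      ((summable_nat_add_iff 1).2 hgeo)
    refine (min_le_left _ _).trans_eq ?_
    rw [zpow_neg, ← Nat.cast_succ, zpow_natCast, Real.inv_rpow (by positivity), ← Real.rpow_neg
      (by positivity), ← Real.rpow_natCast, ← Real.rpow_mul (by norm_num), ← Real.rpow_natCast,
      ← Real.rpow_mul (by norm_num), mul_comm]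

/-- The inverse Fourier transform of a dyadic symbol is the sum of its dyadic pieces, with a bound
for the sum of their `L¹` norms. -/
theorem exists_tsum_integral_annPiece_le (hn : 1 ≤ n) {c₀ κ ε : ℝ} (hc₀ : 0 ≤ c₀) (hκ : 0 ≤ κ)
    (hε : 0 < ε) :
    ∃ C : ℝ, 0 < C ∧ ∀ (θ lam A : ℝ) (m : EuclideanSpace ℝ (Fin n) → ℂ), 0 ≤ θ → 0 < lam → 0 < A →
      IsDyadicSymbol c₀ κ ε θ lam A m →
      Summable (fun j : ℤ => ∫ x, ‖𝓕⁻ (annPiece m (lam * 2 ^ (-j))) x‖) ∧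
      ∑' j : ℤ, ∫ x, ‖𝓕⁻ (annPiece m (lam * 2 ^ (-j))) x‖ ≤ C * A := by
  obtain ⟨C, hC, h⟩ := exists_integral_annPiece_le hn hc₀ hκ hε.le
  have hs := summable_two_zpow_min hε
  set S := ∑' j : ℤ, min (((2 : ℝ) ^ j) ^ ε) (((2 : ℝ) ^ j) ^ (-ε)) with hS
  have hS0 : 0 ≤ S := tsum_nonneg fun j => by positivity
  refine ⟨C * (S + 1), by positivity, ?_⟩
  intro θ lam A m hθ hlam hA hm
  have hle : ∀ j : ℤ, ∫ x, ‖𝓕⁻ (annPiece m (lam * 2 ^ (-j))) x‖ ≤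
      C * (A * min (((2 : ℝ) ^ j) ^ ε) (((2 : ℝ) ^ j) ^ (-ε))) := by
    intro j
    have := h θ lam A m hθ hlam hA hm (lam * 2 ^ (-j)) (by positivity)
    have e : lam * (lam * 2 ^ (-j))⁻¹ = (2 : ℝ) ^ j := by
      rw [mul_inv, zpow_neg, inv_inv, mul_inv_cancel_left₀ hlam.ne']
    rwa [e] at this
  have hsum := (hs.mul_left A).mul_left C
  have hsum2 := Summable.of_nonneg_of_le (fun j => integral_nonneg fun x => norm_nonneg _) hle hsum
  refine ⟨hsum2, (hsum2.tsum_le_tsum hle hsum).trans ?_⟩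
  rw [tsum_mul_left, tsum_mul_left]
  calc C * (A * S) = C * S * A := by ring
    _ ≤ C * (S + 1) * A := by gcongr; linarith

lemma continuous_fourierInv {m : EuclideanSpace ℝ (Fin n) → ℂ} (hm : Integrable m) :
    Continuous (𝓕⁻ m) := by
  have h : 𝓕⁻ m = fun x => 𝓕 m (-x) := by
    ext x; rw [Real.fourierInv_eq_fourier_neg]
  rw [h]
  have h2 : Continuous (𝓕 m) := VectorFourier.fourierIntegral_continuous Real.continuous_fourierChar
    (by exact continuous_inner) hm
  exact h2.comp continuous_neg

lemma integral_fourierInv_le_tsum {m : EuclideanSpace ℝ (Fin n) → ℂ} {lam : ℝ} (hlam : 0 < lam)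
    (hsm : ∀ ξ ≠ 0, ContDiffAt ℝ ((⊤ : ℕ∞) : WithTop ℕ∞) m ξ) (hn : 1 ≤ n)
    (hint : Integrable m)
    (hsum : Summable (fun j : ℤ => ∫ x, ‖𝓕⁻ (annPiece m (lam * 2 ^ (-j))) x‖)) :
    Integrable (𝓕⁻ m) ∧
      ∫ x, ‖𝓕⁻ m x‖ ≤ ∑' j : ℤ, ∫ x, ‖𝓕⁻ (annPiece m (lam * 2 ^ (-j))) x‖ := by
  have hF : ∀ j : ℤ, Integrable (𝓕⁻ (annPiece m (lam * 2 ^ (-j)))) := by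
    intro j
    have := (𝓕⁻ (annSchwartz m (lam * 2 ^ (-j)) (by positivity) hsm)).integrable (μ := volume)
    rwa [SchwartzMap.fourierInv_coe, coe_annSchwartz] at this
  have hpt := hasSum_fourierInv_annPiece hlam hsm hn hint
  have heq : 𝓕⁻ m = fun x => ∑' j : ℤ, 𝓕⁻ (annPiece m (lam * 2 ^ (-j))) x := by
    ext x; exact (hpt x).tsum_eq.symm
  have hlin : ∑' j : ℤ, ∫⁻ x, ‖𝓕⁻ (annPiece m (lam * 2 ^ (-j))) x‖ₑ =
      ENNReal.ofReal (∑' j : ℤ, ∫ x, ‖𝓕⁻ (annPiece m (lam * 2 ^ (-j))) x‖) := by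
    rw [ENNReal.ofReal_tsum_of_nonneg (fun j => integral_nonneg fun x => norm_nonneg _) hsum]
    congr 1; ext j
    rw [ofReal_integral_norm_eq_lintegral_enorm (hF j)]
  have hle : ∫⁻ x, ‖𝓕⁻ m x‖ₑ ≤
      ENNReal.ofReal (∑' j : ℤ, ∫ x, ‖𝓕⁻ (annPiece m (lam * 2 ^ (-j))) x‖) := by
    rw [← hlin, ← lintegral_tsum (fun j => (hF j).aestronglyMeasurable.enorm)]
    refine lintegral_mono fun x => ?_
    rw [heq]
    exact enorm_tsum_le_tsum_enorm
  have hI : Integrable (𝓕⁻ m) :=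
    ⟨(continuous_fourierInv hint).aestronglyMeasurable,
      hle.trans_lt ENNReal.ofReal_lt_top⟩
  refine ⟨hI, ?_⟩
  rw [← ofReal_integral_norm_eq_lintegral_enorm hI] at hle
  exact (ENNReal.ofReal_le_ofReal_iff
    (tsum_nonneg fun j => integral_nonneg fun x => norm_nonneg _)).1 hle

end SymbolClass

end

/-! ### Cauchy estimates for radial symbols -/

noncomputable section

section Cauchy

variable {n : ℕ}

lemma iteratedDeriv_comp_ofReal {U : Set ℂ} (hU : IsOpen U) (k : ℕ) {g : ℂ → ℂ}
    (hg : DifferentiableOn ℂ g U) {s : ℝ} (hs : (s : ℂ) ∈ U) :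
    iteratedDeriv k (fun s : ℝ => g s) s = iteratedDeriv k g s := by
  induction k generalizing g with
  | zero => simp
  | succ k ih =>
    rw [iteratedDeriv_succ', iteratedDeriv_succ', ← ih (hg.deriv hU)]
    apply Filter.EventuallyEq.iteratedDeriv_eq
    have : ∀ᶠ r : ℝ in nhds s, (r : ℂ) ∈ U :=
      Complex.continuous_ofReal.continuousAt.eventually (hU.mem_nhds hs)
    filter_upwards [this] with r hr
    exact ((hg.differentiableAt (hU.mem_nhds hr)).hasDerivAt.comp_ofReal).deriv

lemma norm_add_smul_single_sq (ξ : EuclideanSpace ℝ (Fin n)) (i : Fin n) (s : ℝ) :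
    ‖ξ + s • EuclideanSpace.single i (1 : ℝ)‖ ^ 2 = ‖ξ‖ ^ 2 + 2 * s * ξ i + s ^ 2 := by
  rw [norm_add_sq_real, inner_smul_right, EuclideanSpace.inner_single_right, norm_smul]
  simp
  ring

/-- Cauchy estimates for radial symbols: `f z` is the value of the symbol at `|ξ|² (1 + z)`. -/
lemma lineBound_of_holomorphic {m : EuclideanSpace ℝ (Fin n) → ℂ} {F : ℝ → ℂ}
    (hF : ∀ η, m η = F ‖η‖) {ξ : EuclideanSpace ℝ (Fin n)} (hξ : ξ ≠ 0) {f : ℂ → ℂ} {κ B : ℝ}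
    (hκ : 0 < κ) (hκ2 : κ ≤ 1 / 2) (hf : DifferentiableOn ℂ f (Metric.ball 0 1))
    (hfF : ∀ z : ℝ, |z| < 1 → F (‖ξ‖ * √(1 + z)) = f z) (hB0 : 0 ≤ B)
    (hB : ∀ z : ℂ, ‖z‖ ≤ κ → ‖f z‖ ≤ B) : LineBound m ξ B (3 * n / κ / ‖ξ‖) := by
  intro i k hk
  have hpos : 0 < ‖ξ‖ := norm_pos_iff.2 hξ
  -- For |ζ| ≤ R the relative change of the square of the norm is at most 2κ/3 + κ²/9 ≤ κ, so the
  -- disc stays where f is bounded by B.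
  set R : ℝ := κ * ‖ξ‖ / 3 with hR
  have hR0 : 0 < R := by positivity
  -- The relative change of |ξ + ζeᵢ|², a polynomial in ζ and so defined for complex ζ.
  set q : ℂ → ℂ := fun ζ => (2 * ζ * (ξ i : ℂ) + ζ ^ 2) / (‖ξ‖ : ℂ) ^ 2 with hq
  have hqd : Differentiable ℂ q := by
    intro ζ; simp only [hq]; fun_prop
  have hξi : |ξ i| ≤ ‖ξ‖ := by simpa using PiLp.norm_apply_le ξ i
  have hqb : ∀ ζ : ℂ, ‖ζ‖ ≤ R → ‖q ζ‖ ≤ κ := by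
    intro ζ hζ
    simp only [hq]
    rw [norm_div, norm_pow, Complex.norm_real, Real.norm_of_nonneg hpos.le,
      div_le_iff₀ (by positivity)]
    refine (norm_add_le _ _).trans ?_
    rw [norm_mul, norm_mul, norm_pow, Complex.norm_real, Complex.norm_ofNat, Real.norm_eq_abs]
    calc 2 * ‖ζ‖ * |ξ i| + ‖ζ‖ ^ 2 ≤ 2 * R * ‖ξ‖ + R ^ 2 := by gcongr
      _ = (2 / 3 * κ + κ ^ 2 / 9) * ‖ξ‖ ^ 2 := by rw [hR]; ring
      _ ≤ _ := by gcongr; nlinarith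
  set U : Set ℂ := q ⁻¹' (Metric.ball 0 1) with hU
  have hUo : IsOpen U := Metric.isOpen_ball.preimage hqd.continuous
  have hgd : DifferentiableOn ℂ (fun ζ => f (q ζ)) U :=
    hf.comp hqd.differentiableOn (fun ζ hζ => hζ)
  have hball : Metric.closedBall 0 R ⊆ U := by
    intro ζ hζ
    rw [hU, mem_preimage, mem_ball_zero_iff]
    exact (hqb ζ (by simpa using hζ)).trans_lt (by linarith)
  have h0U : ((0 : ℝ) : ℂ) ∈ U := hball (by simp [hR0.le])
  have e1 : (fun s : ℝ => m (ξ + s • EuclideanSpace.single i (1 : ℝ))) =ᶠ[nhds 0]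
      fun s : ℝ => f (q s) := by
    have : ∀ᶠ r : ℝ in nhds 0, (r : ℂ) ∈ U :=
      Complex.continuous_ofReal.continuousAt.eventually (hUo.mem_nhds h0U)
    filter_upwards [this] with s hs
    set z : ℝ := (2 * s * ξ i + s ^ 2) / ‖ξ‖ ^ 2 with hz
    have hqz : q s = z := by simp only [hq, hz]; push_cast; rfl
    have hz1 : |z| < 1 := by
      rw [hU, mem_preimage, mem_ball_zero_iff, hqz, Complex.norm_real] at hs; exact hs
    have hn : ‖ξ + s • EuclideanSpace.single i (1 : ℝ)‖ = ‖ξ‖ * √(1 + z) := by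
      have h1z : 0 ≤ 1 + z := by linarith [(abs_lt.1 hz1).1]
      rw [← Real.sqrt_sq (norm_nonneg (ξ + _)), norm_add_smul_single_sq]
      rw [show ‖ξ‖ ^ 2 + 2 * s * ξ i + s ^ 2 = ‖ξ‖ ^ 2 * (1 + z) by rw [hz]; field_simp; ring]
      rw [Real.sqrt_mul (by positivity), Real.sqrt_sq hpos.le]
    rw [hF, hn, hfF z hz1, hqz]
  rw [e1.iteratedDeriv_eq, iteratedDeriv_comp_ofReal (g := fun ζ => f (q ζ)) hUo k hgd h0U]
  have hdc : DiffContOnCl ℂ (fun ζ => f (q ζ)) (Metric.ball ((0 : ℝ) : ℂ) R) := by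
    apply DifferentiableOn.diffContOnCl
    rw [Complex.ofReal_zero, closure_ball _ hR0.ne']
    exact hgd.mono hball
  have := Complex.norm_iteratedDeriv_le_of_forall_mem_sphere_norm_le k hR0 hdc (C := B) (by
    intro ζ hζ
    apply hB _ (hqb ζ _)
    simp at hζ; exact hζ.le)
  refine this.trans ?_
  -- The factorial of Cauchy's estimate is absorbed in the geometric factor, with k ≤ n; this is
  -- where 3n comes from.
  have hfac : (k.factorial : ℝ) ≤ (n : ℝ) ^ k := by
    calc (k.factorial : ℝ) ≤ (k : ℝ) ^ k := by exact_mod_cast Nat.factorial_le_pow k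
      _ ≤ _ := by gcongr
  calc k.factorial * B / R ^ k ≤ (n : ℝ) ^ k * B / R ^ k := by gcongr
    _ = B * (n / R) ^ k := by
      have (R : ℝ) : (n : ℝ) ^ k * B / R ^ k = B * (n / R) ^ k := by rw [div_pow]; ring
      exact this R
    _ = _ := by
      congr 2; rw [hR]; field_simp

end Cauchy

end

/-! ### From holomorphic bounds to kernels of radial symbols -/

noncomputable section

section Radial

variable {n : ℕ}

/-- `F` extends holomorphically around every `x > 0`, in the variable `z` with `x² (1 + z)` the
square of the argument of `F`. -/
structure IsRadialExt (F : ℝ → ℂ) (f : ℝ → ℂ → ℂ) : Prop where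
  diff : ∀ x > 0, DifferentiableOn ℂ (f x) (Metric.ball 0 1)
  eq : ∀ x > 0, ∀ z : ℝ, |z| < 1 → F (x * √(1 + z)) = f x z

lemma IsRadialExt.contDiffAt {F : ℝ → ℂ} {f : ℝ → ℂ → ℂ} (h : IsRadialExt F f)
    {ξ : EuclideanSpace ℝ (Fin n)} (hξ : ξ ≠ 0) :
    ContDiffAt ℝ ((⊤ : ℕ∞) : WithTop ℕ∞)
      (fun η : EuclideanSpace ℝ (Fin n) => F (2 * Real.pi * ‖η‖)) ξ := by
  have hpos : 0 < ‖ξ‖ := norm_pos_iff.2 hξ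
  set x := 2 * Real.pi * ‖ξ‖ with hx
  have hx0 : 0 < x := by positivity
  set q : EuclideanSpace ℝ (Fin n) → ℝ := fun η => ‖η‖ ^ 2 / ‖ξ‖ ^ 2 - 1 with hq
  have hqc : ContDiff ℝ ((⊤ : ℕ∞) : WithTop ℕ∞) q := ((contDiff_norm_sq ℝ).div_const _).sub contDiff_const
  have hqξ : q ξ = 0 := by simp only [hq]; field_simp; simp
  have h1 : ContDiffAt ℝ ((⊤ : ℕ∞) : WithTop ℕ∞) (f x) ((q ξ : ℝ) : ℂ) := by
    rw [hqξ, Complex.ofReal_zero]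
    have := (h.diff x hx0).contDiffOn (n := ((⊤ : ℕ∞) : WithTop ℕ∞)) Metric.isOpen_ball
    exact (this.contDiffAt (Metric.ball_mem_nhds 0 one_pos)).restrict_scalars ℝ
  have h2 : ContDiffAt ℝ ((⊤ : ℕ∞) : WithTop ℕ∞) (fun η => ((q η : ℝ) : ℂ)) ξ :=
    (Complex.ofRealCLM.contDiff.comp hqc).contDiffAt
  refine (ContDiffAt.comp ξ h1 h2).congr_of_eventuallyEq ?_
  have hev : ∀ᶠ η in nhds ξ, |q η| < 1 := by
    have : Filter.Tendsto (fun η => |q η|) (nhds ξ) (nhds |q ξ|) :=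
      (continuous_abs.comp hqc.continuous).continuousAt
    rw [hqξ, abs_zero] at this
    exact this.eventually (gt_mem_nhds one_pos)
  filter_upwards [hev] with η hη
  have := h.eq x hx0 (q η) hη
  rw [Function.comp_apply, ← this]
  congr 1
  have e : 1 + q η = (‖η‖ / ‖ξ‖) ^ 2 := by simp only [hq]; ring
  rw [e, Real.sqrt_sq (by positivity), hx]; field_simp

/-- An `L¹` bound for the inverse Fourier transform of a radial symbol. -/
theorem exists_integral_fourierInv_radial_le (hn : 1 ≤ n) {κ' κ ε : ℝ} (hκ' : 0 < κ')
    (hκ'2 : κ' ≤ 1 / 2) (hκ : 0 ≤ κ) (hε : 0 < ε) :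
    ∃ C : ℝ, 0 < C ∧ ∀ (θ lam A : ℝ) (F : ℝ → ℂ) (f : ℝ → ℂ → ℂ), 0 ≤ θ → 0 < lam → 0 < A →
      IsRadialExt F f →
      (∀ x > 0, ∀ z : ℂ, ‖z‖ ≤ κ' / (1 + θ * x ^ κ) → ‖f x z‖ * (1 + θ * x ^ κ) ^ ((n : ℝ) / 2) ≤
        A * min ((lam * x) ^ ε) ((lam * x) ^ (-ε))) →
      Integrable (fun ξ : EuclideanSpace ℝ (Fin n) => F (2 * Real.pi * ‖ξ‖)) →
      Integrable (𝓕⁻ (fun ξ : EuclideanSpace ℝ (Fin n) => F (2 * Real.pi * ‖ξ‖))) ∧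
      ∫ x, ‖𝓕⁻ (fun ξ : EuclideanSpace ℝ (Fin n) => F (2 * Real.pi * ‖ξ‖)) x‖ ≤ C * A := by
  -- Cauchy's estimate on a disc of relative radius κ'/N costs 3nN/(κ'|ξ|) per derivative, hence c₀
  -- = 3n/κ'.
  obtain ⟨C, hC, h⟩ := exists_tsum_integral_annPiece_le (n := n) (c₀ := 3 * n / κ') (κ := κ) (ε := ε)
    hn (by positivity) hκ hε
  refine ⟨C, hC, ?_⟩
  intro θ lam A F f hθ hlam hA hF hb hint
  have hsm : ∀ ξ : EuclideanSpace ℝ (Fin n), ξ ≠ 0 → ContDiffAt ℝ ((⊤ : ℕ∞) : WithTop ℕ∞)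
      (fun η : EuclideanSpace ℝ (Fin n) => F (2 * Real.pi * ‖η‖)) ξ := fun ξ hξ => hF.contDiffAt hξ
  have hp : 0 < 2 * Real.pi := by positivity
  -- The factor 2π of the frequency variable is moved into θ and the scale, so the constants do not
  -- change.
  have hdy : IsDyadicSymbol (3 * n / κ') κ ε (θ * (2 * Real.pi) ^ κ) (lam * (2 * Real.pi)) A
      (fun ξ : EuclideanSpace ℝ (Fin n) => F (2 * Real.pi * ‖ξ‖)) := by
    refine ⟨hsm, fun ξ hξ => ?_⟩
    have hpos : 0 < ‖ξ‖ := norm_pos_iff.2 hξ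
    set x := 2 * Real.pi * ‖ξ‖ with hx
    have hx0 : 0 < x := by positivity
    have eN : 1 + θ * (2 * Real.pi) ^ κ * ‖ξ‖ ^ κ = 1 + θ * x ^ κ := by
      rw [hx, Real.mul_rpow hp.le hpos.le]; ring
    have eL : lam * (2 * Real.pi) * ‖ξ‖ = lam * x := by rw [hx]; ring
    rw [eN, eL]
    set N := 1 + θ * x ^ κ with hN
    have hN1 : 1 ≤ N := by rw [hN]; linarith [show 0 ≤ θ * x ^ κ by positivity]
    have hN0 : 0 < N := by linarith
    set B := A * min ((lam * x) ^ ε) ((lam * x) ^ (-ε)) / N ^ ((n : ℝ) / 2) with hB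
    have hB0 : 0 ≤ B := by positivity
    refine ⟨B, hB0, ?_, ?_⟩
    · have h1 := lineBound_of_holomorphic (m := fun ξ : EuclideanSpace ℝ (Fin n) => F (2 * Real.pi * ‖ξ‖))
        (F := fun ρ => F (2 * Real.pi * ρ)) (fun η => rfl) hξ (f := f x) (κ := κ' / N) (B := B)
        (by positivity) ((div_le_self hκ'.le hN1).trans hκ'2) (hF.diff x hx0)
        (fun z hz => by
          rw [← hF.eq x hx0 z hz, hx, mul_assoc (2 * Real.pi)]) hB0
        (fun z hz => by
          rw [hB, le_div_iff₀ (by positivity)]; exact hb x hx0 z hz)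
      convert h1 using 1
      field_simp
    · rw [hB, div_mul_cancel₀ _ (by positivity)]
  obtain ⟨h1, h2⟩ := h (θ * (2 * Real.pi) ^ κ) (lam * (2 * Real.pi)) A _ (by positivity)
    (by positivity) hA hdy
  obtain ⟨h3, h4⟩ := integral_fourierInv_le_tsum (lam := lam * (2 * Real.pi)) (by positivity) hsm hn
    hint h1
  exact ⟨h3, h4.trans h2⟩

lemma ae_ne_zero_euclideanSpace (hn : 1 ≤ n) : ∀ᵐ ξ : EuclideanSpace ℝ (Fin n), ξ ≠ 0 := by
  have : Nonempty (Fin n) := ⟨⟨0, hn⟩⟩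
  rw [ae_iff]; simp

lemma IsRadialExt.aestronglyMeasurable (hn : 1 ≤ n) {F : ℝ → ℂ} {f : ℝ → ℂ → ℂ}
    (hF : IsRadialExt F f) :
    AEStronglyMeasurable (fun ξ : EuclideanSpace ℝ (Fin n) => F (2 * Real.pi * ‖ξ‖)) := by
  have hc : ContinuousOn (fun ξ : EuclideanSpace ℝ (Fin n) => F (2 * Real.pi * ‖ξ‖)) {0}ᶜ :=
    fun ξ hξ => (hF.contDiffAt hξ).continuousAt.continuousWithinAt
  have := hc.aestronglyMeasurable (μ := volume) (measurableSet_singleton _).compl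
  rwa [Measure.restrict_eq_self_of_ae_mem] at this
  exact ae_ne_zero_euclideanSpace hn

/-- Integrals of radial symbols of size `x^a (1 + λx)^{-(n+1+a)}`. -/
lemma exists_integral_radial_le (hn : 1 ≤ n) (a : ℝ) (ha : 0 ≤ a) :
    ∃ C : ℝ, 0 < C ∧ ∀ (lam A : ℝ) (F : ℝ → ℂ) (f : ℝ → ℂ → ℂ), 0 < lam → 0 ≤ A →
      IsRadialExt F f →
      (∀ x > 0, ‖F x‖ ≤ A * (x ^ a * (1 + lam * x) ^ (-(n + 1 + a)))) →
      Integrable (fun ξ : EuclideanSpace ℝ (Fin n) => F (2 * Real.pi * ‖ξ‖)) ∧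
      ∫ ξ : EuclideanSpace ℝ (Fin n), ‖F (2 * Real.pi * ‖ξ‖)‖ ≤ C * (A * lam ^ (-(n + a))) := by
  have hint : Integrable (fun ξ : EuclideanSpace ℝ (Fin n) => (1 + ‖ξ‖) ^ (-((n : ℝ) + 1))) := by
    apply integrable_one_add_norm
    simp
  set I := ∫ ξ : EuclideanSpace ℝ (Fin n), (1 + ‖ξ‖) ^ (-((n : ℝ) + 1)) with hI
  have hI0 : 0 ≤ I := integral_nonneg fun ξ => by positivity
  refine ⟨(2 * Real.pi) ^ (-(n : ℝ)) * I + 1, by positivity, ?_⟩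
  intro lam A F f hlam hA hF hb
  have hp : 0 < 2 * Real.pi := by positivity
  set R := lam * (2 * Real.pi) with hR
  have hR0 : 0 < R := by positivity
  have hbound : ∀ᵐ ξ : EuclideanSpace ℝ (Fin n), ‖F (2 * Real.pi * ‖ξ‖)‖ ≤
      A * lam ^ (-a) * (1 + ‖R • ξ‖) ^ (-((n : ℝ) + 1)) := by
    filter_upwards [ae_ne_zero_euclideanSpace hn] with ξ hξ
    have hpos : 0 < ‖ξ‖ := norm_pos_iff.2 hξ
    set x := 2 * Real.pi * ‖ξ‖ with hx
    have hx0 : 0 < x := by positivity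
    have e : ‖R • ξ‖ = lam * x := by
      rw [norm_smul, Real.norm_of_nonneg hR0.le, hR, hx]; ring
    rw [e]
    refine (hb x hx0).trans ?_
    rw [mul_assoc]
    refine mul_le_mul_of_nonneg_left ?_ hA
    have h1 : 0 < 1 + lam * x := by positivity
    have h2 : x ^ a = lam ^ (-a) * (lam * x) ^ a := by
      rw [Real.mul_rpow hlam.le hx0.le, ← mul_assoc, ← Real.rpow_add hlam]; simp
    rw [neg_add _ a, Real.rpow_add h1, h2]
    have h3 : (lam * x) ^ a ≤ (1 + lam * x) ^ a := by gcongr; linarith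
    calc lam ^ (-a) * (lam * x) ^ a * ((1 + lam * x) ^ (-((n : ℝ) + 1)) * (1 + lam * x) ^ (-a))
        ≤ lam ^ (-a) * (1 + lam * x) ^ a *
          ((1 + lam * x) ^ (-((n : ℝ) + 1)) * (1 + lam * x) ^ (-a)) := by gcongr
      _ = lam ^ (-a) * (1 + lam * x) ^ (-((n : ℝ) + 1)) *
          ((1 + lam * x) ^ a * (1 + lam * x) ^ (-a)) := by ring
      _ = _ := by rw [← Real.rpow_add h1]; simp
  have hint2 : Integrable (fun ξ : EuclideanSpace ℝ (Fin n) =>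
      A * lam ^ (-a) * (1 + ‖R • ξ‖) ^ (-((n : ℝ) + 1))) :=
    (hint.comp_smul hR0.ne').const_mul _
  refine ⟨hint2.mono' (hF.aestronglyMeasurable hn) hbound, ?_⟩
  calc ∫ ξ : EuclideanSpace ℝ (Fin n), ‖F (2 * Real.pi * ‖ξ‖)‖
      ≤ ∫ ξ : EuclideanSpace ℝ (Fin n), A * lam ^ (-a) * (1 + ‖R • ξ‖) ^ (-((n : ℝ) + 1)) :=
        integral_mono_of_nonneg (Filter.Eventually.of_forall fun _ => norm_nonneg _) hint2 hbound
    _ = A * lam ^ (-a) * (R ^ (-(n : ℝ)) * I) := by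
        rw [integral_const_mul, Measure.integral_comp_smul volume
          (fun ξ : EuclideanSpace ℝ (Fin n) => (1 + ‖ξ‖) ^ (-((n : ℝ) + 1)))]
        rw [finrank_euclideanSpace_fin, abs_of_nonneg (by positivity), Real.rpow_neg hR0.le,
          Real.rpow_natCast, smul_eq_mul]
    _ = (2 * Real.pi) ^ (-(n : ℝ)) * I * (A * lam ^ (-(n + a))) := by
        rw [hR, Real.mul_rpow hlam.le hp.le, neg_add, Real.rpow_add hlam]; ring
    _ ≤ _ := by gcongr; linarith

end Radial

end

/-! ### Kernels with a positive power of |D|, and kernels compared with a Gaussian -/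

noncomputable section

section RadialKernels

variable {n : ℕ}

lemma one_add_mem_slitPlane {z : ℂ} (hz : ‖z‖ < 1) : 1 + z ∈ Complex.slitPlane := by
  left
  have := (abs_le.1 (Complex.abs_re_le_norm z)).1
  simp; linarith

lemma differentiableOn_one_add_cpow (α : ℂ) :
    DifferentiableOn ℂ (fun z : ℂ => (1 + z) ^ α) (Metric.ball 0 1) := by
  intro z hz
  apply DifferentiableAt.differentiableWithinAt
  apply DifferentiableAt.cpow_const (by fun_prop)
  exact one_add_mem_slitPlane (by simpa using hz)

lemma rpow_mul_sqrt_one_add {x : ℝ} (hx : 0 < x) {z : ℝ} (hz : |z| < 1) (a : ℝ) :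
    (((x * √(1 + z)) ^ a : ℝ) : ℂ) = (x ^ a : ℝ) * (1 + (z : ℂ)) ^ ((a / 2 : ℝ) : ℂ) := by
  have h1 : 0 ≤ 1 + z := by linarith [(abs_lt.1 hz).1]
  rw [Real.mul_rpow hx.le (Real.sqrt_nonneg _), Complex.ofReal_mul, Real.sqrt_eq_rpow,
    ← Real.rpow_mul h1, show (1 / 2 * a) = a / 2 by ring, Complex.ofReal_cpow h1]
  push_cast; rfl

lemma IsRadialExt.rpow_mul {G : ℝ → ℂ} {g : ℝ → ℂ → ℂ} (h : IsRadialExt G g) (a : ℝ) :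
    IsRadialExt (fun x => ((x ^ a : ℝ) : ℂ) * G x)
      (fun x z => (x ^ a : ℝ) * (1 + z) ^ ((a / 2 : ℝ) : ℂ) * g x z) := by
  refine ⟨fun x hx => ?_, fun x hx z hz => ?_⟩
  · exact ((differentiableOn_one_add_cpow _).const_mul _).mul (h.diff x hx)
  · rw [h.eq x hx z hz, rpow_mul_sqrt_one_add hx hz]

lemma IsRadialExt.sub {F G : ℝ → ℂ} {f g : ℝ → ℂ → ℂ} (hF : IsRadialExt F f)
    (hG : IsRadialExt G g) : IsRadialExt (fun x => F x - G x) (fun x z => f x z - g x z) :=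
  ⟨fun x hx => (hF.diff x hx).sub (hG.diff x hx), fun x hx z hz => by
    rw [hF.eq x hx z hz, hG.eq x hx z hz]⟩

/-- The Gaussian symbol `exp (-(λx)²)`. -/
lemma isRadialExt_gaussian (lam : ℝ) :
    IsRadialExt (fun x => Complex.exp (-(((lam * x) ^ 2 : ℝ) : ℂ)))
      (fun x z => Complex.exp (-(((lam * x) ^ 2 : ℝ) * (1 + z)))) := by
  refine ⟨fun x hx => ?_, fun x hx z hz => ?_⟩
  · exact Differentiable.differentiableOn (by fun_prop)
  · have h1 : 0 ≤ 1 + z := by linarith [(abs_lt.1 hz).1]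
    rw [← mul_assoc, mul_pow, Real.sq_sqrt h1]
    push_cast; rfl

lemma norm_one_add_cpow_le {α : ℝ} (hα : 0 ≤ α) {z : ℂ} (hz : ‖z‖ ≤ 1 / 2) :
    ‖(1 + z) ^ (α : ℂ)‖ ≤ 1 + α * Real.exp α := by
  have h := norm_one_add_cpow_sub_one_le hα hz
  have h2 := norm_add_le ((1 + z) ^ (α : ℂ) - 1) 1
  rw [sub_add_cancel, norm_one] at h2
  have h3 : 2 * α * Real.exp α * ‖z‖ ≤ 2 * α * Real.exp α * (1 / 2) := by gcongr
  linarith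

/-- The size of a radial symbol with decaying amplitude, in `L¹`. -/
theorem exists_integral_rpow_radial_le (hn : 1 ≤ n) {a : ℝ} (ha : 0 ≤ a) :
    ∃ C : ℝ, 0 < C ∧ ∀ (lam B : ℝ) (G : ℝ → ℂ) (g : ℝ → ℂ → ℂ), 0 < lam → 0 < B →
      IsRadialExt G g →
      (∀ x > 0, ‖G x‖ ≤ B * (1 + lam * x) ^ (-(n + 1 + a))) →
      Integrable (fun ξ : EuclideanSpace ℝ (Fin n) =>
        (((2 * Real.pi * ‖ξ‖) ^ a : ℝ) : ℂ) * G (2 * Real.pi * ‖ξ‖)) ∧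
      ∫ ξ : EuclideanSpace ℝ (Fin n), ‖(((2 * Real.pi * ‖ξ‖) ^ a : ℝ) : ℂ) * G (2 * Real.pi * ‖ξ‖)‖
        ≤ C * (B * lam ^ (-(n + a))) := by
  obtain ⟨C, hC, h⟩ := exists_integral_radial_le (n := n) hn a ha
  refine ⟨C, hC, fun lam B G g hlam hB hG hb => ?_⟩
  refine h lam B (fun x => ((x ^ a : ℝ) : ℂ) * G x) _ hlam hB.le (hG.rpow_mul a) fun x hx => ?_
  rw [norm_mul, Complex.norm_real, Real.norm_of_nonneg (by positivity), mul_left_comm]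
  exact mul_le_mul_of_nonneg_left (hb x hx) (by positivity)

lemma one_add_rpow_bound {θ κ x S y : ℝ} (hθ : 0 ≤ θ) (hx : 0 < x) (hy : 0 < y)
    (hS : 0 < S) (h : 1 + θ * x ^ κ ≤ S * (1 + y) ^ κ) :
    (1 + θ * x ^ κ) ^ ((n : ℝ) / 2) ≤ S ^ ((n : ℝ) / 2) * (1 + y) ^ (κ * n / 2) := by
  calc (1 + θ * x ^ κ) ^ ((n : ℝ) / 2) ≤ (S * (1 + y) ^ κ) ^ ((n : ℝ) / 2) := by gcongr
    _ = _ := by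
      rw [Real.mul_rpow hS.le (by positivity), ← Real.rpow_mul (by positivity)]
      congr 2; ring

lemma rpow_mul_one_add_rpow_le_min {a y : ℝ} (ha : 0 ≤ a) (hy : 0 < y) :
    y ^ a * (1 + y) ^ (-(2 * a)) ≤ min (y ^ a) (y ^ (-a)) := by
  refine le_min ?_ ?_
  · calc y ^ a * (1 + y) ^ (-(2 * a)) ≤ y ^ a * 1 := by
          gcongr; exact Real.rpow_le_one_of_one_le_of_nonpos (by linarith) (by linarith)
      _ = _ := mul_one _
  · calc y ^ a * (1 + y) ^ (-(2 * a)) ≤ y ^ a * y ^ (-(2 * a)) := by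
          gcongr y ^ a * ?_
          exact Real.rpow_le_rpow_of_nonpos hy (by linarith) (by linarith)
      _ = _ := by rw [← Real.rpow_add hy]; congr 1; ring

/-- `L¹` bound for the kernel of `|D|^a G(|D|)`, `a > 0`. -/
theorem exists_integral_fourierInv_rpow_radial_le (hn : 1 ≤ n) {κ' κ a : ℝ} (hκ' : 0 < κ')
    (hκ'2 : κ' ≤ 1 / 2) (hκ : 0 ≤ κ) (ha : 0 < a) :
    ∃ C : ℝ, 0 < C ∧ ∀ (θ lam B S : ℝ) (G : ℝ → ℂ) (g : ℝ → ℂ → ℂ), 0 ≤ θ → 0 < lam → 0 < B →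
      0 < S → IsRadialExt G g →
      (∀ x > 0, 1 + θ * x ^ κ ≤ S * (1 + lam * x) ^ κ) →
      (∀ x > 0, ∀ z : ℂ, ‖z‖ ≤ κ' / (1 + θ * x ^ κ) →
        ‖g x z‖ ≤ B * (1 + lam * x) ^ (-(2 * a + κ * n / 2))) →
      Integrable (fun ξ : EuclideanSpace ℝ (Fin n) =>
        (((2 * Real.pi * ‖ξ‖) ^ a : ℝ) : ℂ) * G (2 * Real.pi * ‖ξ‖)) →
      Integrable (𝓕⁻ (fun ξ : EuclideanSpace ℝ (Fin n) =>
        (((2 * Real.pi * ‖ξ‖) ^ a : ℝ) : ℂ) * G (2 * Real.pi * ‖ξ‖))) ∧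
      ∫ x, ‖𝓕⁻ (fun ξ : EuclideanSpace ℝ (Fin n) =>
        (((2 * Real.pi * ‖ξ‖) ^ a : ℝ) : ℂ) * G (2 * Real.pi * ‖ξ‖)) x‖
        ≤ C * (B * S ^ ((n : ℝ) / 2) * lam ^ (-a)) := by
  obtain ⟨C, hC, h⟩ := exists_integral_fourierInv_radial_le (n := n) hn hκ' hκ'2 hκ ha
  set M := 1 + a / 2 * Real.exp (a / 2) with hM
  have hM0 : 0 < M := by positivity
  refine ⟨C * M, by positivity, fun θ lam B S G g hθ hlam hB hS hG hN hb hint => ?_⟩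
  have key := h θ lam (M * (B * S ^ ((n : ℝ) / 2) * lam ^ (-a))) (fun x => ((x ^ a : ℝ) : ℂ) * G x) _ hθ hlam
    (by positivity) (hG.rpow_mul a) ?_ hint
  · rwa [← mul_assoc] at key
  intro x hx z hz
  set y := lam * x with hy
  have hy0 : 0 < y := by positivity
  have hzs : ‖z‖ ≤ 1 / 2 := by
    refine hz.trans ((div_le_self hκ'.le ?_).trans hκ'2)
    linarith [show 0 ≤ θ * x ^ κ by positivity]
  have e1 : x ^ a = lam ^ (-a) * y ^ a := by
    rw [hy, Real.mul_rpow hlam.le hx.le, ← mul_assoc, ← Real.rpow_add hlam]; simp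
  rw [norm_mul, norm_mul, Complex.norm_real, Real.norm_of_nonneg (by positivity)]
  have hc := norm_one_add_cpow_le (α := a / 2) (by positivity) hzs
  -- Of the decay exponent 2a + κn/2, the part κn/2 pays for the Bernstein loss and 2a turns y^a
  -- into the two-sided weight min(y^a, y^{-a}).
  calc x ^ a * ‖(1 + z) ^ ((a / 2 : ℝ) : ℂ)‖ * ‖g x z‖ * (1 + θ * x ^ κ) ^ ((n : ℝ) / 2)
      ≤ x ^ a * M * (B * (1 + y) ^ (-(2 * a + κ * n / 2))) *
        (S ^ ((n : ℝ) / 2) * (1 + y) ^ (κ * n / 2)) := by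
        gcongr
        · exact hb x hx z hz
        · exact one_add_rpow_bound hθ hx hy0 hS (hN x hx)
    _ = M * (B * S ^ ((n : ℝ) / 2) * lam ^ (-a)) *
        (y ^ a * ((1 + y) ^ (-(2 * a + κ * n / 2)) * (1 + y) ^ (κ * n / 2))) := by rw [e1]; ring
    _ = M * (B * S ^ ((n : ℝ) / 2) * lam ^ (-a)) * (y ^ a * (1 + y) ^ (-(2 * a))) := by
        rw [← Real.rpow_add (by positivity)]; congr 3; ring
    _ ≤ _ := by gcongr; exact rpow_mul_one_add_rpow_le_min ha.le hy0

/-- The Gaussian kernel is an `L¹`-normalised positive function. -/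
lemma integral_fourierInv_gaussian {lam : ℝ} (hlam : 0 < lam) :
    Integrable (fun ξ : EuclideanSpace ℝ (Fin n) =>
      Complex.exp (-(((lam * (2 * Real.pi * ‖ξ‖)) ^ 2 : ℝ) : ℂ))) ∧
    Integrable (𝓕⁻ (fun ξ : EuclideanSpace ℝ (Fin n) =>
      Complex.exp (-(((lam * (2 * Real.pi * ‖ξ‖)) ^ 2 : ℝ) : ℂ)))) ∧
    ∫ x, ‖𝓕⁻ (fun ξ : EuclideanSpace ℝ (Fin n) =>
      Complex.exp (-(((lam * (2 * Real.pi * ‖ξ‖)) ^ 2 : ℝ) : ℂ))) x‖ = 1 := by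
  set b : ℝ := (lam * (2 * Real.pi)) ^ 2 with hb
  have hb0 : 0 < b := by positivity
  have e : (fun ξ : EuclideanSpace ℝ (Fin n) =>
      Complex.exp (-(((lam * (2 * Real.pi * ‖ξ‖)) ^ 2 : ℝ) : ℂ))) =
      fun ξ => Complex.exp (-(b : ℂ) * (‖ξ‖ : ℂ) ^ 2) := by
    ext ξ; rw [hb]; push_cast; ring_nf
  rw [e]
  have hbre : 0 < (b : ℂ).re := by simpa using hb0
  have hF : 𝓕⁻ (fun ξ : EuclideanSpace ℝ (Fin n) => Complex.exp (-(b : ℂ) * (‖ξ‖ : ℂ) ^ 2)) =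
      fun x => ((((Real.pi / b) ^ ((n : ℝ) / 2) : ℝ) : ℂ) *
        ((Real.exp (-(Real.pi ^ 2 / b) * ‖x‖ ^ 2) : ℝ) : ℂ)) := by
    ext x
    rw [Real.fourierInv_eq_fourier_neg, fourier_gaussian_innerProductSpace hbre]
    rw [finrank_euclideanSpace_fin, Complex.ofReal_cpow (by positivity), norm_neg]
    push_cast
    congr 2
    ring
  refine ⟨?_, ?_, ?_⟩
  · have := GaussianFourier.integrable_cexp_neg_mul_sq_norm_add (V := EuclideanSpace ℝ (Fin n)) hbre 0 0
    simpa using this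
  · rw [hF]
    have hb2 : 0 < ((Real.pi ^ 2 / b : ℝ) : ℂ).re := by
      rw [Complex.ofReal_re]; positivity
    have := GaussianFourier.integrable_cexp_neg_mul_sq_norm_add (V := EuclideanSpace ℝ (Fin n)) hb2 0 0
    refine Integrable.const_mul ?_ _
    convert this using 2 with x
    push_cast; simp
  · rw [hF]
    have : ∀ x : EuclideanSpace ℝ (Fin n), ‖((((Real.pi / b) ^ ((n : ℝ) / 2) : ℝ) : ℂ) *
        ((Real.exp (-(Real.pi ^ 2 / b) * ‖x‖ ^ 2) : ℝ) : ℂ))‖ =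
        (Real.pi / b) ^ ((n : ℝ) / 2) * Real.exp (-(Real.pi ^ 2 / b) * ‖x‖ ^ 2) := by
      intro x
      rw [norm_mul, Complex.norm_real, Complex.norm_real, Real.norm_of_nonneg (by positivity),
        Real.norm_of_nonneg (by positivity)]
    simp_rw [this]
    rw [integral_const_mul, GaussianFourier.integral_rexp_neg_mul_sq_norm (by positivity),
      finrank_euclideanSpace_fin, ← Real.mul_rpow (by positivity) (by positivity)]
    rw [show Real.pi / b * (Real.pi / (Real.pi ^ 2 / b)) = 1 by field_simp]
    simp

lemma gaussian_ext_bounds {y : ℝ} {z : ℂ} (hz : ‖z‖ ≤ 1 / 2) :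
    ‖Complex.exp (-((y ^ 2 : ℝ) * (1 + z))) - 1‖ ≤ 2 * y ^ 2 ∧
    ‖Complex.exp (-((y ^ 2 : ℝ) * (1 + z)))‖ ≤ Real.exp (-(1 / 2 * y ^ (2 : ℝ))) := by
  have h1 := (abs_le.1 (Complex.abs_re_le_norm z)).1
  have hre : (-(((y ^ 2 : ℝ) : ℂ) * (1 + z))).re = -(y ^ 2 * (1 + z.re)) := by
    rw [Complex.neg_re, Complex.re_ofReal_mul]; simp
  have hy := sq_nonneg y
  constructor
  · refine (norm_exp_sub_one_le_of_re_nonpos ?_).trans ?_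
    · rw [hre]; nlinarith
    · rw [norm_neg, norm_mul, Complex.norm_real, Real.norm_of_nonneg hy]
      have := norm_add_le 1 z
      rw [norm_one] at this
      nlinarith
  · rw [Complex.norm_exp, hre, Real.rpow_two]
    apply Real.exp_le_exp.2
    nlinarith

/-- `L¹` bound for the kernel of `G(|D|)` when `G - 1` vanishes at the origin. -/
theorem exists_integral_fourierInv_radial_sub_one_le (hn : 1 ≤ n) {κ' κ ε : ℝ} (hκ' : 0 < κ')
    (hκ'2 : κ' ≤ 1 / 2) (hκ : 0 ≤ κ) (hε : 0 < ε) (hε2 : ε ≤ 2) :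
    ∃ C : ℝ, 0 < C ∧ ∀ (θ lam B B₁ S : ℝ) (G : ℝ → ℂ) (g : ℝ → ℂ → ℂ), 0 ≤ θ → 0 < lam → 0 < B →
      0 < B₁ → 0 < S → IsRadialExt G g →
      (∀ x > 0, 1 + θ * x ^ κ ≤ S * (1 + lam * x) ^ κ) →
      (∀ x > 0, ∀ z : ℂ, ‖z‖ ≤ κ' / (1 + θ * x ^ κ) → lam * x ≤ 1 →
        ‖g x z - 1‖ ≤ B * (lam * x) ^ ε) →
      (∀ x > 0, ∀ z : ℂ, ‖z‖ ≤ κ' / (1 + θ * x ^ κ) → 1 ≤ lam * x →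
        ‖g x z‖ * (1 + θ * x ^ κ) ^ ((n : ℝ) / 2) ≤ B₁ * (lam * x) ^ (-ε)) →
      Integrable (fun ξ : EuclideanSpace ℝ (Fin n) => G (2 * Real.pi * ‖ξ‖)) →
      Integrable (𝓕⁻ (fun ξ : EuclideanSpace ℝ (Fin n) => G (2 * Real.pi * ‖ξ‖))) ∧
      ∫ x, ‖𝓕⁻ (fun ξ : EuclideanSpace ℝ (Fin n) => G (2 * Real.pi * ‖ξ‖)) x‖
        ≤ C * (B₁ + (B + 1) * S ^ ((n : ℝ) / 2)) + 1 := by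
  obtain ⟨C, hC, h⟩ := exists_integral_fourierInv_radial_le (n := n) hn hκ' hκ'2 hκ hε
  obtain ⟨C₂, hC₂, hexp⟩ := exp_neg_rpow_le_one_add_rpow (c := 1 / 2) (θ := 2) (by norm_num)
    (by norm_num) (ε + κ * n / 2) (by positivity)
  set M : ℝ := 2 * 2 ^ (κ * n / 2) + C₂ + 1 with hM
  have hM1 : 1 ≤ M := by rw [hM]; linarith [show (0 : ℝ) ≤ 2 * 2 ^ (κ * n / 2) by positivity]
  refine ⟨C * M, by positivity, fun θ lam B B₁ S G g hθ hlam hB hB₁ hS hG hN hlow hhigh hint => ?_⟩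
  -- The Gaussian at the same scale equals 1 at the origin, so G minus the Gaussian is small at low
  -- frequencies and its dyadic sum converges. The final + 1 is the L¹ norm of the Gaussian kernel,
  -- and ε ≤ 2 because the Gaussian departs from 1 quadratically.
  obtain ⟨g1, g2, g3⟩ := integral_fourierInv_gaussian (n := n) hlam
  have key := h θ lam (M * (B₁ + (B + 1) * S ^ ((n : ℝ) / 2))) _ _ hθ hlam (by positivity)
    (hG.sub (isRadialExt_gaussian lam)) ?_ (hint.sub g1)
  · have e : (𝓕⁻ (fun ξ : EuclideanSpace ℝ (Fin n) => G (2 * Real.pi * ‖ξ‖))) = fun x =>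
        𝓕⁻ (fun ξ : EuclideanSpace ℝ (Fin n) => G (2 * Real.pi * ‖ξ‖) -
          Complex.exp (-(((lam * (2 * Real.pi * ‖ξ‖)) ^ 2 : ℝ) : ℂ))) x +
        𝓕⁻ (fun ξ : EuclideanSpace ℝ (Fin n) =>
          Complex.exp (-(((lam * (2 * Real.pi * ‖ξ‖)) ^ 2 : ℝ) : ℂ))) x := by
      ext x
      simp only [Real.fourierInv_eq]
      rw [← integral_add]
      · congr 1; ext ξ; rw [← smul_add, sub_add_cancel]
      · exact (Real.fourierIntegral_convergent_iff (-x)).2 (hint.sub g1) |>.congr (by simp)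
      · exact (Real.fourierIntegral_convergent_iff (-x)).2 g1 |>.congr (by simp)
    rw [e]
    refine ⟨key.1.add g2, ?_⟩
    calc _ ≤ ∫ x, (‖𝓕⁻ (fun ξ : EuclideanSpace ℝ (Fin n) => G (2 * Real.pi * ‖ξ‖) -
          Complex.exp (-(((lam * (2 * Real.pi * ‖ξ‖)) ^ 2 : ℝ) : ℂ))) x‖ +
        ‖𝓕⁻ (fun ξ : EuclideanSpace ℝ (Fin n) =>
          Complex.exp (-(((lam * (2 * Real.pi * ‖ξ‖)) ^ 2 : ℝ) : ℂ))) x‖) :=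
          integral_mono (key.1.add g2).norm (key.1.norm.add g2.norm) fun x => norm_add_le _ _
      _ ≤ _ := by
        rw [integral_add key.1.norm g2.norm, g3, mul_assoc]
        gcongr; exact key.2
  intro x hx z hz
  set y := lam * x with hy
  have hy0 : 0 < y := by positivity
  have hzs : ‖z‖ ≤ 1 / 2 := by
    refine hz.trans ((div_le_self hκ'.le ?_).trans hκ'2)
    linarith [show 0 ≤ θ * x ^ κ by positivity]
  obtain ⟨gb1, gb2⟩ := gaussian_ext_bounds (y := y) hzs
  have hNb := one_add_rpow_bound (n := n) hθ hx hy0 hS (hN x hx)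
  rcases le_total y 1 with hy1 | hy1
  · have hm : min (y ^ ε) (y ^ (-ε)) = y ^ ε := by
      apply min_eq_left
      exact Real.rpow_le_rpow_of_exponent_ge hy0 hy1 (by linarith)
    rw [hm]
    have h1 : ‖g x z - Complex.exp (-((y ^ 2 : ℝ) * (1 + z)))‖ ≤ 2 * (B + 1) * y ^ ε := by
      have h2 : y ^ 2 ≤ y ^ ε := by
        rw [← Real.rpow_two]; exact Real.rpow_le_rpow_of_exponent_ge hy0 hy1 hε2
      have h3 := hlow x hx z hz hy1
      have h4 := norm_sub_le (g x z - 1) (Complex.exp (-((y ^ 2 : ℝ) * (1 + z))) - 1)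
      rw [sub_sub_sub_cancel_right] at h4
      have h5 : 0 ≤ B * y ^ ε := by positivity
      linarith
    calc _ ≤ 2 * (B + 1) * y ^ ε * (S ^ ((n : ℝ) / 2) * 2 ^ (κ * n / 2)) := by
          gcongr
          refine hNb.trans ?_
          gcongr; linarith
      _ = (2 * 2 ^ (κ * n / 2)) * ((B + 1) * S ^ ((n : ℝ) / 2)) * y ^ ε := by ring
      _ ≤ M * (B₁ + (B + 1) * S ^ ((n : ℝ) / 2)) * y ^ ε := by
          gcongr
          · rw [hM]; linarith
          · linarith
  · have hm : min (y ^ ε) (y ^ (-ε)) = y ^ (-ε) := by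
      apply min_eq_right
      exact Real.rpow_le_rpow_of_exponent_le hy1 (by linarith)
    rw [hm]
    have h3 := hhigh x hx z hz hy1
    have h4 : ‖Complex.exp (-((y ^ 2 : ℝ) * (1 + z)))‖ * (1 + θ * x ^ κ) ^ ((n : ℝ) / 2) ≤
        C₂ * (S ^ ((n : ℝ) / 2)) * y ^ (-ε) := by
      calc _ ≤ C₂ * (1 + y) ^ (-(ε + κ * n / 2)) * (S ^ ((n : ℝ) / 2) * (1 + y) ^ (κ * n / 2)) := by
            gcongr
            exact gb2.trans (hexp y hy0.le)
        _ = C₂ * S ^ ((n : ℝ) / 2) * ((1 + y) ^ (-(ε + κ * n / 2)) * (1 + y) ^ (κ * n / 2)) := by ring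
        _ = C₂ * S ^ ((n : ℝ) / 2) * (1 + y) ^ (-ε) := by
            rw [← Real.rpow_add (by positivity)]; congr 2; ring
        _ ≤ _ := by
            gcongr ?_ * ?_
            exact Real.rpow_le_rpow_of_nonpos hy0 (by linarith) (by linarith)
    calc _ ≤ (‖g x z‖ + ‖Complex.exp (-((y ^ 2 : ℝ) * (1 + z)))‖) *
          (1 + θ * x ^ κ) ^ ((n : ℝ) / 2) := by gcongr; exact norm_sub_le _ _
      _ ≤ B₁ * y ^ (-ε) + C₂ * (S ^ ((n : ℝ) / 2)) * y ^ (-ε) := by rw [add_mul]; gcongr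
      _ = (1 * B₁ + C₂ * (1 * S ^ ((n : ℝ) / 2))) * y ^ (-ε) := by ring
      _ ≤ (M * B₁ + M * ((B + 1) * S ^ ((n : ℝ) / 2))) * y ^ (-ε) := by
          gcongr
          · rw [hM]; linarith [show (0 : ℝ) ≤ 2 * 2 ^ (κ * n / 2) by positivity]
          · linarith
      _ = _ := by ring

end RadialKernels

end

/-! ### Kernels of the propagators for small times -/

noncomputable section

section PropagatorKernels

variable {n : ℕ} {σ δ μ : ℝ}

/-- The symbol `|ξ|^a P(t, μ|ξ|^{2δ}, |ξ|^{2σ})`, with the frequency variable `2πξ`. -/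
def propSym (P : ℝ → ℂ → ℂ → ℂ) (σ δ μ a t : ℝ) (ξ : EuclideanSpace ℝ (Fin n)) : ℂ :=
  (((2 * Real.pi * ‖ξ‖) ^ a : ℝ) : ℂ) *
    P t ((μ * (2 * Real.pi * ‖ξ‖) ^ (2 * δ) : ℝ) : ℂ) (((2 * Real.pi * ‖ξ‖) ^ (2 * σ) : ℝ) : ℂ)

lemma isRadialExt_prop {P : ℝ → ℂ → ℂ → ℂ} (hP : P ∈ ({meanProp, cosProp} : Set (ℝ → ℂ → ℂ → ℂ)))
    (σ δ μ t : ℝ) :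
    IsRadialExt (fun x => P t ((μ * x ^ (2 * δ) : ℝ) : ℂ) ((x ^ (2 * σ) : ℝ) : ℂ))
      (fun x z => P t (dampSym δ μ x z) (waveSym σ x z)) := by
  refine ⟨fun x hx => ?_, fun x hx z hz => ?_⟩
  · have hd : DifferentiableOn ℂ (fun z => dampSym δ μ x z) (Metric.ball 0 1) :=
      (differentiableOn_one_add_cpow _).const_mul _
    have hw : DifferentiableOn ℂ (fun z => waveSym σ x z) (Metric.ball 0 1) :=
      (differentiableOn_one_add_cpow _).const_mul _
    have hv : DifferentiableOn ℂ (fun z => (t : ℂ) ^ 2 * (dampSym δ μ x z ^ 2 / 4 - waveSym σ x z))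
        (Metric.ball 0 1) := (((hd.pow 2).div_const 4).sub hw).const_mul _
    have he : DifferentiableOn ℂ (fun z => Complex.exp (-(dampSym δ μ x z * t / 2)))
        (Metric.ball 0 1) := ((hd.mul_const _).div_const 2).neg.cexp
    have hs := differentiable_sinhcSqrt.comp_differentiableOn hv
    have hc := differentiable_coshSqrt.comp_differentiableOn hv
    rcases hP with rfl | rfl
    · exact he.mul hs
    · exact he.mul (hc.add (((hd.mul_const _).div_const 2).mul hs))
  · have e1 : ((μ * (x * √(1 + z)) ^ (2 * δ) : ℝ) : ℂ) = dampSym δ μ x z := by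
      rw [dampSym, Complex.ofReal_mul, rpow_mul_sqrt_one_add hx hz, Complex.ofReal_mul]
      rw [show 2 * δ / 2 = δ by ring]; ring
    have e2 : (((x * √(1 + z)) ^ (2 * σ) : ℝ) : ℂ) = waveSym σ x z := by
      rw [waveSym, rpow_mul_sqrt_one_add hx hz, show 2 * σ / 2 = σ by ring]
      congr 1
      rw [← Complex.ofReal_pow, ← Real.rpow_natCast, ← Real.rpow_mul hx.le]
      congr 2; push_cast; ring
    rw [e1, e2]

lemma IsRadialExt.apply_eq {F : ℝ → ℂ} {f : ℝ → ℂ → ℂ} (h : IsRadialExt F f) {x : ℝ} (hx : 0 < x) :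
    F x = f x 0 := by
  have := h.eq x hx 0 (by simp)
  simpa using this

lemma mul_rpow_eq_scaled {t x b : ℝ} (ht : 0 < t) (hx : 0 ≤ x) (hb : b ≠ 0) :
    t * x ^ b = (t ^ (1 / b) * x) ^ b := by
  rw [Real.mul_rpow (by positivity) hx, ← Real.rpow_mul ht.le, one_div_mul_cancel hb, Real.rpow_one]

lemma one_add_mul_rpow_le {s y κ : ℝ} (hs : 1 ≤ s) (hy : 0 < y) (hκ : 0 ≤ κ) :
    1 + s * y ^ κ ≤ 2 * s * (1 + y) ^ κ := by
  have h1 : 1 ≤ (1 + y) ^ κ := Real.one_le_rpow (by linarith) hκ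
  have h2 : y ^ κ ≤ (1 + y) ^ κ := by gcongr; linarith
  have h3 : 1 ≤ s * (1 + y) ^ κ := one_le_mul_of_one_le_of_one_le hs h1
  have h4 : s * y ^ κ ≤ s * (1 + y) ^ κ := by gcongr
  linarith

/-- With y = t^{1/(2δ)}x the damping is tx^{2δ} = y^{2δ} and the phase is tx^σ = s y^σ, where s =
t^{1-σ/(2δ)} ≥ 1. So N is at most 2s(1+y)^σ, the factor (1+y)^σ is absorbed by the exponential decay
in y, and the loss is s^{n/2}. For a = 0 the comparison with 1 near the origin costs another
s^{1/2}; for a > 0 the exponent is weakened to (n+1)/2 for a common statement. -/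
theorem small_time_kernel (hn : 1 ≤ n) (hσ : 0 < σ) (hμ : 0 < μ) (hδ : 0 < δ) (hδσ : 2 * δ < σ)
    {a : ℝ} (ha : 0 ≤ a) :
    ∃ C : ℝ, 0 < C ∧ ∀ t ∈ Ioc (0 : ℝ) 1, ∀ P ∈ ({meanProp, cosProp} : Set (ℝ → ℂ → ℂ → ℂ)),
      Integrable (propSym (n := n) P σ δ μ a t) ∧
      ∫ ξ, ‖propSym (n := n) P σ δ μ a t ξ‖ ≤ C * t ^ (-(n + a) / (2 * δ)) ∧
      Integrable (𝓕⁻ (propSym (n := n) P σ δ μ a t)) ∧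
      ∫ x, ‖𝓕⁻ (propSym (n := n) P σ δ μ a t) x‖ ≤
        C * (t ^ (-a / (2 * δ)) * (t ^ (1 - σ / (2 * δ))) ^ (((n : ℝ) + 1) / 2)) := by
  obtain ⟨κ', hκ', hκ'2, c, hc, C₀, hC₀, hsym⟩ := small_time_symbol hσ hμ hδ hδσ 1 zero_le_one
  obtain ⟨C₁, hC₁, hint⟩ := exists_integral_rpow_radial_le (n := n) hn ha
  obtain ⟨E₁, hE₁, hexp₁⟩ := exp_neg_rpow_le_one_add_rpow (θ := 2 * δ) hc (by positivity) (n + 1 + a)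
    (by positivity)
  have h2δ : 2 * δ ≠ 0 := by positivity
  have hL1 : ∀ t ∈ Ioc (0 : ℝ) 1, ∀ P ∈ ({meanProp, cosProp} : Set (ℝ → ℂ → ℂ → ℂ)),
      Integrable (propSym (n := n) P σ δ μ a t) ∧
      ∫ ξ, ‖propSym (n := n) P σ δ μ a t ξ‖ ≤ C₁ * (C₀ * E₁) * t ^ (-(n + a) / (2 * δ)) := by
    intro t ht P hP
    have hlam : 0 < t ^ (1 / (2 * δ)) := Real.rpow_pos_of_pos ht.1 _
    have := hint (t ^ (1 / (2 * δ))) (C₀ * E₁) _ _ hlam (by positivity) (isRadialExt_prop hP σ δ μ t)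
      (fun x hx => by
        rw [(isRadialExt_prop hP σ δ μ t).apply_eq hx]
        refine ((hsym t x 0 ht.1.le ht.2 hx ?_ P hP).1).trans ?_
        · have := ht.1; rw [norm_zero]; positivity
        · rw [mul_rpow_eq_scaled ht.1 hx.le h2δ, mul_assoc]
          gcongr
          exact hexp₁ _ (by positivity))
    refine ⟨this.1, this.2.trans_eq ?_⟩
    rw [← Real.rpow_mul ht.1.le, ← mul_assoc]
    congr 2; field_simp
  have hs1 : ∀ t ∈ Ioc (0 : ℝ) 1, 1 ≤ t ^ (1 - σ / (2 * δ)) := by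
    intro t ht
    apply Real.one_le_rpow_of_pos_of_le_one_of_nonpos ht.1 ht.2
    rw [sub_nonpos, le_div_iff₀ (by positivity)]; linarith
  have hscale : ∀ t ∈ Ioc (0 : ℝ) 1, ∀ x > 0,
      t * x ^ σ = t ^ (1 - σ / (2 * δ)) * (t ^ (1 / (2 * δ)) * x) ^ σ := by
    intro t ht x hx
    have ht0 := ht.1
    rw [Real.mul_rpow (by positivity) hx.le, ← Real.rpow_mul ht0.le, ← mul_assoc,
      ← Real.rpow_add ht0]
    rw [show 1 - σ / (2 * δ) + 1 / (2 * δ) * σ = 1 by ring, Real.rpow_one]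
  have hN : ∀ t ∈ Ioc (0 : ℝ) 1, ∀ x > 0, 1 + t * x ^ σ ≤
      2 * t ^ (1 - σ / (2 * δ)) * (1 + t ^ (1 / (2 * δ)) * x) ^ σ := by
    intro t ht x hx
    have ht0 := ht.1
    rw [hscale t ht x hx]
    exact one_add_mul_rpow_le (hs1 t ht) (by positivity) hσ.le
  have hS : ∀ s : ℝ, 1 ≤ s → (2 * s) ^ ((n : ℝ) / 2) ≤ 2 ^ ((n : ℝ) / 2) * s ^ (((n : ℝ) + 1) / 2) := by
    intro s hs
    rw [Real.mul_rpow (by norm_num) (by linarith)]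
    gcongr
    linarith
  rcases ha.eq_or_lt with rfl | ha
  -- The case a = 0. The exponent ε must not exceed δ, the rate of approach to 1, nor 2, the rate of
  -- the Gaussian.
  · set ε := min δ 2 with hε
    have hε0 : 0 < ε := lt_min hδ (by norm_num)
    obtain ⟨C₂, hC₂, hker⟩ := exists_integral_fourierInv_radial_sub_one_le (n := n) (κ := σ) hn hκ' hκ'2
      hσ.le hε0 (min_le_right _ _)
    obtain ⟨E₂, hE₂, hexp₂⟩ := exp_neg_rpow_le_one_add_rpow (θ := 2 * δ) hc (by positivity)
      (ε + σ * n / 2) (by positivity)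
    set B₀ := (C₀ + 1) * (√μ + 1) with hB₀
    refine ⟨C₁ * (C₀ * E₁) + (C₂ * (C₀ * E₂ + B₀ + 1) * 2 ^ ((n : ℝ) / 2) + 1), by positivity,
      fun t ht P hP => ?_⟩
    obtain ⟨i1, i2⟩ := hL1 t ht P hP
    have ht0 := ht.1
    set s := t ^ (1 - σ / (2 * δ)) with hs
    have hs1 : 1 ≤ s := hs1 t ht
    set lam := t ^ (1 / (2 * δ)) with hlam
    have hlam0 : 0 < lam := Real.rpow_pos_of_pos ht.1 _
    refine ⟨i1, i2.trans ?_, ?_⟩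
    · gcongr
      linarith [show 0 ≤ C₂ * (C₀ * E₂ + B₀ + 1) * 2 ^ ((n : ℝ) / 2) by positivity]
    have hsymeq : propSym (n := n) P σ δ μ 0 t = fun ξ : EuclideanSpace ℝ (Fin n) =>
        P t ((μ * (2 * Real.pi * ‖ξ‖) ^ (2 * δ) : ℝ) : ℂ)
          (((2 * Real.pi * ‖ξ‖) ^ (2 * σ) : ℝ) : ℂ) := by
      ext ξ; simp [propSym]
    have key := hker t lam (B₀ * s ^ ((1 : ℝ) / 2)) (C₀ * E₂ * (2 * s) ^ ((n : ℝ) / 2)) (2 * s) _ _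
      ht0.le hlam0 (by positivity) (by positivity) (by positivity) (isRadialExt_prop hP σ δ μ t)
      (hN t ht) ?_ ?_ (by rwa [hsymeq] at i1)
    · rw [hsymeq]
      refine ⟨key.1, key.2.trans ?_⟩
      rw [neg_zero, zero_div, Real.rpow_zero, one_mul]
      set w := s ^ (((n : ℝ) + 1) / 2) with hw
      have hw1 : 1 ≤ w := Real.one_le_rpow hs1 (by positivity)
      have e1 : s ^ ((1 : ℝ) / 2) * s ^ ((n : ℝ) / 2) = w := by
        rw [← Real.rpow_add (by linarith)]; congr 1; ring
      have e2 : (2 * s) ^ ((n : ℝ) / 2) ≤ 2 ^ ((n : ℝ) / 2) * w := hS s hs1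
      have e3 : s ^ ((1 : ℝ) / 2) * (2 * s) ^ ((n : ℝ) / 2) = 2 ^ ((n : ℝ) / 2) * w := by
        rw [Real.mul_rpow (by norm_num) (by linarith), ← e1]; ring
      calc C₂ * (C₀ * E₂ * (2 * s) ^ ((n : ℝ) / 2) + (B₀ * s ^ ((1 : ℝ) / 2) + 1) * (2 * s) ^ ((n : ℝ) / 2)) + 1
          = C₂ * (C₀ * E₂ * (2 * s) ^ ((n : ℝ) / 2) + B₀ * (s ^ ((1 : ℝ) / 2) * (2 * s) ^ ((n : ℝ) / 2)) +
            (2 * s) ^ ((n : ℝ) / 2)) + 1 := by ring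
        _ ≤ C₂ * (C₀ * E₂ * (2 ^ ((n : ℝ) / 2) * w) + B₀ * (2 ^ ((n : ℝ) / 2) * w) +
            (2 ^ ((n : ℝ) / 2) * w)) + w := by
            rw [e3]; gcongr
        _ = (0 + (C₂ * (C₀ * E₂ + B₀ + 1) * 2 ^ ((n : ℝ) / 2) + 1)) * w := by ring
        _ ≤ _ := by gcongr; positivity
    · intro x hx z hz hy1
      set y := lam * x with hy
      have hy0 : 0 < y := by positivity
      have hyε : y ^ δ ≤ y ^ ε := Real.rpow_le_rpow_of_exponent_ge hy0 hy1 (min_le_left _ _)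
      have hs12 : 1 ≤ s ^ ((1 : ℝ) / 2) := Real.one_le_rpow hs1 (by norm_num)
      have hmain : ‖P t (dampSym δ μ x z) (waveSym σ x z) - 1‖ ≤ B₀ * s ^ ((1 : ℝ) / 2) * y ^ δ := by
        obtain ⟨h1, h2⟩ := hsym t x z ht0.le ht.2 hx hz P hP
        have e1 : t * (μ * x ^ (2 * δ)) = μ * y ^ (2 * δ) := by
          rw [hy, hlam, ← mul_rpow_eq_scaled ht0 hx.le h2δ]; ring
        have e2 : √(μ * y ^ (2 * δ)) = √μ * y ^ δ := by
          rw [Real.sqrt_mul hμ.le, Real.sqrt_eq_rpow (y ^ (2 * δ)), ← Real.rpow_mul hy0.le]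
          congr 2; ring
        rcases le_total (t * (μ * x ^ (2 * δ))) 1 with h3 | h3
        · refine (h2 h3).trans ?_
          -- √(tx^σ) = s^{1/2} y^{σ/2}, and y^{σ/2} ≤ y^δ since y ≤ 1 and σ/2 ≥ δ. This is the extra
          -- half power of s.
          have e3 : √(t * x ^ σ) ≤ s ^ ((1 : ℝ) / 2) * y ^ δ := by
            rw [hscale t ht x hx, ← hlam, ← hy, ← hs, Real.sqrt_mul (by linarith), Real.sqrt_eq_rpow,
              Real.sqrt_eq_rpow, ← Real.rpow_mul hy0.le]
            refine mul_le_mul_of_nonneg_left ?_ (by positivity)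
            exact Real.rpow_le_rpow_of_exponent_ge hy0 hy1 (by linarith)
          rw [e1, e2]
          calc C₀ * (√μ * y ^ δ + √(t * x ^ σ)) ≤
                (C₀ + 1) * (√μ * (s ^ ((1 : ℝ) / 2) * y ^ δ) + 1 * (s ^ ((1 : ℝ) / 2) * y ^ δ)) := by
                gcongr
                · linarith
                · exact le_mul_of_one_le_left (by positivity) hs12
                · linarith
            _ = _ := by rw [hB₀]; ring
        -- If t times the damping is at least 1, then √μ y^δ ≥ 1, and boundedness of the propagator
        -- already implies the estimate.
        · have h4 : 1 ≤ √μ * y ^ δ := by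
            rw [← e2, ← e1]; exact Real.one_le_sqrt.2 h3
          have h5 : ‖P t (dampSym δ μ x z) (waveSym σ x z)‖ ≤ C₀ := by
            refine h1.trans (mul_le_of_le_one_right hC₀.le (Real.exp_le_one_iff.2 ?_))
            rw [neg_nonpos]; positivity
          calc _ ≤ ‖P t (dampSym δ μ x z) (waveSym σ x z)‖ + ‖(1 : ℂ)‖ := norm_sub_le _ _
            _ ≤ (C₀ + 1) * 1 * 1 := by rw [norm_one]; linarith
            _ ≤ (C₀ + 1) * (s ^ ((1 : ℝ) / 2)) * (√μ * y ^ δ + y ^ δ) := by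
                gcongr; linarith [show 0 ≤ y ^ δ by positivity]
            _ = _ := by rw [hB₀]; ring
      exact hmain.trans (by gcongr)
    · intro x hx z hz hy1
      set y := lam * x with hy
      have hy0 : 0 < y := by positivity
      have h1 := (hsym t x z ht0.le ht.2 hx hz P hP).1
      rw [mul_rpow_eq_scaled ht0 hx.le h2δ] at h1
      have hb := one_add_rpow_bound (n := n) ht0.le hx hy0 (by positivity) (hN t ht x hx)
      calc _ ≤ C₀ * (E₂ * (1 + y) ^ (-(ε + σ * n / 2))) * ((2 * s) ^ ((n : ℝ) / 2) * (1 + y) ^ (σ * n / 2)) := by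
            gcongr
            refine h1.trans ?_
            gcongr
            exact hexp₂ _ (by positivity)
        _ = C₀ * E₂ * (2 * s) ^ ((n : ℝ) / 2) *
            ((1 + y) ^ (-(ε + σ * n / 2)) * (1 + y) ^ (σ * n / 2)) := by ring
        _ = C₀ * E₂ * (2 * s) ^ ((n : ℝ) / 2) * (1 + y) ^ (-ε) := by
            rw [← Real.rpow_add (by positivity)]; congr 2; ring
        _ ≤ _ := by
            gcongr ?_ * ?_
            exact Real.rpow_le_rpow_of_nonpos hy0 (by linarith) (by linarith)
  · obtain ⟨C₂, hC₂, hker⟩ := exists_integral_fourierInv_rpow_radial_le (n := n) (κ := σ) hn hκ' hκ'2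
      hσ.le ha
    obtain ⟨E₂, hE₂, hexp₂⟩ := exp_neg_rpow_le_one_add_rpow (θ := 2 * δ) hc (by positivity)
      (2 * a + σ * n / 2) (by positivity)
    refine ⟨C₁ * (C₀ * E₁) + C₂ * (C₀ * E₂) * 2 ^ ((n : ℝ) / 2), by positivity, fun t ht P hP => ?_⟩
    obtain ⟨i1, i2⟩ := hL1 t ht P hP
    have ht0 := ht.1
    refine ⟨i1, i2.trans ?_, ?_⟩
    · gcongr
      linarith [show 0 ≤ C₂ * (C₀ * E₂) * 2 ^ ((n : ℝ) / 2) by positivity]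
    set s := t ^ (1 - σ / (2 * δ)) with hs
    have hs1 : 1 ≤ s := hs1 t ht
    obtain ⟨k1, k2⟩ := hker t (t ^ (1 / (2 * δ))) (C₀ * E₂) (2 * s) _ _ ht0.le (by positivity)
      (by positivity) (by positivity) (isRadialExt_prop hP σ δ μ t) (hN t ht) (fun x hx z hz => by
        refine ((hsym t x z ht.1.le ht.2 hx hz P hP).1).trans ?_
        rw [mul_rpow_eq_scaled ht.1 hx.le h2δ, mul_assoc]
        gcongr
        exact hexp₂ _ (by positivity)) i1
    refine ⟨k1, k2.trans ?_⟩
    calc C₂ * (C₀ * E₂ * (2 * s) ^ ((n : ℝ) / 2) * (t ^ (1 / (2 * δ))) ^ (-a))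
        ≤ C₂ * (C₀ * E₂ * (2 ^ ((n : ℝ) / 2) * s ^ (((n : ℝ) + 1) / 2)) * (t ^ (1 / (2 * δ))) ^ (-a)) := by
          gcongr; exact hS s hs1
      _ = (0 + C₂ * (C₀ * E₂) * 2 ^ ((n : ℝ) / 2)) *
          (t ^ (-a / (2 * δ)) * s ^ (((n : ℝ) + 1) / 2)) := by
          rw [← Real.rpow_mul ht0.le (1 / (2 * δ)), show 1 / (2 * δ) * -a = -a / (2 * δ) by ring]; ring
      _ ≤ _ := by gcongr; positivity

end PropagatorKernels

end

/-! ### Kernels of the propagators for large times -/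

noncomputable section

section LargeTimeKernels

variable {n : ℕ} {σ δ μ : ℝ}

lemma propSym_zero_exponent (P : ℝ → ℂ → ℂ → ℂ) (t : ℝ) :
    propSym (n := n) P σ δ μ 0 t = fun ξ : EuclideanSpace ℝ (Fin n) =>
      P t ((μ * (2 * Real.pi * ‖ξ‖) ^ (2 * δ) : ℝ) : ℂ)
        (((2 * Real.pi * ‖ξ‖) ^ (2 * σ) : ℝ) : ℂ) := by
  ext ξ; simp [propSym]

lemma le_of_high_frequency (hμ : 0 < μ) (hδσ : 2 * δ < σ) {x : ℝ} (hx : 0 < x)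
    (h : μ * x ^ (2 * δ) ≤ 4 * x ^ σ) : (μ / 4) ^ (1 / (σ - 2 * δ)) ≤ x := by
  have h1 : μ / 4 ≤ x ^ (σ - 2 * δ) := by
    rw [Real.rpow_sub hx, div_le_div_iff₀ (by norm_num) (by positivity)]; linarith
  have hpos : 0 < σ - 2 * δ := by linarith
  calc (μ / 4) ^ (1 / (σ - 2 * δ)) ≤ (x ^ (σ - 2 * δ)) ^ (1 / (σ - 2 * δ)) := by gcongr
    _ = x := by rw [← Real.rpow_mul hx.le, mul_one_div_cancel hpos.ne', Real.rpow_one]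

lemma mul_one_add_rpow_le {G B E N S y ε κ : ℝ} (hN : 0 ≤ N) (hy : 0 < y) (hε : 0 ≤ ε) (hB : 0 ≤ B)
    (hS : 0 ≤ S) (hE : 0 ≤ E) (h1 : G ≤ B * (E * (1 + y) ^ (-(ε + κ)))) (h2 : N ≤ S * (1 + y) ^ κ) :
    G * N ≤ B * E * S * y ^ (-ε) := by
  calc G * N ≤ B * (E * (1 + y) ^ (-(ε + κ))) * (S * (1 + y) ^ κ) :=
        mul_le_mul h1 h2 hN (by positivity)
    _ = B * E * S * ((1 + y) ^ (-(ε + κ)) * (1 + y) ^ κ) := by ring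
    _ = B * E * S * (1 + y) ^ (-ε) := by
        rw [← Real.rpow_add (by positivity)]; congr 2; ring
    _ ≤ _ := by
        gcongr ?_ * ?_
        exact Real.rpow_le_rpow_of_nonpos hy (by linarith) (by linarith)

/-- At the diffusive scale y = t^{1/b}x, with b = 2(σ-δ), N is 1 + y^b and there is no loss in t.
Higher frequencies decay at least as well because t ≥ 1 and 2δ ≤ b. When a = 0 the two propagators
need different scales, since `meanProp` departs from 1 already at tx^{2δ} ~ 1, that is, at much
lower frequencies. -/
theorem large_time_kernel (hn : 1 ≤ n) (hμ : 0 < μ) (hδ : 0 < δ) (hδσ : 2 * δ < σ)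
    {a : ℝ} (ha : 0 ≤ a) :
    ∃ C : ℝ, 0 < C ∧ ∀ t : ℝ, 1 ≤ t → ∀ P ∈ ({meanProp, cosProp} : Set (ℝ → ℂ → ℂ → ℂ)),
      Integrable (propSym (n := n) P σ δ μ a t) ∧
      ∫ ξ, ‖propSym (n := n) P σ δ μ a t ξ‖ ≤ C * t ^ (-(n + a) / (2 * (σ - δ))) ∧
      Integrable (𝓕⁻ (propSym (n := n) P σ δ μ a t)) ∧
      ∫ x, ‖𝓕⁻ (propSym (n := n) P σ δ μ a t) x‖ ≤ C * t ^ (-a / (2 * (σ - δ))) := by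
  have hσ : 0 < σ := by linarith
  obtain ⟨κ', hκ', hκ'2, c, hc, C₀, hC₀, hsym⟩ := large_time_symbol hσ hμ hδ
  set b := 2 * (σ - δ) with hb
  have hb0 : 0 < b := by rw [hb]; linarith
  have hδb : 2 * δ ≤ b := by rw [hb]; linarith
  have h2δ : 0 < 2 * δ := by positivity
  -- The decay in the damped zone, re-expressed in the diffusive variable: t^{2δ/b} ≤ t since t ≥ 1
  -- and 2δ ≤ b.
  have hhigh : ∀ t x : ℝ, 1 ≤ t → 0 < x → (t ^ (1 / b) * x) ^ (2 * δ) ≤ t * x ^ (2 * δ) := by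
    intro t x ht hx
    rw [Real.mul_rpow (by positivity) hx.le, ← Real.rpow_mul (by positivity)]
    gcongr
    calc t ^ (1 / b * (2 * δ)) ≤ t ^ (1 : ℝ) := by
          apply Real.rpow_le_rpow_of_exponent_le ht
          rw [one_div_mul_eq_div, div_le_one hb0]; exact hδb
      _ = t := Real.rpow_one t
  have hdecay : ∀ K : ℝ, 0 ≤ K → ∃ E : ℝ, 0 < E ∧ ∀ (t x : ℝ) (z : ℂ), 1 ≤ t → 0 < x →
      ‖z‖ ≤ κ' / (1 + t * x ^ b) → ∀ P ∈ ({meanProp, cosProp} : Set (ℝ → ℂ → ℂ → ℂ)),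
      ‖P t (dampSym δ μ x z) (waveSym σ x z)‖ ≤ C₀ * (E * (1 + t ^ (1 / b) * x) ^ (-K)) := by
    intro K hK
    obtain ⟨E₁, hE₁, h₁⟩ := exp_neg_rpow_le_one_add_rpow (θ := b) hc hb0 K hK
    obtain ⟨E₂, hE₂, h₂⟩ := exp_neg_rpow_le_one_add_rpow (θ := 2 * δ) hc h2δ K hK
    refine ⟨max E₁ E₂, lt_max_of_lt_left hE₁, fun t x z ht hx hz P hP => ?_⟩
    have ht0 : 0 < t := by linarith
    have hy : 0 ≤ t ^ (1 / b) * x := by positivity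
    obtain ⟨hl, hh⟩ := hsym t x z ht hx hz
    rcases le_total (4 * x ^ σ) (μ * x ^ (2 * δ)) with h | h
    · refine ((hl h).1 P hP).trans ?_
      rw [mul_rpow_eq_scaled ht0 hx.le hb0.ne']
      gcongr
      refine (h₁ _ hy).trans ?_
      gcongr; exact le_max_left _ _
    · refine (hh h P hP).trans ?_
      gcongr
      calc Real.exp (-(c * (t * x ^ (2 * δ)))) ≤ Real.exp (-(c * (t ^ (1 / b) * x) ^ (2 * δ))) := by
            gcongr; exact hhigh t x ht hx
        _ ≤ _ := (h₂ _ hy).trans (by gcongr; exact le_max_right _ _)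
  obtain ⟨C₁, hC₁, hint⟩ := exists_integral_rpow_radial_le (n := n) hn ha
  obtain ⟨E₁, hE₁, hdec₁⟩ := hdecay (n + 1 + a) (by positivity)
  have hL1 : ∀ t : ℝ, 1 ≤ t → ∀ P ∈ ({meanProp, cosProp} : Set (ℝ → ℂ → ℂ → ℂ)),
      Integrable (propSym (n := n) P σ δ μ a t) ∧
      ∫ ξ, ‖propSym (n := n) P σ δ μ a t ξ‖ ≤ C₁ * (C₀ * E₁) * t ^ (-(n + a) / b) := by
    intro t ht P hP
    have ht0 : 0 < t := by linarith
    have := hint (t ^ (1 / b)) (C₀ * E₁) _ _ (by positivity) (by positivity)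
      (isRadialExt_prop hP σ δ μ t)
      (fun x hx => by
        rw [(isRadialExt_prop hP σ δ μ t).apply_eq hx, mul_assoc]
        exact hdec₁ t x 0 ht hx (by rw [norm_zero]; positivity) P hP)
    refine ⟨this.1, this.2.trans_eq ?_⟩
    rw [← Real.rpow_mul ht0.le, ← mul_assoc]
    congr 2; field_simp
  have hN : ∀ t x lam : ℝ, 1 ≤ t → 0 < x → t ^ (1 / b) ≤ lam →
      1 + t * x ^ b ≤ 2 * (1 + lam * x) ^ b := by
    intro t x lam ht hx hlam
    have ht0 : 0 < t := by linarith
    have hl0 : 0 < t ^ (1 / b) := by positivity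
    rw [mul_rpow_eq_scaled ht0 hx.le hb0.ne']
    calc 1 + (t ^ (1 / b) * x) ^ b ≤ 1 + 1 * (lam * x) ^ b := by rw [one_mul]; gcongr
      _ ≤ 2 * 1 * (1 + lam * x) ^ b :=
          one_add_mul_rpow_le le_rfl (mul_pos (hl0.trans_le hlam) hx) hb0.le
      _ = _ := by ring
  rcases ha.eq_or_lt with rfl | ha
  · set ε := min (2 * δ) 2 with hε
    have hε0 : 0 < ε := lt_min h2δ (by norm_num)
    obtain ⟨C₂, hC₂, hker⟩ := exists_integral_fourierInv_radial_sub_one_le (n := n) (κ := b) hn hκ' hκ'2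
      hb0.le hε0 (min_le_right _ _)
    obtain ⟨E₂, hE₂, hdec₂⟩ := hdecay (ε + b * n / 2) (by positivity)
    obtain ⟨E₃, hE₃, hexp₃⟩ := exp_neg_rpow_le_one_add_rpow (θ := 1) hc one_pos ((n : ℝ) / 2)
      (by positivity)
    obtain ⟨E₄, hE₄, hexp₄⟩ := exp_neg_rpow_le_one_add_rpow (θ := 2 * δ) hc h2δ (ε + b * n / 2)
      (by positivity)
    set x₀ := (μ / 4) ^ (1 / (σ - 2 * δ)) with hx₀
    have hx₀0 : 0 < x₀ := by positivity
    set B := C₀ + (C₀ + 1) * x₀ ^ (-ε) with hB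
    have hB0 : 0 < B := by positivity
    set B₁ := C₀ * (E₂ + E₃ + E₄) * 2 ^ ((n : ℝ) / 2) with hB₁
    have hB₁0 : 0 < B₁ := by positivity
    have htwo : (1 : ℝ) ≤ 2 ^ ((n : ℝ) / 2) := Real.one_le_rpow (by norm_num) (by positivity)
    -- In the high-frequency zone x is at least the fixed x₀, so for scales lam ≥ 1 the power
    -- (lam·x)^ε is bounded below and the trivial bound C₀ + 1 is good enough.
    have hcoarse : ∀ (t x : ℝ) (z : ℂ), 1 ≤ t → 0 < x → ‖z‖ ≤ κ' / (1 + t * x ^ b) →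
        μ * x ^ (2 * δ) ≤ 4 * x ^ σ → ∀ P ∈ ({meanProp, cosProp} : Set (ℝ → ℂ → ℂ → ℂ)),
        ∀ lam : ℝ, 1 ≤ lam →
        ‖P t (dampSym δ μ x z) (waveSym σ x z) - 1‖ ≤ B * (lam * x) ^ ε := by
      intro t x z ht hx hz h P hP lam hlam
      have h5 : ‖P t (dampSym δ μ x z) (waveSym σ x z)‖ ≤ C₀ := by
        refine ((hsym t x z ht hx hz).2 h P hP).trans
          (mul_le_of_le_one_right hC₀.le (Real.exp_le_one_iff.2 ?_))
        rw [neg_nonpos]; positivity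
      have h6 : 1 ≤ x₀ ^ (-ε) * (lam * x) ^ ε := by
        have h7 : x₀ ≤ lam * x := (le_of_high_frequency hμ hδσ hx h).trans
          (le_mul_of_one_le_left hx.le hlam)
        calc (1 : ℝ) = x₀ ^ (-ε) * x₀ ^ ε := by rw [← Real.rpow_add hx₀0]; simp
          _ ≤ _ := by gcongr
      calc _ ≤ ‖P t (dampSym δ μ x z) (waveSym σ x z)‖ + ‖(1 : ℂ)‖ := norm_sub_le _ _
        _ ≤ (C₀ + 1) * 1 := by rw [norm_one]; linarith
        _ ≤ (C₀ + 1) * (x₀ ^ (-ε) * (lam * x) ^ ε) := by gcongr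
        _ ≤ C₀ * (lam * x) ^ ε + (C₀ + 1) * (x₀ ^ (-ε) * (lam * x) ^ ε) := by
            have : 0 < lam := by linarith
            linarith [show 0 ≤ C₀ * (lam * x) ^ ε by positivity]
        _ = _ := by rw [hB]; ring
    refine ⟨C₁ * (C₀ * E₁) + (C₂ * (B₁ + (B + 1) * 2 ^ ((n : ℝ) / 2)) + 1), by positivity,
      fun t ht P hP => ?_⟩
    obtain ⟨i1, i2⟩ := hL1 t ht P hP
    have ht0 : 0 < t := by linarith
    refine ⟨i1, i2.trans ?_, ?_⟩
    · gcongr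
      linarith [show 0 ≤ C₂ * (B₁ + (B + 1) * 2 ^ ((n : ℝ) / 2)) by positivity]
    have hfin : ∀ lam : ℝ, t ^ (1 / b) ≤ lam →
        (∀ x > 0, ∀ z : ℂ, ‖z‖ ≤ κ' / (1 + t * x ^ b) → lam * x ≤ 1 →
          ‖P t (dampSym δ μ x z) (waveSym σ x z) - 1‖ ≤ B * (lam * x) ^ ε) →
        (∀ x > 0, ∀ z : ℂ, ‖z‖ ≤ κ' / (1 + t * x ^ b) → 1 ≤ lam * x →
          ‖P t (dampSym δ μ x z) (waveSym σ x z)‖ * (1 + t * x ^ b) ^ ((n : ℝ) / 2) ≤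
            B₁ * (lam * x) ^ (-ε)) →
        Integrable (𝓕⁻ (propSym (n := n) P σ δ μ 0 t)) ∧
        ∫ x, ‖𝓕⁻ (propSym (n := n) P σ δ μ 0 t) x‖ ≤
          (C₁ * (C₀ * E₁) + (C₂ * (B₁ + (B + 1) * 2 ^ ((n : ℝ) / 2)) + 1)) * t ^ (-0 / b) := by
      intro lam hlam h1 h2
      have hlam0 : 0 < lam := lt_of_lt_of_le (by positivity) hlam
      have key := hker t lam B B₁ 2 _ _ ht0.le hlam0 hB0 hB₁0 two_pos (isRadialExt_prop hP σ δ μ t)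
        (fun x hx => hN t x lam ht hx hlam) h1 h2 (by rwa [propSym_zero_exponent] at i1)
      rw [propSym_zero_exponent]
      refine ⟨key.1, key.2.trans ?_⟩
      rw [neg_zero, zero_div, Real.rpow_zero, mul_one]
      linarith [show 0 ≤ C₁ * (C₀ * E₁) by positivity]
    have hNn : ∀ x lam : ℝ, 0 < x → t ^ (1 / b) ≤ lam → (1 + t * x ^ b) ^ ((n : ℝ) / 2) ≤
        2 ^ ((n : ℝ) / 2) * (1 + lam * x) ^ (b * n / 2) := by
      intro x lam hx hlam
      have hlam0 : 0 < lam := lt_of_lt_of_le (by positivity) hlam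
      exact one_add_rpow_bound ht0.le hx (by positivity) two_pos (hN t x lam ht hx hlam)
    rcases hP with rfl | rfl
    · have hP : meanProp ∈ ({meanProp, cosProp} : Set (ℝ → ℂ → ℂ → ℂ)) := by simp
      -- The scale of `meanProp` is t^{1/(2δ)}, for which t x^{2δ} = y^{2δ}. It is larger than
      -- t^{1/b}, so the bound on N remains available.
      have hlam1 : 1 ≤ t ^ (1 / (2 * δ)) := Real.one_le_rpow ht (by positivity)
      have hlam : t ^ (1 / b) ≤ t ^ (1 / (2 * δ)) := by
        apply Real.rpow_le_rpow_of_exponent_le ht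
        gcongr
      refine hfin _ hlam (fun x hx z hz hy1 => ?_) (fun x hx z hz hy1 => ?_)
      · have hy0 : 0 < t ^ (1 / (2 * δ)) * x := by positivity
        rcases le_total (4 * x ^ σ) (μ * x ^ (2 * δ)) with h | h
        · refine (((hsym t x z ht hx hz).1 h).2.2.2).trans ?_
          rw [mul_rpow_eq_scaled ht0 hx.le h2δ.ne']
          gcongr ?_ * ?_
          · rw [hB]; linarith [show 0 ≤ (C₀ + 1) * x₀ ^ (-ε) by positivity]
          · exact Real.rpow_le_rpow_of_exponent_ge hy0 hy1 (min_le_left _ _)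
        · exact hcoarse t x z ht hx hz h _ hP _ hlam1
      · set y := t ^ (1 / (2 * δ)) * x with hy
        have hy0 : 0 < y := by positivity
        rcases le_total (4 * x ^ σ) (μ * x ^ (2 * δ)) with h | h
        · have h1 := ((hsym t x z ht hx hz).1 h).2.1
          rw [mul_rpow_eq_scaled ht0 hx.le h2δ.ne', ← hy] at h1
          -- Here the decay in y is only y^{-2δ}, from the gain 1/(tx^{2δ}); the Bernstein loss
          -- (1+X)^{n/2} is absorbed by the diffusive exponential in X.
          set X := t * x ^ b with hX
          have hX0 : 0 ≤ X := by positivity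
          have h2 := hexp₃ X hX0
          rw [Real.rpow_one] at h2
          have h3 : y ^ (2 * δ) * (‖meanProp t (dampSym δ μ x z) (waveSym σ x z)‖ *
              (1 + X) ^ ((n : ℝ) / 2)) ≤ C₀ * E₃ := by
            calc _ = y ^ (2 * δ) * ‖meanProp t (dampSym δ μ x z) (waveSym σ x z)‖ *
                  (1 + X) ^ ((n : ℝ) / 2) := by ring
              _ ≤ C₀ * (E₃ * (1 + X) ^ (-((n : ℝ) / 2))) * (1 + X) ^ ((n : ℝ) / 2) := by
                  refine mul_le_mul_of_nonneg_right ?_ (by positivity)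
                  exact h1.trans (by gcongr)
              _ = C₀ * E₃ * ((1 + X) ^ (-((n : ℝ) / 2)) * (1 + X) ^ ((n : ℝ) / 2)) := by ring
              _ = C₀ * E₃ := by rw [← Real.rpow_add (by positivity)]; simp
          calc _ = y ^ (-(2 * δ)) * (y ^ (2 * δ) *
                (‖meanProp t (dampSym δ μ x z) (waveSym σ x z)‖ * (1 + X) ^ ((n : ℝ) / 2))) := by
                rw [← mul_assoc (y ^ (-(2 * δ))), ← Real.rpow_add hy0]; simp
            _ ≤ y ^ (-ε) * (C₀ * E₃) := by
                gcongr
                exact min_le_left _ _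
            _ = C₀ * E₃ * 1 * y ^ (-ε) := by ring
            _ ≤ _ := by
                rw [hB₁]; gcongr; linarith
        · refine (mul_one_add_rpow_le (by positivity) hy0 hε0.le hC₀.le (by positivity) hE₄.le
            (((hsym t x z ht hx hz).2 h _ hP).trans ?_) (hNn x _ hx hlam)).trans ?_
          · rw [mul_rpow_eq_scaled ht0 hx.le h2δ.ne']
            gcongr
            exact hexp₄ _ hy0.le
          · rw [hB₁]; gcongr; linarith
    · have hP : cosProp ∈ ({meanProp, cosProp} : Set (ℝ → ℂ → ℂ → ℂ)) := by simp
      have hlam1 : 1 ≤ t ^ (1 / b) := Real.one_le_rpow ht (by positivity)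
      refine hfin _ le_rfl (fun x hx z hz hy1 => ?_) (fun x hx z hz hy1 => ?_)
      · have hy0 : 0 < t ^ (1 / b) * x := by positivity
        rcases le_total (4 * x ^ σ) (μ * x ^ (2 * δ)) with h | h
        · refine (((hsym t x z ht hx hz).1 h).2.2.1).trans ?_
          rw [mul_rpow_eq_scaled ht0 hx.le hb0.ne']
          gcongr ?_ * ?_
          · rw [hB]; linarith [show 0 ≤ (C₀ + 1) * x₀ ^ (-ε) by positivity]
          · exact Real.rpow_le_rpow_of_exponent_ge hy0 hy1 ((min_le_left _ _).trans hδb)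
        · exact hcoarse t x z ht hx hz h _ hP _ hlam1
      · have hy0 : 0 < t ^ (1 / b) * x := by positivity
        refine (mul_one_add_rpow_le (by positivity) hy0 hε0.le hC₀.le (by positivity) hE₂.le
          (hdec₂ t x z ht hx hz _ hP) (hNn x _ hx le_rfl)).trans ?_
        rw [hB₁]; gcongr; linarith
  · obtain ⟨C₂, hC₂, hker⟩ := exists_integral_fourierInv_rpow_radial_le (n := n) (κ := b) hn hκ' hκ'2
      hb0.le ha
    obtain ⟨E₂, hE₂, hdec₂⟩ := hdecay (2 * a + b * n / 2) (by positivity)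
    refine ⟨C₁ * (C₀ * E₁) + C₂ * (C₀ * E₂) * 2 ^ ((n : ℝ) / 2), by positivity, fun t ht P hP => ?_⟩
    obtain ⟨i1, i2⟩ := hL1 t ht P hP
    have ht0 : 0 < t := by linarith
    refine ⟨i1, i2.trans ?_, ?_⟩
    · gcongr
      linarith [show 0 ≤ C₂ * (C₀ * E₂) * 2 ^ ((n : ℝ) / 2) by positivity]
    obtain ⟨k1, k2⟩ := hker t (t ^ (1 / b)) (C₀ * E₂) 2 _ _ ht0.le (by positivity)
      (by positivity) (by positivity) (isRadialExt_prop hP σ δ μ t)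
      (fun x hx => hN t x _ ht hx le_rfl) (fun x hx z hz => by
        rw [mul_assoc]; exact hdec₂ t x z ht hx hz P hP) i1
    refine ⟨k1, k2.trans ?_⟩
    calc C₂ * (C₀ * E₂ * 2 ^ ((n : ℝ) / 2) * (t ^ (1 / b)) ^ (-a))
        = (0 + C₂ * (C₀ * E₂) * 2 ^ ((n : ℝ) / 2)) * t ^ (-a / b) := by
          rw [← Real.rpow_mul ht0.le (1 / b), show 1 / b * -a = -a / b by ring]; ring
      _ ≤ _ := by gcongr; positivity

end LargeTimeKernels

end

/-! ### Young's inequality and duality for convolutions -/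

noncomputable section

section Young

variable {n : ℕ}

/-- The convolution `k * f`, the kernel `k` being a function on `ℝⁿ`. -/
def kernelConv (k f : EuclideanSpace ℝ (Fin n) → ℂ) (x : EuclideanSpace ℝ (Fin n)) : ℂ :=
  ∫ y, k (x - y) * f y

variable {k f : EuclideanSpace ℝ (Fin n) → ℂ}

lemma aemeasurable_enorm_kernel_mul (hk : Continuous k) {g : EuclideanSpace ℝ (Fin n) → ℝ≥0∞}
    (hg : AEMeasurable g) :
    AEMeasurable (fun z : EuclideanSpace ℝ (Fin n) × EuclideanSpace ℝ (Fin n) =>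
      ‖k (z.1 - z.2)‖ₑ * g z.2) (volume.prod volume) := by
  refine AEMeasurable.mul ?_ hg.comp_snd
  exact (hk.comp (continuous_fst.sub continuous_snd)).measurable.enorm.aemeasurable

/-- Comparison of the L¹ and L^p norms of f for the finite measure |k(x - y)| dy, whose total mass
does not depend on x. -/
lemma lintegral_enorm_kernel_le (hk : Continuous k) (hf : AEStronglyMeasurable f) {p : ℝ≥0∞}
    (hp : 1 ≤ p) (x : EuclideanSpace ℝ (Fin n)) :
    ∫⁻ y, ‖k (x - y)‖ₑ * ‖f y‖ₑ ≤
      eLpNorm f p (volume.withDensity fun y => ‖k (x - y)‖ₑ) * (∫⁻ y, ‖k y‖ₑ) ^ (1 - 1 / p.toReal) := by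
  have hkm : Measurable fun y => ‖k (x - y)‖ₑ :=
    (hk.comp (continuous_const.sub continuous_id)).measurable.enorm
  set ν := volume.withDensity fun y => ‖k (x - y)‖ₑ with hν
  have h1 := eLpNorm_le_eLpNorm_mul_rpow_measure_univ hp
    (hf.mono_ac (withDensity_absolutelyContinuous volume fun y => ‖k (x - y)‖ₑ))
  have h2 : ν univ = ∫⁻ y, ‖k y‖ₑ := by
    rw [hν, withDensity_apply _ MeasurableSet.univ, Measure.restrict_univ,
      lintegral_sub_left_eq_self (fun y => ‖k y‖ₑ)]
  rw [← hν, h2, eLpNorm_one_eq_lintegral_enorm, hν,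
    lintegral_withDensity_eq_lintegral_mul₀ hkm.aemeasurable hf.enorm] at h1
  simpa using h1

/-- Young's inequality, with the norm of the kernel interpolated between `L¹` and `L^∞`. -/
theorem lintegral_kernel_young (hk : Continuous k) {K M : ℝ} (hK : 0 < K) (hM : 0 < M)
    (hkK : ∫⁻ y, ‖k y‖ₑ ≤ ENNReal.ofReal K) (hkM : ∀ y, ‖k y‖ ≤ M) {p q r : ℝ≥0∞} (hp : 1 ≤ p)
    (hpq : p ≤ q) (hr : 1 + q⁻¹ = r⁻¹ + p⁻¹) (hf : AEStronglyMeasurable f) :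
    eLpNorm (fun x => ∫⁻ y, ‖k (x - y)‖ₑ * ‖f y‖ₑ) q volume ≤
      ENNReal.ofReal (K ^ (r⁻¹).toReal * M ^ (1 - (r⁻¹).toReal)) * eLpNorm f p volume := by
  have hp0 : p ≠ 0 := (zero_lt_one.trans_le hp).ne'
  have hq : 1 ≤ q := hp.trans hpq
  have hq0 : q ≠ 0 := (zero_lt_one.trans_le hq).ne'
  set F := eLpNorm f p volume with hF
  set θ := (r⁻¹).toReal with hθ
  have hpinv : p⁻¹ ≠ ∞ := by simpa using hp0
  have hqinv : q⁻¹ ≠ ∞ := by simpa using hq0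
  have hrinv : r⁻¹ ≠ ∞ := by
    intro h; rw [h, top_add] at hr; exact (ENNReal.add_ne_top.2 ⟨ENNReal.one_ne_top, hqinv⟩) hr
  -- θ = 1/r read off from the relation between p, q, r in the extended reals; the conventions 1/∞ =
  -- 0 agree on both sides.
  have hθeq : θ = 1 + 1 / q.toReal - 1 / p.toReal := by
    have := congrArg ENNReal.toReal hr
    rw [ENNReal.toReal_add ENNReal.one_ne_top hqinv, ENNReal.toReal_add hrinv hpinv,
      ENNReal.toReal_one, ENNReal.toReal_inv q, ENNReal.toReal_inv p] at this
    rw [one_div, one_div, hθ]; linarith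
  have hKe : ENNReal.ofReal K ≠ 0 := by simpa using hK
  have hconst : ∀ α β : ℝ, ENNReal.ofReal K ^ α * ENNReal.ofReal M ^ β =
      ENNReal.ofReal (K ^ α * M ^ β) := by
    intro α β
    rw [ENNReal.ofReal_mul (by positivity), ENNReal.ofReal_rpow_of_pos hK, ENNReal.ofReal_rpow_of_pos hM]
  rcases eq_or_ne p ∞ with hptop | hptop
  · subst hptop
    have hqtop : q = ∞ := top_le_iff.1 hpq
    subst hqtop
    have hθ1 : θ = 1 := by rw [hθeq]; simp
    rw [hθ1, eLpNorm_exponent_top]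
    refine eLpNormEssSup_le_of_ae_enorm_bound (Filter.Eventually.of_forall fun x => ?_)
    rw [enorm_eq_self]
    refine (lintegral_enorm_kernel_le hk hf hp x).trans ?_
    simp only [ENNReal.toReal_top, div_zero, sub_zero, ENNReal.rpow_one, sub_self, Real.rpow_one,
      Real.rpow_zero, mul_one]
    rw [mul_comm]
    gcongr
    rw [eLpNorm_exponent_top, hF, eLpNorm_exponent_top]
    exact eLpNormEssSup_mono_measure f (withDensity_absolutelyContinuous _ _)
  set P := p.toReal with hP
  have hP1 : 1 ≤ P := by
    rw [hP, ← ENNReal.toReal_one]; exact ENNReal.toReal_mono hptop hp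
  have hP0 : 0 < P := by linarith
  have hFP : ∫⁻ y, ‖f y‖ₑ ^ P = F ^ P := by
    rw [hF, eLpNorm_eq_lintegral_rpow_enorm_toReal hp0 hptop, ← ENNReal.rpow_mul,
      one_div_mul_cancel hP0.ne', ENNReal.rpow_one]
  -- I = |k| * |f|^p is bounded by M‖f‖^p pointwise and has integral at most K‖f‖^p.
  set I : EuclideanSpace ℝ (Fin n) → ℝ≥0∞ := fun x => ∫⁻ y, ‖k (x - y)‖ₑ * ‖f y‖ₑ ^ P with hI
  have hfP : AEMeasurable fun y => ‖f y‖ₑ ^ P := hf.enorm.pow_const P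
  have hIM : ∀ x, I x ≤ ENNReal.ofReal M * F ^ P := by
    intro x
    rw [← hFP, ← lintegral_const_mul'' _ hfP]
    refine lintegral_mono fun y => ?_
    refine mul_le_mul_left ?_ _
    rw [← ofReal_norm]
    exact ENNReal.ofReal_le_ofReal (hkM _)
  have hIint : ∫⁻ x, I x ≤ ENNReal.ofReal K * F ^ P := by
    rw [hI, lintegral_lintegral_swap (aemeasurable_enorm_kernel_mul hk hfP)]
    calc ∫⁻ y, ∫⁻ x, ‖k (x - y)‖ₑ * ‖f y‖ₑ ^ P = ∫⁻ y, (∫⁻ x, ‖k x‖ₑ) * ‖f y‖ₑ ^ P := by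
          refine lintegral_congr fun y => ?_
          have hm : Measurable fun x => ‖k (x - y)‖ₑ :=
            (hk.comp (continuous_id.sub continuous_const)).measurable.enorm
          rw [lintegral_mul_const _ hm]
          congr 1
          exact lintegral_sub_right_eq_self (fun x => ‖k x‖ₑ) y
      _ = (∫⁻ x, ‖k x‖ₑ) * F ^ P := by rw [lintegral_const_mul'' _ hfP, hFP]
      _ ≤ _ := by gcongr
  set Q := q.toReal with hQ
  have hQP : 1 / Q ≤ 1 / P := by
    rw [one_div, one_div, hQ, hP, ← ENNReal.toReal_inv, ← ENNReal.toReal_inv]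
    exact ENNReal.toReal_mono hpinv (ENNReal.inv_le_inv.2 hpq)
  have hQ0 : 0 ≤ 1 / Q := by positivity
  have hd0 : 0 ≤ 1 / P - 1 / Q := by linarith
  have hP1' : 0 ≤ 1 - 1 / P := by rw [sub_nonneg, div_le_one hP0]; exact hP1
  set c := (ENNReal.ofReal M * F ^ P) ^ (1 / P - 1 / Q) * ENNReal.ofReal K ^ (1 - 1 / P) with hc
  -- I^{1/p} is split as I^{1/q} · I^{1/p-1/q}: the second factor is bounded by the sup norm of the
  -- kernel, the first is left for the L^q integration.
  have hpt : ∀ x, ∫⁻ y, ‖k (x - y)‖ₑ * ‖f y‖ₑ ≤ I x ^ (1 / Q) * c := by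
    intro x
    refine (lintegral_enorm_kernel_le hk hf hp x).trans ?_
    have hkm : Measurable fun y => ‖k (x - y)‖ₑ :=
      (hk.comp (continuous_const.sub continuous_id)).measurable.enorm
    have e : eLpNorm f p (volume.withDensity fun y => ‖k (x - y)‖ₑ) = I x ^ (1 / P) := by
      rw [eLpNorm_eq_lintegral_rpow_enorm_toReal hp0 hptop,
        lintegral_withDensity_eq_lintegral_mul₀ hkm.aemeasurable hfP]
      rfl
    rw [e, hc, ← mul_assoc]
    gcongr
    calc I x ^ (1 / P) = I x ^ (1 / Q) * I x ^ (1 / P - 1 / Q) := by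
          rw [← ENNReal.rpow_add_of_nonneg _ _ hQ0 hd0]; congr 1; ring
      _ ≤ _ := by gcongr; exact hIM x
  have hfinal : (ENNReal.ofReal K * F ^ P) ^ (1 / Q) * c =
      ENNReal.ofReal (K ^ θ * M ^ (1 - θ)) * F := by
    rw [hc, ENNReal.mul_rpow_of_nonneg _ _ hQ0, ENNReal.mul_rpow_of_nonneg _ _ hd0]
    have e1 : (F ^ P) ^ (1 / Q) * (F ^ P) ^ (1 / P - 1 / Q) = F := by
      rw [← ENNReal.rpow_add_of_nonneg _ _ hQ0 hd0, ← ENNReal.rpow_mul]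
      rw [show P * (1 / Q + (1 / P - 1 / Q)) = 1 by rw [add_sub_cancel]; exact mul_one_div_cancel hP0.ne',
        ENNReal.rpow_one]
    have e2 : ENNReal.ofReal K ^ (1 / Q) * ENNReal.ofReal K ^ (1 - 1 / P) = ENNReal.ofReal K ^ θ := by
      rw [← ENNReal.rpow_add_of_nonneg _ _ hQ0 hP1']; congr 1; rw [hθeq]; ring
    rw [← hconst, ← e2, show 1 - θ = 1 / P - 1 / Q by rw [hθeq]; ring]
    conv_rhs => rw [← e1]
    ring
  rw [← hfinal]
  rcases eq_or_ne q ∞ with hqtop | hqtop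
  · have hQ' : 1 / Q = 0 := by rw [hQ, hqtop]; simp
    rw [hQ', ENNReal.rpow_zero, one_mul, hqtop, eLpNorm_exponent_top]
    refine eLpNormEssSup_le_of_ae_enorm_bound (Filter.Eventually.of_forall fun x => ?_)
    rw [enorm_eq_self]
    refine (hpt x).trans ?_
    rw [hQ', ENNReal.rpow_zero, one_mul]
  · have hQpos : 0 < Q := ENNReal.toReal_pos hq0 hqtop
    rw [eLpNorm_eq_lintegral_rpow_enorm_toReal hq0 hqtop, ← hQ]
    calc (∫⁻ x, ‖∫⁻ y, ‖k (x - y)‖ₑ * ‖f y‖ₑ‖ₑ ^ Q) ^ (1 / Q)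
        ≤ (∫⁻ x, I x * c ^ Q) ^ (1 / Q) := by
          gcongr with x
          rw [enorm_eq_self]
          calc (∫⁻ y, ‖k (x - y)‖ₑ * ‖f y‖ₑ) ^ Q ≤ (I x ^ (1 / Q) * c) ^ Q := by
                gcongr; exact hpt x
            _ = _ := by
                rw [ENNReal.mul_rpow_of_nonneg _ _ hQpos.le, ← ENNReal.rpow_mul,
                  one_div_mul_cancel hQpos.ne', ENNReal.rpow_one]
      _ ≤ (ENNReal.ofReal K * F ^ P * c ^ Q) ^ (1 / Q) := by
          gcongr
          rw [lintegral_mul_const'' _ (aemeasurable_enorm_kernel_mul hk hfP).lintegral_prod_right']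
          gcongr
      _ = _ := by
          rw [ENNReal.mul_rpow_of_nonneg _ _ hQ0, ← ENNReal.rpow_mul c, mul_one_div_cancel hQpos.ne',
            ENNReal.rpow_one]

lemma aestronglyMeasurable_kernelConv (hk : Continuous k) (hf : AEStronglyMeasurable f) :
    AEStronglyMeasurable (kernelConv k f) := by
  have : AEStronglyMeasurable (fun z : EuclideanSpace ℝ (Fin n) × EuclideanSpace ℝ (Fin n) =>
      k (z.1 - z.2) * f z.2) (volume.prod volume) :=
    (hk.comp (continuous_fst.sub continuous_snd)).aestronglyMeasurable.mul hf.comp_snd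
  exact this.integral_prod_right'

theorem eLpNorm_kernelConv_le (hk : Continuous k) {K M : ℝ} (hK : 0 < K) (hM : 0 < M)
    (hki : Integrable k) (hkK : ∫ y, ‖k y‖ ≤ K) (hkM : ∀ y, ‖k y‖ ≤ M) {p q r : ℝ≥0∞} (hp : 1 ≤ p)
    (hpq : p ≤ q) (hr : 1 + q⁻¹ = r⁻¹ + p⁻¹) (hf : AEStronglyMeasurable f) :
    eLpNorm (kernelConv k f) q volume ≤
      ENNReal.ofReal (K ^ (r⁻¹).toReal * M ^ (1 - (r⁻¹).toReal)) * eLpNorm f p volume := by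
  have h1 : ∫⁻ y, ‖k y‖ₑ ≤ ENNReal.ofReal K := by
    rw [← ofReal_integral_norm_eq_lintegral_enorm hki]
    exact ENNReal.ofReal_le_ofReal hkK
  refine le_trans ?_ (lintegral_kernel_young hk hK hM h1 hkM hp hpq hr hf)
  refine eLpNorm_mono_enorm fun x => ?_
  rw [enorm_eq_self]
  refine (enorm_integral_le_lintegral_enorm _).trans_eq ?_
  simp_rw [enorm_mul]

/-- Moving a convolution to the test function. -/
theorem integral_kernelConv_mul (hk : Continuous k) (hki : Integrable k) {M : ℝ}
    (hkM : ∀ y, ‖k y‖ ≤ M) {p : ℝ≥0∞} (hp : 1 ≤ p)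
    (hf : MemLp f p volume) {φ : EuclideanSpace ℝ (Fin n) → ℂ} (hφ : Integrable φ) :
    Integrable (fun x => kernelConv k f x * φ x) ∧
    ∫ x, kernelConv k f x * φ x = ∫ y, f y * ∫ x, k (x - y) * φ x := by
  set H : EuclideanSpace ℝ (Fin n) × EuclideanSpace ℝ (Fin n) → ℂ :=
    fun z => k (z.1 - z.2) * f z.2 * φ z.1 with hH
  have hHm : AEStronglyMeasurable H (volume.prod volume) :=
    ((hk.comp (continuous_fst.sub continuous_snd)).aestronglyMeasurable.mul
      hf.aestronglyMeasurable.comp_snd).mul hφ.aestronglyMeasurable.comp_fst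
  have hpinv : p⁻¹ ≤ 1 := by simpa using hp
  -- Young's inequality with q = ∞ and r conjugate to p bounds |k| * |f| almost everywhere, which is
  -- what Fubini requires. The summands + 1 below only make the constants positive.
  have hr : 1 + (∞ : ℝ≥0∞)⁻¹ = ((1 - p⁻¹)⁻¹)⁻¹ + p⁻¹ := by
    rw [inv_inv, tsub_add_cancel_of_le hpinv]; simp
  have hW := lintegral_kernel_young hk (K := (∫⁻ y, ‖k y‖ₑ).toReal + 1) (M := |M| + 1)
    (by positivity) (by positivity)
    (by
      rw [ENNReal.ofReal_add ENNReal.toReal_nonneg zero_le_one, ENNReal.ofReal_toReal hki.2.ne]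
      exact le_self_add)
    (fun y => (hkM y).trans ((le_abs_self M).trans (by linarith))) hp le_top hr
    hf.aestronglyMeasurable
  set c := ENNReal.ofReal (((∫⁻ y, ‖k y‖ₑ).toReal + 1) ^ ((1 - p⁻¹)⁻¹⁻¹).toReal *
    (|M| + 1) ^ (1 - ((1 - p⁻¹)⁻¹⁻¹).toReal)) * eLpNorm f p volume with hc
  have hctop : c < ∞ := ENNReal.mul_lt_top ENNReal.ofReal_lt_top hf.2
  have hWae : ∀ᵐ x, ∫⁻ y, ‖k (x - y)‖ₑ * ‖f y‖ₑ ≤ c := by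
    rw [eLpNorm_exponent_top] at hW
    filter_upwards [enorm_ae_le_eLpNormEssSup
      (fun x => ∫⁻ y, ‖k (x - y)‖ₑ * ‖f y‖ₑ) volume] with x hx
    rw [enorm_eq_self] at hx
    exact hx.trans hW
  have hHint : Integrable H (volume.prod volume) := by
    refine ⟨hHm, ?_⟩
    rw [HasFiniteIntegral, lintegral_prod _ hHm.enorm]
    calc ∫⁻ x, ∫⁻ y, ‖H (x, y)‖ₑ = ∫⁻ x, (∫⁻ y, ‖k (x - y)‖ₑ * ‖f y‖ₑ) * ‖φ x‖ₑ := by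
          refine lintegral_congr fun x => ?_
          simp only [hH, enorm_mul]
          have hm : AEMeasurable fun y => ‖k (x - y)‖ₑ * ‖f y‖ₑ :=
            (hk.comp (continuous_const.sub continuous_id)).measurable.enorm.aemeasurable.mul
              hf.aestronglyMeasurable.enorm
          rw [lintegral_mul_const'' _ hm]
      _ ≤ ∫⁻ x, c * ‖φ x‖ₑ := by
          refine lintegral_mono_ae ?_
          filter_upwards [hWae] with x hx
          gcongr
      _ = c * ∫⁻ x, ‖φ x‖ₑ := lintegral_const_mul'' _ hφ.aestronglyMeasurable.enorm
      _ < ∞ := ENNReal.mul_lt_top hctop hφ.2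
  have e1 : ∀ x, ∫ y, H (x, y) = kernelConv k f x * φ x := fun x => by
    simp only [hH, kernelConv]; rw [integral_mul_const]
  have e2 : ∀ y, ∫ x, H (x, y) = f y * ∫ x, k (x - y) * φ x := fun y => by
    simp only [hH]; rw [← integral_const_mul]; congr 1; ext x; ring
  refine ⟨?_, ?_⟩
  · have := hHint.integral_prod_left
    simpa only [e1] using this
  · have := integral_integral_swap (f := fun x y => H (x, y)) hHint
    simpa only [e1, e2] using this

/-- Convolving a test function with the kernel of an even symbol. -/
theorem integral_fourierInv_sub_mul {m : EuclideanSpace ℝ (Fin n) → ℂ} (hm : Integrable m)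
    (heven : ∀ ξ, m (-ξ) = m ξ) {φ : EuclideanSpace ℝ (Fin n) → ℂ} (hφ : Integrable φ)
    (y : EuclideanSpace ℝ (Fin n)) :
    ∫ x, 𝓕⁻ m (x - y) * φ x = 𝓕⁻ (fun ξ => m ξ * 𝓕 φ ξ) y := by
  -- Evenness of m turns the translated inverse transform into the forward transform of a modulated
  -- symbol, so that the transform can be moved to φ.
  set g : EuclideanSpace ℝ (Fin n) → ℂ := fun ξ => Real.fourierChar (inner ℝ ξ y) • m ξ with hg
  have hgi : Integrable g := by
    have := (Real.fourierIntegral_convergent_iff (-y)).2 hm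
    simpa [hg] using this
  have e1 : ∀ x, 𝓕⁻ m (x - y) = 𝓕 g x := by
    intro x
    rw [Real.fourierInv_eq, Real.fourier_eq, ← integral_neg_eq_self]
    refine integral_congr_ae (Filter.Eventually.of_forall fun ξ => ?_)
    simp only [hg, heven]
    rw [smul_smul, ← AddChar.map_add_eq_mul]
    congr 2
    rw [inner_neg_left, inner_sub_right]; ring
  have e2 : ∫ x, 𝓕 g x * φ x = ∫ ξ, g ξ * 𝓕 φ ξ := by
    have := VectorFourier.integral_fourierIntegral_smul_eq_flip (L := innerₗ (EuclideanSpace ℝ (Fin n)))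
      (μ := volume) (ν := volume)
      Real.continuous_fourierChar continuous_inner hgi hφ
    simpa using! this
  simp_rw [e1]
  rw [e2, Real.fourierInv_eq]
  refine integral_congr_ae (Filter.Eventually.of_forall fun ξ => ?_)
  simp only [hg, smul_mul_assoc]

end Young

end

/-! ### Series of test functions, uniform boundedness and Taylor series -/

noncomputable section

section SchwartzSeries

variable {n : ℕ}

/-- Absolutely convergent combinations of a bounded family of Schwartz functions. -/
theorem exists_hasSum_smul_schwartz {G : ℕ → 𝓢(EuclideanSpace ℝ (Fin n), ℂ)}
    (hG : ∀ k l : ℕ, ∃ B : ℝ, ∀ i ξ, ‖ξ‖ ^ k * ‖iteratedFDeriv ℝ l (G i) ξ‖ ≤ B) {c : ℕ → ℂ}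
    (hc : Summable fun i => ‖c i‖) :
    ∃ g : 𝓢(EuclideanSpace ℝ (Fin n), ℂ), HasSum (fun i => c i • G i) g ∧
      ∀ ξ, HasSum (fun i => c i • G i ξ) (g ξ) := by
  choose B hB using hG
  have hB0 : ∀ k l, 0 ≤ B k l := fun k l =>
    (by positivity : 0 ≤ ‖(0 : EuclideanSpace ℝ (Fin n))‖ ^ k * ‖iteratedFDeriv ℝ l (G 0) 0‖).trans
      (hB k l 0 0)
  have hsm : ∀ i, ContDiff ℝ ((⊤ : ℕ∞) : WithTop ℕ∞) (fun ξ => c i • G i ξ) := fun i =>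
    (G i).smooth'.const_smul (c i)
  have hder : ∀ i l ξ, iteratedFDeriv ℝ l (fun ξ => c i • G i ξ) ξ = c i • iteratedFDeriv ℝ l (G i) ξ :=
    fun i l ξ => iteratedFDeriv_const_smul_apply' (((G i).smooth l).contDiffAt)
  have hbd : ∀ k l i ξ, ‖ξ‖ ^ k * ‖iteratedFDeriv ℝ l (fun ξ => c i • G i ξ) ξ‖ ≤ ‖c i‖ * B k l := by
    intro k l i ξ
    rw [hder, norm_smul, mul_left_comm]
    gcongr
    exact hB k l i ξ
  have hv : ∀ l : ℕ, Summable fun i => ‖c i‖ * B 0 l := fun l => hc.mul_right _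
  have hbd0 : ∀ (l i : ℕ) (ξ : EuclideanSpace ℝ (Fin n)), (l : ℕ∞) ≤ (⊤ : ℕ∞) →
      ‖iteratedFDeriv ℝ l (fun ξ => c i • G i ξ) ξ‖ ≤ ‖c i‖ * B 0 l := fun l i ξ _ => by
    simpa using hbd 0 l i ξ
  -- Stated for reindexed subfamilies, so that one estimate serves the full series (the identity)
  -- and its tails (the complement of a finite set).
  have hD : ∀ {ι : Type} (e : ι → ℕ), Function.Injective e → ∀ l ξ,
      iteratedFDeriv ℝ l (fun ξ => ∑' i, c (e i) • G (e i) ξ) ξ =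
      ∑' i, iteratedFDeriv ℝ l (fun ξ => c (e i) • G (e i) ξ) ξ := fun e he l ξ =>
    iteratedFDeriv_tsum_apply (fun i => hsm (e i)) (fun l _ => (hv l).comp_injective he)
      (fun l i ξ h => hbd0 l (e i) ξ h) le_top ξ
  have htail : ∀ {ι : Type} (e : ι → ℕ), Function.Injective e → ∀ k l ξ,
      ‖ξ‖ ^ k * ‖iteratedFDeriv ℝ l (fun ξ => ∑' i, c (e i) • G (e i) ξ) ξ‖ ≤
        ∑' i, ‖c (e i)‖ * B k l := by
    intro ι e he k l ξ
    have h1 : Summable fun i => ‖iteratedFDeriv ℝ l (fun ξ => c (e i) • G (e i) ξ) ξ‖ :=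
      Summable.of_nonneg_of_le (fun i => norm_nonneg _) (fun i => hbd0 l (e i) ξ le_top)
        ((hv l).comp_injective he)
    calc _ ≤ ‖ξ‖ ^ k * ∑' i, ‖iteratedFDeriv ℝ l (fun ξ => c (e i) • G (e i) ξ) ξ‖ := by
          rw [hD e he]
          gcongr
          exact norm_tsum_le_tsum_norm h1
      _ = ∑' i, ‖ξ‖ ^ k * ‖iteratedFDeriv ℝ l (fun ξ => c (e i) • G (e i) ξ) ξ‖ :=
          tsum_mul_left.symm
      _ ≤ _ := by
          apply Summable.tsum_le_tsum (fun i => hbd k l (e i) ξ) (h1.mul_left _)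
          exact (hc.mul_right _).comp_injective he
  let g : 𝓢(EuclideanSpace ℝ (Fin n), ℂ) :=
    { toFun := fun ξ => ∑' i, c i • G i ξ
      smooth' := contDiff_tsum hsm (fun l _ => hv l) hbd0
      decay' := fun k l => ⟨∑' i, ‖c i‖ * B k l, fun ξ => htail id Function.injective_id k l ξ⟩ }
  have hsum : ∀ ξ, Summable fun i => c i • G i ξ := fun ξ =>
    Summable.of_norm_bounded (hv 0) fun i => by simpa using hbd0 0 i ξ le_top
  refine ⟨g, ?_, fun ξ => (hsum ξ).hasSum⟩
  rw [HasSum, (schwartz_withSeminorms ℝ (EuclideanSpace ℝ (Fin n)) ℂ).tendsto_nhds]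
  intro kl ε hε
  have h0 := tendsto_tsum_compl_atTop_zero (fun i => ‖c i‖ * B kl.1 kl.2)
  filter_upwards [h0.eventually (gt_mem_nhds hε)] with s hs
  refine lt_of_le_of_lt ?_ hs
  apply SchwartzMap.seminorm_le_bound ℝ kl.1 kl.2
  · exact tsum_nonneg fun i => mul_nonneg (norm_nonneg _) (hB0 _ _)
  intro ξ
  have hcoe : ⇑(∑ i ∈ s, c i • G i - g) =
      -(fun ξ => ∑' i : {i // i ∉ s}, c i • G i ξ) := by
    ext ξ
    have h2 := (hsum ξ).sum_add_tsum_subtype_compl s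
    have h3 : g ξ = ∑' i, c i • G i ξ := rfl
    rw [sub_apply, sum_apply, h3, ← h2]
    simp
  rw [hcoe, iteratedFDeriv_neg_apply, norm_neg]
  exact htail (fun i : {i // i ∉ s} => (i : ℕ)) Subtype.val_injective kl.1 kl.2 ξ

lemma exists_norm_clm_le {G : ℕ → 𝓢(EuclideanSpace ℝ (Fin n), ℂ)}
    (hG : ∀ k l : ℕ, ∃ B : ℝ, ∀ i ξ, ‖ξ‖ ^ k * ‖iteratedFDeriv ℝ l (G i) ξ‖ ≤ B)
    (Λ : 𝓢(EuclideanSpace ℝ (Fin n), ℂ) →L[ℂ] ℂ) : ∃ B : ℝ, ∀ i, ‖Λ (G i)‖ ≤ B := by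
  choose B hB using hG
  obtain ⟨s, C, -, h⟩ := Seminorm.bound_of_continuous
    (schwartz_withSeminorms ℂ (EuclideanSpace ℝ (Fin n)) ℂ)
    ((normSeminorm ℂ ℂ).comp Λ.toLinearMap) (by exact continuous_norm.comp Λ.continuous)
  refine ⟨C * ∑ j ∈ s, |B j.1 j.2|, fun i => ?_⟩
  refine (h (G i)).trans ?_
  rw [smul_apply, NNReal.smul_def, smul_eq_mul]
  gcongr
  refine Seminorm.finset_sup_apply_le (by positivity) fun j hj => ?_
  refine (SchwartzMap.seminorm_le_bound ℂ j.1 j.2 (G i) (abs_nonneg _) fun ξ =>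
    (hB j.1 j.2 i ξ).trans (le_abs_self _)).trans ?_
  exact Finset.single_le_sum (f := fun j : ℕ × ℕ => |B j.1 j.2|) (fun _ _ => abs_nonneg _) hj

/-- Uniform boundedness for families of sequences, tested against `ℓ¹`. -/
theorem exists_forall_norm_le_of_summable {ι : Type*} {lam : ι → ℕ → ℂ}
    (hb : ∀ i, ∃ B : ℝ, ∀ k, ‖lam i k‖ ≤ B)
    (h : ∀ c : ℕ → ℂ, (Summable fun k => ‖c k‖) → ∃ C : ℝ, ∀ i, ‖∑' k, c k * lam i k‖ ≤ C) :
    ∃ C : ℝ, ∀ i k, ‖lam i k‖ ≤ C := by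
  choose B hB using hb
  have hB0 : ∀ i, 0 ≤ B i := fun i => (norm_nonneg _).trans (hB i 0)
  have hnorm : ∀ c : lp (fun _ : ℕ => ℂ) 1, Summable (fun k => ‖c k‖) ∧ ‖c‖ = ∑' k, ‖c k‖ := by
    intro c
    have h1 := (lp.memℓp c).summable (by simp)
    have h2 := lp.norm_eq_tsum_rpow (by simp) c
    simp only [ENNReal.toReal_one, Real.rpow_one, div_one] at h1 h2
    exact ⟨h1, h2⟩
  have hs : ∀ i (c : lp (fun _ : ℕ => ℂ) 1), Summable fun k => ‖c k * lam i k‖ := by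
    intro i c
    refine Summable.of_nonneg_of_le (fun _ => norm_nonneg _) (fun k => ?_) ((hnorm c).1.mul_right (B i))
    rw [norm_mul]; gcongr; exact hB i k
  -- The functionals are moved to ℓ¹, a Banach space, where the uniform boundedness principle
  -- applies; evaluation at unit vectors returns the scalars.
  let g : ι → lp (fun _ : ℕ => ℂ) 1 →L[ℂ] ℂ := fun i => LinearMap.mkContinuous
    { toFun := fun c => ∑' k, c k * lam i k
      map_add' := fun c d => by
        rw [← (hs i c).of_norm.tsum_add (hs i d).of_norm]
        congr 1; ext k; rw [lp.coeFn_add, Pi.add_apply, add_mul]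
      map_smul' := fun a c => by
        rw [RingHom.id_apply, smul_eq_mul, ← tsum_mul_left]
        congr 1; ext k; rw [lp.coeFn_smul, Pi.smul_apply, smul_eq_mul, mul_assoc] } (B i) (fun c => by
      change ‖∑' k, c k * lam i k‖ ≤ _
      refine (norm_tsum_le_tsum_norm (hs i c)).trans ?_
      rw [(hnorm c).2, ← tsum_mul_left]
      refine Summable.tsum_le_tsum (fun k => ?_) (hs i c) ((hnorm c).1.mul_left _)
      rw [norm_mul, mul_comm]; gcongr; exact hB i k)
  obtain ⟨C, hC⟩ := banach_steinhaus (g := g) fun c => h c (hnorm c).1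
  refine ⟨C, fun i k => ?_⟩
  have h1 := (g i).le_of_opNorm_le (hC i) (lp.single 1 k (1 : ℂ))
  rw [lp.norm_single (by simp)] at h1
  have h2 : g i (lp.single 1 k (1 : ℂ)) = lam i k := by
    change ∑' j, (lp.single 1 k (1 : ℂ) : ℕ → ℂ) j * lam i j = _
    rw [tsum_eq_single k]
    · simp
    · intro j hj; simp [lp.single_apply, hj]
  rw [h2] at h1; simpa using h1

/-- The weight √k! is a compromise: it dominates every geometric sequence, yet the series of t^k/k!
· √k! still converges for every t. -/
lemma pow_le_mul_sqrt_factorial (D : ℝ) (k : ℕ) :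
    D ^ k ≤ √(Real.exp (D ^ 2)) * √(k.factorial) := by
  rw [← Real.sqrt_mul (Real.exp_nonneg _)]
  apply Real.le_sqrt_of_sq_le
  have := Real.pow_div_factorial_le_exp (D ^ 2) (by positivity) k
  rw [div_le_iff₀ (by positivity)] at this
  calc (D ^ k) ^ 2 = (D ^ 2) ^ k := by rw [← pow_mul, ← pow_mul, mul_comm]
    _ ≤ _ := this

lemma summable_pow_mul_sqrt_factorial (t : ℝ) (ht : 0 ≤ t) :
    Summable fun k : ℕ => t ^ k / k.factorial * √(k.factorial) := by
  refine Summable.of_nonneg_of_le (fun k => by positivity) (fun k => ?_)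
    ((summable_geometric_two).mul_left (√(Real.exp ((2 * t) ^ 2))))
  have h := pow_le_mul_sqrt_factorial (2 * t) k
  have hk : 0 < √(k.factorial : ℝ) := Real.sqrt_pos.2 (by positivity)
  have e : (k.factorial : ℝ) = √(k.factorial : ℝ) * √(k.factorial : ℝ) :=
    (Real.mul_self_sqrt (by positivity)).symm
  rw [mul_pow] at h
  have h2 : t ^ k / k.factorial * √(k.factorial) = t ^ k / √(k.factorial) := by
    conv_lhs => rw [e]
    field_simp
    rw [Real.sq_sqrt (by positivity)]
  rw [h2, div_le_iff₀ hk, one_div, inv_pow]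
  have h3 : (0 : ℝ) < 2 ^ k := by positivity
  rw [mul_assoc, mul_comm _ (√(k.factorial : ℝ)), ← mul_assoc, ← div_eq_mul_inv, le_div_iff₀ h3]
  linarith

/-- Taylor series for a chain of derivatives of moderate growth. -/
theorem hasSum_taylor_of_hasDerivWithinAt {J : ℕ → ℝ → ℂ} {T C : ℝ} (hT : 0 ≤ T)
    (hJ : ∀ k, ∀ t, 0 ≤ t → HasDerivWithinAt (J k) (J (k + 1) t) (Ici 0) t)
    (hC : ∀ k, ∀ t ∈ Icc 0 T, ‖J k t‖ ≤ C * √(k.factorial)) :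
    HasSum (fun k : ℕ => ((T ^ k / k.factorial : ℝ) : ℂ) * J k 0) (J 0 T) := by
  have hC0 : 0 ≤ C := by
    have h1 := (norm_nonneg _).trans (hC 0 0 ⟨le_rfl, hT⟩)
    simpa using h1
  -- Induction on the length m for all k at once: differentiating the remainder of J k of length m +
  -- 1 gives the remainder of J (k+1) of length m.
  have hrem : ∀ m k, ∀ t ∈ Icc 0 T,
      ‖J k t - ∑ i ∈ Finset.range m, ((t ^ i / i.factorial : ℝ) : ℂ) * J (k + i) 0‖ ≤
        C * √((k + m).factorial) * (t ^ m / m.factorial) := by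
    intro m
    induction m with
    | zero => intro k t ht; simpa using hC k t ht
    | succ m ih =>
      intro k t ht
      have hpoly : ∀ t : ℝ, HasDerivAt (fun t : ℝ => ∑ i ∈ Finset.range (m + 1),
          ((t ^ i / i.factorial : ℝ) : ℂ) * J (k + i) 0)
          (∑ i ∈ Finset.range m, ((t ^ i / i.factorial : ℝ) : ℂ) * J (k + 1 + i) 0) t := by
        intro t
        have h1 : ∀ i : ℕ, HasDerivAt (fun t : ℝ => ((t ^ (i + 1) / (i + 1).factorial : ℝ) : ℂ))
            ((t ^ i / i.factorial : ℝ) : ℂ) t := by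
          intro i
          apply HasDerivAt.ofReal_comp
          refine ((hasDerivAt_pow (i + 1) t).div_const _).congr_deriv ?_
          rw [Nat.factorial_succ]
          push_cast
          field_simp
        have h2 : HasDerivAt (fun t : ℝ => ∑ i ∈ Finset.range m,
            ((t ^ (i + 1) / (i + 1).factorial : ℝ) : ℂ) * J (k + (i + 1)) 0)
            (∑ i ∈ Finset.range m, ((t ^ i / i.factorial : ℝ) : ℂ) * J (k + (i + 1)) 0) t :=
          HasDerivAt.fun_sum fun i _ => (h1 i).mul_const _
        have h3 := h2.add_const (J k 0)
        refine (h3.congr_of_eventuallyEq (Filter.Eventually.of_forall fun t => ?_)).congr_deriv ?_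
        · simp [Finset.sum_range_succ']
        · refine Finset.sum_congr rfl fun i _ => ?_
          rw [show k + (i + 1) = k + 1 + i by ring]
      have hB : ∀ x : ℝ, HasDerivAt (fun x => C * √((k + (m + 1)).factorial) *
          (x ^ (m + 1) / (m + 1).factorial)) (C * √((k + (m + 1)).factorial) * (x ^ m / m.factorial)) x := by
        intro x
        refine (((hasDerivAt_pow (m + 1) x).div_const _).const_mul _).congr_deriv ?_
        rw [Nat.factorial_succ m]
        push_cast
        field_simp
      refine image_norm_le_of_norm_deriv_right_le_deriv_boundary (a := 0) (b := T)
        (f := fun t => J k t - ∑ i ∈ Finset.range (m + 1), ((t ^ i / i.factorial : ℝ) : ℂ) * J (k + i) 0)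
        (f' := fun t => J (k + 1) t - ∑ i ∈ Finset.range m, ((t ^ i / i.factorial : ℝ) : ℂ) *
          J (k + 1 + i) 0) ?_ ?_ ?_ hB ?_ ht
      · intro t ht
        exact (((hJ k t ht.1).sub (hpoly t).hasDerivWithinAt).continuousWithinAt).mono Icc_subset_Ici_self
      · intro t ht
        exact ((hJ k t ht.1).sub (hpoly t).hasDerivWithinAt).mono (Ici_subset_Ici.2 ht.1)
      · simp [Finset.sum_range_succ']
      · intro t ht
        have := ih (k + 1) t ⟨ht.1, ht.2.le⟩
        rwa [show k + 1 + m = k + (m + 1) by ring] at this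
  have hsum : Summable fun k : ℕ => T ^ k / k.factorial * √(k.factorial) :=
    summable_pow_mul_sqrt_factorial T hT
  have hs : Summable fun k : ℕ => ((T ^ k / k.factorial : ℝ) : ℂ) * J k 0 := by
    refine Summable.of_norm_bounded (hsum.mul_left C) fun k => ?_
    rw [norm_mul, Complex.norm_real, Real.norm_of_nonneg (by positivity)]
    calc T ^ k / k.factorial * ‖J k 0‖ ≤ T ^ k / k.factorial * (C * √(k.factorial)) := by
          gcongr; exact hC k 0 ⟨le_rfl, hT⟩
      _ = _ := by ring
  rw [hs.hasSum_iff_tendsto_nat, tendsto_iff_norm_sub_tendsto_zero]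
  have h0 := (hsum.mul_left C).tendsto_atTop_zero
  refine squeeze_zero (fun _ => norm_nonneg _) (fun m => ?_) h0
  have := hrem m 0 T ⟨hT, le_rfl⟩
  simp only [zero_add] at this
  rw [norm_sub_rev]
  exact this.trans_eq (by ring)

lemma InSomeLp.exists_clm {f : EuclideanSpace ℝ (Fin n) → ℂ} (hf : InSomeLp f) :
    ∃ Λ : 𝓢(EuclideanSpace ℝ (Fin n), ℂ) →L[ℂ] ℂ, ∀ φ, Λ φ = ∫ x, f x * φ x := by
  obtain ⟨s, hs, hf⟩ := hf
  have : Fact (1 ≤ s) := ⟨hs⟩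
  have hc := ENNReal.HolderConjugate.inv_one_sub_inv' hs
  have : Fact (1 ≤ (1 - s⁻¹)⁻¹) := ⟨by simp⟩
  refine ⟨((ContinuousLinearMap.lsmul ℂ ℂ).flip.lpPairing volume s (1 - s⁻¹)⁻¹ (hf.toLp f)) ∘L
    SchwartzMap.toLpCLM ℂ ℂ (1 - s⁻¹)⁻¹ volume, fun φ => ?_⟩
  rw [ContinuousLinearMap.comp_apply, SchwartzMap.toLpCLM_apply, ContinuousLinearMap.lpPairing_eq_integral]
  apply integral_congr_ae
  filter_upwards [φ.coeFn_toLp (1 - s⁻¹)⁻¹ volume, hf.coeFn_toLp] with x h1 h2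
  rw [h1, h2]
  simp [mul_comm]

end SchwartzSeries

end

/-! ### The dual evolution on an annulus -/

noncomputable section

section Annular

variable {n : ℕ}

/-- Iterates of `(x, y) ↦ (-Q y, x - A y)`. -/
def stateIter (A Q : ℂ) (v : ℂ × ℂ) : ℕ → ℂ × ℂ
  | 0 => v
  | k + 1 => (-(Q * (stateIter A Q v k).2), (stateIter A Q v k).1 - A * (stateIter A Q v k).2)

lemma norm_stateIter_le (A Q : ℂ) (v : ℂ × ℂ) (k : ℕ) :
    ‖(stateIter A Q v k).1‖ + ‖(stateIter A Q v k).2‖ ≤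
      (1 + ‖A‖ + ‖Q‖) ^ k * (‖v.1‖ + ‖v.2‖) := by
  induction k with
  | zero => simp [stateIter]
  | succ k ih =>
    set x := (stateIter A Q v k).1
    set y := (stateIter A Q v k).2
    have h1 : ‖x - A * y‖ ≤ ‖x‖ + ‖A‖ * ‖y‖ := (norm_sub_le _ _).trans_eq (by rw [norm_mul])
    have h2 : ‖-(Q * y)‖ = ‖Q‖ * ‖y‖ := by rw [norm_neg, norm_mul]
    calc ‖-(Q * y)‖ + ‖x - A * y‖ ≤ (1 + ‖A‖ + ‖Q‖) * (‖x‖ + ‖y‖) := by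
          nlinarith [norm_nonneg A, norm_nonneg Q, norm_nonneg x, norm_nonneg y,
            mul_nonneg (norm_nonneg A) (norm_nonneg x), mul_nonneg (norm_nonneg Q) (norm_nonneg x)]
      _ ≤ (1 + ‖A‖ + ‖Q‖) * ((1 + ‖A‖ + ‖Q‖) ^ k * (‖v.1‖ + ‖v.2‖)) := by gcongr
      _ = _ := by ring

/-- The iteration is the transpose of the ODE as a first-order system, so for a solution p the
quantity p x_k + p' y_k has derivative p x_{k+1} + p' y_{k+1}. The sum is thus the Taylor series of
p v₁ + p' v₂ at 0. -/
lemma hasSum_stateIter_of_ode {A Q : ℂ} {p p' : ℝ → ℂ} (hp : ∀ t, HasDerivAt p (p' t) t)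
    (hp' : ∀ t, HasDerivAt p' (-(Q * p t) - A * p' t) t) (v : ℂ × ℂ) {t : ℝ} (ht : 0 ≤ t) :
    HasSum (fun k : ℕ => ((t ^ k / k.factorial : ℝ) : ℂ) *
      (p 0 * (stateIter A Q v k).1 + p' 0 * (stateIter A Q v k).2)) (p t * v.1 + p' t * v.2) := by
  have hpc : Continuous p := continuous_iff_continuousAt.2 fun t => (hp t).continuousAt
  have hpc' : Continuous p' := continuous_iff_continuousAt.2 fun t => (hp' t).continuousAt
  obtain ⟨M, hM⟩ := isCompact_Icc.exists_bound_of_continuousOn (s := Icc 0 t)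
    (hpc.norm.add hpc'.norm).continuousOn
  refine hasSum_taylor_of_hasDerivWithinAt (J := fun k t =>
    p t * (stateIter A Q v k).1 + p' t * (stateIter A Q v k).2)
    (C := M * ((‖v.1‖ + ‖v.2‖) * √(Real.exp ((1 + ‖A‖ + ‖Q‖) ^ 2)))) ht ?_ ?_
  · intro k t _
    refine (((hp t).mul_const _).add ((hp' t).mul_const _)).hasDerivWithinAt.congr_deriv ?_
    simp only [stateIter]; ring
  · intro k s hs
    have h1 := hM s hs
    have hpos : 0 ≤ ‖p s‖ + ‖p' s‖ := by positivity
    rw [Pi.add_apply, Real.norm_of_nonneg hpos] at h1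
    have hM0 : 0 ≤ M := hpos.trans h1
    set x := (stateIter A Q v k).1 with hx
    set y := (stateIter A Q v k).2 with hy
    calc ‖p s * x + p' s * y‖ ≤ ‖p s‖ * ‖x‖ + ‖p' s‖ * ‖y‖ := by
          refine (norm_add_le _ _).trans ?_; rw [norm_mul, norm_mul]
      _ ≤ M * ‖x‖ + M * ‖y‖ := by
          gcongr
          · linarith [norm_nonneg (p' s)]
          · linarith [norm_nonneg (p s)]
      _ = M * (‖x‖ + ‖y‖) := by ring
      _ ≤ M * ((1 + ‖A‖ + ‖Q‖) ^ k * (‖v.1‖ + ‖v.2‖)) := by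
          gcongr; exact norm_stateIter_le A Q v k
      _ ≤ M * (√(Real.exp ((1 + ‖A‖ + ‖Q‖) ^ 2)) * √(k.factorial) * (‖v.1‖ + ‖v.2‖)) := by
          gcongr; exact pow_le_mul_sqrt_factorial _ k
      _ = _ := by ring

/-- The initial values (1, 0) of `cosProp` and (0, 1) of t `meanProp` single out the two components.
-/
lemma hasSum_stateIter (A Q : ℂ) (v : ℂ × ℂ) {t : ℝ} (ht : 0 ≤ t) :
    HasSum (fun k : ℕ => ((t ^ k / k.factorial : ℝ) : ℂ) * (stateIter A Q v k).1)
      (cosProp t A Q * v.1 - Q * (t * meanProp t A Q) * v.2) ∧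
    HasSum (fun k : ℕ => ((t ^ k / k.factorial : ℝ) : ℂ) * (stateIter A Q v k).2)
      (t * meanProp t A Q * v.1 + (cosProp t A Q - A * (t * meanProp t A Q)) * v.2) := by
  constructor
  · have := hasSum_stateIter_of_ode (A := A) (Q := Q) (hasDerivAt_cosProp A Q)
      (fun t => ((hasDerivAt_t_mul_meanProp A Q t).const_mul Q).fun_neg.congr_deriv (by ring)) v ht
    simpa [sub_eq_add_neg] using this
  · have := hasSum_stateIter_of_ode (A := A) (Q := Q) (hasDerivAt_t_mul_meanProp A Q)
      (fun t => ((hasDerivAt_cosProp A Q t).sub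
        ((hasDerivAt_t_mul_meanProp A Q t).const_mul A)).congr_deriv (by ring)) v ht
    simpa using this

lemma exists_bound_iteratedFDeriv {f : EuclideanSpace ℝ (Fin n) → ℂ} (hc : HasCompactSupport f)
    (hf : ContDiff ℝ ((⊤ : ℕ∞) : WithTop ℕ∞) f) (l : ℕ) :
    ∃ b : ℝ, ∀ j ≤ l, ∀ ξ, ‖iteratedFDeriv ℝ j f ξ‖ ≤ b := by
  choose B hB using fun j => (hc.toSchwartzMap hf).decay' 0 j
  refine ⟨∑ j ∈ Finset.range (l + 1), |B j|, fun j hj ξ => ?_⟩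
  have h1 : ‖iteratedFDeriv ℝ j f ξ‖ ≤ B j := by
    have := hB j ξ
    rw [pow_zero, one_mul] at this
    exact this
  refine h1.trans ((le_abs_self _).trans ?_)
  exact Finset.single_le_sum (f := fun j => |B j|) (fun _ _ => abs_nonneg _)
    (Finset.mem_range.2 (Nat.lt_succ_iff.2 hj))

lemma norm_iteratedFDeriv_mul_le_of_bound {f g : EuclideanSpace ℝ (Fin n) → ℂ}
    (hf : ContDiff ℝ ((⊤ : ℕ∞) : WithTop ℕ∞) f) (hg : ContDiff ℝ ((⊤ : ℕ∞) : WithTop ℕ∞) g) {l : ℕ}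
    {b d : ℝ} (hb : ∀ j ≤ l, ∀ ξ, ‖iteratedFDeriv ℝ j f ξ‖ ≤ b)
    (hd : ∀ j ≤ l, ∀ ξ, ‖iteratedFDeriv ℝ j g ξ‖ ≤ d) :
    ∀ j ≤ l, ∀ ξ, ‖iteratedFDeriv ℝ j (fun ξ => f ξ * g ξ) ξ‖ ≤ 2 ^ l * b * d := by
  intro j hj ξ
  have hb0 : 0 ≤ b := (norm_nonneg _).trans (hb 0 (Nat.zero_le _) ξ)
  have hd0 : 0 ≤ d := (norm_nonneg _).trans (hd 0 (Nat.zero_le _) ξ)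
  refine (norm_iteratedFDeriv_mul_le hf hg ξ (n := j) (by exact_mod_cast le_top)).trans ?_
  calc _ ≤ ∑ i ∈ Finset.range (j + 1), (j.choose i : ℝ) * b * d := by
        refine Finset.sum_le_sum fun i hi => ?_
        have hij : i ≤ j := Nat.lt_succ_iff.1 (Finset.mem_range.1 hi)
        gcongr
        · exact hb i (hij.trans hj) ξ
        · exact hd (j - i) ((Nat.sub_le _ _).trans hj) ξ
    _ = 2 ^ j * b * d := by
        rw [← Finset.sum_mul, ← Finset.sum_mul]
        congr 2
        exact_mod_cast Nat.sum_range_choose j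
    _ ≤ _ := by gcongr; norm_num

/-- Derivative bounds, exponential in `k`, for an iteration of multiplication operators. -/
lemma exists_pow_bound_iteratedFDeriv {A Q : EuclideanSpace ℝ (Fin n) → ℂ}
    {X Y : ℕ → EuclideanSpace ℝ (Fin n) → ℂ}
    (hA : ContDiff ℝ ((⊤ : ℕ∞) : WithTop ℕ∞) A) (hQ : ContDiff ℝ ((⊤ : ℕ∞) : WithTop ℕ∞) Q)
    (hAc : HasCompactSupport A) (hQc : HasCompactSupport Q)
    (hX : ∀ k, ContDiff ℝ ((⊤ : ℕ∞) : WithTop ℕ∞) (X k))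
    (hY : ∀ k, ContDiff ℝ ((⊤ : ℕ∞) : WithTop ℕ∞) (Y k))
    (hXc : HasCompactSupport (X 0)) (hYc : HasCompactSupport (Y 0))
    (hXs : ∀ k ξ, X (k + 1) ξ = -(Q ξ * Y k ξ)) (hYs : ∀ k ξ, Y (k + 1) ξ = X k ξ - A ξ * Y k ξ)
    (l : ℕ) : ∃ D : ℝ, ∀ k, ∀ j ≤ l, ∀ ξ,
      ‖iteratedFDeriv ℝ j (X k) ξ‖ ≤ D ^ (k + 1) ∧ ‖iteratedFDeriv ℝ j (Y k) ξ‖ ≤ D ^ (k + 1) := by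
  obtain ⟨a, ha⟩ := exists_bound_iteratedFDeriv hAc hA l
  obtain ⟨q, hq⟩ := exists_bound_iteratedFDeriv hQc hQ l
  obtain ⟨x, hx⟩ := exists_bound_iteratedFDeriv hXc (hX 0) l
  obtain ⟨y, hy⟩ := exists_bound_iteratedFDeriv hYc (hY 0) l
  have ha0 : 0 ≤ a := (norm_nonneg _).trans (ha 0 (Nat.zero_le _) 0)
  have hq0 : 0 ≤ q := (norm_nonneg _).trans (hq 0 (Nat.zero_le _) 0)
  have hx0 : 0 ≤ x := (norm_nonneg _).trans (hx 0 (Nat.zero_le _) 0)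
  have hy0 : 0 ≤ y := (norm_nonneg _).trans (hy 0 (Nat.zero_le _) 0)
  -- Chosen to bound both the initial functions and one step of the iteration, the factor 2^l coming
  -- from Leibniz's rule.
  set D := 1 + 2 ^ l * a + 2 ^ l * q + x + y with hD
  have h1 : 0 ≤ 2 ^ l * a := by positivity
  have h2 : 0 ≤ 2 ^ l * q := by positivity
  have hD0 : 0 ≤ D := by positivity
  refine ⟨D, fun k => ?_⟩
  induction k with
  | zero =>
    intro j hj ξ
    rw [zero_add, pow_one]
    exact ⟨(hx j hj ξ).trans (by rw [hD]; linarith), (hy j hj ξ).trans (by rw [hD]; linarith)⟩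
  | succ k ih =>
    have hDk : 0 ≤ D ^ (k + 1) := by positivity
    intro j hj ξ
    constructor
    · rw [show X (k + 1) = -(fun ξ => Q ξ * Y k ξ) by ext ξ; simp [hXs], iteratedFDeriv_neg_apply, norm_neg]
      refine (norm_iteratedFDeriv_mul_le_of_bound hQ (hY k) hq (fun j hj ξ => (ih j hj ξ).2) j hj ξ).trans ?_
      rw [pow_succ' D (k + 1)]
      gcongr
      rw [hD]; linarith
    · have e : Y (k + 1) = X k + -(fun ξ => A ξ * Y k ξ) := by
        ext ξ; simp [hYs, sub_eq_add_neg]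
      have hAY : ContDiff ℝ ((⊤ : ℕ∞) : WithTop ℕ∞) (fun ξ => A ξ * Y k ξ) := hA.mul (hY k)
      have hle : ((j : ℕ) : WithTop ℕ∞) ≤ ((⊤ : ℕ∞) : WithTop ℕ∞) := by exact_mod_cast le_top
      have hAYn : ContDiff ℝ ((⊤ : ℕ∞) : WithTop ℕ∞) (-(fun ξ => A ξ * Y k ξ)) := hAY.neg
      rw [e, iteratedFDeriv_add_apply ((hX k).of_le hle).contDiffAt (hAYn.of_le hle).contDiffAt,
        iteratedFDeriv_neg_apply]
      refine (norm_add_le _ _).trans ?_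
      rw [norm_neg]
      have h3 := (ih j hj ξ).1
      have h4 := norm_iteratedFDeriv_mul_le_of_bound hA (hY k) ha (fun j hj ξ => (ih j hj ξ).2) j hj ξ
      calc _ ≤ D ^ (k + 1) + 2 ^ l * a * D ^ (k + 1) := add_le_add h3 h4
        _ = (1 + 2 ^ l * a) * D ^ (k + 1) := by ring
        _ ≤ D * D ^ (k + 1) := by gcongr; rw [hD]; linarith
        _ = _ := (pow_succ' D (k + 1)).symm

/-- A compactly supported smooth function that agrees with `m` on the support of `annPiece _ r`. -/
def fatAnnPiece (m : EuclideanSpace ℝ (Fin n) → ℂ) (r : ℝ) (ξ : EuclideanSpace ℝ (Fin n)) : ℂ :=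
  annPiece m (r / 4) ξ + annPiece m (r / 2) ξ + annPiece m r ξ + annPiece m (2 * r) ξ

/-- The four neighbouring bumps telescope to 1 on the annulus. There the singular multipliers
|ξ|^{2σ} and |ξ|^{2δ} may hence be replaced by smooth compactly supported ones. -/
lemma fatAnnPiece_mul_annPiece (m y : EuclideanSpace ℝ (Fin n) → ℂ) {r : ℝ} (hr : 0 < r)
    (ξ : EuclideanSpace ℝ (Fin n)) :
    fatAnnPiece m r ξ * annPiece y r ξ = annPiece (fun ξ => m ξ * y ξ) r ξ := by
  by_cases h : ‖ξ‖ ≤ r⁻¹ ∨ 4 * r⁻¹ ≤ ‖ξ‖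
  · rw [annPiece_eq_zero hr h, annPiece_eq_zero hr h, mul_zero]
  · push Not at h
    have hs : annBump ((r / 4) • ξ) + annBump ((r / 2) • ξ) + annBump (r • ξ) + annBump ((2 * r) • ξ)
        = 1 := by
      have h1 : ballBump ((r / 8) • ξ) = 1 := by
        apply ballBump_eq_one
        rw [norm_smul, Real.norm_of_nonneg (by positivity)]
        calc r / 8 * ‖ξ‖ ≤ r / 8 * (4 * r⁻¹) := by gcongr; exact h.2.le
          _ = 1 / 2 := by field_simp; norm_num
          _ ≤ 1 := by norm_num
      have h2 : ballBump ((2 * r) • ξ) = 0 := by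
        apply ballBump_eq_zero
        rw [norm_smul, Real.norm_of_nonneg (by positivity)]
        calc 2 = 2 * r * r⁻¹ := by field_simp
          _ ≤ 2 * r * ‖ξ‖ := by gcongr; exact h.1.le
      simp only [annBump, smul_smul]
      rw [show 2⁻¹ * (r / 4) = r / 8 by ring, show 2⁻¹ * (r / 2) = r / 4 by ring,
        show 2⁻¹ * r = r / 2 by ring, show 2⁻¹ * (2 * r) = r by ring, h1, h2]
      ring
    have hs' : (annBump ((r / 4) • ξ) : ℂ) + annBump ((r / 2) • ξ) + annBump (r • ξ) +
        annBump ((2 * r) • ξ) = 1 := by exact_mod_cast hs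
    simp only [fatAnnPiece, annPiece]
    rw [← add_mul, ← add_mul, ← add_mul, hs']
    ring

lemma contDiff_fatAnnPiece {m : EuclideanSpace ℝ (Fin n) → ℂ} {r : ℝ} (hr : 0 < r)
    (hm : ∀ ξ ≠ 0, ContDiffAt ℝ ((⊤ : ℕ∞) : WithTop ℕ∞) m ξ) :
    ContDiff ℝ ((⊤ : ℕ∞) : WithTop ℕ∞) (fatAnnPiece m r) :=
  (((contDiff_annPiece (by positivity) hm).add (contDiff_annPiece (by positivity) hm)).add
    (contDiff_annPiece hr hm)).add (contDiff_annPiece (by positivity) hm)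

lemma hasCompactSupport_fatAnnPiece {m : EuclideanSpace ℝ (Fin n) → ℂ} {r : ℝ} (hr : 0 < r) :
    HasCompactSupport (fatAnnPiece m r) :=
  (((hasCompactSupport_annPiece (by positivity)).add (hasCompactSupport_annPiece (by positivity))).add
    (hasCompactSupport_annPiece hr)).add (hasCompactSupport_annPiece (by positivity))

end Annular

end

/-! ### Solutions tested on an annulus -/

noncomputable section

section AnnularRepresentation

variable {n : ℕ} {σ δ μ : ℝ}

/-- The symbol `μ|ξ|^{2δ}` of the damping, with the frequency variable `2πξ`. -/
def dampMul (δ μ : ℝ) (ξ : EuclideanSpace ℝ (Fin n)) : ℂ :=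
  ((μ * (2 * Real.pi * ‖ξ‖) ^ (2 * δ) : ℝ) : ℂ)

/-- The symbol `|ξ|^{2σ}`, with the frequency variable `2πξ`. -/
def waveMul (σ : ℝ) (ξ : EuclideanSpace ℝ (Fin n)) : ℂ :=
  (((2 * Real.pi * ‖ξ‖) ^ (2 * σ) : ℝ) : ℂ)

lemma contDiffAt_rpow_norm (a : ℝ) {ξ : EuclideanSpace ℝ (Fin n)} (hξ : ξ ≠ 0) :
    ContDiffAt ℝ ((⊤ : ℕ∞) : WithTop ℕ∞)
      (fun ξ : EuclideanSpace ℝ (Fin n) => (((2 * Real.pi * ‖ξ‖) ^ a : ℝ) : ℂ)) ξ := by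
  have h1 : ContDiffAt ℝ ((⊤ : ℕ∞) : WithTop ℕ∞)
      (fun ξ : EuclideanSpace ℝ (Fin n) => 2 * Real.pi * ‖ξ‖) ξ :=
    contDiffAt_const.mul (contDiffAt_norm ℝ hξ)
  have hpos : 0 < ‖ξ‖ := norm_pos_iff.2 hξ
  have h2 := h1.rpow_const_of_ne (p := a) (by positivity)
  exact Complex.ofRealCLM.contDiff.contDiffAt.comp ξ h2

lemma contDiffAt_waveMul (σ : ℝ) {ξ : EuclideanSpace ℝ (Fin n)} (hξ : ξ ≠ 0) :
    ContDiffAt ℝ ((⊤ : ℕ∞) : WithTop ℕ∞) (waveMul (n := n) σ) ξ := contDiffAt_rpow_norm _ hξ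

lemma contDiffAt_dampMul (δ μ : ℝ) {ξ : EuclideanSpace ℝ (Fin n)} (hξ : ξ ≠ 0) :
    ContDiffAt ℝ ((⊤ : ℕ∞) : WithTop ℕ∞) (dampMul (n := n) δ μ) ξ := by
  have := (contDiffAt_const (c := (μ : ℂ))).mul (contDiffAt_rpow_norm (2 * δ) hξ)
  refine this.congr_of_eventuallyEq (Filter.Eventually.of_forall fun ξ => ?_)
  simp [dampMul]

lemma contDiffAt_stateIter {A Q x y : EuclideanSpace ℝ (Fin n) → ℂ} {ξ : EuclideanSpace ℝ (Fin n)}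
    {N : WithTop ℕ∞} (hA : ContDiffAt ℝ N A ξ) (hQ : ContDiffAt ℝ N Q ξ) (hx : ContDiffAt ℝ N x ξ)
    (hy : ContDiffAt ℝ N y ξ) (k : ℕ) :
    ContDiffAt ℝ N (fun ξ => (stateIter (A ξ) (Q ξ) (x ξ, y ξ) k).1) ξ ∧
    ContDiffAt ℝ N (fun ξ => (stateIter (A ξ) (Q ξ) (x ξ, y ξ) k).2) ξ := by
  induction k with
  | zero => exact ⟨hx, hy⟩
  | succ k ih => exact ⟨(hQ.mul ih.2).neg, ih.1.sub (hA.mul ih.2)⟩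

lemma absD_fourierInv (a : ℝ) (g : 𝓢(EuclideanSpace ℝ (Fin n), ℂ)) :
    absD a (𝓕⁻ g) = 𝓕⁻ (fun ξ : EuclideanSpace ℝ (Fin n) =>
      (((2 * Real.pi * ‖ξ‖) ^ a : ℝ) : ℂ) * g ξ) := by
  have : 𝓕 (⇑(𝓕⁻ g : 𝓢(EuclideanSpace ℝ (Fin n), ℂ))) = ⇑g := by
    rw [← SchwartzMap.fourier_coe, FourierTransform.fourier_fourierInv_eq]
  simp only [absD, this]

/-- Pairing with the inverse Fourier transform of a Schwartz function. -/
lemma InSomeLp.exists_clm_fourierInv {f : EuclideanSpace ℝ (Fin n) → ℂ} (hf : InSomeLp f) :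
    ∃ Λ : 𝓢(EuclideanSpace ℝ (Fin n), ℂ) →L[ℂ] ℂ, ∀ g,
      Λ g = ∫ x, f x * 𝓕⁻ (g : EuclideanSpace ℝ (Fin n) → ℂ) x := by
  obtain ⟨Λ, hΛ⟩ := hf.exists_clm
  refine ⟨Λ ∘L FourierTransform.fourierInvCLM ℂ 𝓢(EuclideanSpace ℝ (Fin n), ℂ), fun g => ?_⟩
  rw [ContinuousLinearMap.comp_apply, FourierTransform.fourierInvCLM_apply, hΛ, SchwartzMap.fourierInv_coe]

/-- Local uniform boundedness in time of a weakly continuous family on a bounded sequence of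
Schwartz functions. -/
lemma exists_forall_norm_pairing_le {v : ℝ → EuclideanSpace ℝ (Fin n) → ℂ} {T : ℝ}
    {Λ : ℝ → 𝓢(EuclideanSpace ℝ (Fin n), ℂ) →L[ℂ] ℂ}
    (hΛ : ∀ t, 0 ≤ t → ∀ g, Λ t g = ∫ x, v t x * 𝓕⁻ (g : EuclideanSpace ℝ (Fin n) → ℂ) x)
    (hcont : ∀ φ : 𝓢(EuclideanSpace ℝ (Fin n), ℂ),
      ContinuousOn (fun t => ∫ x, v t x * φ x) (Ici 0))
    {G : ℕ → 𝓢(EuclideanSpace ℝ (Fin n), ℂ)}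
    (hG : ∀ k l : ℕ, ∃ B : ℝ, ∀ i ξ, ‖ξ‖ ^ k * ‖iteratedFDeriv ℝ l (G i) ξ‖ ≤ B) :
    ∃ C : ℝ, ∀ k, ∀ t ∈ Icc 0 T, ‖Λ t (G k)‖ ≤ C := by
  obtain ⟨C, hC⟩ := exists_forall_norm_le_of_summable
    (lam := fun (t : Icc (0 : ℝ) T) k => Λ t (G k)) (fun t => exists_norm_clm_le hG (Λ t)) (by
      intro c hc
      obtain ⟨g, hg, -⟩ := exists_hasSum_smul_schwartz hG hc
      obtain ⟨C, hC⟩ := isCompact_Icc.exists_bound_of_continuousOn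
        ((hcont (𝓕⁻ g)).mono (t := Icc 0 T) Icc_subset_Ici_self)
      refine ⟨C, fun t => ?_⟩
      have h1 := (hg.mapL (Λ t)).tsum_eq
      simp only [map_smul, smul_eq_mul] at h1
      rw [h1, hΛ t t.2.1, ← SchwartzMap.fourierInv_coe]
      exact hC t t.2)
  exact ⟨C, fun k t ht => hC ⟨t, ht⟩ k⟩

/-- The representation of a solution on frequencies in an annulus. -/
theorem annular_representation {u₀ u₁ : EuclideanSpace ℝ (Fin n) → ℂ}
    {u ut : ℝ → EuclideanSpace ℝ (Fin n) → ℂ} (hsol : IsSolution σ δ μ u₀ u₁ u ut) {T : ℝ}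
    (hT : 0 ≤ T) {m₁ m₂ : EuclideanSpace ℝ (Fin n) → ℂ}
    (hm₁ : ∀ ξ ≠ 0, ContDiffAt ℝ ((⊤ : ℕ∞) : WithTop ℕ∞) m₁ ξ)
    (hm₂ : ∀ ξ ≠ 0, ContDiffAt ℝ ((⊤ : ℕ∞) : WithTop ℕ∞) m₂ ξ) {r : ℝ} (hr : 0 < r) :
    (∫ x, u T x * 𝓕⁻ (annPiece m₁ r) x) + ∫ x, ut T x * 𝓕⁻ (annPiece m₂ r) x =
    (∫ x, u₀ x * 𝓕⁻ (annPiece (fun ξ => cosProp T (dampMul δ μ ξ) (waveMul σ ξ) * m₁ ξ -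
      waveMul σ ξ * (T * meanProp T (dampMul δ μ ξ) (waveMul σ ξ)) * m₂ ξ) r) x) +
    ∫ x, u₁ x * 𝓕⁻ (annPiece (fun ξ => T * meanProp T (dampMul δ μ ξ) (waveMul σ ξ) * m₁ ξ +
      (cosProp T (dampMul δ μ ξ) (waveMul σ ξ) -
        dampMul δ μ ξ * (T * meanProp T (dampMul δ μ ξ) (waveMul σ ξ))) * m₂ ξ) r) x := by
  set x : ℕ → EuclideanSpace ℝ (Fin n) → ℂ := fun k ξ =>
    (stateIter (dampMul δ μ ξ) (waveMul σ ξ) (m₁ ξ, m₂ ξ) k).1 with hx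
  set y : ℕ → EuclideanSpace ℝ (Fin n) → ℂ := fun k ξ =>
    (stateIter (dampMul δ μ ξ) (waveMul σ ξ) (m₁ ξ, m₂ ξ) k).2 with hy
  have hsm : ∀ k, ∀ ξ ≠ 0, ContDiffAt ℝ ((⊤ : ℕ∞) : WithTop ℕ∞) (x k) ξ ∧
      ContDiffAt ℝ ((⊤ : ℕ∞) : WithTop ℕ∞) (y k) ξ := fun k ξ hξ =>
    contDiffAt_stateIter (contDiffAt_dampMul δ μ hξ) (contDiffAt_waveMul σ hξ) (hm₁ ξ hξ) (hm₂ ξ hξ) k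
  set X : ℕ → 𝓢(EuclideanSpace ℝ (Fin n), ℂ) := fun k =>
    annSchwartz (x k) r hr fun ξ hξ => (hsm k ξ hξ).1 with hX
  set Y : ℕ → 𝓢(EuclideanSpace ℝ (Fin n), ℂ) := fun k =>
    annSchwartz (y k) r hr fun ξ hξ => (hsm k ξ hξ).2 with hY
  have hXc : ∀ k, ⇑(X k) = annPiece (x k) r := fun k => rfl
  have hYc : ∀ k, ⇑(Y k) = annPiece (y k) r := fun k => rfl
  -- derivative bounds
  have hbd : ∀ l : ℕ, ∃ D : ℝ, ∀ k, ∀ j ≤ l, ∀ ξ,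
      ‖iteratedFDeriv ℝ j (X k) ξ‖ ≤ D ^ (k + 1) ∧ ‖iteratedFDeriv ℝ j (Y k) ξ‖ ≤ D ^ (k + 1) := by
    refine exists_pow_bound_iteratedFDeriv (A := fatAnnPiece (dampMul δ μ) r)
      (Q := fatAnnPiece (waveMul σ) r) (contDiff_fatAnnPiece hr fun ξ => contDiffAt_dampMul δ μ)
      (contDiff_fatAnnPiece hr fun ξ => contDiffAt_waveMul σ) (hasCompactSupport_fatAnnPiece hr)
      (hasCompactSupport_fatAnnPiece hr) (fun k => (X k).smooth') (fun k => (Y k).smooth')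
      (hasCompactSupport_annPiece hr) (hasCompactSupport_annPiece hr) ?_ ?_
    · intro k ξ
      rw [hXc, hYc, fatAnnPiece_mul_annPiece _ _ hr]
      simp only [annPiece, hx, hy, stateIter]; ring
    · intro k ξ
      rw [hXc, hYc, hYc, fatAnnPiece_mul_annPiece _ _ hr]
      simp only [annPiece, hx, hy, stateIter]; ring
  have hvanish : ∀ (m : EuclideanSpace ℝ (Fin n) → ℂ) (l : ℕ) (ξ), 4 * r⁻¹ < ‖ξ‖ →
      iteratedFDeriv ℝ l (annPiece m r) ξ = 0 := by
    intro m l ξ hξ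
    by_contra hcon
    have h1 := support_iteratedFDeriv_subset (𝕜 := ℝ) (f := annPiece m r) l (Function.mem_support.2 hcon)
    exact absurd (tsupport_annPiece_subset hr h1).2 (not_le.2 hξ)
  -- Division by √i! makes the iterates a bounded family in the Schwartz space: derivatives grow at
  -- most geometrically, and the supports lie in a fixed ball.
  have hpb : ∀ (m : ℕ → EuclideanSpace ℝ (Fin n) → ℂ) (Z : ℕ → 𝓢(EuclideanSpace ℝ (Fin n), ℂ)),
      (∀ k, ⇑(Z k) = annPiece (m k) r) →
      (∀ l : ℕ, ∃ D : ℝ, ∀ k, ∀ ξ, ‖iteratedFDeriv ℝ l (Z k) ξ‖ ≤ D ^ (k + 1)) →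
      ∀ k l : ℕ, ∃ B : ℝ, ∀ i ξ,
        ‖ξ‖ ^ k * ‖iteratedFDeriv ℝ l (((√(i.factorial) : ℝ) : ℂ)⁻¹ • Z i) ξ‖ ≤ B := by
    intro m Z hZ hD k l
    obtain ⟨D, hD⟩ := hD l
    have hD0 : 0 ≤ D := by simpa using (norm_nonneg _).trans (hD 0 0)
    refine ⟨(4 * r⁻¹) ^ k * (D * √(Real.exp (D ^ 2))), fun i ξ => ?_⟩
    have hi : 0 < √(i.factorial : ℝ) := Real.sqrt_pos.2 (by positivity)
    have e : iteratedFDeriv ℝ l (⇑(((√(i.factorial) : ℝ) : ℂ)⁻¹ • Z i)) ξ =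
        ((√(i.factorial) : ℝ) : ℂ)⁻¹ • iteratedFDeriv ℝ l (Z i) ξ := by
      rw [show ⇑(((√(i.factorial) : ℝ) : ℂ)⁻¹ • Z i) = fun ξ => ((√(i.factorial) : ℝ) : ℂ)⁻¹ • Z i ξ
        from rfl]
      exact iteratedFDeriv_const_smul_apply' (((Z i).smooth l).contDiffAt)
    rw [e, norm_smul, norm_inv, Complex.norm_real, Real.norm_of_nonneg hi.le]
    by_cases hξ : 4 * r⁻¹ < ‖ξ‖
    · rw [hZ, hvanish _ _ _ hξ, norm_zero, mul_zero, mul_zero]; positivity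
    · rw [not_lt] at hξ
      have h1 : (√(i.factorial : ℝ))⁻¹ * ‖iteratedFDeriv ℝ l (Z i) ξ‖ ≤ D * √(Real.exp (D ^ 2)) := by
        rw [inv_mul_le_iff₀ hi]
        refine (hD i ξ).trans ?_
        have := pow_le_mul_sqrt_factorial D i
        calc D ^ (i + 1) = D * D ^ i := pow_succ' D i
          _ ≤ D * (√(Real.exp (D ^ 2)) * √(i.factorial)) := by gcongr
          _ = _ := by ring
      gcongr
  have hGX := hpb x X hXc fun l => by
    obtain ⟨D, hD⟩ := hbd l; exact ⟨D, fun k ξ => (hD k l le_rfl ξ).1⟩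
  have hGY := hpb y Y hYc fun l => by
    obtain ⟨D, hD⟩ := hbd l; exact ⟨D, fun k ξ => (hD k l le_rfl ξ).2⟩
  -- functionals
  have hex : ∀ t, ∃ Λ : 𝓢(EuclideanSpace ℝ (Fin n), ℂ) →L[ℂ] ℂ, 0 ≤ t → ∀ g,
      Λ g = ∫ x, u t x * 𝓕⁻ (g : EuclideanSpace ℝ (Fin n) → ℂ) x := by
    intro t
    by_cases ht : 0 ≤ t
    · obtain ⟨Λ, hΛ⟩ := (hsol.inLp t ht).exists_clm_fourierInv; exact ⟨Λ, fun _ => hΛ⟩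
    · exact ⟨0, fun h => absurd h ht⟩
  have hex' : ∀ t, ∃ Λ : 𝓢(EuclideanSpace ℝ (Fin n), ℂ) →L[ℂ] ℂ, 0 ≤ t → ∀ g,
      Λ g = ∫ x, ut t x * 𝓕⁻ (g : EuclideanSpace ℝ (Fin n) → ℂ) x := by
    intro t
    by_cases ht : 0 ≤ t
    · obtain ⟨Λ, hΛ⟩ := (hsol.inLp_deriv t ht).exists_clm_fourierInv; exact ⟨Λ, fun _ => hΛ⟩
    · exact ⟨0, fun h => absurd h ht⟩
  choose Λ hΛ using hex
  choose M hM using hex'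
  obtain ⟨C₁, hC₁⟩ := exists_forall_norm_pairing_le (T := T) hΛ
    (fun φ t ht => (hsol.hasDeriv φ t ht).continuousWithinAt) hGX
  obtain ⟨C₂, hC₂⟩ := exists_forall_norm_pairing_le (T := T) hM
    (fun φ t ht => (hsol.equation φ t ht).continuousWithinAt) hGY
  have hscale : ∀ (L : 𝓢(EuclideanSpace ℝ (Fin n), ℂ) →L[ℂ] ℂ) (k : ℕ) (Z : 𝓢(EuclideanSpace ℝ (Fin n), ℂ)),
      L Z = ((√(k.factorial) : ℝ) : ℂ) * L (((√(k.factorial) : ℝ) : ℂ)⁻¹ • Z) := by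
    intro L k Z
    have hk : ((√(k.factorial : ℝ) : ℝ) : ℂ) ≠ 0 := by
      rw [Complex.ofReal_ne_zero]; exact (Real.sqrt_pos.2 (by positivity)).ne'
    rw [map_smul, smul_eq_mul, mul_inv_cancel_left₀ hk]
  -- The pairing of (u, u_t) with the k-th iterate has the pairing with the next iterate as its time
  -- derivative; this is the equation. The growth condition comes from uniform boundedness on [0,
  -- T].
  have htaylor := hasSum_taylor_of_hasDerivWithinAt (J := fun k t => Λ t (X k) + M t (Y k))
    (C := C₁ + C₂) hT ?_ ?_
  rotate_left
  · intro k t ht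
    set W : 𝓢(EuclideanSpace ℝ (Fin n), ℂ) := annSchwartz (fun ξ => waveMul σ ξ * y k ξ) r hr
      (fun ξ hξ => (contDiffAt_waveMul σ hξ).mul (hsm k ξ hξ).2) with hW
    set V : 𝓢(EuclideanSpace ℝ (Fin n), ℂ) := annSchwartz (fun ξ => dampMul δ μ ξ * y k ξ) r hr
      (fun ξ hξ => (contDiffAt_dampMul δ μ hξ).mul (hsm k ξ hξ).2) with hV
    have e1 : X (k + 1) = -W := by
      ext ξ
      change annPiece (x (k + 1)) r ξ = -annPiece _ r ξ
      simp only [annPiece, hx, hy, stateIter]; ring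
    have e2 : Y (k + 1) = X k - V := by
      ext ξ
      change annPiece (y (k + 1)) r ξ = annPiece _ r ξ - annPiece _ r ξ
      simp only [annPiece, hx, hy, stateIter]; ring
    have e3 : absD (2 * σ) (𝓕⁻ (Y k)) = 𝓕⁻ (W : EuclideanSpace ℝ (Fin n) → ℂ) := by
      rw [absD_fourierInv]
      congr 1; ext ξ
      rw [hYc, hW, coe_annSchwartz]
      simp only [annPiece, waveMul]; ring
    have e4 : ∀ z, (μ : ℂ) * absD (2 * δ) (𝓕⁻ (Y k)) z = 𝓕⁻ (V : EuclideanSpace ℝ (Fin n) → ℂ) z := by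
      intro z
      rw [absD_fourierInv, Real.fourierInv_eq, Real.fourierInv_eq, ← integral_const_mul]
      congr 1; ext ξ
      have : V ξ = (μ : ℂ) * ((((2 * Real.pi * ‖ξ‖) ^ (2 * δ) : ℝ) : ℂ) * Y k ξ) := by
        rw [hYc, hV, coe_annSchwartz]
        simp only [annPiece, dampMul]; push_cast; ring
      rw [this, mul_smul_comm]
    have h1 := (hsol.hasDeriv (𝓕⁻ (X k)) t ht).add (hsol.equation (𝓕⁻ (Y k)) t ht)
    have h2 : HasDerivWithinAt (fun t => Λ t (X k) + M t (Y k)) _ (Ici 0) t :=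
      h1.congr (fun s hs => by
        rw [hΛ s hs, hM s hs, ← SchwartzMap.fourierInv_coe, ← SchwartzMap.fourierInv_coe]; rfl)
        (by rw [hΛ t ht, hM t ht, ← SchwartzMap.fourierInv_coe, ← SchwartzMap.fourierInv_coe]; rfl)
    refine h2.congr_deriv ?_
    rw [e1, e2, map_neg, map_sub, hΛ t ht, hM t ht, hM t ht, e3, ← integral_const_mul,
      SchwartzMap.fourierInv_coe]
    have e5 : ∫ z, (μ : ℂ) * (ut t z * absD (2 * δ) (𝓕⁻ (Y k)) z) = ∫ z, ut t z * 𝓕⁻ (V : EuclideanSpace ℝ (Fin n) → ℂ) z := by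
      congr 1; ext z; rw [← e4 z]; ring
    rw [e5]; ring
  · intro k t ht
    rw [hscale (Λ t) k (X k), hscale (M t) k (Y k), ← mul_add, norm_mul, Complex.norm_real,
      Real.norm_of_nonneg (Real.sqrt_nonneg _), mul_comm]
    gcongr
    exact (norm_add_le _ _).trans (add_le_add (hC₁ k t ht) (hC₂ k t ht))
  -- the series on the side of the data
  set c : ℕ → ℂ := fun k => ((T ^ k / k.factorial * √(k.factorial) : ℝ) : ℂ) with hc
  have hcs : Summable fun k => ‖c k‖ := by
    refine (summable_pow_mul_sqrt_factorial T hT).congr fun k => ?_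
    rw [hc, Complex.norm_real, Real.norm_of_nonneg (by positivity)]
  have hcZ : ∀ (k : ℕ) (a : ℂ), c k • (((√(k.factorial) : ℝ) : ℂ)⁻¹ • a) =
      ((T ^ k / k.factorial : ℝ) : ℂ) * a := by
    intro k a
    have hk : ((√(k.factorial : ℝ) : ℝ) : ℂ) ≠ 0 := by
      rw [Complex.ofReal_ne_zero]; exact (Real.sqrt_pos.2 (by positivity)).ne'
    rw [hc]
    simp only [Complex.ofReal_mul, smul_eq_mul]
    rw [mul_assoc, mul_inv_cancel_left₀ hk]
  obtain ⟨gX, hgX, hgXp⟩ := exists_hasSum_smul_schwartz hGX hcs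
  obtain ⟨gY, hgY, hgYp⟩ := exists_hasSum_smul_schwartz hGY hcs
  have hsum : HasSum (fun k : ℕ => ((T ^ k / k.factorial : ℝ) : ℂ) * (Λ 0 (X k) + M 0 (Y k)))
      (Λ 0 gX + M 0 gY) := by
    have h1 := (hgX.mapL (Λ 0)).add (hgY.mapL (M 0))
    refine h1.congr_fun fun k => ?_
    simp only [map_smul]
    rw [hcZ, hcZ]; ring
  have hfin := htaylor.unique hsum
  have hgXe : ⇑gX = annPiece (fun ξ => cosProp T (dampMul δ μ ξ) (waveMul σ ξ) * m₁ ξ -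
      waveMul σ ξ * (T * meanProp T (dampMul δ μ ξ) (waveMul σ ξ)) * m₂ ξ) r := by
    ext ξ
    refine (hgXp ξ).unique ?_
    have h1 := ((hasSum_stateIter (dampMul δ μ ξ) (waveMul σ ξ) (m₁ ξ, m₂ ξ) hT).1).mul_left
      (annBump (r • ξ) : ℂ)
    refine h1.congr_fun fun k => ?_
    rw [smul_apply, hcZ]
    change _ * annPiece (x k) r ξ = _
    simp only [annPiece, hx]; ring
  have hgYe : ⇑gY = annPiece (fun ξ => T * meanProp T (dampMul δ μ ξ) (waveMul σ ξ) * m₁ ξ +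
      (cosProp T (dampMul δ μ ξ) (waveMul σ ξ) -
        dampMul δ μ ξ * (T * meanProp T (dampMul δ μ ξ) (waveMul σ ξ))) * m₂ ξ) r := by
    ext ξ
    refine (hgYp ξ).unique ?_
    have h1 := ((hasSum_stateIter (dampMul δ μ ξ) (waveMul σ ξ) (m₁ ξ, m₂ ξ) hT).2).mul_left
      (annBump (r • ξ) : ℂ)
    refine h1.congr_fun fun k => ?_
    rw [smul_apply, hcZ]
    change _ * annPiece (y k) r ξ = _
    simp only [annPiece, hy]; ring
  rw [hΛ T hT, hM T hT, hΛ 0 le_rfl, hM 0 le_rfl, hgXe, hgYe] at hfin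
  rw [show annPiece m₁ r = X 0 from rfl, show annPiece m₂ r = Y 0 from rfl, hfin]
  congr 1
  · refine integral_congr_ae ?_
    filter_upwards [hsol.initial] with z hz
    rw [hz]
  · refine integral_congr_ae ?_
    filter_upwards [hsol.initial_deriv] with z hz
    rw [hz]

end AnnularRepresentation

end

/-! ### Summation of the annular formula over dyadic scales -/

noncomputable section

section DyadicPairing

variable {n : ℕ}

/-- A function in some `L^s` can be paired with every bounded integrable function. -/
lemma InSomeLp.exists_integral_mul_le {w : EuclideanSpace ℝ (Fin n) → ℂ} (hw : InSomeLp w) :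
    ∃ K : ℝ, 0 ≤ K ∧ ∀ (h : EuclideanSpace ℝ (Fin n) → ℂ) (B : ℝ), Integrable h → (∀ x, ‖h x‖ ≤ B) →
      Integrable (fun x => w x * h x) ∧ ∫ x, ‖w x * h x‖ ≤ K * (∫ x, ‖h x‖) + K * B := by
  obtain ⟨s, hs, hw⟩ := hw
  rcases eq_or_ne s ∞ with rfl | hs'
  · set M := (eLpNormEssSup w volume).toReal with hM
    have hle : ∀ᵐ x, ‖w x‖ ≤ M := by
      have hfin : eLpNormEssSup w volume < ∞ := by simpa using hw.eLpNorm_lt_top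
      filter_upwards [ae_le_eLpNormEssSup (f := w) (μ := volume)] with x hx
      have := ENNReal.toReal_mono hfin.ne hx
      simpa using this
    refine ⟨M, ENNReal.toReal_nonneg, fun h B hh hB => ?_⟩
    have hI : Integrable (fun x => w x * h x) := hh.bdd_mul hw.aestronglyMeasurable hle
    refine ⟨hI, ?_⟩
    have hB0 : 0 ≤ B := (norm_nonneg _).trans (hB 0)
    have hM0 : 0 ≤ M := ENNReal.toReal_nonneg
    calc ∫ x, ‖w x * h x‖ ≤ ∫ x, M * ‖h x‖ := by
          refine integral_mono_ae hI.norm (hh.norm.const_mul _) ?_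
          filter_upwards [hle] with x hx
          simp only [norm_mul]
          gcongr
      _ = M * ∫ x, ‖h x‖ := integral_const_mul _ _
      _ ≤ _ := by linarith [mul_nonneg hM0 hB0]
  · have hs0 : s ≠ 0 := (zero_lt_one.trans_le hs).ne'
    have hs1 : 1 ≤ s.toReal := by
      have := ENNReal.toReal_mono hs' hs
      simpa using this
    have hint := hw.integrable_norm_rpow hs0 hs'
    set K := ∫ x, ‖w x‖ ^ s.toReal with hK
    have hK0 : 0 ≤ K := integral_nonneg fun x => by positivity
    refine ⟨K + 1, by positivity, fun h B hh hB => ?_⟩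
    have hB0 : 0 ≤ B := (norm_nonneg _).trans (hB 0)
    -- Either |w| ≤ 1 or |w| ≤ |w|^s, so a bounded integrable function can be paired without
    -- Hölder's inequality.
    have hpt : ∀ x, ‖w x * h x‖ ≤ ‖h x‖ + ‖w x‖ ^ s.toReal * B := by
      intro x
      rw [norm_mul]
      rcases le_total ‖w x‖ 1 with h1 | h1
      · have : ‖w x‖ * ‖h x‖ ≤ 1 * ‖h x‖ := by gcongr
        have : 0 ≤ ‖w x‖ ^ s.toReal * B := by positivity
        linarith
      · have h2 : ‖w x‖ ≤ ‖w x‖ ^ s.toReal := by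
          simpa using Real.rpow_le_rpow_of_exponent_le h1 hs1
        have : ‖w x‖ * ‖h x‖ ≤ ‖w x‖ ^ s.toReal * B := by gcongr; exact hB x
        linarith [norm_nonneg (h x)]
    have hdom := hh.norm.add (hint.mul_const B)
    have hI : Integrable (fun x => w x * h x) :=
      hdom.mono' (hw.aestronglyMeasurable.mul hh.aestronglyMeasurable)
        (Filter.Eventually.of_forall hpt)
    refine ⟨hI, ?_⟩
    have hh0 : 0 ≤ ∫ x, ‖h x‖ := integral_nonneg fun x => norm_nonneg _
    calc ∫ x, ‖w x * h x‖ ≤ ∫ x, (‖h x‖ + ‖w x‖ ^ s.toReal * B) :=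
          integral_mono hI.norm hdom hpt
      _ = (∫ x, ‖h x‖) + K * B := by
          rw [integral_add hh.norm (hint.mul_const B), integral_mul_const]
      _ ≤ _ := by nlinarith

lemma norm_fourierInv_le (m : EuclideanSpace ℝ (Fin n) → ℂ) (x : EuclideanSpace ℝ (Fin n)) :
    ‖𝓕⁻ m x‖ ≤ ∫ ξ, ‖m ξ‖ := by
  rw [Real.fourierInv_eq]
  refine (norm_integral_le_integral_norm _).trans_eq ?_
  simp only [Circle.norm_smul]

lemma integrable_fourierInv_integrand {m : EuclideanSpace ℝ (Fin n) → ℂ} (hm : Integrable m)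
    (x : EuclideanSpace ℝ (Fin n)) :
    Integrable (fun ξ => Real.fourierChar (inner ℝ ξ x) • m ξ) := by
  have h : Continuous fun ξ : EuclideanSpace ℝ (Fin n) => Real.fourierChar (inner ℝ ξ x) := by
    fun_prop
  refine ⟨h.aestronglyMeasurable.smul hm.aestronglyMeasurable, ?_⟩
  refine hm.hasFiniteIntegral.congr' (Filter.Eventually.of_forall fun ξ => ?_)
  rw [Circle.norm_smul]

lemma fourierInv_fun_add {m₁ m₂ : EuclideanSpace ℝ (Fin n) → ℂ} (h₁ : Integrable m₁)
    (h₂ : Integrable m₂) (x : EuclideanSpace ℝ (Fin n)) :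
    𝓕⁻ (fun ξ => m₁ ξ + m₂ ξ) x = 𝓕⁻ m₁ x + 𝓕⁻ m₂ x := by
  simp only [Real.fourierInv_eq, smul_add]
  exact integral_add (integrable_fourierInv_integrand h₁ x) (integrable_fourierInv_integrand h₂ x)

lemma fourierInv_const_mul (c : ℂ) (m : EuclideanSpace ℝ (Fin n) → ℂ)
    (x : EuclideanSpace ℝ (Fin n)) : 𝓕⁻ (fun ξ => c * m ξ) x = c * 𝓕⁻ m x := by
  simp only [Real.fourierInv_eq, Circle.smul_def, smul_eq_mul, ← integral_const_mul]
  congr 1; ext ξ; ring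

/-- Integrable symbols, smooth off the origin, whose dyadic pieces have kernels with `L¹` norms
summing up to at most `D`. -/
structure SummableSym (m : EuclideanSpace ℝ (Fin n) → ℂ) (D : ℝ) : Prop where
  smooth : ∀ ξ ≠ 0, ContDiffAt ℝ ((⊤ : ℕ∞) : WithTop ℕ∞) m ξ
  integrable : Integrable m
  summable : Summable (fun j : ℤ => ∫ x, ‖𝓕⁻ (annPiece m (1 * 2 ^ (-j))) x‖)
  tsum_le : ∑' j : ℤ, ∫ x, ‖𝓕⁻ (annPiece m (1 * 2 ^ (-j))) x‖ ≤ D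

namespace SummableSym

variable {m m₁ m₂ : EuclideanSpace ℝ (Fin n) → ℂ} {D D₁ D₂ : ℝ}

lemma integrable_fourierInv_annPiece (hm : SummableSym m D) (j : ℤ) :
    Integrable (𝓕⁻ (annPiece m (1 * 2 ^ (-j)))) := by
  have := (𝓕⁻ (annSchwartz m (1 * 2 ^ (-j)) (by positivity) hm.smooth)).integrable (μ := volume)
  rwa [SchwartzMap.fourierInv_coe, coe_annSchwartz] at this

lemma integrable_annPiece (hm : SummableSym m D) (j : ℤ) :
    Integrable (annPiece m (1 * 2 ^ (-j))) := by
  have := (annSchwartz m (1 * 2 ^ (-j)) (by positivity) hm.smooth).integrable (μ := volume)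
  rwa [coe_annSchwartz] at this

lemma integral_fourierInv_le (hn : 1 ≤ n) (hm : SummableSym m D) :
    Integrable (𝓕⁻ m) ∧ ∫ x, ‖𝓕⁻ m x‖ ≤ D := by
  have := integral_fourierInv_le_tsum one_pos hm.smooth hn hm.integrable hm.summable
  exact ⟨this.1, this.2.trans hm.tsum_le⟩

lemma add (h₁ : SummableSym m₁ D₁) (h₂ : SummableSym m₂ D₂) :
    SummableSym (fun ξ => m₁ ξ + m₂ ξ) (D₁ + D₂) := by
  have hle : ∀ j : ℤ, ∫ x, ‖𝓕⁻ (annPiece (fun ξ => m₁ ξ + m₂ ξ) (1 * 2 ^ (-j))) x‖ ≤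
      (∫ x, ‖𝓕⁻ (annPiece m₁ (1 * 2 ^ (-j))) x‖) + ∫ x, ‖𝓕⁻ (annPiece m₂ (1 * 2 ^ (-j))) x‖ := by
    intro j
    have e : ∀ x, 𝓕⁻ (annPiece (fun ξ => m₁ ξ + m₂ ξ) (1 * 2 ^ (-j))) x =
        𝓕⁻ (annPiece m₁ (1 * 2 ^ (-j))) x + 𝓕⁻ (annPiece m₂ (1 * 2 ^ (-j))) x := by
      intro x
      rw [← fourierInv_fun_add (h₁.integrable_annPiece j) (h₂.integrable_annPiece j)]
      refine congrArg (fun f : EuclideanSpace ℝ (Fin n) → ℂ => 𝓕⁻ f x) (funext fun ξ => ?_)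
      simp only [annPiece]; ring
    have i₁ := h₁.integrable_fourierInv_annPiece j
    have i₂ := h₂.integrable_fourierInv_annPiece j
    simp only [e]
    rw [← integral_add i₁.norm i₂.norm]
    exact integral_mono (i₁.add i₂).norm (i₁.norm.add i₂.norm) fun x => norm_add_le _ _
  have hs := Summable.of_nonneg_of_le (fun j => integral_nonneg fun x => norm_nonneg _) hle
    (h₁.summable.add h₂.summable)
  refine ⟨fun ξ hξ => (h₁.smooth ξ hξ).add (h₂.smooth ξ hξ), h₁.integrable.add h₂.integrable, hs, ?_⟩
  refine (hs.tsum_le_tsum hle (h₁.summable.add h₂.summable)).trans ?_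
  rw [h₁.summable.tsum_add h₂.summable]
  exact add_le_add h₁.tsum_le h₂.tsum_le

lemma const_mul (hm : SummableSym m D) (c : ℂ) : SummableSym (fun ξ => c * m ξ) (‖c‖ * D) := by
  have e : ∀ j : ℤ, ∫ x, ‖𝓕⁻ (annPiece (fun ξ => c * m ξ) (1 * 2 ^ (-j))) x‖ =
      ‖c‖ * ∫ x, ‖𝓕⁻ (annPiece m (1 * 2 ^ (-j))) x‖ := by
    intro j
    rw [← integral_const_mul]
    congr 1; ext x
    rw [← norm_mul, ← fourierInv_const_mul]
    refine congrArg (fun f : EuclideanSpace ℝ (Fin n) → ℂ => ‖𝓕⁻ f x‖) (funext fun ξ => ?_)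
    simp only [annPiece]; ring
  refine ⟨fun ξ hξ => contDiffAt_const.mul (hm.smooth ξ hξ), hm.integrable.const_mul c, ?_, ?_⟩
  · simp only [e]; exact hm.summable.mul_left _
  · simp only [e, tsum_mul_left]
    exact mul_le_mul_of_nonneg_left hm.tsum_le (norm_nonneg _)

lemma mono (hm : SummableSym m D) {D' : ℝ} (h : D ≤ D') : SummableSym m D' :=
  ⟨hm.smooth, hm.integrable, hm.summable, hm.tsum_le.trans h⟩

lemma congr (hm : SummableSym m₁ D) (h : ∀ ξ, m₁ ξ = m₂ ξ) : SummableSym m₂ D := by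
  rwa [← funext h]

lemma summable_integral_annPiece (hn : 1 ≤ n) (hm : SummableSym m D) :
    Summable (fun j : ℤ => ∫ ξ, ‖annPiece m (1 * 2 ^ (-j)) ξ‖) := by
  refine summable_of_sum_le (c := ∫ ξ, ‖m ξ‖) (fun j => integral_nonneg fun ξ => norm_nonneg _)
    fun s => ?_
  rw [← integral_finsetSum s (f := fun (j : ℤ) ξ => ‖annPiece m (1 * 2 ^ (-j)) ξ‖)
    fun j _ => (hm.integrable_annPiece j).norm]
  refine integral_mono_ae (integrable_finsetSum _ fun j _ => (hm.integrable_annPiece j).norm)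
    hm.integrable.norm ?_
  filter_upwards [ae_ne_zero_euclideanSpace hn] with ξ hξ
  simp only [annPiece, norm_mul, Complex.norm_real, Real.norm_of_nonneg (annBump_nonneg _)]
  rw [← Finset.sum_mul]
  have := (hasSum_annBump one_pos hξ)
  have h1 := this.summable.sum_le_tsum s fun j _ => annBump_nonneg _
  rw [this.tsum_eq] at h1
  exact (mul_le_mul_of_nonneg_right h1 (norm_nonneg _)).trans_eq (one_mul _)

/-- Dyadic decomposition of a pairing. -/
lemma hasSum_integral_mul (hn : 1 ≤ n) (hm : SummableSym m D) {w : EuclideanSpace ℝ (Fin n) → ℂ}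
    (hw : InSomeLp w) :
    HasSum (fun j : ℤ => ∫ x, w x * 𝓕⁻ (annPiece m (1 * 2 ^ (-j))) x) (∫ x, w x * 𝓕⁻ m x) := by
  obtain ⟨K, hK, hp⟩ := hw.exists_integral_mul_le
  have hp' := fun j : ℤ => hp _ _ (hm.integrable_fourierInv_annPiece j)
    (norm_fourierInv_le (annPiece m (1 * 2 ^ (-j))))
  have hs : Summable fun j : ℤ => ∫ x, ‖w x * 𝓕⁻ (annPiece m (1 * 2 ^ (-j))) x‖ :=
    Summable.of_nonneg_of_le (fun j => integral_nonneg fun x => norm_nonneg _) (fun j => (hp' j).2)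
      ((hm.summable.mul_left K).add ((hm.summable_integral_annPiece hn).mul_left K))
  have h := hasSum_integral_of_summable_integral_norm (fun j => (hp' j).1) hs
  have e : ∀ x, ∑' j : ℤ, w x * 𝓕⁻ (annPiece m (1 * 2 ^ (-j))) x = w x * 𝓕⁻ m x := fun x =>
    ((hasSum_fourierInv_annPiece one_pos hm.smooth hn hm.integrable x).mul_left _).tsum_eq
  simpa only [e] using h

end SummableSym

/-- The solution formula, tested against summable symbols. -/
theorem summable_representation (hn : 1 ≤ n) {σ δ μ : ℝ} {u₀ u₁ : EuclideanSpace ℝ (Fin n) → ℂ}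
    (h₀ : InSomeLp u₀) (h₁ : InSomeLp u₁)
    {u ut : ℝ → EuclideanSpace ℝ (Fin n) → ℂ} (hsol : IsSolution σ δ μ u₀ u₁ u ut) {T : ℝ}
    (hT : 0 ≤ T) {m₁ m₂ : EuclideanSpace ℝ (Fin n) → ℂ} {D₁ D₂ D₃ D₄ : ℝ}
    (hm₁ : SummableSym m₁ D₁) (hm₂ : SummableSym m₂ D₂)
    (hM₀ : SummableSym (fun ξ => cosProp T (dampMul δ μ ξ) (waveMul σ ξ) * m₁ ξ -
      waveMul σ ξ * (T * meanProp T (dampMul δ μ ξ) (waveMul σ ξ)) * m₂ ξ) D₃)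
    (hM₁ : SummableSym (fun ξ => T * meanProp T (dampMul δ μ ξ) (waveMul σ ξ) * m₁ ξ +
      (cosProp T (dampMul δ μ ξ) (waveMul σ ξ) -
        dampMul δ μ ξ * (T * meanProp T (dampMul δ μ ξ) (waveMul σ ξ))) * m₂ ξ) D₄) :
    (∫ x, u T x * 𝓕⁻ m₁ x) + ∫ x, ut T x * 𝓕⁻ m₂ x =
    (∫ x, u₀ x * 𝓕⁻ (fun ξ => cosProp T (dampMul δ μ ξ) (waveMul σ ξ) * m₁ ξ -
      waveMul σ ξ * (T * meanProp T (dampMul δ μ ξ) (waveMul σ ξ)) * m₂ ξ) x) +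
    ∫ x, u₁ x * 𝓕⁻ (fun ξ => T * meanProp T (dampMul δ μ ξ) (waveMul σ ξ) * m₁ ξ +
      (cosProp T (dampMul δ μ ξ) (waveMul σ ξ) -
        dampMul δ μ ξ * (T * meanProp T (dampMul δ μ ξ) (waveMul σ ξ))) * m₂ ξ) x := by
  have hl := (hm₁.hasSum_integral_mul hn (hsol.inLp T hT)).add
    (hm₂.hasSum_integral_mul hn (hsol.inLp_deriv T hT))
  have hr := (hM₀.hasSum_integral_mul hn h₀).add (hM₁.hasSum_integral_mul hn h₁)
  refine hl.unique (hr.congr_fun fun j => ?_)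
  exact annular_representation hsol hT hm₁.smooth hm₂.smooth (by positivity)

end DyadicPairing

end

/-! ### Propagators times test functions are summable symbols -/

noncomputable section

section TestedSymbols

variable {n : ℕ} {σ δ μ : ℝ}

lemma contDiffAt_propSym {P : ℝ → ℂ → ℂ → ℂ} (hP : P ∈ ({meanProp, cosProp} : Set (ℝ → ℂ → ℂ → ℂ)))
    (σ δ μ a t : ℝ) {ξ : EuclideanSpace ℝ (Fin n)} (hξ : ξ ≠ 0) :
    ContDiffAt ℝ ((⊤ : ℕ∞) : WithTop ℕ∞) (propSym P σ δ μ a t) ξ :=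
  ((isRadialExt_prop hP σ δ μ t).rpow_mul a).contDiffAt hξ

lemma aestronglyMeasurable_propSym (hn : 1 ≤ n) {P : ℝ → ℂ → ℂ → ℂ}
    (hP : P ∈ ({meanProp, cosProp} : Set (ℝ → ℂ → ℂ → ℂ))) (σ δ μ a t : ℝ) :
    AEStronglyMeasurable (propSym (n := n) P σ δ μ a t) :=
  ((isRadialExt_prop hP σ δ μ t).rpow_mul a).aestronglyMeasurable hn

/-- On bounded time intervals the propagators, cut off by a Schwartz function, are dominated by an
integrable function. -/
lemma exists_norm_propSym_mul_le (hn : 1 ≤ n) (hσ : 0 < σ) (hμ : 0 < μ) (hδ : 0 < δ)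
    (hδσ : 2 * δ < σ) {a : ℝ} (ha : 0 ≤ a) {T : ℝ} (hT : 0 ≤ T)
    (g : 𝓢(EuclideanSpace ℝ (Fin n), ℂ)) :
    ∃ b : EuclideanSpace ℝ (Fin n) → ℝ, Integrable b ∧ ∀ s ∈ Icc 0 T,
      ∀ P ∈ ({meanProp, cosProp} : Set (ℝ → ℂ → ℂ → ℂ)),
      Integrable (fun ξ => propSym P σ δ μ a s ξ * g ξ) ∧
      ∀ ξ ≠ 0, ‖propSym P σ δ μ a s ξ * g ξ‖ ≤ b ξ := by
  obtain ⟨κ', hκ', -, c, hc, C₀, hC₀, hsym⟩ := small_time_symbol hσ hμ hδ hδσ T hT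
  obtain ⟨M, hM⟩ := exists_nat_ge (a + (n + 1))
  obtain ⟨G, hG, hg⟩ := exists_schwartz_line_decay g M
  set b : EuclideanSpace ℝ (Fin n) → ℝ :=
    fun ξ => (2 * Real.pi) ^ a * C₀ * G * (1 + ‖ξ‖) ^ (-((n : ℝ) + 1)) with hb
  have hbi : Integrable b := (integrable_one_add_norm (by simp)).const_mul _
  have hle : ∀ s ∈ Icc 0 T, ∀ P ∈ ({meanProp, cosProp} : Set (ℝ → ℂ → ℂ → ℂ)),
      ∀ ξ ≠ 0, ‖propSym P σ δ μ a s ξ * g ξ‖ ≤ b ξ := by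
    intro s hs P hP ξ hξ
    have hpos : 0 < ‖ξ‖ := norm_pos_iff.2 hξ
    set x := 2 * Real.pi * ‖ξ‖ with hx
    have hx0 : 0 < x := by positivity
    have h1 : ‖propSym P σ δ μ a s ξ‖ ≤ x ^ a * C₀ := by
      have hz : ‖(0 : ℂ)‖ ≤ κ' / (1 + s * x ^ σ) := by
        have := hs.1; rw [norm_zero]; positivity
      have h2 := (hsym s x 0 hs.1 hs.2 hx0 hz P hP).1
      rw [← (isRadialExt_prop hP σ δ μ s).apply_eq hx0] at h2
      rw [propSym, norm_mul, Complex.norm_real, Real.norm_of_nonneg (by positivity)]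
      refine mul_le_mul_of_nonneg_left (h2.trans ?_) (by positivity)
      have he : Real.exp (-(c * (s * x ^ (2 * δ)))) ≤ 1 := by
        have := hs.1
        exact Real.exp_le_one_iff.2 (neg_nonpos.2 (by positivity))
      nlinarith
    have h3 : ‖g ξ‖ ≤ G * (1 + ‖ξ‖) ^ (-(M : ℝ)) := by
      have := hg ⟨0, hn⟩ 0 (Nat.zero_le _) ξ
      simp only [iteratedDeriv_zero, zero_smul, add_zero] at this
      rw [Real.rpow_neg (by positivity), Real.rpow_natCast, ← div_eq_mul_inv,
        le_div_iff₀ (by positivity), mul_comm]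
      exact this
    rw [norm_mul]
    calc _ ≤ x ^ a * C₀ * (G * (1 + ‖ξ‖) ^ (-(M : ℝ))) := by gcongr
      _ ≤ ((2 * Real.pi) ^ a * (1 + ‖ξ‖) ^ a) * C₀ * (G * (1 + ‖ξ‖) ^ (-(a + ((n : ℝ) + 1)))) := by
          rw [hx, Real.mul_rpow (by positivity) hpos.le]
          gcongr <;> linarith
      _ = (2 * Real.pi) ^ a * C₀ * G * ((1 + ‖ξ‖) ^ a * (1 + ‖ξ‖) ^ (-(a + ((n : ℝ) + 1)))) := by ring
      _ = b ξ := by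
          rw [← Real.rpow_add (by positivity), hb]
          congr 2; ring
  refine ⟨b, hbi, fun s hs P hP => ⟨hbi.mono' ((aestronglyMeasurable_propSym hn hP σ δ μ a s).mul
    g.continuous.aestronglyMeasurable) ?_, hle s hs P hP⟩⟩
  filter_upwards [ae_ne_zero_euclideanSpace hn] with ξ hξ using hle s hs P hP ξ hξ

/-- Only finiteness, uniform on [0, T], is wanted, so the scale is 1: the factor |ξ|^a with a > 0
gives decay at low frequencies and the Schwartz function at high ones. For a = 0 the low-frequency
sum need not converge. -/
theorem exists_summableSym_prop (hn : 1 ≤ n) (hσ : 1 ≤ σ) (hμ : 0 < μ) (hδ : 0 < δ)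
    (hδσ : 2 * δ < σ) {a : ℝ} (ha : 0 < a) {T : ℝ} (hT : 0 ≤ T)
    (g : 𝓢(EuclideanSpace ℝ (Fin n), ℂ)) :
    ∃ D : ℝ, 0 ≤ D ∧ ∀ s ∈ Icc 0 T, ∀ P ∈ ({meanProp, cosProp} : Set (ℝ → ℂ → ℂ → ℂ)),
      SummableSym (fun ξ => propSym P σ δ μ a s ξ * g ξ) D := by
  have hσ0 : 0 < σ := by linarith
  obtain ⟨κ', hκ', hκ'2, c, hc, C₀, hC₀, hsym⟩ := small_time_symbol hσ0 hμ hδ hδσ T hT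
  obtain ⟨b, -, hb⟩ := exists_norm_propSym_mul_le hn hσ0 hμ hδ hδσ ha.le hT g
  obtain ⟨M, hM⟩ := exists_nat_ge (2 * a + σ * n / 2)
  obtain ⟨G, hG, hg⟩ := exists_schwartz_line_decay g M
  have hn1 : (1 : ℝ) ≤ n := by exact_mod_cast hn
  set c₀ : ℝ := 3 * n / κ' with hc₀
  have hc₀1 : 1 ≤ c₀ := by rw [hc₀, le_div_iff₀ hκ']; linarith
  obtain ⟨C₁, hC₁, hdy⟩ := exists_tsum_integral_annPiece_le (n := n) (c₀ := c₀) (κ := σ) (ε := a) hn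
    (by linarith) hσ0.le ha
  have hp1 : 1 ≤ 2 * Real.pi := by linarith [Real.pi_gt_three]
  set θ : ℝ := (T + 1) * (2 * Real.pi) ^ σ with hθ
  have hθ1 : 1 ≤ θ := one_le_mul_of_one_le_of_one_le (by linarith) (Real.one_le_rpow hp1 hσ0.le)
  have hθ0 : 0 < θ := by linarith
  set W : ℝ := (2 * Real.pi) ^ a * (1 + a / 2 * Real.exp (a / 2)) * C₀ with hW
  have hW0 : 0 < W := by positivity
  set A : ℝ := 2 ^ n * W * G * (2 * θ) ^ ((n : ℝ) / 2) with hA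
  have hA0 : 0 < A := by positivity
  refine ⟨C₁ * A, by positivity, fun s hs P hP => ?_⟩
  have hsm : ∀ ξ : EuclideanSpace ℝ (Fin n), ξ ≠ 0 → ContDiffAt ℝ ((⊤ : ℕ∞) : WithTop ℕ∞)
      (fun ξ => propSym P σ δ μ a s ξ * g ξ) ξ := fun ξ hξ =>
    (contDiffAt_propSym hP σ δ μ a s hξ).mul ((g.smooth ⊤).contDiffAt)
  have hsymb : IsDyadicSymbol c₀ σ a θ 1 A (fun ξ => propSym P σ δ μ a s ξ * g ξ) := by
    refine ⟨hsm, fun ξ hξ => ?_⟩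
    have hpos : 0 < ‖ξ‖ := norm_pos_iff.2 hξ
    set N := 1 + θ * ‖ξ‖ ^ σ with hN
    have hN1 : 1 ≤ N := by rw [hN]; linarith [show 0 ≤ θ * ‖ξ‖ ^ σ by positivity]
    have hN0 : 0 < N := by linarith
    -- Derivatives of g cost a constant, while the symbol class charges c₀N/|ξ|. The latter is at
    -- least 1 also for large |ξ| because σ ≥ 1.
    have hL1 : 1 ≤ c₀ * N / ‖ξ‖ := by
      rw [le_div_iff₀ hpos, one_mul]
      have h1 : ‖ξ‖ ≤ N := by
        rw [hN]
        rcases le_total ‖ξ‖ 1 with h | h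
        · linarith [show 0 ≤ θ * ‖ξ‖ ^ σ by positivity]
        · have h2 : ‖ξ‖ ≤ ‖ξ‖ ^ σ := by simpa using Real.rpow_le_rpow_of_exponent_le h hσ
          nlinarith
      nlinarith
    set x := 2 * Real.pi * ‖ξ‖ with hx
    have hx0 : 0 < x := by positivity
    have hext := (isRadialExt_prop hP σ δ μ s).rpow_mul a
    have hNs : 1 + s * x ^ σ ≤ N := by
      rw [hN, hx, hθ, Real.mul_rpow (by positivity) hpos.le, mul_assoc]
      gcongr; linarith [hs.2]
    have hs0 := hs.1
    have hl1 : LineBound (propSym P σ δ μ a s) ξ (W * ‖ξ‖ ^ a) (c₀ * N / ‖ξ‖) := by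
      have h1 := lineBound_of_holomorphic (m := propSym (n := n) P σ δ μ a s)
        (F := fun ρ => (((2 * Real.pi * ρ) ^ a : ℝ) : ℂ) * P s ((μ * (2 * Real.pi * ρ) ^ (2 * δ) : ℝ) : ℂ)
          (((2 * Real.pi * ρ) ^ (2 * σ) : ℝ) : ℂ)) (fun η => rfl) hξ (κ := κ' / N)
        (B := W * ‖ξ‖ ^ a) (by positivity) ((div_le_self hκ'.le hN1).trans hκ'2) (hext.diff x hx0)
        (fun z hz => by
          rw [← hext.eq x hx0 z hz, hx, mul_assoc (2 * Real.pi)]) (by positivity)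
        (fun z hz => by
          have hz2 : ‖z‖ ≤ 1 / 2 := hz.trans ((div_le_self hκ'.le hN1).trans hκ'2)
          have hz3 : ‖z‖ ≤ κ' / (1 + s * x ^ σ) := hz.trans (by gcongr)
          have h2 := (hsym s x z hs.1 hs.2 hx0 hz3 P hP).1
          have he : Real.exp (-(c * (s * x ^ (2 * δ)))) ≤ 1 :=
            Real.exp_le_one_iff.2 (neg_nonpos.2 (by positivity))
          have h3 := norm_one_add_cpow_le (α := a / 2) (by positivity) hz2
          rw [norm_mul, norm_mul, Complex.norm_real, Real.norm_of_nonneg (by positivity)]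
          calc _ ≤ x ^ a * (1 + a / 2 * Real.exp (a / 2)) * (C₀ * 1) := by
                refine mul_le_mul (by gcongr) (h2.trans (by gcongr)) (norm_nonneg _) (by positivity)
            _ = _ := by rw [hx, hW, Real.mul_rpow (by positivity) hpos.le]; ring)
      convert h1 using 1
      rw [hc₀]; field_simp
    have hl2 : LineBound (fun ξ => g ξ) ξ (G * (1 + ‖ξ‖) ^ (-(M : ℝ))) (c₀ * N / ‖ξ‖) := by
      intro i k hk
      have h1 := hg i k hk ξ
      rw [mul_comm, ← le_div_iff₀ (by positivity)] at h1
      rw [Real.rpow_neg (by positivity), Real.rpow_natCast, ← div_eq_mul_inv]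
      exact h1.trans (le_mul_of_one_le_right (by positivity) (one_le_pow₀ hL1))
    refine ⟨_, by positivity, hl1.mul hl2 ((contDiffAt_propSym hP σ δ μ a s hξ).of_le
      (by exact_mod_cast le_top)) ((g.smooth n).contDiffAt) (by positivity) (by positivity)
      (by positivity), ?_⟩
    have hNb := one_add_rpow_bound (n := n) (θ := θ) (κ := σ) (S := 2 * θ) (x := ‖ξ‖) (y := ‖ξ‖) hθ0.le hpos
      hpos (by positivity) (one_add_mul_rpow_le hθ1 hpos hσ0.le)
    have hmin := rpow_mul_one_add_rpow_le_min ha.le hpos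
    simp only [one_mul]
    calc 2 ^ n * (W * ‖ξ‖ ^ a) * (G * (1 + ‖ξ‖) ^ (-(M : ℝ))) * N ^ ((n : ℝ) / 2)
        ≤ 2 ^ n * (W * ‖ξ‖ ^ a) * (G * (1 + ‖ξ‖) ^ (-(2 * a + σ * n / 2))) *
          ((2 * θ) ^ ((n : ℝ) / 2) * (1 + ‖ξ‖) ^ (σ * n / 2)) := by
          refine mul_le_mul ?_ hNb (by positivity) (by positivity)
          gcongr; linarith
      _ = A * (‖ξ‖ ^ a * ((1 + ‖ξ‖) ^ (-(2 * a + σ * n / 2)) * (1 + ‖ξ‖) ^ (σ * n / 2))) := by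
          rw [hA]; ring
      _ = A * (‖ξ‖ ^ a * (1 + ‖ξ‖) ^ (-(2 * a))) := by
          rw [← Real.rpow_add (by positivity)]; congr 3; ring
      _ ≤ _ := by gcongr
  obtain ⟨h1, h2⟩ := hdy θ 1 A _ hθ0.le one_pos hA0 hsymb
  exact ⟨hsm, (hb s hs P hP).1, h1, h2⟩

end TestedSymbols

end

/-! ### The solution formula for positive powers of |D| -/

noncomputable section

section DataSymbols

variable {n : ℕ} {σ δ μ : ℝ}

/-- The symbol that carries `u₀` in `c₁ |D|^{a₁} u(s) + c₂ |D|^{a₂} u_t(s)`. -/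
def dataSym₀ (σ δ μ a₁ a₂ : ℝ) (c₁ c₂ : ℂ) (s : ℝ) (ξ : EuclideanSpace ℝ (Fin n)) : ℂ :=
  c₁ * propSym cosProp σ δ μ a₁ s ξ - c₂ * (s * propSym meanProp σ δ μ (a₂ + 2 * σ) s ξ)

/-- The symbol that carries `u₁` in `c₁ |D|^{a₁} u(s) + c₂ |D|^{a₂} u_t(s)`. -/
def dataSym₁ (σ δ μ a₁ a₂ : ℝ) (c₁ c₂ : ℂ) (s : ℝ) (ξ : EuclideanSpace ℝ (Fin n)) : ℂ :=
  c₁ * (s * propSym meanProp σ δ μ a₁ s ξ) + c₂ * (propSym cosProp σ δ μ a₂ s ξ -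
    μ * (s * propSym meanProp σ δ μ (a₂ + 2 * δ) s ξ))

lemma waveMul_mul_propSym (P : ℝ → ℂ → ℂ → ℂ) (hσ : 0 ≤ σ) {a : ℝ} (ha : 0 ≤ a) (s : ℝ)
    (ξ : EuclideanSpace ℝ (Fin n)) :
    waveMul σ ξ * propSym P σ δ μ a s ξ = propSym P σ δ μ (a + 2 * σ) s ξ := by
  simp only [propSym, waveMul]
  rw [Real.rpow_add_of_nonneg (by positivity) ha (by positivity)]
  push_cast; ring

lemma dampMul_mul_propSym (P : ℝ → ℂ → ℂ → ℂ) (hδ : 0 ≤ δ) {a : ℝ} (ha : 0 ≤ a) (s : ℝ)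
    (ξ : EuclideanSpace ℝ (Fin n)) :
    dampMul δ μ ξ * propSym P σ δ μ a s ξ = μ * propSym P σ δ μ (a + 2 * δ) s ξ := by
  simp only [propSym, dampMul]
  rw [Real.rpow_add_of_nonneg (by positivity) ha (by positivity)]
  push_cast; ring

lemma propSym_eq_rpow_mul (P : ℝ → ℂ → ℂ → ℂ) (σ δ μ a s : ℝ) (ξ : EuclideanSpace ℝ (Fin n)) :
    propSym P σ δ μ a s ξ = (((2 * Real.pi * ‖ξ‖) ^ a : ℝ) : ℂ) * P s (dampMul δ μ ξ) (waveMul σ ξ) :=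
  rfl

lemma exists_summableSym_dataSym (hn : 1 ≤ n) (hσ : 1 ≤ σ) (hμ : 0 < μ) (hδ : 0 < δ)
    (hδσ : 2 * δ < σ) {a₁ a₂ : ℝ} (ha₁ : 0 < a₁) (ha₂ : 0 < a₂) (c₁ c₂ : ℂ) {T : ℝ} (hT : 0 ≤ T)
    (g : 𝓢(EuclideanSpace ℝ (Fin n), ℂ)) :
    ∃ D : ℝ, 0 ≤ D ∧ ∀ s ∈ Icc 0 T, SummableSym (fun ξ => dataSym₀ σ δ μ a₁ a₂ c₁ c₂ s ξ * g ξ) D ∧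
      SummableSym (fun ξ => dataSym₁ σ δ μ a₁ a₂ c₁ c₂ s ξ * g ξ) D := by
  obtain ⟨D₁, hD₁, h₁⟩ := exists_summableSym_prop hn hσ hμ hδ hδσ ha₁ hT g
  obtain ⟨D₂, hD₂, h₂⟩ := exists_summableSym_prop hn hσ hμ hδ hδσ ha₂ hT g
  obtain ⟨D₃, hD₃, h₃⟩ := exists_summableSym_prop hn hσ hμ hδ hδσ (a := a₂ + 2 * σ) (by linarith) hT g
  obtain ⟨D₄, hD₄, h₄⟩ := exists_summableSym_prop hn hσ hμ hδ hδσ (a := a₂ + 2 * δ) (by linarith) hT g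
  refine ⟨(‖c₁‖ * D₁ + ‖c₂‖ * T * D₃) + (‖c₁‖ * T * D₁ + (‖c₂‖ * D₂ + ‖c₂‖ * μ * T * D₄)),
    by positivity, fun s hs => ?_⟩
  have hn' : ‖(s : ℂ)‖ ≤ T := by
    rw [Complex.norm_real, Real.norm_of_nonneg hs.1]; exact hs.2
  constructor
  · have := ((h₁ s hs cosProp (by simp)).const_mul c₁).add
      ((h₃ s hs meanProp (by simp)).const_mul (-(c₂ * s)))
    refine (this.congr fun ξ => ?_).mono ?_
    · simp only [dataSym₀]; ring
    · have h5 : ‖-(c₂ * s)‖ * D₃ ≤ ‖c₂‖ * T * D₃ := by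
        rw [norm_neg, norm_mul]; gcongr
      have : 0 ≤ ‖c₁‖ * T * D₁ + (‖c₂‖ * D₂ + ‖c₂‖ * μ * T * D₄) := by positivity
      linarith
  · have := ((h₁ s hs meanProp (by simp)).const_mul (c₁ * s)).add
      (((h₂ s hs cosProp (by simp)).const_mul c₂).add
        ((h₄ s hs meanProp (by simp)).const_mul (-(c₂ * μ * s))))
    refine (this.congr fun ξ => ?_).mono ?_
    · simp only [dataSym₁]; ring
    · have h5 : ‖-(c₂ * μ * s)‖ * D₄ ≤ ‖c₂‖ * μ * T * D₄ := by
        rw [norm_neg, norm_mul, norm_mul, Complex.norm_real μ, Real.norm_of_nonneg hμ.le]; gcongr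
      have h6 : ‖c₁ * s‖ * D₁ ≤ ‖c₁‖ * T * D₁ := by rw [norm_mul]; gcongr
      have : 0 ≤ ‖c₁‖ * D₁ + ‖c₂‖ * T * D₃ := by positivity
      linarith

/-- The solution formula for `c₁ |D|^{a₁} u(T) + c₂ |D|^{a₂} u_t(T)`, `a₁, a₂ > 0`. -/
theorem dataSym_representation (hn : 1 ≤ n) (hσ : 1 ≤ σ) (hμ : 0 < μ) (hδ : 0 < δ)
    (hδσ : 2 * δ < σ) {a₁ a₂ : ℝ} (ha₁ : 0 < a₁) (ha₂ : 0 < a₂) (c₁ c₂ : ℂ) {T : ℝ} (hT : 0 ≤ T)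
    {u₀ u₁ : EuclideanSpace ℝ (Fin n) → ℂ} (h₀ : InSomeLp u₀) (h₁ : InSomeLp u₁)
    {u ut : ℝ → EuclideanSpace ℝ (Fin n) → ℂ} (hsol : IsSolution σ δ μ u₀ u₁ u ut)
    (g : 𝓢(EuclideanSpace ℝ (Fin n), ℂ)) :
    c₁ * (∫ x, u T x * 𝓕⁻ (fun ξ : EuclideanSpace ℝ (Fin n) =>
      (((2 * Real.pi * ‖ξ‖) ^ a₁ : ℝ) : ℂ) * g ξ) x) +
    c₂ * (∫ x, ut T x * 𝓕⁻ (fun ξ : EuclideanSpace ℝ (Fin n) =>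
      (((2 * Real.pi * ‖ξ‖) ^ a₂ : ℝ) : ℂ) * g ξ) x) =
    (∫ x, u₀ x * 𝓕⁻ (fun ξ => dataSym₀ σ δ μ a₁ a₂ c₁ c₂ T ξ * g ξ) x) +
    ∫ x, u₁ x * 𝓕⁻ (fun ξ => dataSym₁ σ δ μ a₁ a₂ c₁ c₂ T ξ * g ξ) x := by
  obtain ⟨D₁, hD₁, hp₁⟩ := exists_summableSym_prop hn hσ hμ hδ hδσ ha₁ hT g
  obtain ⟨D₂, hD₂, hp₂⟩ := exists_summableSym_prop hn hσ hμ hδ hδσ ha₂ hT g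
  obtain ⟨D, hD, hd⟩ := exists_summableSym_dataSym hn hσ hμ hδ hδσ ha₁ ha₂ c₁ c₂ hT g
  -- At time 0 the propagator `meanProp` is 1, so c₁|ξ|^{a₁}g is itself one of the summable symbols;
  -- likewise for the second.
  have hm₁ := ((hp₁ 0 ⟨le_rfl, hT⟩ meanProp (by simp)).const_mul c₁)
  have hm₂ := ((hp₂ 0 ⟨le_rfl, hT⟩ meanProp (by simp)).const_mul c₂)
  have hσ0 : 0 ≤ σ := by linarith
  have e₀ : (fun ξ => dataSym₀ σ δ μ a₁ a₂ c₁ c₂ T ξ * g ξ) =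
      fun ξ => cosProp T (dampMul δ μ ξ) (waveMul σ ξ) * (c₁ * (propSym meanProp σ δ μ a₁ 0 ξ * g ξ)) -
      waveMul σ ξ * (T * meanProp T (dampMul δ μ ξ) (waveMul σ ξ)) *
        (c₂ * (propSym meanProp σ δ μ a₂ 0 ξ * g ξ)) := by
    funext ξ
    rw [dataSym₀, ← waveMul_mul_propSym _ hσ0 ha₂.le]
    simp only [propSym_eq_rpow_mul, meanProp_zero]
    ring
  have e₁ : (fun ξ => dataSym₁ σ δ μ a₁ a₂ c₁ c₂ T ξ * g ξ) =
      fun ξ => T * meanProp T (dampMul δ μ ξ) (waveMul σ ξ) *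
        (c₁ * (propSym meanProp σ δ μ a₁ 0 ξ * g ξ)) +
      (cosProp T (dampMul δ μ ξ) (waveMul σ ξ) -
        dampMul δ μ ξ * (T * meanProp T (dampMul δ μ ξ) (waveMul σ ξ))) *
        (c₂ * (propSym meanProp σ δ μ a₂ 0 ξ * g ξ)) := by
    funext ξ
    rw [dataSym₁, mul_left_comm (μ : ℂ), ← dampMul_mul_propSym _ hδ.le ha₂.le]
    simp only [propSym_eq_rpow_mul, meanProp_zero]
    ring
  have hM := hd T ⟨hT, le_rfl⟩
  rw [e₀, e₁] at hM ⊢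
  rw [← summable_representation hn h₀ h₁ hsol hT hm₁ hm₂ hM.1 hM.2]
  simp only [fourierInv_const_mul, mul_left_comm _ c₁, mul_left_comm _ c₂, integral_const_mul,
    propSym_eq_rpow_mul, meanProp_zero, mul_one]

lemma continuous_propSym {P : ℝ → ℂ → ℂ → ℂ} (hP : P ∈ ({meanProp, cosProp} : Set (ℝ → ℂ → ℂ → ℂ)))
    (hσ : 0 ≤ σ) (hδ : 0 ≤ δ) (μ : ℝ) {a : ℝ} (ha : 0 ≤ a) :
    Continuous (fun q : ℝ × EuclideanSpace ℝ (Fin n) => propSym P σ δ μ a q.1 q.2) := by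
  have hpow : ∀ b : ℝ, 0 ≤ b → Continuous (fun q : ℝ × EuclideanSpace ℝ (Fin n) =>
      (((2 * Real.pi * ‖q.2‖) ^ b : ℝ) : ℂ)) := fun b hb =>
    Complex.continuous_ofReal.comp ((continuous_const.mul continuous_snd.norm).rpow_const
      fun _ => Or.inr hb)
  have ht : Continuous (fun q : ℝ × EuclideanSpace ℝ (Fin n) => (q.1 : ℂ)) :=
    Complex.continuous_ofReal.comp continuous_fst
  have hA : Continuous (fun q : ℝ × EuclideanSpace ℝ (Fin n) => dampMul δ μ q.2) := by
    have := (hpow (2 * δ) (by positivity)).const_mul (μ : ℂ)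
    simpa [dampMul] using this
  have hQ : Continuous (fun q : ℝ × EuclideanSpace ℝ (Fin n) => waveMul σ q.2) :=
    hpow (2 * σ) (by positivity)
  have hv : Continuous (fun q : ℝ × EuclideanSpace ℝ (Fin n) =>
      (q.1 : ℂ) ^ 2 * (dampMul δ μ q.2 ^ 2 / 4 - waveMul σ q.2)) :=
    (ht.pow 2).mul (((hA.pow 2).div_const 4).sub hQ)
  have he : Continuous (fun q : ℝ × EuclideanSpace ℝ (Fin n) =>
      Complex.exp (-(dampMul δ μ q.2 * q.1 / 2))) := ((hA.mul ht).div_const 2).neg.cexp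
  have hs := differentiable_sinhcSqrt.continuous.comp hv
  have hc := differentiable_coshSqrt.continuous.comp hv
  refine (hpow a ha).mul ?_
  rcases hP with rfl | rfl
  · exact he.mul hs
  · exact he.mul (hc.add (((hA.mul ht).div_const 2).mul hs))

lemma continuous_dataSym (hσ : 0 ≤ σ) (hδ : 0 ≤ δ) (μ : ℝ) {a₁ a₂ : ℝ} (ha₁ : 0 ≤ a₁)
    (ha₂ : 0 ≤ a₂) (c₁ c₂ : ℂ) :
    Continuous (fun q : ℝ × EuclideanSpace ℝ (Fin n) => dataSym₀ σ δ μ a₁ a₂ c₁ c₂ q.1 q.2) ∧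
    Continuous (fun q : ℝ × EuclideanSpace ℝ (Fin n) => dataSym₁ σ δ μ a₁ a₂ c₁ c₂ q.1 q.2) := by
  have ht : Continuous (fun q : ℝ × EuclideanSpace ℝ (Fin n) => (q.1 : ℂ)) :=
    Complex.continuous_ofReal.comp continuous_fst
  constructor
  · exact (continuous_const.mul (continuous_propSym (by simp) hσ hδ μ ha₁)).sub
      (continuous_const.mul (ht.mul (continuous_propSym (by simp) hσ hδ μ (by linarith))))
  · exact (continuous_const.mul (ht.mul (continuous_propSym (by simp) hσ hδ μ ha₁))).add
      (continuous_const.mul ((continuous_propSym (by simp) hσ hδ μ ha₂).sub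
        (continuous_const.mul (ht.mul (continuous_propSym (by simp) hσ hδ μ (by linarith))))))

/-- Domination of the data symbols on bounded time intervals. -/
lemma exists_norm_dataSym_mul_le (hn : 1 ≤ n) (hσ : 0 < σ) (hμ : 0 < μ) (hδ : 0 < δ)
    (hδσ : 2 * δ < σ) {a₁ a₂ : ℝ} (ha₁ : 0 ≤ a₁) (ha₂ : 0 ≤ a₂) (c₁ c₂ : ℂ) {T : ℝ} (hT : 0 ≤ T)
    (g : 𝓢(EuclideanSpace ℝ (Fin n), ℂ)) :
    ∃ b : EuclideanSpace ℝ (Fin n) → ℝ, Integrable b ∧ ∀ s ∈ Icc 0 T, ∀ ξ ≠ 0,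
      ‖dataSym₀ σ δ μ a₁ a₂ c₁ c₂ s ξ * g ξ‖ ≤ b ξ ∧
      ‖dataSym₁ σ δ μ a₁ a₂ c₁ c₂ s ξ * g ξ‖ ≤ b ξ := by
  obtain ⟨b₁, i₁, h₁⟩ := exists_norm_propSym_mul_le hn hσ hμ hδ hδσ ha₁ hT g
  obtain ⟨b₂, i₂, h₂⟩ := exists_norm_propSym_mul_le hn hσ hμ hδ hδσ ha₂ hT g
  obtain ⟨b₃, i₃, h₃⟩ := exists_norm_propSym_mul_le hn hσ hμ hδ hδσ (a := a₂ + 2 * σ) (by linarith) hT g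
  obtain ⟨b₄, i₄, h₄⟩ := exists_norm_propSym_mul_le hn hσ hμ hδ hδσ (a := a₂ + 2 * δ) (by linarith) hT g
  refine ⟨fun ξ => (‖c₁‖ * b₁ ξ + ‖c₂‖ * T * b₃ ξ) + (‖c₁‖ * T * b₁ ξ + (‖c₂‖ * b₂ ξ +
    ‖c₂‖ * μ * T * b₄ ξ)), ((i₁.const_mul _).add (i₃.const_mul _)).add ((i₁.const_mul _).add
      ((i₂.const_mul _).add (i₄.const_mul _))), fun s hs ξ hξ => ?_⟩
  have hs' : ‖(s : ℂ)‖ ≤ T := by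
    rw [Complex.norm_real, Real.norm_of_nonneg hs.1]; exact hs.2
  have k₁ := fun P hP => (h₁ s hs P hP).2 ξ hξ
  have k₂ := fun P hP => (h₂ s hs P hP).2 ξ hξ
  have k₃ := fun P hP => (h₃ s hs P hP).2 ξ hξ
  have k₄ := fun P hP => (h₄ s hs P hP).2 ξ hξ
  have p₁ := (norm_nonneg _).trans (k₁ cosProp (by simp))
  have p₂ := (norm_nonneg _).trans (k₂ cosProp (by simp))
  have p₃ := (norm_nonneg _).trans (k₃ cosProp (by simp))
  have p₄ := (norm_nonneg _).trans (k₄ cosProp (by simp))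
  constructor
  · have e : dataSym₀ σ δ μ a₁ a₂ c₁ c₂ s ξ * g ξ = c₁ * (propSym cosProp σ δ μ a₁ s ξ * g ξ) -
        c₂ * s * (propSym meanProp σ δ μ (a₂ + 2 * σ) s ξ * g ξ) := by simp only [dataSym₀]; ring
    rw [e]
    refine (norm_sub_le _ _).trans ?_
    rw [norm_mul c₁, norm_mul (c₂ * s), norm_mul c₂]
    have : 0 ≤ ‖c₁‖ * T * b₁ ξ + (‖c₂‖ * b₂ ξ + ‖c₂‖ * μ * T * b₄ ξ) := by positivity
    refine le_add_of_le_of_nonneg (add_le_add ?_ ?_) this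
    · exact mul_le_mul_of_nonneg_left (k₁ cosProp (by simp)) (norm_nonneg _)
    · exact mul_le_mul (mul_le_mul_of_nonneg_left hs' (norm_nonneg _)) (k₃ meanProp (by simp))
        (norm_nonneg _) (by positivity)
  · have e : dataSym₁ σ δ μ a₁ a₂ c₁ c₂ s ξ * g ξ =
        c₁ * s * (propSym meanProp σ δ μ a₁ s ξ * g ξ) + (c₂ * (propSym cosProp σ δ μ a₂ s ξ * g ξ) -
        c₂ * μ * s * (propSym meanProp σ δ μ (a₂ + 2 * δ) s ξ * g ξ)) := by
      simp only [dataSym₁]; ring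
    rw [e]
    refine (norm_add_le _ _).trans ((add_le_add le_rfl (norm_sub_le _ _)).trans ?_)
    rw [norm_mul (c₁ * s), norm_mul c₁, norm_mul c₂ (_ * _), norm_mul (c₂ * μ * s), norm_mul (c₂ * μ),
      norm_mul c₂, Complex.norm_real μ, Real.norm_of_nonneg hμ.le]
    have : 0 ≤ ‖c₁‖ * b₁ ξ + ‖c₂‖ * T * b₃ ξ := by positivity
    refine le_add_of_nonneg_of_le this (add_le_add ?_ (add_le_add ?_ ?_))
    · exact mul_le_mul (mul_le_mul_of_nonneg_left hs' (norm_nonneg _)) (k₁ meanProp (by simp))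
        (norm_nonneg _) (by positivity)
    · exact mul_le_mul_of_nonneg_left (k₂ cosProp (by simp)) (norm_nonneg _)
    · exact mul_le_mul (mul_le_mul_of_nonneg_left hs' (by positivity)) (k₄ meanProp (by simp))
        (norm_nonneg _) (by positivity)

end DataSymbols

end

/-! ### The solution formula at order zero by integration in time -/

noncomputable section

section ZeroOrder

variable {n : ℕ} {σ δ μ : ℝ}

/-- Time integrals of symbols: the pairing with the kernel commutes with the integral. -/
lemma integral_mul_fourierInv_intervalIntegral (hn : 1 ≤ n) {v : EuclideanSpace ℝ (Fin n) → ℂ}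
    (hv : InSomeLp v) {M : ℝ → EuclideanSpace ℝ (Fin n) → ℂ} {T : ℝ} (hT : 0 ≤ T)
    (hM : Continuous (fun q : ℝ × EuclideanSpace ℝ (Fin n) => M q.1 q.2))
    {b : EuclideanSpace ℝ (Fin n) → ℝ} (hb : Integrable b)
    (hbM : ∀ s ∈ Icc 0 T, ∀ ξ ≠ 0, ‖M s ξ‖ ≤ b ξ) {D : ℝ}
    (hD : ∀ s ∈ Icc 0 T, Integrable (𝓕⁻ (M s)) ∧ ∫ x, ‖𝓕⁻ (M s) x‖ ≤ D) :
    IntervalIntegrable (fun s => ∫ x, v x * 𝓕⁻ (M s) x) volume 0 T ∧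
    Integrable (fun x => v x * 𝓕⁻ (fun ξ => ∫ s in (0 : ℝ)..T, M s ξ) x) ∧
    ∫ x, v x * 𝓕⁻ (fun ξ => ∫ s in (0 : ℝ)..T, M s ξ) x =
      ∫ s in (0 : ℝ)..T, ∫ x, v x * 𝓕⁻ (M s) x := by
  obtain ⟨K, hK, hp⟩ := hv.exists_integral_mul_le
  have hvm : AEStronglyMeasurable v := by
    obtain ⟨s, -, hs⟩ := hv; exact hs.aestronglyMeasurable
  have hae := ae_ne_zero_euclideanSpace hn
  set ν : Measure ℝ := volume.restrict (Ioc 0 T) with hν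
  have hνm : ∀ᵐ s ∂ν, s ∈ Icc 0 T := by
    filter_upwards [ae_restrict_mem measurableSet_Ioc] with s hs using Ioc_subset_Icc_self hs
  -- the kernel depends measurably on time and space
  have hker : StronglyMeasurable (fun q : ℝ × EuclideanSpace ℝ (Fin n) => 𝓕⁻ (M q.1) q.2) := by
    simp only [Real.fourierInv_eq]
    have hc : Continuous (fun z : (ℝ × EuclideanSpace ℝ (Fin n)) × EuclideanSpace ℝ (Fin n) =>
        Real.fourierChar (inner ℝ z.2 z.1.2) • M z.1.1 z.2) := by
      have h1 : Continuous (fun z : (ℝ × EuclideanSpace ℝ (Fin n)) × EuclideanSpace ℝ (Fin n) =>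
        M z.1.1 z.2) := hM.comp ((continuous_fst.comp continuous_fst).prodMk continuous_snd)
      have h2 : Continuous (fun z : (ℝ × EuclideanSpace ℝ (Fin n)) × EuclideanSpace ℝ (Fin n) =>
        Real.fourierChar (inner ℝ z.2 z.1.2)) := by fun_prop
      exact h2.smul h1
    exact hc.stronglyMeasurable.integral_prod_right'
  have hMm : ∀ s, AEStronglyMeasurable (M s) := fun s =>
    (hM.comp (continuous_const.prodMk continuous_id)).aestronglyMeasurable
  have hMi : ∀ s ∈ Icc 0 T, Integrable (M s) ∧ ∫ ξ, ‖M s ξ‖ ≤ ∫ ξ, b ξ := by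
    intro s hs
    have hle : ∀ᵐ ξ, ‖M s ξ‖ ≤ b ξ := by filter_upwards [hae] with ξ hξ using hbM s hs ξ hξ
    have hi : Integrable (M s) := hb.mono' (hMm s) hle
    exact ⟨hi, integral_mono_ae hi.norm hb hle⟩
  have hpair : ∀ s ∈ Icc 0 T, Integrable (fun x => v x * 𝓕⁻ (M s) x) ∧
      ∫ x, ‖v x * 𝓕⁻ (M s) x‖ ≤ K * D + K * ∫ ξ, b ξ := by
    intro s hs
    have h1 := hp _ _ (hD s hs).1 fun x => (norm_fourierInv_le (M s) x).trans (hMi s hs).2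
    exact ⟨h1.1, h1.2.trans (by gcongr; exact (hD s hs).2)⟩
  -- Joint integrability in time and space, from the uniform bounds on the kernels; it allows the
  -- interchange of the pairing with the time integral.
  have hF : Integrable (Function.uncurry fun s x => v x * 𝓕⁻ (M s) x) (ν.prod volume) := by
    have hm : AEStronglyMeasurable (Function.uncurry fun s x => v x * 𝓕⁻ (M s) x) (ν.prod volume) :=
      hvm.comp_snd.mul hker.aestronglyMeasurable
    rw [integrable_prod_iff hm]
    refine ⟨?_, ?_⟩
    · filter_upwards [hνm] with s hs using (hpair s hs).1
    · refine Integrable.mono' (integrable_const (K * D + K * ∫ ξ, b ξ)) hm.norm.integral_prod_right' ?_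
      filter_upwards [hνm] with s hs
      rw [Real.norm_of_nonneg (integral_nonneg fun x => norm_nonneg _)]
      exact (hpair s hs).2
  have hswap : ∀ x, ∫ s, 𝓕⁻ (M s) x ∂ν = 𝓕⁻ (fun ξ => ∫ s in (0 : ℝ)..T, M s ξ) x := by
    intro x
    simp only [Real.fourierInv_eq, intervalIntegral.integral_of_le hT]
    have hint : Integrable (Function.uncurry fun s (ξ : EuclideanSpace ℝ (Fin n)) =>
        Real.fourierChar (inner ℝ ξ x) • M s ξ) (ν.prod volume) := by
      refine Integrable.mono' (hb.comp_snd ν) ?_ ?_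
      · have h2 : Continuous (fun q : ℝ × EuclideanSpace ℝ (Fin n) =>
          Real.fourierChar (inner ℝ q.2 x)) := by fun_prop
        exact (h2.smul hM).aestronglyMeasurable
      · have h1 : ∀ᵐ q ∂ν.prod (volume : Measure (EuclideanSpace ℝ (Fin n))), q.1 ∈ Icc 0 T :=
          Measure.quasiMeasurePreserving_fst.ae hνm
        have h2 : ∀ᵐ q ∂ν.prod (volume : Measure (EuclideanSpace ℝ (Fin n))), q.2 ≠ 0 :=
          Measure.quasiMeasurePreserving_snd.ae hae
        filter_upwards [h1, h2] with q hq1 hq2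
        simp only [Function.uncurry, Circle.norm_smul]
        exact hbM _ hq1 _ hq2
    rw [integral_integral_swap hint]
    refine integral_congr_ae (Filter.Eventually.of_forall fun ξ => ?_)
    simp only [Circle.smul_def]
    rw [integral_smul]
  have e : ∀ x, ∫ s, v x * 𝓕⁻ (M s) x ∂ν = v x * 𝓕⁻ (fun ξ => ∫ s in (0 : ℝ)..T, M s ξ) x := by
    intro x; rw [integral_const_mul, hswap]
  refine ⟨?_, ?_, ?_⟩
  · rw [intervalIntegrable_iff_integrableOn_Ioc_of_le hT]
    exact hF.integral_prod_left
  · refine hF.integral_prod_right.congr (Filter.Eventually.of_forall fun x => ?_)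
    exact e x
  · rw [intervalIntegral.integral_of_le hT, integral_integral_swap hF]
    simp only [e]

/-- With exponents 2σ, 2δ and coefficients -1, -μ the data symbols are the second time derivatives
of the two propagators. Integrating by parts, c₁y(T) + c₂y'(T) equals c₁y(0) + (c₁T + c₂)y'(0) plus
the integral of (c₁(T-s) + c₂)y''(s). -/
lemma integral_weight_mul_dataSym (hσ : 0 ≤ σ) (hδ : 0 ≤ δ) (c₁ c₂ : ℂ) (T : ℝ)
    (ξ : EuclideanSpace ℝ (Fin n)) :
    (∫ s in (0 : ℝ)..T, (c₁ * (T - s) + c₂) * dataSym₀ σ δ μ (2 * σ) (2 * δ) (-1) (-μ) s ξ) =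
      dataSym₀ σ δ μ 0 0 c₁ c₂ T ξ - c₁ ∧
    (∫ s in (0 : ℝ)..T, (c₁ * (T - s) + c₂) * dataSym₁ σ δ μ (2 * σ) (2 * δ) (-1) (-μ) s ξ) =
      dataSym₁ σ δ μ 0 0 c₁ c₂ T ξ - (c₁ * T + c₂) := by
  set A : ℂ := dampMul δ μ ξ with hA
  set Q : ℂ := waveMul σ ξ with hQ
  have hz : ∀ (P : ℝ → ℂ → ℂ → ℂ) (s : ℝ), propSym P σ δ μ 0 s ξ = P s A Q := by
    intro P s; simp [propSym_eq_rpow_mul, hA, hQ]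
  have hq : ∀ (P : ℝ → ℂ → ℂ → ℂ) (s : ℝ), propSym P σ δ μ (2 * σ) s ξ = Q * P s A Q := fun _ _ => rfl
  have hq' : ∀ (P : ℝ → ℂ → ℂ → ℂ) (s : ℝ), propSym P σ δ μ (0 + 2 * σ) s ξ = Q * P s A Q := by
    intro P s; rw [zero_add, hq]
  have ha' : ∀ (P : ℝ → ℂ → ℂ → ℂ) (s : ℝ), (μ : ℂ) * propSym P σ δ μ (0 + 2 * δ) s ξ = A * P s A Q := by
    intro P s; rw [← dampMul_mul_propSym P hδ le_rfl, hz]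
  have ha : ∀ (P : ℝ → ℂ → ℂ → ℂ) (s : ℝ), (μ : ℂ) * propSym P σ δ μ (2 * δ) s ξ = A * P s A Q := by
    intro P s; rw [← ha', zero_add]
  have haq : ∀ (P : ℝ → ℂ → ℂ → ℂ) (s : ℝ), (μ : ℂ) * propSym P σ δ μ (2 * δ + 2 * σ) s ξ =
      A * Q * P s A Q := by
    intro P s
    rw [← waveMul_mul_propSym P hσ (by positivity), mul_left_comm, ha, ← hQ]; ring
  have haa : ∀ (P : ℝ → ℂ → ℂ → ℂ) (s : ℝ), (μ : ℂ) * (μ * propSym P σ δ μ (2 * δ + 2 * δ) s ξ) =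
      A * A * P s A Q := by
    intro P s
    rw [← dampMul_mul_propSym P hδ (by positivity), mul_left_comm, ha, ← hA]; ring
  have e0 : ∀ s : ℝ, dataSym₀ σ δ μ (2 * σ) (2 * δ) (-1) (-μ) s ξ =
      -(Q * (cosProp s A Q - A * (s * meanProp s A Q))) := by
    intro s; rw [dataSym₀, hq]; linear_combination (s : ℂ) * haq meanProp s
  have e1 : ∀ s : ℝ, dataSym₁ σ δ μ (2 * σ) (2 * δ) (-1) (-μ) s ξ =
      -(Q * (s * meanProp s A Q)) - A * (cosProp s A Q - A * (s * meanProp s A Q)) := by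
    intro s; rw [dataSym₁, hq]
    linear_combination (s : ℂ) * haa meanProp s - ha cosProp s
  have e0' : ∀ s : ℝ, dataSym₀ σ δ μ 0 0 c₁ c₂ s ξ =
      c₁ * cosProp s A Q - c₂ * (Q * (s * meanProp s A Q)) := by
    intro s; rw [dataSym₀, hz, hq']; ring
  have e1' : ∀ s : ℝ, dataSym₁ σ δ μ 0 0 c₁ c₂ s ξ =
      c₁ * (s * meanProp s A Q) + c₂ * (cosProp s A Q - A * (s * meanProp s A Q)) := by
    intro s; rw [dataSym₁, hz, hz]; linear_combination (-c₂ * s) * ha' meanProp s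
  have hd := continuous_dataSym (n := n) hσ hδ μ (a₁ := 2 * σ) (a₂ := 2 * δ) (by positivity)
    (by positivity) (-1) (-μ)
  have hline : Continuous (fun s : ℝ => (s, ξ)) := continuous_id.prodMk continuous_const
  have hwc : Continuous (fun s : ℝ => c₁ * ((T : ℂ) - s) + c₂) := by fun_prop
  have hi1 : IntervalIntegrable (fun s : ℝ => (c₁ * ((T : ℂ) - s) + c₂) *
      dataSym₀ σ δ μ (2 * σ) (2 * δ) (-1) (-μ) s ξ) volume 0 T :=
    (hwc.mul (hd.1.comp hline)).intervalIntegrable _ _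
  have hi2 : IntervalIntegrable (fun s : ℝ => (c₁ * ((T : ℂ) - s) + c₂) *
      dataSym₁ σ δ μ (2 * σ) (2 * δ) (-1) (-μ) s ξ) volume 0 T :=
    (hwc.mul (hd.2.comp hline)).intervalIntegrable _ _
  have hm := hasDerivAt_t_mul_meanProp A Q
  have hc := hasDerivAt_cosProp A Q
  have hw : ∀ s : ℝ, HasDerivAt (fun s : ℝ => c₁ * ((T : ℂ) - s) + c₂) (-c₁) s := by
    intro s
    have := ((((hasDerivAt_id (s : ℂ)).comp_ofReal).const_sub (T : ℂ)).const_mul c₁).add_const c₂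
    simpa using this
  constructor
  · rw [intervalIntegral.integral_eq_sub_of_hasDerivAt
      (f := fun s : ℝ => (c₁ * ((T : ℂ) - s) + c₂) * -(Q * (s * meanProp s A Q)) + c₁ * cosProp s A Q)
      (fun s _ => ?_) hi1]
    · simp only [e0']; simp
      ring
    · have := ((hw s).mul ((hm s).const_mul Q).fun_neg).add ((hc s).const_mul c₁)
      refine this.congr_deriv ?_
      rw [e0]; ring
  · rw [intervalIntegral.integral_eq_sub_of_hasDerivAt
      (f := fun s : ℝ => (c₁ * ((T : ℂ) - s) + c₂) * (cosProp s A Q - A * (s * meanProp s A Q)) +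
        c₁ * (s * meanProp s A Q))
      (fun s _ => ?_) hi2]
    · simp only [e1']; simp
      ring
    · have := ((hw s).mul ((hc s).fun_sub ((hm s).const_mul A))).add ((hm s).const_mul c₁)
      refine this.congr_deriv ?_
      rw [e1]; ring

lemma absD_eq_fourierInv (a : ℝ) (φ : 𝓢(EuclideanSpace ℝ (Fin n), ℂ)) :
    absD a φ = 𝓕⁻ (fun ξ : EuclideanSpace ℝ (Fin n) =>
      (((2 * Real.pi * ‖ξ‖) ^ a : ℝ) : ℂ) * (𝓕 φ : 𝓢(EuclideanSpace ℝ (Fin n), ℂ)) ξ) := by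
  rw [absD, SchwartzMap.fourier_coe]

lemma fourierInv_fourier_coe (φ : 𝓢(EuclideanSpace ℝ (Fin n), ℂ)) :
    𝓕⁻ ((𝓕 φ : 𝓢(EuclideanSpace ℝ (Fin n), ℂ)) : EuclideanSpace ℝ (Fin n) → ℂ) = φ := by
  rw [← SchwartzMap.fourierInv_coe, FourierTransform.fourierInv_fourier_eq]

lemma absD_zero (φ : 𝓢(EuclideanSpace ℝ (Fin n), ℂ)) : absD 0 φ = φ := by
  rw [absD_eq_fourierInv]
  simp only [Real.rpow_zero, Complex.ofReal_one, one_mul]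
  exact fourierInv_fourier_coe φ

/-- Separates the zero-order part c, which acts as a multiple of the identity on φ, from the part d
- c, for which integrability of the pairing comes from the time integral. -/
lemma integral_mul_fourierInv_eq_add {v d : EuclideanSpace ℝ (Fin n) → ℂ} {c : ℂ} (hv : InSomeLp v)
    (φ : 𝓢(EuclideanSpace ℝ (Fin n), ℂ))
    (hd : Integrable (fun ξ => d ξ * (𝓕 φ : 𝓢(EuclideanSpace ℝ (Fin n), ℂ)) ξ))
    (hint : Integrable (fun x => v x *
      𝓕⁻ (fun ξ => (d ξ - c) * (𝓕 φ : 𝓢(EuclideanSpace ℝ (Fin n), ℂ)) ξ) x)) :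
    ∫ x, v x * 𝓕⁻ (fun ξ => d ξ * (𝓕 φ : 𝓢(EuclideanSpace ℝ (Fin n), ℂ)) ξ) x =
      c * (∫ x, v x * φ x) +
        ∫ x, v x * 𝓕⁻ (fun ξ => (d ξ - c) * (𝓕 φ : 𝓢(EuclideanSpace ℝ (Fin n), ℂ)) ξ) x := by
  obtain ⟨K, -, hp⟩ := hv.exists_integral_mul_le
  set g : 𝓢(EuclideanSpace ℝ (Fin n), ℂ) := 𝓕 φ with hg
  have hφ := (hp φ _ φ.integrable (fun x => by
    rw [← fourierInv_fourier_coe φ]; exact norm_fourierInv_le _ x)).1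
  have hi2 : Integrable (fun ξ => (d ξ - c) * g ξ) := by
    simp only [sub_mul]; exact hd.sub (g.integrable.const_mul c)
  rw [← integral_const_mul, ← integral_add (hφ.const_mul c) hint]
  congr 1; ext x
  have e : (fun ξ => d ξ * g ξ) = fun ξ => c * g ξ + (d ξ - c) * g ξ := by ext ξ; ring
  rw [e, fourierInv_fun_add (g.integrable.const_mul c) hi2, fourierInv_const_mul, hg,
    fourierInv_fourier_coe]
  ring

/-- The tested solution is the time integral of its tested second derivative. -/
lemma IsSolution.integral_eq {u₀ u₁ : EuclideanSpace ℝ (Fin n) → ℂ}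
    {u ut : ℝ → EuclideanSpace ℝ (Fin n) → ℂ} (hsol : IsSolution σ δ μ u₀ u₁ u ut) (c₁ c₂ : ℂ)
    {T : ℝ} (hT : 0 ≤ T) (φ : 𝓢(EuclideanSpace ℝ (Fin n), ℂ)) {h : ℝ → ℂ}
    (hh : ∀ s, 0 ≤ s → -(∫ x, u s x * absD (2 * σ) φ x) - (μ : ℂ) * ∫ x, ut s x * absD (2 * δ) φ x = h s)
    (hi : IntervalIntegrable (fun s : ℝ => (c₁ * ((T : ℂ) - s) + c₂) * h s) volume 0 T) :
    c₁ * (∫ x, u T x * φ x) + c₂ * (∫ x, ut T x * φ x) = c₁ * (∫ x, u₀ x * φ x) +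
      (c₁ * T + c₂) * (∫ x, u₁ x * φ x) + ∫ s in (0 : ℝ)..T, (c₁ * ((T : ℂ) - s) + c₂) * h s := by
  set f : ℝ → ℂ := fun s => (c₁ * ((T : ℂ) - s) + c₂) * (∫ x, ut s x * φ x) +
    c₁ * ∫ x, u s x * φ x with hf
  have hw : ∀ s : ℝ, HasDerivAt (fun s : ℝ => c₁ * ((T : ℂ) - s) + c₂) (-c₁) s := by
    intro s
    have := ((((hasDerivAt_id (s : ℂ)).comp_ofReal).const_sub (T : ℂ)).const_mul c₁).add_const c₂
    simpa using this
  have hder : ∀ s, 0 ≤ s → HasDerivWithinAt f ((c₁ * ((T : ℂ) - s) + c₂) * h s) (Ici 0) s := by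
    intro s hs
    have h1 := ((hw s).hasDerivWithinAt.mul (hsol.equation φ s hs)).add
      ((hsol.hasDeriv φ s hs).const_mul c₁)
    rw [hh s hs] at h1
    refine h1.congr_deriv ?_
    ring
  have key := intervalIntegral.integral_eq_sub_of_hasDeriv_right_of_le hT
    (fun s hs => (hder s hs.1).continuousWithinAt.mono Icc_subset_Ici_self)
    (fun s hs => (hder s hs.1.le).mono (fun r hr => hs.1.le.trans (le_of_lt hr))) hi
  have i0 : ∫ x, u 0 x * φ x = ∫ x, u₀ x * φ x := by
    refine integral_congr_ae ?_
    filter_upwards [hsol.initial] with x hx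
    rw [hx]
  have i1 : ∫ x, ut 0 x * φ x = ∫ x, u₁ x * φ x := by
    refine integral_congr_ae ?_
    filter_upwards [hsol.initial_deriv] with x hx
    rw [hx]
  rw [key, hf]
  simp only [i0, i1, Complex.ofReal_zero]
  ring

/-- The solution formula for `c₁ u(T) + c₂ u_t(T)`. -/
theorem dataSym_representation_zero (hn : 1 ≤ n) (hσ : 1 ≤ σ) (hμ : 0 < μ) (hδ : 0 < δ)
    (hδσ : 2 * δ < σ) (c₁ c₂ : ℂ) {T : ℝ} (hT : 0 ≤ T)
    {u₀ u₁ : EuclideanSpace ℝ (Fin n) → ℂ} (h₀ : InSomeLp u₀) (h₁ : InSomeLp u₁)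
    {u ut : ℝ → EuclideanSpace ℝ (Fin n) → ℂ} (hsol : IsSolution σ δ μ u₀ u₁ u ut)
    (φ : 𝓢(EuclideanSpace ℝ (Fin n), ℂ)) :
    c₁ * (∫ x, u T x * φ x) + c₂ * (∫ x, ut T x * φ x) =
    (∫ x, u₀ x * 𝓕⁻ (fun ξ => dataSym₀ σ δ μ 0 0 c₁ c₂ T ξ *
      (𝓕 φ : 𝓢(EuclideanSpace ℝ (Fin n), ℂ)) ξ) x) +
    ∫ x, u₁ x * 𝓕⁻ (fun ξ => dataSym₁ σ δ μ 0 0 c₁ c₂ T ξ *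
      (𝓕 φ : 𝓢(EuclideanSpace ℝ (Fin n), ℂ)) ξ) x := by
  set g : 𝓢(EuclideanSpace ℝ (Fin n), ℂ) := 𝓕 φ with hg
  have hσ0 : 0 < σ := by linarith
  -- Symbols of the second time derivative. Both terms of the equation carry a positive power of
  -- |D|, so the formula for positive order applies to them.
  set S₀ : ℝ → EuclideanSpace ℝ (Fin n) → ℂ := fun s ξ =>
    dataSym₀ σ δ μ (2 * σ) (2 * δ) (-1) (-μ) s ξ * g ξ with hS₀
  set S₁ : ℝ → EuclideanSpace ℝ (Fin n) → ℂ := fun s ξ =>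
    dataSym₁ σ δ μ (2 * σ) (2 * δ) (-1) (-μ) s ξ * g ξ with hS₁
  obtain ⟨D, hD, hsum⟩ := exists_summableSym_dataSym hn hσ hμ hδ hδσ (a₁ := 2 * σ) (a₂ := 2 * δ)
    (by positivity) (by positivity) (-1) (-μ) hT g
  obtain ⟨b, hb, hdom⟩ := exists_norm_dataSym_mul_le hn hσ0 hμ hδ hδσ (a₁ := 2 * σ) (a₂ := 2 * δ)
    (by positivity) (by positivity) (-1) (-μ) hT g
  have hcont := continuous_dataSym (n := n) hσ0.le hδ.le μ (a₁ := 2 * σ) (a₂ := 2 * δ) (by positivity)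
    (by positivity) (-1) (-μ)
  have hgc : Continuous (fun q : ℝ × EuclideanSpace ℝ (Fin n) => g q.2) := g.continuous.comp continuous_snd
  set w : ℝ → ℂ := fun s => c₁ * ((T : ℂ) - s) + c₂ with hw
  have hwc : Continuous (fun q : ℝ × EuclideanSpace ℝ (Fin n) => w q.1) := by
    simp only [hw]; fun_prop
  set W : ℝ := ‖c₁‖ * T + ‖c₂‖ with hW
  have hW0 : 0 ≤ W := by positivity
  have hwW : ∀ s ∈ Icc 0 T, ‖w s‖ ≤ W := by
    intro s hs
    refine (norm_add_le _ _).trans ?_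
    rw [norm_mul, hW, ← Complex.ofReal_sub, Complex.norm_real,
      Real.norm_of_nonneg (by linarith [hs.2])]
    gcongr; linarith [hs.1]
  -- The right-hand side of the equation at time s, written in terms of the data.
  have hrep : ∀ s, 0 ≤ s → -(∫ x, u s x * absD (2 * σ) φ x) -
      (μ : ℂ) * ∫ x, ut s x * absD (2 * δ) φ x =
      (∫ x, u₀ x * 𝓕⁻ (S₀ s) x) + ∫ x, u₁ x * 𝓕⁻ (S₁ s) x := by
    intro s hs
    rw [← dataSym_representation hn hσ hμ hδ hδσ (by positivity) (by positivity) (-1) (-μ) hs h₀ h₁ hsol g,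
      absD_eq_fourierInv, absD_eq_fourierInv]
    ring
  have hmul : ∀ (v : EuclideanSpace ℝ (Fin n) → ℂ) (S : ℝ → EuclideanSpace ℝ (Fin n) → ℂ) (s : ℝ),
      ∫ x, v x * 𝓕⁻ (fun ξ => w s * S s ξ) x = w s * ∫ x, v x * 𝓕⁻ (S s) x := by
    intro v S s
    rw [← integral_const_mul]
    congr 1; ext x; rw [fourierInv_const_mul]; ring
  have hker : ∀ S : ℝ → EuclideanSpace ℝ (Fin n) → ℂ, (∀ s ∈ Icc 0 T, SummableSym (S s) D) →
      ∀ s ∈ Icc 0 T, Integrable (𝓕⁻ (fun ξ => w s * S s ξ)) ∧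
        ∫ x, ‖𝓕⁻ (fun ξ => w s * S s ξ) x‖ ≤ W * D := fun S hS s hs =>
    (((hS s hs).const_mul (w s)).mono (mul_le_mul_of_nonneg_right (hwW s hs) hD)).integral_fourierInv_le hn
  have hbd : ∀ S : ℝ → EuclideanSpace ℝ (Fin n) → ℂ, (∀ s ∈ Icc 0 T, ∀ ξ ≠ 0, ‖S s ξ‖ ≤ b ξ) →
      ∀ s ∈ Icc 0 T, ∀ ξ ≠ 0, ‖w s * S s ξ‖ ≤ W * b ξ := by
    intro S hS s hs ξ hξ
    rw [norm_mul]
    exact mul_le_mul (hwW s hs) (hS s hs ξ hξ) (norm_nonneg _) hW0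
  obtain ⟨p₁, p₂, p₃⟩ := integral_mul_fourierInv_intervalIntegral hn h₀
    (M := fun s ξ => w s * S₀ s ξ) hT (hwc.mul (hcont.1.mul hgc)) (hb.const_mul W)
    (hbd S₀ fun s hs ξ hξ => (hdom s hs ξ hξ).1) (hker S₀ fun s hs => (hsum s hs).1)
  obtain ⟨q₁, q₂, q₃⟩ := integral_mul_fourierInv_intervalIntegral hn h₁
    (M := fun s ξ => w s * S₁ s ξ) hT (hwc.mul (hcont.2.mul hgc)) (hb.const_mul W)
    (hbd S₁ fun s hs ξ hξ => (hdom s hs ξ hξ).2) (hker S₁ fun s hs => (hsum s hs).2)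
  simp only [hmul] at p₁ p₃ q₁ q₃
  have hi : IntervalIntegrable (fun s : ℝ => w s * ((∫ x, u₀ x * 𝓕⁻ (S₀ s) x) +
      ∫ x, u₁ x * 𝓕⁻ (S₁ s) x)) volume 0 T := by
    simp only [mul_add]; exact p₁.add q₁
  have key := hsol.integral_eq c₁ c₂ hT φ hrep hi
  simp only [mul_add] at key
  rw [intervalIntegral.integral_add p₁ q₁, ← p₃, ← q₃] at key
  rw [key]
  -- The weighted time integrals reproduce the order-zero symbols minus their Taylor polynomials;
  -- the latter account for the initial values in `IsSolution.integral_eq`.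
  have e₀ : ∀ ξ, (∫ s in (0 : ℝ)..T, w s * S₀ s ξ) = (dataSym₀ σ δ μ 0 0 c₁ c₂ T ξ - c₁) * g ξ := by
    intro ξ
    rw [← (integral_weight_mul_dataSym hσ0.le hδ.le c₁ c₂ T ξ).1, ← intervalIntegral.integral_mul_const]
    simp only [hS₀, hw, mul_assoc]
  have e₁ : ∀ ξ, (∫ s in (0 : ℝ)..T, w s * S₁ s ξ) =
      (dataSym₁ σ δ μ 0 0 c₁ c₂ T ξ - (c₁ * T + c₂)) * g ξ := by
    intro ξ
    rw [← (integral_weight_mul_dataSym hσ0.le hδ.le c₁ c₂ T ξ).2, ← intervalIntegral.integral_mul_const]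
    simp only [hS₁, hw, mul_assoc]
  simp only [e₀] at p₂ ⊢
  simp only [e₁] at q₂ ⊢
  obtain ⟨b', hb', hdom'⟩ := exists_norm_dataSym_mul_le hn hσ0 hμ hδ hδσ (a₁ := 0) (a₂ := 0)
    le_rfl le_rfl c₁ c₂ hT g
  have hcont' := continuous_dataSym (n := n) hσ0.le hδ.le μ (a₁ := 0) (a₂ := 0) le_rfl le_rfl c₁ c₂
  have hline : Continuous (fun ξ : EuclideanSpace ℝ (Fin n) => (T, ξ)) :=
    continuous_const.prodMk continuous_id
  have d₀ : Integrable (fun ξ => dataSym₀ σ δ μ 0 0 c₁ c₂ T ξ * g ξ) := by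
    refine hb'.mono' ((hcont'.1.comp hline).mul g.continuous).aestronglyMeasurable ?_
    filter_upwards [ae_ne_zero_euclideanSpace hn] with ξ hξ using (hdom' T ⟨hT, le_rfl⟩ ξ hξ).1
  have d₁ : Integrable (fun ξ => dataSym₁ σ δ μ 0 0 c₁ c₂ T ξ * g ξ) := by
    refine hb'.mono' ((hcont'.2.comp hline).mul g.continuous).aestronglyMeasurable ?_
    filter_upwards [ae_ne_zero_euclideanSpace hn] with ξ hξ using (hdom' T ⟨hT, le_rfl⟩ ξ hξ).2
  rw [integral_mul_fourierInv_eq_add h₀ φ d₀ p₂, integral_mul_fourierInv_eq_add h₁ φ d₁ q₂]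
  ring

/-- The solution formula. -/
theorem solution_formula (hn : 1 ≤ n) (hσ : 1 ≤ σ) (hμ : 0 < μ) (hδ : 0 < δ)
    (hδσ : 2 * δ < σ) {a : ℝ} (ha : 0 ≤ a) (c₁ c₂ : ℂ) {T : ℝ} (hT : 0 ≤ T)
    {u₀ u₁ : EuclideanSpace ℝ (Fin n) → ℂ} (h₀ : InSomeLp u₀) (h₁ : InSomeLp u₁)
    {u ut : ℝ → EuclideanSpace ℝ (Fin n) → ℂ} (hsol : IsSolution σ δ μ u₀ u₁ u ut)
    (φ : 𝓢(EuclideanSpace ℝ (Fin n), ℂ)) :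
    c₁ * (∫ x, u T x * absD a φ x) + c₂ * (∫ x, ut T x * absD a φ x) =
    (∫ x, u₀ x * 𝓕⁻ (fun ξ => dataSym₀ σ δ μ a a c₁ c₂ T ξ *
      𝓕 (φ : EuclideanSpace ℝ (Fin n) → ℂ) ξ) x) +
    ∫ x, u₁ x * 𝓕⁻ (fun ξ => dataSym₁ σ δ μ a a c₁ c₂ T ξ *
      𝓕 (φ : EuclideanSpace ℝ (Fin n) → ℂ) ξ) x := by
  rw [← SchwartzMap.fourier_coe]
  rcases ha.eq_or_lt with rfl | ha
  · rw [absD_zero]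
    exact dataSym_representation_zero hn hσ hμ hδ hδσ c₁ c₂ hT h₀ h₁ hsol φ
  · rw [absD_eq_fourierInv]
    exact dataSym_representation hn hσ hμ hδ hδσ ha ha c₁ c₂ hT h₀ h₁ hsol _

end ZeroOrder

end

/-! ### Powers of t for the kernels of |D|^a u and |D|^a u_t -/

noncomputable section

section KernelEstimates

variable {n : ℕ} {σ δ μ : ℝ}

/-- The symbol `m` has `L¹` norm at most `C t^β`, and its kernel has `L¹` norm at most `C t^α`. -/
structure PowKernel (t C α β : ℝ) (m : EuclideanSpace ℝ (Fin n) → ℂ) : Prop where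
  integrable : Integrable m
  integral_le : ∫ ξ, ‖m ξ‖ ≤ C * t ^ β
  integrable_kernel : Integrable (𝓕⁻ m)
  integral_kernel_le : ∫ x, ‖𝓕⁻ m x‖ ≤ C * t ^ α

namespace PowKernel

variable {t C C₁ C₂ α β α' β' : ℝ} {m m₁ m₂ : EuclideanSpace ℝ (Fin n) → ℂ}

lemma mono (h : PowKernel t C α β m) (ht : 0 ≤ t) (hC : C ≤ C₁) (hC₁ : 0 ≤ C₁)
    (hα : t ^ α ≤ t ^ α') (hβ : t ^ β ≤ t ^ β') : PowKernel t C₁ α' β' m :=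
  ⟨h.integrable, h.integral_le.trans (mul_le_mul hC hβ (by positivity) hC₁), h.integrable_kernel,
    h.integral_kernel_le.trans (mul_le_mul hC hα (by positivity) hC₁)⟩

lemma add (h₁ : PowKernel t C₁ α β m₁) (h₂ : PowKernel t C₂ α β m₂) :
    PowKernel t (C₁ + C₂) α β (fun ξ => m₁ ξ + m₂ ξ) := by
  have e : 𝓕⁻ (fun ξ => m₁ ξ + m₂ ξ) = fun x => 𝓕⁻ m₁ x + 𝓕⁻ m₂ x :=
    funext fun x => fourierInv_fun_add h₁.integrable h₂.integrable x
  have hi := h₁.integrable_kernel.add h₂.integrable_kernel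
  refine ⟨h₁.integrable.add h₂.integrable, ?_, by rw [e]; exact hi, ?_⟩
  · refine (integral_mono (h₁.integrable.add h₂.integrable).norm
      (h₁.integrable.norm.add h₂.integrable.norm) fun ξ => norm_add_le _ _).trans ?_
    rw [add_mul]
    exact (integral_add h₁.integrable.norm h₂.integrable.norm).trans_le
      (add_le_add h₁.integral_le h₂.integral_le)
  · rw [e, add_mul]
    refine (integral_mono hi.norm (h₁.integrable_kernel.norm.add h₂.integrable_kernel.norm)
      fun ξ => norm_add_le _ _).trans ?_
    exact (integral_add h₁.integrable_kernel.norm h₂.integrable_kernel.norm).trans_le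
      (add_le_add h₁.integral_kernel_le h₂.integral_kernel_le)

lemma const_mul (h : PowKernel t C α β m) (c : ℂ) : PowKernel t (‖c‖ * C) α β (fun ξ => c * m ξ) := by
  have e : 𝓕⁻ (fun ξ => c * m ξ) = fun x => c * 𝓕⁻ m x := funext fun x => fourierInv_const_mul c m x
  refine ⟨h.integrable.const_mul c, ?_, by rw [e]; exact h.integrable_kernel.const_mul c, ?_⟩
  · simp only [norm_mul, integral_const_mul, mul_assoc]
    exact mul_le_mul_of_nonneg_left h.integral_le (norm_nonneg _)
  · simp only [e, norm_mul, integral_const_mul, mul_assoc]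
    exact mul_le_mul_of_nonneg_left h.integral_kernel_le (norm_nonneg _)

lemma time_mul (h : PowKernel t C α β m) (ht : 0 < t) :
    PowKernel t C (α + 1) (β + 1) (fun ξ => (t : ℂ) * m ξ) := by
  have h1 := h.const_mul (t : ℂ)
  rw [Complex.norm_real, Real.norm_of_nonneg ht.le] at h1
  refine ⟨h1.integrable, h1.integral_le.trans_eq ?_, h1.integrable_kernel,
    h1.integral_kernel_le.trans_eq ?_⟩ <;>
  · rw [Real.rpow_add ht, Real.rpow_one]; ring

lemma congr (h : PowKernel t C α β m₁) (e : ∀ ξ, m₁ ξ = m₂ ξ) : PowKernel t C α β m₂ := by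
  rwa [← funext e]

/-- The convolution operator of a symbol, between Lebesgue spaces. -/
lemma eLpNorm_kernelConv_le (h : PowKernel t C α β m) (ht : 0 < t) (hC : 0 < C) {p q r : ℝ≥0∞}
    (hp : 1 ≤ p) (hpq : p ≤ q) (hr : 1 + q⁻¹ = r⁻¹ + p⁻¹) {f : EuclideanSpace ℝ (Fin n) → ℂ}
    (hf : AEStronglyMeasurable f) :
    eLpNorm (kernelConv (𝓕⁻ m) f) q volume ≤ ENNReal.ofReal C *
      (ENNReal.ofReal (t ^ (α * (r⁻¹).toReal + β * (1 - (r⁻¹).toReal))) * eLpNorm f p volume) := by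
  refine (_root_.eLpNorm_kernelConv_le (continuous_fourierInv h.integrable) (K := C * t ^ α)
    (M := C * t ^ β) (by positivity) (by positivity) h.integrable_kernel h.integral_kernel_le
    (fun y => (norm_fourierInv_le m y).trans h.integral_le) hp hpq hr hf).trans_eq ?_
  rw [← mul_assoc, ← ENNReal.ofReal_mul hC.le]
  congr 2
  set ρ := (r⁻¹).toReal
  rw [Real.mul_rpow hC.le (by positivity), Real.mul_rpow hC.le (by positivity),
    ← Real.rpow_mul ht.le, ← Real.rpow_mul ht.le, Real.rpow_add ht]
  calc C ^ ρ * t ^ (α * ρ) * (C ^ (1 - ρ) * t ^ (β * (1 - ρ)))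
      = (C ^ ρ * C ^ (1 - ρ)) * (t ^ (α * ρ) * t ^ (β * (1 - ρ))) := by ring
    _ = _ := by rw [← Real.rpow_add hC, add_sub_cancel, Real.rpow_one]

end PowKernel

/-- Estimates for `|D|^a f`, when `f` is given by multipliers acting on the data. -/
lemma absDNormLE_of_powKernel {p q r : ℝ≥0∞} (hp : 1 ≤ p) (hpq : p ≤ q) (hr : 1 + q⁻¹ = r⁻¹ + p⁻¹)
    {u₀ u₁ f m₀ m₁ : EuclideanSpace ℝ (Fin n) → ℂ} (h₀ : MemLp u₀ p volume) (h₁ : MemLp u₁ p volume)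
    {a t C α₀ β₀ α₁ β₁ α β : ℝ} (ht : 0 < t) (hC : 0 < C) (hm₀ : PowKernel t C α₀ β₀ m₀)
    (hm₁ : PowKernel t C α₁ β₁ m₁) (even₀ : ∀ ξ, m₀ (-ξ) = m₀ ξ) (even₁ : ∀ ξ, m₁ (-ξ) = m₁ ξ)
    (hf : ∀ φ : 𝓢(EuclideanSpace ℝ (Fin n), ℂ), ∫ x, f x * absD a φ x =
      (∫ x, u₀ x * 𝓕⁻ (fun ξ => m₀ ξ * 𝓕 (φ : EuclideanSpace ℝ (Fin n) → ℂ) ξ) x) +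
      ∫ x, u₁ x * 𝓕⁻ (fun ξ => m₁ ξ * 𝓕 (φ : EuclideanSpace ℝ (Fin n) → ℂ) ξ) x)
    (hα : α = α₀ * (r⁻¹).toReal + β₀ * (1 - (r⁻¹).toReal))
    (hβ : β = α₁ * (r⁻¹).toReal + β₁ * (1 - (r⁻¹).toReal)) :
    AbsDNormLE a f q (dataBound p u₀ u₁ C t α β) := by
  have hq : 1 ≤ q := hp.trans hpq
  have c₀ := continuous_fourierInv hm₀.integrable
  have c₁ := continuous_fourierInv hm₁.integrable
  have s₀ := aestronglyMeasurable_kernelConv c₀ h₀.aestronglyMeasurable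
  have s₁ := aestronglyMeasurable_kernelConv c₁ h₁.aestronglyMeasurable
  have hle : eLpNorm (kernelConv (𝓕⁻ m₀) u₀ + kernelConv (𝓕⁻ m₁) u₁) q volume ≤
      dataBound p u₀ u₁ C t α β := by
    refine (eLpNorm_add_le s₀ s₁ hq).trans ?_
    rw [dataBound, mul_add, hα, hβ]
    exact add_le_add (hm₀.eLpNorm_kernelConv_le ht hC hp hpq hr h₀.aestronglyMeasurable)
      (hm₁.eLpNorm_kernelConv_le ht hC hp hpq hr h₁.aestronglyMeasurable)
  refine ⟨kernelConv (𝓕⁻ m₀) u₀ + kernelConv (𝓕⁻ m₁) u₁, ⟨s₀.add s₁, hle.trans_lt ?_⟩, ?_, hle⟩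
  · exact ENNReal.mul_lt_top ENNReal.ofReal_lt_top (ENNReal.add_lt_top.2
      ⟨ENNReal.mul_lt_top ENNReal.ofReal_lt_top h₀.eLpNorm_lt_top,
        ENNReal.mul_lt_top ENNReal.ofReal_lt_top h₁.eLpNorm_lt_top⟩)
  · intro φ
    have i₀ := integral_kernelConv_mul c₀ hm₀.integrable_kernel (norm_fourierInv_le m₀) hp h₀
      (φ := φ) φ.integrable
    have i₁ := integral_kernelConv_mul c₁ hm₁.integrable_kernel (norm_fourierInv_le m₁) hp h₁
      (φ := φ) φ.integrable
    simp only [integral_fourierInv_sub_mul hm₀.integrable even₀ (φ := φ) φ.integrable] at i₀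
    simp only [integral_fourierInv_sub_mul hm₁.integrable even₁ (φ := φ) φ.integrable] at i₁
    rw [hf, ← i₀.2, ← i₁.2, ← integral_add i₀.1 i₁.1]
    simp only [Pi.add_apply, add_mul]

lemma propSym_neg (P : ℝ → ℂ → ℂ → ℂ) (σ δ μ a t : ℝ) (ξ : EuclideanSpace ℝ (Fin n)) :
    propSym P σ δ μ a t (-ξ) = propSym P σ δ μ a t ξ := by simp only [propSym, norm_neg]

lemma dataSym₀_neg (a₁ a₂ : ℝ) (c₁ c₂ : ℂ) (t : ℝ) (ξ : EuclideanSpace ℝ (Fin n)) :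
    dataSym₀ σ δ μ a₁ a₂ c₁ c₂ t (-ξ) = dataSym₀ σ δ μ a₁ a₂ c₁ c₂ t ξ := by
  simp only [dataSym₀, propSym_neg]

lemma dataSym₁_neg (a₁ a₂ : ℝ) (c₁ c₂ : ℂ) (t : ℝ) (ξ : EuclideanSpace ℝ (Fin n)) :
    dataSym₁ σ δ μ a₁ a₂ c₁ c₂ t (-ξ) = dataSym₁ σ δ μ a₁ a₂ c₁ c₂ t ξ := by
  simp only [dataSym₁, propSym_neg]

/-- As t ≤ 1 and σ/(2δ) ≥ 1, the power (n+1)/2 of t^{1-σ/(2δ)} may be replaced by any larger k,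
which leaves room for the integer part of n/2. -/
lemma small_time_powKernel (hn : 1 ≤ n) (hσ : 0 < σ) (hμ : 0 < μ) (hδ : 0 < δ) (hδσ : 2 * δ < σ)
    {a : ℝ} (ha : 0 ≤ a) :
    ∃ C : ℝ, 0 < C ∧ ∀ t ∈ Ioc (0 : ℝ) 1, ∀ P ∈ ({meanProp, cosProp} : Set (ℝ → ℂ → ℂ → ℂ)),
      ∀ k : ℝ, ((n : ℝ) + 1) / 2 ≤ k → PowKernel t C (-k * (σ / (2 * δ) - 1) - a / (2 * δ))
        (-(n / (2 * δ)) - a / (2 * δ)) (propSym (n := n) P σ δ μ a t) := by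
  obtain ⟨C, hC, h⟩ := small_time_kernel (n := n) hn hσ hμ hδ hδσ ha
  refine ⟨C, hC, fun t ht P hP k hk => ?_⟩
  obtain ⟨h1, h2, h3, h4⟩ := h t ht P hP
  have ht0 := ht.1
  refine ⟨h1, h2.trans_eq ?_, h3, h4.trans ?_⟩
  · congr 2; ring
  · rw [← Real.rpow_mul ht0.le, ← Real.rpow_add ht0]
    refine mul_le_mul_of_nonneg_left (Real.rpow_le_rpow_of_exponent_ge ht0 ht.2 ?_) hC.le
    have : 0 ≤ σ / (2 * δ) - 1 := by
      rw [sub_nonneg, le_div_iff₀ (by positivity)]; linarith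
    have e : -a / (2 * δ) + (1 - σ / (2 * δ)) * (((n : ℝ) + 1) / 2) =
      -(((n : ℝ) + 1) / 2) * (σ / (2 * δ) - 1) - a / (2 * δ) := by ring
    rw [e]
    nlinarith

lemma large_time_powKernel (hn : 1 ≤ n) (hμ : 0 < μ) (hδ : 0 < δ) (hδσ : 2 * δ < σ)
    {a : ℝ} (ha : 0 ≤ a) :
    ∃ C : ℝ, 0 < C ∧ ∀ t, 1 ≤ t → ∀ P ∈ ({meanProp, cosProp} : Set (ℝ → ℂ → ℂ → ℂ)),
      PowKernel t C (-(a / (2 * (σ - δ)))) (-(n / (2 * (σ - δ))) - a / (2 * (σ - δ)))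
        (propSym (n := n) P σ δ μ a t) := by
  obtain ⟨C, hC, h⟩ := large_time_kernel (n := n) hn hμ hδ hδσ ha
  refine ⟨C, hC, fun t ht P hP => ?_⟩
  obtain ⟨h1, h2, h3, h4⟩ := h t ht P hP
  refine ⟨h1, h2.trans_eq ?_, h3, h4.trans_eq ?_⟩ <;> (congr 2; ring)

/-- Small times: kernels of the data symbols of `|D|^a u` and `|D|^a u_t`. -/
theorem small_time_dataSym (hn : 1 ≤ n) (hσ : 0 < σ) (hμ : 0 < μ) (hδ : 0 < δ) (hδσ : 2 * δ < σ)
    {a : ℝ} (ha : 0 ≤ a) {k₁ k₂ : ℝ} (hk₁ : ((n : ℝ) + 1) / 2 ≤ k₁) (hk₂ : ((n : ℝ) + 1) / 2 ≤ k₂) :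
    ∃ C : ℝ, 0 < C ∧ ∀ t ∈ Ioc (0 : ℝ) 1,
      PowKernel t C (-k₂ * (σ / (2 * δ) - 1) - a / (2 * δ)) (-(n / (2 * δ)) - a / (2 * δ))
        (dataSym₀ (n := n) σ δ μ a a 1 0 t) ∧
      PowKernel t C (-k₁ * (σ / (2 * δ) - 1) - a / (2 * δ) + 1) (-(n / (2 * δ)) - a / (2 * δ) + 1)
        (dataSym₁ (n := n) σ δ μ a a 1 0 t) ∧
      PowKernel t C (-k₁ * (σ / (2 * δ) - 1) - (a + 2 * σ) / (2 * δ) + 1)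
        (-(n / (2 * δ)) - (a + 2 * σ) / (2 * δ) + 1) (dataSym₀ (n := n) σ δ μ a a 0 1 t) ∧
      PowKernel t C (-k₂ * (σ / (2 * δ) - 1) - a / (2 * δ)) (-(n / (2 * δ)) - a / (2 * δ))
        (dataSym₁ (n := n) σ δ μ a a 0 1 t) := by
  obtain ⟨C₁, hC₁, h₁⟩ := small_time_powKernel (n := n) hn hσ hμ hδ hδσ ha
  obtain ⟨C₂, hC₂, h₂⟩ := small_time_powKernel (n := n) hn hσ hμ hδ hδσ (a := a + 2 * σ) (by positivity)
  obtain ⟨C₃, hC₃, h₃⟩ := small_time_powKernel (n := n) hn hσ hμ hδ hδσ (a := a + 2 * δ) (by positivity)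
  have hμC : 0 < μ * C₃ := by positivity
  refine ⟨C₁ + C₂ + μ * C₃, by positivity, fun t ht => ?_⟩
  have ht0 := ht.1
  refine ⟨?_, ?_, ?_, ?_⟩
  · refine ((h₁ t ht cosProp (by simp) k₂ hk₂).congr fun ξ => ?_).mono ht0.le (by linarith)
      (by positivity) le_rfl le_rfl
    simp [dataSym₀]
  · refine (((h₁ t ht meanProp (by simp) k₁ hk₁).time_mul ht0).congr fun ξ => ?_).mono ht0.le
      (by linarith) (by positivity) le_rfl le_rfl
    simp [dataSym₁]
  · have := (((h₂ t ht meanProp (by simp) k₁ hk₁).time_mul ht0).const_mul (-1))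
    rw [norm_neg, norm_one, one_mul] at this
    refine (this.congr fun ξ => ?_).mono ht0.le (by linarith) (by positivity) le_rfl le_rfl
    simp [dataSym₀]
  · have h3 := ((h₃ t ht meanProp (by simp) k₂ hk₂).time_mul ht0).const_mul (-(μ : ℂ))
    rw [norm_neg, Complex.norm_real, Real.norm_of_nonneg hμ.le] at h3
    -- The 2δ extra derivatives cost exactly t⁻¹ at the small-time scale, which the factor t in
    -- front of `meanProp` repays.
    have e : ∀ b : ℝ, b - (a + 2 * δ) / (2 * δ) + 1 = b - a / (2 * δ) := by
      intro b; field_simp; ring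
    rw [e, e] at h3
    refine (((h₁ t ht cosProp (by simp) k₂ hk₂).add h3).congr fun ξ => ?_).mono ht0.le (by linarith)
      (by positivity) le_rfl le_rfl
    simp only [dataSym₁]; ring

/-- Large times: kernels of the data symbols of `|D|^a u` and `|D|^a u_t`. -/
theorem large_time_dataSym (hn : 1 ≤ n) (hσ : 0 < σ) (hμ : 0 < μ) (hδ : 0 < δ) (hδσ : 2 * δ < σ)
    {a : ℝ} (ha : 0 ≤ a) :
    ∃ C : ℝ, 0 < C ∧ ∀ t, 1 ≤ t →
      PowKernel t C (-(a / (2 * (σ - δ)))) (-(n / (2 * (σ - δ))) - a / (2 * (σ - δ)))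
        (dataSym₀ (n := n) σ δ μ a a 1 0 t) ∧
      PowKernel t C (-(a / (2 * (σ - δ))) + 1) (-(n / (2 * (σ - δ))) - a / (2 * (σ - δ)) + 1)
        (dataSym₁ (n := n) σ δ μ a a 1 0 t) ∧
      PowKernel t C (-((a + 2 * δ) / (2 * (σ - δ))))
        (-(n / (2 * (σ - δ))) - (a + 2 * δ) / (2 * (σ - δ))) (dataSym₀ (n := n) σ δ μ a a 0 1 t) ∧
      PowKernel t C (-((a + 2 * δ) / (2 * (σ - δ))) + 1)
        (-(n / (2 * (σ - δ))) - (a + 2 * δ) / (2 * (σ - δ)) + 1)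
        (dataSym₁ (n := n) σ δ μ a a 0 1 t) := by
  obtain ⟨C₁, hC₁, h₁⟩ := large_time_powKernel (n := n) hn hμ hδ hδσ ha
  obtain ⟨C₂, hC₂, h₂⟩ := large_time_powKernel (n := n) hn hμ hδ hδσ (a := a + 2 * σ) (by positivity)
  obtain ⟨C₃, hC₃, h₃⟩ := large_time_powKernel (n := n) hn hμ hδ hδσ (a := a + 2 * δ) (by positivity)
  have hμC : 0 < μ * C₃ := by positivity
  have hσδ : 0 < σ - δ := by linarith
  refine ⟨C₁ + C₂ + μ * C₃, by positivity, fun t ht => ?_⟩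
  have ht0 : 0 < t := by linarith
  refine ⟨?_, ?_, ?_, ?_⟩
  · refine ((h₁ t ht cosProp (by simp)).congr fun ξ => ?_).mono ht0.le (by linarith)
      (by positivity) le_rfl le_rfl
    simp [dataSym₀]
  · refine (((h₁ t ht meanProp (by simp)).time_mul ht0).congr fun ξ => ?_).mono ht0.le
      (by linarith) (by positivity) le_rfl le_rfl
    simp [dataSym₁]
  · have := (((h₂ t ht meanProp (by simp)).time_mul ht0).const_mul (-1))
    rw [norm_neg, norm_one, one_mul] at this
    -- At the diffusive scale 2σ derivatives gain one power of t more than 2δ derivatives do; it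
    -- cancels the factor t in front of `meanProp`.
    have e : (a + 2 * σ) / (2 * (σ - δ)) = (a + 2 * δ) / (2 * (σ - δ)) + 1 := by field_simp; ring
    refine (this.congr fun ξ => ?_).mono ht0.le (by linarith) (by positivity) (le_of_eq ?_) (le_of_eq ?_)
    · simp [dataSym₀]
    · rw [e]; congr 1; ring
    · rw [e]; congr 1; ring
  · have h3 := ((h₃ t ht meanProp (by simp)).time_mul ht0).const_mul (-(μ : ℂ))
    rw [norm_neg, Complex.norm_real, Real.norm_of_nonneg hμ.le] at h3
    -- The `cosProp` term has the exponent of order a only; as 2δ ≤ 2(σ-δ) and t ≥ 1, it is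
    -- dominated by the other term.
    have hle : (a + 2 * δ) / (2 * (σ - δ)) ≤ a / (2 * (σ - δ)) + 1 := by
      rw [div_add_one (by positivity)]; gcongr; linarith
    have h1 := (h₁ t ht cosProp (by simp)).mono ht0.le le_rfl hC₁.le
      (α' := -((a + 2 * δ) / (2 * (σ - δ))) + 1)
      (β' := -(n / (2 * (σ - δ))) - (a + 2 * δ) / (2 * (σ - δ)) + 1)
      (Real.rpow_le_rpow_of_exponent_le ht (by linarith))
      (Real.rpow_le_rpow_of_exponent_le ht (by linarith))
    refine ((h1.add h3).congr fun ξ => ?_).mono ht0.le (by linarith) (by positivity) le_rfl le_rfl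
    simp only [dataSym₁]; ring

end KernelEstimates

end

/-! ### The estimates -/

theorem theorem1 (n : ℕ) (hn : 1 ≤ n) (σ δ μ : ℝ) (hσ : 1 ≤ σ) (hμ : 0 < μ)
    (hδ : δ ∈ Ioo 0 (σ / 2)) (a : ℝ) (ha : 0 ≤ a)
    (p q r : ℝ≥0∞) (hp : 1 ≤ p) (hpq : p ≤ q) (hr : 1 + q⁻¹ = r⁻¹ + p⁻¹) :
    ∃ C : ℝ, 0 < C ∧
      ∀ (u₀ u₁ : EuclideanSpace ℝ (Fin n) → ℂ) (u ut : ℝ → EuclideanSpace ℝ (Fin n) → ℂ),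
        MemLp u₀ p volume → MemLp u₁ p volume → IsSolution σ δ μ u₀ u₁ u ut →
        (∀ t ∈ Ioc (0 : ℝ) 1,
          AbsDNormLE a (u t) q (dataBound p u₀ u₁ C t
            (-(2 + ((n / 2 : ℕ) : ℝ)) * (σ / (2 * δ) - 1) * (r⁻¹).toReal
              - n / (2 * δ) * (1 - (r⁻¹).toReal) - a / (2 * δ))
            (1 - (1 + ((n / 2 : ℕ) : ℝ)) * (σ / (2 * δ) - 1) * (r⁻¹).toReal
              - n / (2 * δ) * (1 - (r⁻¹).toReal) - a / (2 * δ))) ∧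
          AbsDNormLE a (ut t) q (dataBound p u₀ u₁ C t
            (1 - (1 + ((n / 2 : ℕ) : ℝ)) * (σ / (2 * δ) - 1) * (r⁻¹).toReal
              - n / (2 * δ) * (1 - (r⁻¹).toReal) - (a + 2 * σ) / (2 * δ))
            (-(2 + ((n / 2 : ℕ) : ℝ)) * (σ / (2 * δ) - 1) * (r⁻¹).toReal
              - n / (2 * δ) * (1 - (r⁻¹).toReal) - a / (2 * δ)))) ∧
        (∀ t ∈ Ici (1 : ℝ),
          AbsDNormLE a (u t) q (dataBound p u₀ u₁ C t
            (-(n / (2 * (σ - δ))) * (1 - (r⁻¹).toReal) - a / (2 * (σ - δ)))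
            (1 - n / (2 * (σ - δ)) * (1 - (r⁻¹).toReal) - a / (2 * (σ - δ)))) ∧
          AbsDNormLE a (ut t) q (dataBound p u₀ u₁ C t
            (-(n / (2 * (σ - δ))) * (1 - (r⁻¹).toReal) - (a + 2 * δ) / (2 * (σ - δ)))
            (1 - n / (2 * (σ - δ)) * (1 - (r⁻¹).toReal) - (a + 2 * δ) / (2 * (σ - δ))))) := by
  have hδ0 : 0 < δ := hδ.1
  have hδσ : 2 * δ < σ := by linarith [hδ.2]
  have hσ0 : 0 < σ := by linarith
  -- The kernels lose the power (n+1)/2, which is at most 1 + [n/2] for either parity; the exponents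
  -- with 2 + [n/2] leave room to spare.
  have hfloor : ((n : ℝ) + 1) / 2 ≤ 1 + ((n / 2 : ℕ) : ℝ) := by
    have : n + 1 ≤ 2 * (1 + n / 2) := by omega
    have h2 : (n : ℝ) + 1 ≤ 2 * (1 + ((n / 2 : ℕ) : ℝ)) := by exact_mod_cast this
    linarith
  obtain ⟨C₁, hC₁, hsmall⟩ := small_time_dataSym (n := n) hn hσ0 hμ hδ0 hδσ ha hfloor
    (k₂ := 2 + ((n / 2 : ℕ) : ℝ)) (by linarith)
  obtain ⟨C₂, hC₂, hlarge⟩ := large_time_dataSym (n := n) hn hσ0 hμ hδ0 hδσ ha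
  set C := max C₁ C₂
  have hC : 0 < C := lt_max_of_lt_left hC₁
  refine ⟨C, hC, fun u₀ u₁ u ut hu₀ hu₁ hsol => ?_⟩
  have hform := fun (c₁ c₂ : ℂ) (t : ℝ) (ht : 0 ≤ t) =>
    solution_formula hn hσ hμ hδ0 hδσ ha c₁ c₂ ht ⟨p, hp, hu₀⟩ ⟨p, hp, hu₁⟩ hsol
  -- The choices (c₁, c₂) = (1, 0) and (0, 1) of the general formula single out u and u_t.
  have hu : ∀ t : ℝ, 0 ≤ t → ∀ φ, _ := fun t ht φ => hform 1 0 t ht φ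
  have hut : ∀ t : ℝ, 0 ≤ t → ∀ φ, _ := fun t ht φ => hform 0 1 t ht φ
  simp only [one_mul, zero_mul, add_zero, zero_add] at hu hut
  refine ⟨fun t ht => ?_, fun t ht => ?_⟩
  · obtain ⟨k₁, k₂, k₃, k₄⟩ := hsmall t ht
    have ht0 := ht.1
    have hm := fun {α β : ℝ} {m : EuclideanSpace ℝ (Fin n) → ℂ} (h : PowKernel t C₁ α β m) =>
      h.mono ht0.le (le_max_left C₁ C₂) hC.le le_rfl le_rfl
    exact ⟨absDNormLE_of_powKernel hp hpq hr hu₀ hu₁ ht0 hC (hm k₁) (hm k₂) (dataSym₀_neg a a 1 0 t)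
        (dataSym₁_neg a a 1 0 t) (hu t ht0.le) (by ring) (by ring),
      absDNormLE_of_powKernel hp hpq hr hu₀ hu₁ ht0 hC (hm k₃) (hm k₄) (dataSym₀_neg a a 0 1 t)
        (dataSym₁_neg a a 0 1 t) (hut t ht0.le) (by ring) (by ring)⟩
  · obtain ⟨k₁, k₂, k₃, k₄⟩ := hlarge t ht
    have ht0 : 0 < t := zero_lt_one.trans_le ht
    have hm := fun {α β : ℝ} {m : EuclideanSpace ℝ (Fin n) → ℂ} (h : PowKernel t C₂ α β m) =>
      h.mono ht0.le (le_max_right C₁ C₂) hC.le le_rfl le_rfl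
    exact ⟨absDNormLE_of_powKernel hp hpq hr hu₀ hu₁ ht0 hC (hm k₁) (hm k₂) (dataSym₀_neg a a 1 0 t)
        (dataSym₁_neg a a 1 0 t) (hu t ht0.le) (by ring) (by ring),
      absDNormLE_of_powKernel hp hpq hr hu₀ hu₁ ht0 hC (hm k₃) (hm k₄) (dataSym₀_neg a a 0 1 t)
        (dataSym₁_neg a a 0 1 t) (hut t ht0.le) (by ring) (by ring)⟩
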